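/- Let $G=(U\cup V,E)$ be a finite bipartite graph with job set $U$, machine set $V$, $n=|U|+|V|$ vertices and $m=|E|\ge 1$ edges, in which every job has at least one neighbour. A semi-matching is a set $M\subseteq E$ such that every $u\in U$ is incident with exactly one edge of $M$. Let $\deg_M(v)$ be the number of edges of $M$ at $v$. In the unweighted problem the cost of $M$ is $\sum_{v\in V}\deg_M(v)(\deg_M(v)+1)/2$. In the general problem every machine $v$ has its own function $f_v:\mathbb Z_{\ge 0}\to\mathbb R$ with $f_v(i+1)-f_v(i)\ge f_v(i)-f_v(i-1)$ for all $i\ge 1$, and the cost of $M$ is $\sum_{v\in V}f_v(\deg_M(v))$. A semi-matching is optimal if its cost is minimum. Network. Put $w_v(i)=i$ in the unweighted problem and $w_v(i)=f_v(i)-f_v(i-1)$ in the general one. The network $N$ has a source $s$, a sink $t$, the vertices $U\cup V$, and one cost center for each value $x$ in $\{w_v(i): v\in V,\ 1\le i\le\deg_G(v)\}$ (in the unweighted problem: $1,\dots,\Delta$, where $\Delta$ is the maximum degree of a machine). Its arcs are $s\to u$ for $u\in U$ and $u\to v$ for $uv\in E$, all with capacity 1 and cost 0; for each $v\in V$ and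 $1\le i\le\deg_G(v)$, an arc of capacity 1 and cost $w_v(i)$ from $v$ to the cost center $w_v(i)$; and an arc of infinite capacity and cost 0 from each cost center to $t$. Flows are integral. Algorithm. CancelAll is applied to a maximum flow of $N$ and to the subnetwork induced by a vertex set $S$, initially all vertices but $s$ and $t$. If $S$ contains at most one cost center, it halts. Otherwise it divides the cost centers in $S$ into two sets $C_1,C_2$ whose sizes differ by at most one, all of $C_1$ being smaller than all of $C_2$. It then runs Cancel: as long as the residual graph induced by $S$ has a path from $C_2$ to $C_1$, it augments the flow by a blocking flow from $C_2$ to $C_1$ in the layer graph, which consists of the residual arcs that lie on shortest such paths. Then, with $S_2$ the set of vertices reachable from $C_2$ in the residual graph induced by $S$, it calls itself on $S\setminus S_2$ and on $S_2$. The work of a run is the sum, over its calls, of $1$ for a call that halts at once and of $(k+1)(e+1)$ for any other call, where $k$ is the number of rounds of Cancel in it and $e$ the number of arcs of its subnetwork. Then, in the unweighted problem and, likewise, in the general problem with convex functions $f_v$: (1) There is an absolute constant $c$ such that, for every such instance and every maximum flow of $N$, CancelAll has a run from that flow, and every run of it from that flow ends in a min-cost flow (a maximum flow of minimum cost) of $N$,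 the edges of $E$ carrying flow then form an optimal semi-matching, and the work of the run is at most $c\sqrt n\,m\log n$. (2) CancelAll can be carried out in $O(\sqrt n\,m\log n)$ time: there are a random access machine program and constants $c,d$ such that, for every such graph, given as a list of its edges (and, in the general problem, for every such family $f_v$, given by an oracle that returns $f_v(i)$ in one step), the program halts within $c\sqrt n\,m\log n$ steps, and its output is an optimal semi-matching, namely the one that results from a run of CancelAll started from the flow of the semi-matching in which each job uses its first listed edge (and the jobs on a machine $v$ use the arcs of $v$ with the smallest indices $i$). The machine has unit-cost steps, memory that is initially zero outside the input, and words of $O(\log n)$ bits (every stored word and array index written to is at most $n^d$); in the general problem it can also store, add, subtract and compare real numbers at unit cost. -/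

import Mathlib

open scoped Classical

/-! ## Semi-matchings

A bipartite graph with job set `U` and machine set `V` is given by its edge set
`E : Finset (U × V)`. -/

section SemiMatching

variable {U V : Type} [Fintype U] [Fintype V]

/-- The degree of the machine `v` in the edge set `M`. -/
noncomputable def machineDegree (M : Finset (U × V)) (v : V) : ℕ :=
  (M.filter fun e => e.2 = v).card

/-- `M` is a semi-matching of `E`: every job is incident with exactly one edge of `M`. -/
def IsSemiMatching (E M : Finset (U × V)) : Prop :=
  M ⊆ E ∧ ∀ u : U, ∃! v : V, (u, v) ∈ M

/-- The unweighted cost: a machine of degree `d` costs `1 + 2 + ⋯ + d = d (d + 1) / 2`. -/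
noncomputable def unweightedCost (M : Finset (U × V)) : ℕ :=
  ∑ v : V, machineDegree M v * (machineDegree M v + 1) / 2

/-- The cost for machine-dependent cost functions `f v`. -/
noncomputable def machineCost (f : V → ℕ → ℝ) (M : Finset (U × V)) : ℝ :=
  ∑ v : V, f v (machineDegree M v)

/-- Discrete convexity of a function on the nonnegative integers. -/
def IsDiscreteConvex (g : ℕ → ℝ) : Prop :=
  ∀ i : ℕ, g (i + 1) - g i ≤ g (i + 2) - g (i + 1)

/-- `M` is a semi-matching of `E` of minimum cost. -/
def IsOptimalSemiMatching {α : Type} [LE α] (cost : Finset (U × V) → α)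
    (E M : Finset (U × V)) : Prop :=
  IsSemiMatching E M ∧ ∀ M' : Finset (U × V), IsSemiMatching E M' → cost M ≤ cost M'

end SemiMatching

/-! ## Flow networks (directed multigraphs) and their residual graphs -/

structure FlowNetwork (X A : Type) where
  arcs : Finset A
  tail : A → X
  head : A → X
  cap : A → ℕ∞
  cost : A → ℝ
  source : X
  sink : X

namespace FlowNetwork

variable {X A : Type} (N : FlowNetwork X A)

noncomputable def inflow (φ : A → ℕ) (x : X) : ℕ :=
  ∑ a ∈ N.arcs.filter (fun a => N.head a = x), φ a

noncomputable def outflow (φ : A → ℕ) (x : X) : ℕ :=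
  ∑ a ∈ N.arcs.filter (fun a => N.tail a = x), φ a

/-- Integral flows from the source to the sink. -/
def IsFlow (φ : A → ℕ) : Prop :=
  (∀ a ∈ N.arcs, (φ a : ℕ∞) ≤ N.cap a) ∧ (∀ a ∉ N.arcs, φ a = 0) ∧
    ∀ x : X, x ≠ N.source → x ≠ N.sink → N.inflow φ x = N.outflow φ x

noncomputable def value (φ : A → ℕ) : ℤ :=
  (N.outflow φ N.source : ℤ) - N.inflow φ N.source

noncomputable def flowCost (φ : A → ℕ) : ℝ :=
  ∑ a ∈ N.arcs, N.cost a * φ a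

def IsMaxFlow (φ : A → ℕ) : Prop :=
  N.IsFlow φ ∧ ∀ ψ : A → ℕ, N.IsFlow ψ → N.value ψ ≤ N.value φ

/-- A maximum flow whose cost is minimum among the maximum flows. -/
def IsMinCostFlow (φ : A → ℕ) : Prop :=
  N.IsMaxFlow φ ∧ ∀ ψ : A → ℕ, N.IsMaxFlow ψ → N.flowCost φ ≤ N.flowCost ψ

/-- `(a, true)` is the arc `a`, and `(a, false)` is its reversal, which decreases the flow. -/
def resTail (r : A × Bool) : X := if r.2 then N.tail r.1 else N.head r.1

def resHead (r : A × Bool) : X := if r.2 then N.head r.1 else N.tail r.1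

/-- The arcs of the residual graph of `φ`. -/
def IsResidual (φ : A → ℕ) (r : A × Bool) : Prop :=
  r.1 ∈ N.arcs ∧ if r.2 then (φ r.1 : ℕ∞) < N.cap r.1 else 0 < φ r.1

/-- `p` is a walk from `x` to `y` in the subgraph of the residual graph of `φ` that is induced
by the vertex set `S`. -/
def IsWalk (S : Set X) (φ : A → ℕ) : X → List (A × Bool) → X → Prop
  | x, [], y => x ∈ S ∧ x = y
  | x, r :: p, y =>
      x ∈ S ∧ N.IsResidual φ r ∧ N.resTail r = x ∧ IsWalk S φ (N.resHead r) p y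

/-- `p` is a walk from some vertex of `Y` to some vertex of `Z`. -/
def IsWalkBetween (S : Set X) (φ : A → ℕ) (Y Z : Set X) (p : List (A × Bool)) : Prop :=
  ∃ y ∈ Y, ∃ z ∈ Z, N.IsWalk S φ y p z

/-- `p` is a shortest walk from `Y` to `Z`. -/
def IsShortest (S : Set X) (φ : A → ℕ) (Y Z : Set X) (p : List (A × Bool)) : Prop :=
  N.IsWalkBetween S φ Y Z p ∧
    ∀ q : List (A × Bool), N.IsWalkBetween S φ Y Z q → p.length ≤ q.length

/-- The vertices reachable from `Y` in the residual graph of `φ` induced by `S`. -/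
def reachable (S : Set X) (φ : A → ℕ) (Y : Set X) : Set X :=
  {x | ∃ y ∈ Y, ∃ p, N.IsWalk S φ y p x}

/-- The number of arcs of the subnetwork induced by `S`. -/
noncomputable def numArcs (S : Set X) : ℕ :=
  (N.arcs.filter fun a => N.tail a ∈ S ∧ N.head a ∈ S).card

/-- `g` is a blocking flow, from the set `Y` of sources to the set `Z` of sinks, in the layer
graph of the residual graph of `φ` induced by `S` (all of whose arcs have capacity one, so that
an integral flow is a set of arcs). The layer graph consists of the arcs that lie on at least one
shortest path from `Y` to `Z`; the flow `g` obeys conservation outside `Y ∪ Z`, and each path from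
`Y` to `Z` in the layer graph contains a saturated arc. -/
def IsBlockingFlow (S : Set X) (φ : A → ℕ) (Y Z : Set X) (g : Finset (A × Bool)) : Prop :=
  (∀ r ∈ g, ∃ p, N.IsShortest S φ Y Z p ∧ r ∈ p) ∧
  (∀ x : X, x ∉ Y → x ∉ Z →
    (g.filter fun r => N.resHead r = x).card = (g.filter fun r => N.resTail r = x).card) ∧
  ∀ p, N.IsShortest S φ Y Z p → ∃ r ∈ p, r ∈ g

end FlowNetwork

/-! ## The min-cost flow network of a bipartite graph -/

/-- The vertices of the network. A cost center is named by its cost. -/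
inductive NetVertex (U V : Type) : Type
  | source
  | sink
  | job (u : U)
  | machine (v : V)
  | center (x : ℝ)

/-- The arcs of the network: `supply u` goes from the source to `u`, `assign u v` from `u` to `v`,
`slot v i` from `v` to the cost center of the `(i + 1)`-st job on `v`, and `drain x` from the cost
center `x` to the sink. -/
inductive NetArc (U V : Type) : Type
  | supply (u : U)
  | assign (u : U) (v : V)
  | slot (v : V) (i : ℕ)
  | drain (x : ℝ)

section Network

variable {U V : Type} [Fintype U] [Fintype V]

/-- The set of cost centers, where `w v i` is the cost of the `(i + 1)`-st job on `v`. -/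
noncomputable def centers (E : Finset (U × V)) (w : V → ℕ → ℝ) : Finset ℝ :=
  Finset.univ.biUnion fun v : V => (Finset.range (machineDegree E v)).image (w v)

/-- The min-cost flow network of the graph `E`: the machine `v` has, for every `i < deg v`, an arc
of capacity one and cost `w v i` to the cost center `w v i`. -/
noncomputable def semiMatchingNetwork (E : Finset (U × V)) (w : V → ℕ → ℝ) :
    FlowNetwork (NetVertex U V) (NetArc U V) where
  arcs :=
    Finset.univ.image NetArc.supply ∪ E.image (fun e => NetArc.assign e.1 e.2) ∪
      (Finset.univ.biUnion fun v : V =>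
        (Finset.range (machineDegree E v)).image (NetArc.slot v)) ∪
      (centers E w).image NetArc.drain
  tail
    | .supply _ => .source
    | .assign u _ => .job u
    | .slot v _ => .machine v
    | .drain x => .center x
  head
    | .supply u => .job u
    | .assign _ v => .machine v
    | .slot v i => .center (w v i)
    | .drain _ => .sink
  cap
    | .supply _ => 1
    | .assign _ _ => 1
    | .slot _ _ => 1
    | .drain _ => ⊤
  cost
    | .supply _ => 0
    | .assign _ _ => 0
    | .slot v i => w v i
    | .drain _ => 0
  source := .source
  sink := .sink

/-- In the unweighted problem the `(i + 1)`-st job on a machine costs `i + 1`, so that the cost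
centers are `1, …, Δ`, where `Δ` is the maximum degree of a machine. -/
def unweightedSlot : V → ℕ → ℝ := fun _ i => (i : ℝ) + 1

/-- For cost functions `f v` the `(i + 1)`-st job on `v` costs `f v (i + 1) - f v i`. -/
def marginalSlot (f : V → ℕ → ℝ) : V → ℕ → ℝ := fun v i => f v (i + 1) - f v i

/-- The edges of the graph that carry flow. -/
noncomputable def flowEdges (E : Finset (U × V)) (φ : NetArc U V → ℕ) : Finset (U × V) :=
  E.filter fun e => φ (.assign e.1 e.2) ≠ 0

/-- The flow of a semi-matching `M`: the jobs on a machine `v` occupy its first slots. -/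
noncomputable def flowOf (w : V → ℕ → ℝ) (M : Finset (U × V)) : NetArc U V → ℕ
  | .supply _ => 1
  | .assign u v => if (u, v) ∈ M then 1 else 0
  | .slot v i => if i < machineDegree M v then 1 else 0
  | .drain x => ∑ v : V, ((Finset.range (machineDegree M v)).filter fun i => w v i = x).card

/-! ## The algorithm CancelAll -/

/-- The vertices of the network without the source and the sink. -/
def innerVertices (E : Finset (U × V)) (w : V → ℕ → ℝ) : Set (NetVertex U V) :=
  {x | match x with
    | .source => False
    | .sink => False
    | .job _ => True
    | .machine _ => True
    | .center c => c ∈ centers E w}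

/-- The cost centers of the subnetwork induced by `S`. -/
noncomputable def centersIn (E : Finset (U × V)) (w : V → ℕ → ℝ) (S : Set (NetVertex U V)) :
    Finset ℝ :=
  (centers E w).filter fun c => NetVertex.center c ∈ S

/-- A set of cost centers, as a set of vertices. -/
def centerSet (C : Finset ℝ) : Set (NetVertex U V) := {x | ∃ c ∈ C, x = .center c}

/-- One round of the blocking flow algorithm in the subnetwork induced by `S`: a blocking flow `g`
from `C₂` to `C₁` in the layer graph is added to `φ`. The flow from the cost centers to the sink
follows by conservation. -/
def AugmentRound (E : Finset (U × V)) (w : V → ℕ → ℝ) (S : Set (NetVertex U V))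
    (C₂ C₁ : Finset ℝ) (φ φ' : NetArc U V → ℕ) : Prop :=
  ∃ g : Finset (NetArc U V × Bool),
    (semiMatchingNetwork E w).IsBlockingFlow S φ (centerSet C₂) (centerSet C₁) g ∧
    (semiMatchingNetwork E w).IsFlow φ' ∧
    ∀ a : NetArc U V, (∀ x, a ≠ .drain x) →
      (φ' a : ℤ) = φ a + (if (a, true) ∈ g then 1 else 0) - (if (a, false) ∈ g then 1 else 0)

/-- `Cancel E w S C₂ C₁ φ φ' k`: the procedure Cancel, run on the subnetwork induced by `S`, turns
the flow `φ` into `φ'` in `k` rounds. It performs rounds as long as there is a path from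
`C₂` to `C₁` in the residual graph. -/
inductive Cancel (E : Finset (U × V)) (w : V → ℕ → ℝ) (S : Set (NetVertex U V))
    (C₂ C₁ : Finset ℝ) : (NetArc U V → ℕ) → (NetArc U V → ℕ) → ℕ → Prop
  | done (φ : NetArc U V → ℕ)
      (h : ¬ ∃ p, (semiMatchingNetwork E w).IsWalkBetween S φ (centerSet C₂) (centerSet C₁) p) :
      Cancel E w S C₂ C₁ φ φ 0
  | round (φ φ' φ'' : NetArc U V → ℕ) (k : ℕ)
      (h : ∃ p, (semiMatchingNetwork E w).IsWalkBetween S φ (centerSet C₂) (centerSet C₁) p)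
      (hround : AugmentRound E w S C₂ C₁ φ φ')
      (hrest : Cancel E w S C₂ C₁ φ' φ'' k) :
      Cancel E w S C₂ C₁ φ φ'' (k + 1)

/-- `CancelAll E w S φ φ' t`: a run of CancelAll on the subnetwork induced by `S` turns the flow
`φ` into `φ'` with work `t`. Every round of Cancel, and also the last search of Cancel together
with the division of the subnetwork, is charged the number of arcs of the subnetwork plus one. -/
inductive CancelAll (E : Finset (U × V)) (w : V → ℕ → ℝ) :
    Set (NetVertex U V) → (NetArc U V → ℕ) → (NetArc U V → ℕ) → ℕ → Prop
  | halt (S : Set (NetVertex U V)) (φ : NetArc U V → ℕ)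
      (h : (centersIn E w S).card ≤ 1) :
      CancelAll E w S φ φ 1
  | divide (S S₂ : Set (NetVertex U V)) (C₁ C₂ : Finset ℝ)
      (φ φ₁ φ₂ φ₃ : NetArc U V → ℕ) (k t₁ t₂ : ℕ)
      (h : 1 < (centersIn E w S).card)
      (hunion : C₁ ∪ C₂ = centersIn E w S)
      (horder : ∀ x ∈ C₁, ∀ y ∈ C₂, x < y)
      (hsize₁ : C₁.card ≤ C₂.card + 1) (hsize₂ : C₂.card ≤ C₁.card + 1)
      (hcancel : Cancel E w S C₂ C₁ φ φ₁ k)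
      (hreach : S₂ = (semiMatchingNetwork E w).reachable S φ₁ (centerSet C₂))
      (hrec₁ : CancelAll E w (S \ S₂) φ₁ φ₂ t₁)
      (hrec₂ : CancelAll E w S₂ φ₂ φ₃ t₂) :
      CancelAll E w S φ φ₃ ((k + 1) * ((semiMatchingNetwork E w).numArcs S + 1) + t₁ + t₂)

/-- The semi-matching that assigns every job along its first edge in the list. -/
noncomputable def firstSemiMatching (es : List (U × V)) : Finset (U × V) :=
  es.toFinset.filter fun e => es.find? (fun e' => decide (e'.1 = e.1)) = some e

end Network

/-! ## A random access machine

Programs are structured programs over word registers, arrays of words, real registers and arrays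
of reals. Words are natural numbers. Each evaluated node of an expression and each executed
statement or test costs one step. The reals can only be read off the cost functions (one query per
step), added, subtracted, compared and stored. -/

namespace RAM

structure State where
  reg : ℕ → ℕ
  mem : ℕ → ℕ → ℕ
  realReg : ℕ → ℝ
  realMem : ℕ → ℕ → ℝ

def State.setReg (σ : State) (x n : ℕ) : State :=
  { σ with reg := Function.update σ.reg x n }

def State.setMem (σ : State) (a i n : ℕ) : State :=
  { σ with mem := Function.update σ.mem a (Function.update (σ.mem a) i n) }

noncomputable def State.setRealReg (σ : State) (x : ℕ) (r : ℝ) : State :=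
  { σ with realReg := Function.update σ.realReg x r }

noncomputable def State.setRealMem (σ : State) (a i : ℕ) (r : ℝ) : State :=
  { σ with realMem := Function.update σ.realMem a (Function.update (σ.realMem a) i r) }

inductive WordExp : Type
  | lit (n : ℕ)
  | reg (x : ℕ)
  | mem (a : ℕ) (i : WordExp)
  | plus (e e' : WordExp)
  | minus (e e' : WordExp)
  | times (e e' : WordExp)
  | quot (e e' : WordExp)

namespace WordExp

def eval (σ : State) : WordExp → ℕ
  | lit n => n
  | reg x => σ.reg x
  | mem a i => σ.mem a (i.eval σ)
  | plus e e' => e.eval σ + e'.eval σ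
  | minus e e' => e.eval σ - e'.eval σ
  | times e e' => e.eval σ * e'.eval σ
  | quot e e' => e.eval σ / e'.eval σ

def steps : WordExp → ℕ
  | lit _ => 1
  | reg _ => 1
  | mem _ i => i.steps + 1
  | plus e e' => e.steps + e'.steps + 1
  | minus e e' => e.steps + e'.steps + 1
  | times e e' => e.steps + e'.steps + 1
  | quot e e' => e.steps + e'.steps + 1

end WordExp

/-- `query v i` is the value of the cost function of machine `v` at `i`. -/
inductive RealExp : Type
  | reg (x : ℕ)
  | mem (a : ℕ) (i : WordExp)
  | query (v i : WordExp)
  | plus (r r' : RealExp)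
  | minus (r r' : RealExp)

namespace RealExp

noncomputable def eval (F : ℕ → ℕ → ℝ) (σ : State) : RealExp → ℝ
  | reg x => σ.realReg x
  | mem a i => σ.realMem a (i.eval σ)
  | query v i => F (v.eval σ) (i.eval σ)
  | plus r r' => r.eval F σ + r'.eval F σ
  | minus r r' => r.eval F σ - r'.eval F σ

def steps : RealExp → ℕ
  | reg _ => 1
  | mem _ i => i.steps + 1
  | query v i => v.steps + i.steps + 1
  | plus r r' => r.steps + r'.steps + 1
  | minus r r' => r.steps + r'.steps + 1

end RealExp

inductive Test : Type
  | wordLt (e e' : WordExp)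
  | wordEq (e e' : WordExp)
  | realLt (r r' : RealExp)

namespace Test

def Holds (F : ℕ → ℕ → ℝ) (σ : State) : Test → Prop
  | wordLt e e' => e.eval σ < e'.eval σ
  | wordEq e e' => e.eval σ = e'.eval σ
  | realLt r r' => r.eval F σ < r'.eval F σ

def steps : Test → ℕ
  | wordLt e e' => e.steps + e'.steps + 1
  | wordEq e e' => e.steps + e'.steps + 1
  | realLt r r' => r.steps + r'.steps + 1

end Test

inductive Program : Type
  | nop
  | letWord (x : ℕ) (e : WordExp)
  | putWord (a : ℕ) (i e : WordExp)
  | letReal (x : ℕ) (r : RealExp)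
  | putReal (a : ℕ) (i : WordExp) (r : RealExp)
  | seq (p q : Program)
  | ite (b : Test) (p q : Program)
  | loop (b : Test) (p : Program)

/-- `Exec W F p σ σ' t`: with the cost functions `F`, the program `p`, started in the state `σ`,
halts in the state `σ'` after `t` steps, and every word and every array index that it writes is at
most `W`. (Expressions of a program have bounded size, so that intermediate values are then
bounded by a fixed power of `W`.) -/
inductive Exec (W : ℕ) (F : ℕ → ℕ → ℝ) : Program → State → State → ℕ → Prop
  | nop (σ : State) : Exec W F .nop σ σ 1
  | letWord (σ : State) (x : ℕ) (e : WordExp) (h : e.eval σ ≤ W) :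
      Exec W F (.letWord x e) σ (σ.setReg x (e.eval σ)) (e.steps + 1)
  | putWord (σ : State) (a : ℕ) (i e : WordExp) (hi : i.eval σ ≤ W) (he : e.eval σ ≤ W) :
      Exec W F (.putWord a i e) σ (σ.setMem a (i.eval σ) (e.eval σ)) (i.steps + e.steps + 1)
  | letReal (σ : State) (x : ℕ) (r : RealExp) :
      Exec W F (.letReal x r) σ (σ.setRealReg x (r.eval F σ)) (r.steps + 1)
  | putReal (σ : State) (a : ℕ) (i : WordExp) (r : RealExp) (hi : i.eval σ ≤ W) :
      Exec W F (.putReal a i r) σ (σ.setRealMem a (i.eval σ) (r.eval F σ)) (i.steps + r.steps + 1)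
  | seq (p q : Program) (σ σ' σ'' : State) (t t' : ℕ)
      (hp : Exec W F p σ σ' t) (hq : Exec W F q σ' σ'' t') :
      Exec W F (.seq p q) σ σ'' (t + t')
  | iteTrue (b : Test) (p q : Program) (σ σ' : State) (t : ℕ)
      (hb : b.Holds F σ) (hp : Exec W F p σ σ' t) :
      Exec W F (.ite b p q) σ σ' (b.steps + t)
  | iteFalse (b : Test) (p q : Program) (σ σ' : State) (t : ℕ)
      (hb : ¬ b.Holds F σ) (hq : Exec W F q σ σ' t) :
      Exec W F (.ite b p q) σ σ' (b.steps + t)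
  | loopDone (b : Test) (p : Program) (σ : State) (hb : ¬ b.Holds F σ) :
      Exec W F (.loop b p) σ σ b.steps
  | loopStep (b : Test) (p : Program) (σ σ' σ'' : State) (t t' : ℕ)
      (hb : b.Holds F σ) (hp : Exec W F p σ σ' t) (hrest : Exec W F (.loop b p) σ' σ'' t') :
      Exec W F (.loop b p) σ σ'' (b.steps + t + t')

/-- The initial state for a graph with `nU` jobs and `nV` machines, given by the list of its edges:
registers 0, 1, 2 hold the numbers of jobs, machines and edges, and cell `j` of arrays 0 and 1 holds
the job and the machine of the `j`-th edge. All other registers and cells are zero. -/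
def inputState (nU nV : ℕ) (es : List (Fin nU × Fin nV)) : State where
  reg x := if x = 0 then nU else if x = 1 then nV else if x = 2 then es.length else 0
  mem a j :=
    if a = 0 then (es[j]?.map fun e => (e.1 : ℕ)).getD 0
    else if a = 1 then (es[j]?.map fun e => (e.2 : ℕ)).getD 0
    else 0
  realReg _ := 0
  realMem _ _ := 0

/-- Access to the cost functions of the machines by machine number. -/
noncomputable def costQuery {nV : ℕ} (f : Fin nV → ℕ → ℝ) : ℕ → ℕ → ℝ :=
  fun v i => if h : v < nV then f ⟨v, h⟩ i else 0

/-- On halting, cell `u` of array 2 holds the machine to which `M` assigns the job `u`. -/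
def Outputs {nU nV : ℕ} (σ : State) (M : Finset (Fin nU × Fin nV)) : Prop :=
  ∀ u v, (u, v) ∈ M ↔ σ.mem 2 (u : ℕ) = (v : ℕ)

end RAM

/-- The bound `√n · m · log n`. -/
noncomputable def timeBound (n m : ℕ) : ℝ := Real.sqrt n * m * Real.log n

/-!
Every job sends one unit of flow to a machine, and the unit leaves the machine through one of its
slots, which lead to the cost centers. A maximum flow is one that saturates every job
(`isMaxFlow_iff`). By convexity the slot costs of a machine increase, so that the cheapest flow with
given loads uses the first slots, and the cost of a semi-matching is, up to a constant, the least
cost of a flow that carries it (`slotCost_flowEdges_le`). The unweighted problem is the special case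
of the convex cost functions `d (d + 1) / 2` (`triangularCost`).

*Correctness.* A run of CancelAll ends in a flow without residual paths from a cost center to a
smaller one (`CancelAll.basic`): after Cancel no residual arc leaves the set reached from the larger
centers, and the recursive calls do not change the arcs that cross this set. Labelling a vertex by
the largest center from which it is reachable gives dual potentials that certify the optimality of
such a flow (`NoDescent.flowCost_le`). Runs exist since a blocking flow exists in every layer graph.

*Work.* A round of Cancel increases the length of the shortest residual paths from the larger
centers to the smaller ones (`AugmentRound.length_lt`) and moves at least one unit of flow. If these
paths have length at least `D`, every unit that can still be moved uses `D` of at most `4 |U|` units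
of change (`IsDivision.mul_lowFlow_le`). With `D = k / 2` after half of `k` rounds, `k = O(√|U|)`
(`Rounds.sq_le`). The subnetworks of one level of the recursion are disjoint and there are
`O(log m)` levels, which bounds the work (`CancelAll.work_le`).

*Random access machine.* The flow is stored as an assignment of jobs to machines, whose jobs occupy
the first slots. Consequently the slots and cost centers need not be searched: a machine is
overloaded or underloaded according to whether it has more or fewer jobs than it has slots that lead
to the smaller centers, and Cancel moves jobs from overloaded to underloaded machines. All
subnetworks of one level of the recursion are treated at the same time, each machine knowing the
interval of ranks of the cost centers of its subnetwork. A round consists of one breadth-first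
search, which labels machines, and one depth-first search, which moves jobs along increasing labels;
both take time `O(m)` (`RAM.round_runs`), and the result is a round of Cancel in every subnetwork
where Cancel has not stopped (`LevelState.round`). Hence a level takes as many rounds as the slowest
of its subnetworks (`RAM.level_runs`), and the levels together make up a run of CancelAll
(`LevelRun.cancelAll`). The ranks of the cost centers are found by counting in the unweighted
problem, and by sorting with a tournament tree in the general one (`RAM.SortState`).
-/

set_option linter.unusedSectionVars false

/-! ### Walks in residual graphs -/

namespace FlowNetwork

variable {X A : Type} {N : FlowNetwork X A} {S : Set X} {φ : A → ℕ}

theorem IsWalk.start_mem {x y : X} {p : List (A × Bool)} (h : N.IsWalk S φ x p y) : x ∈ S := by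
  cases p <;> exact h.1

theorem IsWalk.append {x y z : X} {p q : List (A × Bool)} (hp : N.IsWalk S φ x p y)
    (hq : N.IsWalk S φ y q z) : N.IsWalk S φ x (p ++ q) z := by
  induction p generalizing x with
  | nil => obtain ⟨_, rfl⟩ := hp; exact hq
  | cons r p ih => exact ⟨hp.1, hp.2.1, hp.2.2.1, ih hp.2.2.2⟩

theorem IsWalk.end_mem {x y : X} {p : List (A × Bool)} (h : N.IsWalk S φ x p y) : y ∈ S := by
  induction p generalizing x with
  | nil => exact h.2 ▸ h.1
  | cons r p ih => exact ih h.2.2.2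

theorem IsWalk.snoc {x : X} {p : List (A × Bool)} {r : A × Bool}
    (hp : N.IsWalk S φ x p (N.resTail r)) (hr : N.IsResidual φ r) (hS : N.resHead r ∈ S) :
    N.IsWalk S φ x (p ++ [r]) (N.resHead r) :=
  hp.append ⟨hp.end_mem, hr, rfl, hS, rfl⟩

theorem IsWalk.residual {x y : X} {p : List (A × Bool)} (h : N.IsWalk S φ x p y) :
    ∀ r ∈ p, N.IsResidual φ r ∧ N.resTail r ∈ S ∧ N.resHead r ∈ S := by
  induction p generalizing x with
  | nil => simp
  | cons r p ih =>
    obtain ⟨h1, h2, h3, h4⟩ := h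
    intro r' hr'
    rcases List.mem_cons.1 hr' with rfl | hr'
    · exact ⟨h2, h3 ▸ h1, h4.start_mem⟩
    · exact ih h4 r' hr'

theorem IsWalk.congr {φ' : A → ℕ} {x y : X} {p : List (A × Bool)} (h : N.IsWalk S φ x p y)
    (hr : ∀ r ∈ p, N.IsResidual φ' r) : N.IsWalk S φ' x p y := by
  induction p generalizing x with
  | nil => exact h
  | cons r p ih =>
    exact ⟨h.1, hr r (by simp), h.2.2.1, ih h.2.2.2 fun r' h' => hr r' (by simp [h'])⟩

theorem IsWalk.potential_le {f : X → ℕ} {x y : X} {p : List (A × Bool)}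
    (h : N.IsWalk S φ x p y) (hf : ∀ r ∈ p, f (N.resHead r) ≤ f (N.resTail r) + 1) :
    f y ≤ f x + p.length := by
  induction p generalizing x with
  | nil => simp [h.2]
  | cons r p ih =>
    have := ih h.2.2.2 fun r' h' => hf r' (by simp [h'])
    have h1 := hf r (by simp)
    rw [h.2.2.1] at h1
    simp only [List.length_cons]; omega

/-- A walk whose length equals the increase of a potential that grows by at most one along every
arc gains exactly one on each of its arcs. -/
theorem IsWalk.potential_tight {f : X → ℕ} {x y : X} {p : List (A × Bool)}
    (h : N.IsWalk S φ x p y) (hf : ∀ r ∈ p, f (N.resHead r) ≤ f (N.resTail r) + 1)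
    (ht : f y = f x + p.length) : ∀ r ∈ p, f (N.resHead r) = f (N.resTail r) + 1 := by
  induction p generalizing x with
  | nil => simp
  | cons r p ih =>
    have h2 := IsWalk.potential_le h.2.2.2 fun r' h' => hf r' (by simp [h'])
    have h1 := hf r (by simp)
    have h3 := h.2.2.1
    simp only [List.length_cons] at ht
    intro r' hr'
    rw [h3] at h1
    rcases List.mem_cons.1 hr' with rfl | hr'
    · rw [h3]; omega
    · exact ih h.2.2.2 (fun r' h' => hf r' (by simp [h'])) (by omega) r' hr'

theorem mem_reachable_of_residual {Y : Set X} {r : A × Bool}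
    (h : N.resTail r ∈ N.reachable S φ Y) (hr : N.IsResidual φ r) (hS : N.resHead r ∈ S) :
    N.resHead r ∈ N.reachable S φ Y := by
  obtain ⟨y, hy, p, hp⟩ := h
  exact ⟨y, hy, _, hp.snoc hr hS⟩

/-- The distance from `Y` in the residual graph induced by `S`, truncated at `D`. -/
noncomputable def level (N : FlowNetwork X A) (S : Set X) (φ : A → ℕ) (Y : Set X) (D : ℕ)
    (x : X) : ℕ :=
  sInf ({n | ∃ y ∈ Y, ∃ p, N.IsWalk S φ y p x ∧ p.length = n} ∪ {D})

section Level

variable {Y Z : Set X} {D : ℕ}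

theorem level_le_of_walk {x y : X} {p : List (A × Bool)} (hy : y ∈ Y)
    (hp : N.IsWalk S φ y p x) : N.level S φ Y D x ≤ p.length :=
  Nat.sInf_le (Or.inl ⟨y, hy, p, hp, rfl⟩)

theorem level_le (x : X) : N.level S φ Y D x ≤ D := Nat.sInf_le (Or.inr rfl)

/-- A label below `D` is attained by a walk. -/
theorem level_spec (x : X) : (∃ y ∈ Y, ∃ p, N.IsWalk S φ y p x ∧ p.length = N.level S φ Y D x) ∨
    N.level S φ Y D x = D :=
  Nat.sInf_mem (s := {n | ∃ y ∈ Y, ∃ p, N.IsWalk S φ y p x ∧ p.length = n} ∪ {D})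
    ⟨D, Or.inr rfl⟩

theorem level_source {y : X} (hy : y ∈ Y) (hS : y ∈ S) : N.level S φ Y D y = 0 :=
  Nat.le_zero.1 (level_le_of_walk (p := []) hy ⟨hS, rfl⟩)

theorem level_step {r : A × Bool} (hr : N.IsResidual φ r) (hS : N.resHead r ∈ S) :
    N.level S φ Y D (N.resHead r) ≤ N.level S φ Y D (N.resTail r) + 1 := by
  rcases level_spec (N := N) (S := S) (φ := φ) (Y := Y) (D := D) (N.resTail r) with
    ⟨y, hy, p, hp, hl⟩ | h
  · have := level_le_of_walk (D := D) hy (hp.snoc hr hS)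
    simp only [List.length_append, List.length_singleton] at this
    omega
  · have := level_le (N := N) (S := S) (φ := φ) (Y := Y) (D := D) (N.resHead r)
    omega

/-- If all walks to `Z` have length at least `D`, the truncated distance of `Z` is `D`. -/
theorem level_target (hD : ∀ p, N.IsWalkBetween S φ Y Z p → D ≤ p.length) {z : X} (hz : z ∈ Z) :
    N.level S φ Y D z = D := by
  rcases level_spec (N := N) (S := S) (φ := φ) (Y := Y) (D := D) z with ⟨y, hy, p, hp, hl⟩ | h
  · have := hD p ⟨y, hy, z, hz, hp⟩
    have := level_le (N := N) (S := S) (φ := φ) (Y := Y) (D := D) z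
    omega
  · exact h

/-- Along a shortest path the distance grows by one with every arc. -/
theorem level_tight {p : List (A × Bool)} (hp : N.IsShortest S φ Y Z p) {r : A × Bool}
    (hr : r ∈ p) : N.level S φ Y p.length (N.resHead r) =
      N.level S φ Y p.length (N.resTail r) + 1 := by
  obtain ⟨⟨y, hy, z, hz, hw⟩, hmin⟩ := hp
  refine hw.potential_tight (fun r hr => ?_) ?_ r hr
  · exact level_step (hw.residual r hr).1 (hw.residual r hr).2.2
  · rw [level_target hmin hz, level_source hy hw.start_mem, Nat.zero_add]

end Level

theorem exists_isShortest {Y Z : Set X} (h : ∃ p, N.IsWalkBetween S φ Y Z p) :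
    ∃ p, N.IsShortest S φ Y Z p := by
  obtain ⟨p, hp⟩ := h
  obtain ⟨q, hq, hl⟩ := Nat.sInf_mem (s := {n | ∃ p, N.IsWalkBetween S φ Y Z p ∧ p.length = n})
    ⟨_, p, hp, rfl⟩
  exact ⟨q, hq, fun q' hq' => hl ▸ Nat.sInf_le ⟨q', hq', rfl⟩⟩

end FlowNetwork

/-! ### Flows that saturate every job -/

section Flows

variable {U V : Type} [Fintype U] [Fintype V] {E : Finset (U × V)} {w : V → ℕ → ℝ}

@[simp] theorem supply_mem_arcs (u : U) :
    NetArc.supply u ∈ (semiMatchingNetwork E w).arcs := by simp [semiMatchingNetwork]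

@[simp] theorem assign_mem_arcs (u : U) (v : V) :
    NetArc.assign u v ∈ (semiMatchingNetwork E w).arcs ↔ (u, v) ∈ E := by
  simp [semiMatchingNetwork]

@[simp] theorem slot_mem_arcs (v : V) (i : ℕ) :
    NetArc.slot v i ∈ (semiMatchingNetwork E w).arcs ↔ i < machineDegree E v := by
  simp [semiMatchingNetwork]

@[simp] theorem drain_mem_arcs (x : ℝ) :
    NetArc.drain x ∈ (semiMatchingNetwork E w).arcs ↔ x ∈ centers E w := by
  simp [semiMatchingNetwork]

theorem mem_centers {x : ℝ} : x ∈ centers E w ↔ ∃ v, ∃ i < machineDegree E v, w v i = x := by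
  simp [centers]

theorem sum_arcs {β : Type*} [AddCommMonoid β] (F : NetArc U V → β) :
    ∑ a ∈ (semiMatchingNetwork E w).arcs, F a =
      ∑ u, F (.supply u) + ∑ e ∈ E, F (.assign e.1 e.2) +
        ∑ v, ∑ i ∈ Finset.range (machineDegree E v), F (.slot v i) +
        ∑ x ∈ centers E w, F (.drain x) := by
  simp only [semiMatchingNetwork]
  rw [Finset.sum_union, Finset.sum_union, Finset.sum_union, Finset.sum_image, Finset.sum_image,
    Finset.sum_image, Finset.sum_biUnion]
  · congr 2
    refine Finset.sum_congr rfl fun v _ => ?_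
    rw [Finset.sum_image]
    intro a _ b _ h; simpa using h
  · intro v _ v' _ hv
    simp only [Function.onFun]
    rw [Finset.disjoint_left]
    intro a ha ha'
    simp only [Finset.mem_image, Finset.mem_range] at ha ha'
    obtain ⟨i, _, rfl⟩ := ha
    obtain ⟨i', _, h⟩ := ha'
    exact hv (by simpa using (NetArc.slot.inj h).1.symm)
  · intro a _ b _ h; simpa using h
  · intro a _ b _ h
    have := NetArc.assign.inj h
    exact Prod.ext this.1 this.2
  · intro a _ b _ h; simpa using h
  · rw [Finset.disjoint_left]; simp only [Finset.mem_image]; rintro a ⟨_, _, rfl⟩ ⟨_, _, h⟩; cases h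
  · rw [Finset.disjoint_left]
    simp only [Finset.mem_image, Finset.mem_union, Finset.mem_biUnion]
    rintro a (⟨_, _, rfl⟩ | ⟨_, _, rfl⟩) ⟨_, _, _, _, h⟩ <;> cases h
  · rw [Finset.disjoint_left]
    simp only [Finset.mem_image, Finset.mem_union, Finset.mem_biUnion]
    rintro a ((⟨_, _, rfl⟩ | ⟨_, _, rfl⟩) | ⟨_, _, _, _, rfl⟩) ⟨_, _, h⟩ <;> cases h

/-- The arcs that are not incident with the source or the sink. -/
def NetArc.IsInner : NetArc U V → Prop
  | .assign _ _ => True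
  | .slot _ _ => True
  | _ => False

variable (E w) in
/-- The `assign` and `slot` arcs of the network. -/
noncomputable def innerArcs : Finset (NetArc U V) :=
  (semiMatchingNetwork E w).arcs.filter NetArc.IsInner

theorem sum_innerArcs {β : Type*} [AddCommMonoid β] (F : NetArc U V → β) :
    ∑ a ∈ innerArcs E w, F a = ∑ e ∈ E, F (.assign e.1 e.2) +
        ∑ v, ∑ i ∈ Finset.range (machineDegree E v), F (.slot v i) := by
  rw [innerArcs, Finset.sum_filter, sum_arcs]
  simp [NetArc.IsInner]

theorem inflow_eq (φ : NetArc U V → ℕ) (x : NetVertex U V) :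
    (semiMatchingNetwork E w).inflow φ x =
      ∑ a ∈ (semiMatchingNetwork E w).arcs,
        if (semiMatchingNetwork E w).head a = x then φ a else 0 := by
  rw [FlowNetwork.inflow, Finset.sum_filter]

theorem outflow_eq (φ : NetArc U V → ℕ) (x : NetVertex U V) :
    (semiMatchingNetwork E w).outflow φ x =
      ∑ a ∈ (semiMatchingNetwork E w).arcs,
        if (semiMatchingNetwork E w).tail a = x then φ a else 0 := by
  rw [FlowNetwork.outflow, Finset.sum_filter]

variable (E w) in
/-- The integral flows that send one unit through every job, in terms of their conservation laws. -/
structure IsFull (φ : NetArc U V → ℕ) : Prop where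
  supply : ∀ u, φ (.supply u) = 1
  assign_le : ∀ u v, φ (.assign u v) ≤ 1
  slot_le : ∀ v i, φ (.slot v i) ≤ 1
  zero : ∀ a ∉ (semiMatchingNetwork E w).arcs, φ a = 0
  job : ∀ u, ∑ e ∈ E.filter (fun e => e.1 = u), φ (.assign e.1 e.2) = 1
  machine : ∀ v, ∑ e ∈ E.filter (fun e => e.2 = v), φ (.assign e.1 e.2) =
    ∑ i ∈ Finset.range (machineDegree E v), φ (.slot v i)
  drain : ∀ x ∈ centers E w, ∑ v, ∑ i ∈ Finset.range (machineDegree E v),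
    (if w v i = x then φ (.slot v i) else 0) = φ (.drain x)

theorem isFull_iff {φ : NetArc U V → ℕ} :
    IsFull E w φ ↔ (semiMatchingNetwork E w).IsFlow φ ∧ ∀ u, φ (.supply u) = 1 := by
  constructor
  · intro h
    refine ⟨⟨?_, h.zero, ?_⟩, h.supply⟩
    · rintro (u | ⟨u, v⟩ | ⟨v, i⟩ | x) _
      · simp [semiMatchingNetwork, h.supply]
      · simpa [semiMatchingNetwork] using h.assign_le u v
      · simpa [semiMatchingNetwork] using h.slot_le v i
      · simp [semiMatchingNetwork]
    · intro x hs ht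
      rw [inflow_eq, outflow_eq, sum_arcs, sum_arcs]
      rcases x with _ | _ | u | v | x
      · exact absurd rfl hs
      · exact absurd rfl ht
      · have := h.job u
        rw [Finset.sum_filter] at this
        simp [semiMatchingNetwork, h.supply, this]
      · have := h.machine v
        rw [Finset.sum_filter] at this
        simp [semiMatchingNetwork, this]
      · simp only [semiMatchingNetwork, reduceCtorEq, if_false, Finset.sum_const_zero,
          NetVertex.center.injEq, zero_add, add_zero]
        by_cases hx : x ∈ centers E w
        · rw [h.drain x hx]; simp [hx]
        · simp only [Finset.sum_ite_eq', hx, if_false]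
          refine Finset.sum_eq_zero fun v _ => Finset.sum_eq_zero fun i hi => ?_
          rw [if_neg]; rintro rfl
          exact hx (mem_centers.2 ⟨v, i, by simpa using hi, rfl⟩)
  · rintro ⟨⟨hc, hz, hcons⟩, hs⟩
    refine ⟨hs, ?_, ?_, hz, ?_, ?_, ?_⟩
    · intro u v
      by_cases h : (u, v) ∈ E
      · simpa [semiMatchingNetwork] using hc (.assign u v) (by simpa using h)
      · rw [hz _ (by simpa using h)]; simp
    · intro v i
      by_cases h : i < machineDegree E v
      · simpa [semiMatchingNetwork] using hc (.slot v i) (by simpa using h)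
      · rw [hz _ (by simpa using h)]; simp
    · intro u
      have := hcons (.job u) (by simp [semiMatchingNetwork]) (by simp [semiMatchingNetwork])
      rw [inflow_eq, outflow_eq, sum_arcs, sum_arcs] at this
      rw [Finset.sum_filter]
      simpa [semiMatchingNetwork, hs, eq_comm] using this
    · intro v
      have := hcons (.machine v) (by simp [semiMatchingNetwork]) (by simp [semiMatchingNetwork])
      rw [inflow_eq, outflow_eq, sum_arcs, sum_arcs] at this
      rw [Finset.sum_filter]
      simpa [semiMatchingNetwork, ← Finset.ite_sum_zero] using this
    · intro x hx
      have := hcons (.center x) (by simp [semiMatchingNetwork]) (by simp [semiMatchingNetwork])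
      rw [inflow_eq, outflow_eq, sum_arcs, sum_arcs] at this
      simpa [semiMatchingNetwork, hx] using this

theorem value_eq (φ : NetArc U V → ℕ) :
    (semiMatchingNetwork E w).value φ = ∑ u, (φ (.supply u) : ℤ) := by
  rw [FlowNetwork.value, inflow_eq, outflow_eq, sum_arcs, sum_arcs]
  simp [semiMatchingNetwork]

theorem flowCost_eq (φ : NetArc U V → ℕ) :
    (semiMatchingNetwork E w).flowCost φ =
      ∑ v, ∑ i ∈ Finset.range (machineDegree E v), w v i * φ (.slot v i) := by
  rw [FlowNetwork.flowCost, sum_arcs]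
  simp [semiMatchingNetwork]

theorem machineDegree_mono {M : Finset (U × V)} (h : M ⊆ E) (v : V) :
    machineDegree M v ≤ machineDegree E v :=
  Finset.card_le_card (Finset.filter_subset_filter _ h)

/-- The flow of a semi-matching is full. -/
theorem IsSemiMatching.isFull {M : Finset (U × V)} (hM : IsSemiMatching E M) :
    IsFull E w (flowOf w M) := by
  have hdeg := fun v => machineDegree_mono hM.1 v
  have hr : ∀ v, (Finset.range (machineDegree E v)).filter (fun i => i < machineDegree M v) =
      Finset.range (machineDegree M v) := by
    intro v; ext i; have := hdeg v; simp; omega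
  have hS : ∀ (P : U × V → Prop), E.filter (fun e => P e ∧ e ∈ M) = M.filter P := by
    intro P; ext e; simp only [Finset.mem_filter]
    exact ⟨fun h => ⟨h.2.2, h.2.1⟩, fun h => ⟨hM.1 h.1, h.2, h.1⟩⟩
  refine ⟨fun u => rfl, ?_, ?_, ?_, ?_, ?_, ?_⟩
  · intro u v; simp only [flowOf]; split_ifs <;> simp
  · intro u v; simp only [flowOf]; split_ifs <;> simp
  · rintro (u | ⟨u, v⟩ | ⟨v, i⟩ | x) h
    · simp at h
    · simp only [assign_mem_arcs] at h
      simp only [flowOf]; rw [if_neg]; exact fun h' => h (hM.1 h')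
    · simp only [slot_mem_arcs] at h
      simp only [flowOf]; rw [if_neg]; have := hdeg v; omega
    · simp only [drain_mem_arcs] at h
      simp only [flowOf, Finset.sum_eq_zero_iff, Finset.card_eq_zero, Finset.filter_eq_empty_iff]
      rintro v - i hi rfl
      exact h (mem_centers.2 ⟨v, i, lt_of_lt_of_le (by simpa using hi) (hdeg v), rfl⟩)
  · intro u
    simp only [flowOf, Prod.mk.eta]
    rw [← Finset.sum_filter, Finset.filter_filter, hS, Finset.sum_const, smul_eq_mul, mul_one,
      Finset.card_eq_one]
    obtain ⟨v, hv, huniq⟩ := hM.2 u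
    refine ⟨(u, v), ?_⟩
    ext ⟨u', v'⟩
    simp only [Finset.mem_filter, Finset.mem_singleton, Prod.mk.injEq]
    constructor
    · rintro ⟨h1, rfl⟩; exact ⟨rfl, huniq _ h1⟩
    · rintro ⟨rfl, rfl⟩; exact ⟨hv, rfl⟩
  · intro v
    simp only [flowOf, Prod.mk.eta]
    rw [← Finset.sum_filter, Finset.filter_filter, hS, Finset.sum_const, smul_eq_mul, mul_one,
      ← Finset.sum_filter, hr]
    simp [machineDegree]
  · intro x _
    simp only [flowOf]
    refine Finset.sum_congr rfl fun v _ => ?_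
    rw [← Finset.sum_filter, ← Finset.sum_filter, Finset.filter_filter, Finset.card_eq_sum_ones]
    refine Finset.sum_congr ?_ fun _ _ => rfl
    ext i; have := hdeg v; simp; constructor <;> rintro ⟨h1, h2⟩
    · exact ⟨h2.2, h2.1⟩
    · exact ⟨by omega, h2, h1⟩

/-- The edges that carry a full flow form a semi-matching. -/
theorem IsFull.isSemiMatching {φ : NetArc U V → ℕ} (h : IsFull E w φ) :
    IsSemiMatching E (flowEdges E φ) := by
  refine ⟨Finset.filter_subset _ _, fun u => ?_⟩
  have h1 : ((E.filter fun e => e.1 = u).filter fun e => φ (.assign e.1 e.2) ≠ 0).card = 1 := by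
    rw [← h.job u, Finset.card_filter]
    refine Finset.sum_congr rfl fun e _ => ?_
    have := h.assign_le e.1 e.2
    split_ifs <;> omega
  obtain ⟨⟨u', v⟩, hv⟩ := Finset.card_eq_one.1 h1
  have h2 : ∀ v', (u, v') ∈ flowEdges E φ ↔ (u', v) = (u, v') := by
    intro v'
    have := Finset.ext_iff.1 hv (u, v')
    simp only [Finset.mem_filter, Finset.mem_singleton] at this
    rw [eq_comm, ← this]; simp [flowEdges]
  have h3 : u' = u := by
    have : (u', v) ∈ ({(u', v)} : Finset (U × V)) := by simp
    rw [← hv] at this; simp at this; exact this.1.2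
  subst h3
  exact ⟨v, (h2 v).2 rfl, fun v' hv' => by have := (h2 v').1 hv'; simp at this; exact this.symm⟩

theorem exists_isSemiMatching (hE : ∀ u, ∃ v, (u, v) ∈ E) : ∃ M, IsSemiMatching E M := by
  choose f hf using hE
  refine ⟨Finset.univ.image fun u => (u, f u), ?_, fun u => ⟨f u, by simp, by simp⟩⟩
  intro e he
  obtain ⟨u, _, rfl⟩ := Finset.mem_image.1 he
  exact hf u

/-- Since every job has a neighbour, the maximum flows are those that saturate all supply arcs. -/
theorem isMaxFlow_iff (hE : ∀ u, ∃ v, (u, v) ∈ E) {φ : NetArc U V → ℕ} :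
    (semiMatchingNetwork E w).IsMaxFlow φ ↔ IsFull E w φ := by
  have hle : ∀ ψ, (semiMatchingNetwork E w).IsFlow ψ → ∀ u, ψ (.supply u) ≤ 1 := by
    intro ψ hψ u
    simpa [semiMatchingNetwork] using hψ.1 (.supply u) (by simp)
  constructor
  · rintro ⟨h, hmax⟩
    refine isFull_iff.2 ⟨h, fun u => ?_⟩
    obtain ⟨M, hM⟩ := exists_isSemiMatching hE
    have h1 := hmax _ (isFull_iff.1 (hM.isFull (w := w))).1
    rw [value_eq, value_eq] at h1
    by_contra hu
    have : ∑ u, (φ (.supply u) : ℤ) < ∑ u, ((flowOf w M (.supply u) : ℕ) : ℤ) := by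
      refine Finset.sum_lt_sum (fun u _ => ?_) ⟨u, Finset.mem_univ _, ?_⟩
      · have := hle φ h u; simp only [flowOf]; omega
      · have := hle φ h u; simp only [flowOf]; omega
    omega
  · intro h
    refine ⟨(isFull_iff.1 h).1, fun ψ hψ => ?_⟩
    rw [value_eq, value_eq]
    refine Finset.sum_le_sum fun u _ => ?_
    have := hle ψ hψ u
    rw [h.supply]; omega

theorem IsFull.le_one {φ : NetArc U V → ℕ} (h : IsFull E w φ) {a : NetArc U V}
    (ha : a.IsInner) : φ a ≤ 1 := by
  rcases a with u | ⟨u, v⟩ | ⟨v, i⟩ | x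
  · exact ha.elim
  · exact h.assign_le u v
  · exact h.slot_le v i
  · exact ha.elim

theorem IsFull.sum_assign {φ : NetArc U V → ℕ} (h : IsFull E w φ) :
    ∑ e ∈ E, φ (.assign e.1 e.2) = Fintype.card U := by
  rw [← Finset.sum_fiberwise E (fun e => e.1)]
  rw [Finset.sum_congr rfl fun u _ => h.job u]
  simp

theorem IsFull.sum_slot {φ : NetArc U V → ℕ} (h : IsFull E w φ) :
    ∑ v, ∑ i ∈ Finset.range (machineDegree E v), φ (.slot v i) = Fintype.card U := by
  rw [← h.sum_assign, ← Finset.sum_fiberwise E (fun e => e.2)]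
  exact Finset.sum_congr rfl fun v _ => (h.machine v).symm

theorem IsFull.sum_innerArcs {φ : NetArc U V → ℕ} (h : IsFull E w φ) :
    ∑ a ∈ innerArcs E w, φ a = 2 * Fintype.card U := by
  rw [_root_.sum_innerArcs, h.sum_assign, h.sum_slot]; ring

/-- Summation by parts for the difference of two full flows: its divergence vanishes at the jobs
and machines, so that only the cost centers contribute. -/
theorem IsFull.sum_sub_mul {φ ψ : NetArc U V → ℕ} (hφ : IsFull E w φ) (hψ : IsFull E w ψ)
    (π : NetVertex U V → ℝ) :
    ∑ a ∈ innerArcs E w, ((ψ a : ℝ) - φ a) *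
        (π ((semiMatchingNetwork E w).head a) - π ((semiMatchingNetwork E w).tail a)) =
      ∑ v, ∑ i ∈ Finset.range (machineDegree E v),
        ((ψ (.slot v i) : ℝ) - φ (.slot v i)) * π (.center (w v i)) := by
  rw [_root_.sum_innerArcs]
  have h1 : ∀ χ : NetArc U V → ℕ, IsFull E w χ →
      ∑ e ∈ E, (χ (.assign e.1 e.2) : ℝ) * π (.job e.1) = ∑ u, π (.job u) := by
    intro χ hχ
    rw [← Finset.sum_fiberwise E (fun e => e.1)]
    refine Finset.sum_congr rfl fun u _ => ?_
    have := hχ.job u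
    rw [Finset.sum_congr rfl (g := fun e => (χ (.assign e.1 e.2) : ℝ) * π (.job u)),
      ← Finset.sum_mul, ← Nat.cast_sum, this]
    · simp
    · intro e he; rw [(Finset.mem_filter.1 he).2]
  have h2 : ∀ χ : NetArc U V → ℕ, IsFull E w χ →
      ∑ e ∈ E, (χ (.assign e.1 e.2) : ℝ) * π (.machine e.2) =
        ∑ v, ∑ i ∈ Finset.range (machineDegree E v), (χ (.slot v i) : ℝ) * π (.machine v) := by
    intro χ hχ
    rw [← Finset.sum_fiberwise E (fun e => e.2)]
    refine Finset.sum_congr rfl fun v _ => ?_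
    have := hχ.machine v
    rw [Finset.sum_congr rfl (g := fun e => (χ (.assign e.1 e.2) : ℝ) * π (.machine v)),
      ← Finset.sum_mul, ← Finset.sum_mul, ← Nat.cast_sum, ← Nat.cast_sum, this]
    intro e he; rw [(Finset.mem_filter.1 he).2]
  have h3 : ∑ e ∈ E, ((ψ (.assign e.1 e.2) : ℝ) - φ (.assign e.1 e.2)) *
      (π (.machine e.2) - π (.job e.1)) =
      ∑ v, ∑ i ∈ Finset.range (machineDegree E v),
        ((ψ (.slot v i) : ℝ) - φ (.slot v i)) * π (.machine v) := by
    simp only [sub_mul, mul_sub, Finset.sum_sub_distrib]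
    rw [h1 φ hφ, h1 ψ hψ, h2 φ hφ, h2 ψ hψ]; ring
  simp only [semiMatchingNetwork] at h3 ⊢
  rw [h3, ← Finset.sum_add_distrib]
  refine Finset.sum_congr rfl fun v _ => ?_
  rw [← Finset.sum_add_distrib]
  refine Finset.sum_congr rfl fun i _ => ?_
  ring

end Flows

/-! ### Rounds of Cancel -/

section Rounds

variable {U V : Type} [Fintype U] [Fintype V] {E : Finset (U × V)} {w : V → ℕ → ℝ}
variable {S : Set (NetVertex U V)} {C₁ C₂ : Finset ℝ} {φ ψ χ : NetArc U V → ℕ}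

theorem mem_innerArcs {a : NetArc U V} :
    a ∈ innerArcs E w ↔ a ∈ (semiMatchingNetwork E w).arcs ∧ a.IsInner := by
  simp [innerArcs]

theorem cap_inner {a : NetArc U V} (ha : a.IsInner) : (semiMatchingNetwork E w).cap a = 1 := by
  rcases a with u | ⟨u, v⟩ | ⟨v, i⟩ | x
  · exact ha.elim
  · rfl
  · rfl
  · exact ha.elim

theorem isResidual_inner {r : NetArc U V × Bool} (hφ : φ r.1 ≤ 1) (ha : r.1.IsInner) :
    (semiMatchingNetwork E w).IsResidual φ r ↔
      r.1 ∈ (semiMatchingNetwork E w).arcs ∧ φ r.1 = if r.2 then 0 else 1 := by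
  rw [FlowNetwork.IsResidual, cap_inner ha]
  refine and_congr_right fun _ => ?_
  cases r.2
  · simp; omega
  · simp

theorem isInner_of_mem (hS : S ⊆ innerVertices E w) {r : NetArc U V × Bool}
    (h₁ : (semiMatchingNetwork E w).resTail r ∈ S)
    (h₂ : (semiMatchingNetwork E w).resHead r ∈ S) : r.1.IsInner := by
  obtain ⟨u | ⟨u, v⟩ | ⟨v, i⟩ | x, b⟩ := r
  · cases b
    · exact (hS h₂).elim
    · exact (hS h₁).elim
  · trivial
  · trivial
  · cases b
    · exact (hS h₁).elim
    · exact (hS h₂).elim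

variable (E w S) in
/-- The flows `φ` and `ψ` differ on no `assign` or `slot` arc that leaves the subnetwork
induced by `S`. -/
def AgreeOff (φ ψ : NetArc U V → ℕ) : Prop :=
  ∀ a : NetArc U V, a.IsInner → ¬ ((semiMatchingNetwork E w).tail a ∈ S ∧
    (semiMatchingNetwork E w).head a ∈ S) → ψ a = φ a

theorem AgreeOff.trans (h₁ : AgreeOff E w S φ ψ) (h₂ : AgreeOff E w S ψ χ) :
    AgreeOff E w S φ χ := fun a ha h => (h₂ a ha h).trans (h₁ a ha h)

variable (E w S C₁ C₂) in
/-- The cost centers of the subnetwork induced by `S` are divided into the smaller ones `C₁` and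
the larger ones `C₂`. -/
structure IsDivision : Prop where
  sub : S ⊆ innerVertices E w
  union : C₁ ∪ C₂ = centersIn E w S
  lt : ∀ x ∈ C₁, ∀ y ∈ C₂, x < y

theorem mem_centersIn (hS : S ⊆ innerVertices E w) {x : ℝ} :
    x ∈ centersIn E w S ↔ NetVertex.center x ∈ S := by
  simp only [centersIn, Finset.mem_filter, and_iff_right_iff_imp]
  exact fun h => hS h

namespace IsDivision

variable (hd : IsDivision E w S C₁ C₂)
include hd

theorem mem_iff {x : ℝ} : NetVertex.center x ∈ S ↔ x ∈ C₁ ∨ x ∈ C₂ := by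
  rw [← mem_centersIn hd.sub, ← hd.union, Finset.mem_union]

theorem notMem {x : ℝ} (h₁ : x ∈ C₁) (h₂ : x ∈ C₂) : False := (hd.lt x h₁ x h₂).false

end IsDivision

@[simp] theorem center_mem_centerSet {C : Finset ℝ} {x : ℝ} :
    (NetVertex.center x : NetVertex U V) ∈ centerSet C ↔ x ∈ C := by
  simp [centerSet]

variable (E w C₁) in
/-- The amount of flow into the cost centers `C₁`. -/
noncomputable def lowFlow (φ : NetArc U V → ℕ) : ℕ :=
  ∑ v, ∑ i ∈ Finset.range (machineDegree E v), if w v i ∈ C₁ then φ (.slot v i) else 0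

theorem IsFull.lowFlow_le (h : IsFull E w φ) : lowFlow E w C₁ φ ≤ Fintype.card U := by
  rw [← h.sum_slot]
  refine Finset.sum_le_sum fun v _ => Finset.sum_le_sum fun i _ => ?_
  split_ifs <;> omega

/-- Summation by parts for a potential that is `0` on `C₂` and `D` on `C₁`: the weighted change of
the flow is `D` times the amount of flow that has moved from `C₂` to `C₁`. -/
theorem IsDivision.sum_sub_mul (hd : IsDivision E w S C₁ C₂) (hφ : IsFull E w φ)
    (hψ : IsFull E w ψ) (hag : AgreeOff E w S φ ψ) (π : NetVertex U V → ℕ) (D : ℕ)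
    (h₁ : ∀ x ∈ C₁, π (.center x) = D) (h₂ : ∀ x ∈ C₂, π (.center x) = 0) :
    ∑ a ∈ innerArcs E w, ((ψ a : ℝ) - φ a) *
        ((π ((semiMatchingNetwork E w).head a) : ℝ) - π ((semiMatchingNetwork E w).tail a)) =
      D * ((lowFlow E w C₁ ψ : ℝ) - lowFlow E w C₁ φ) := by
  rw [hφ.sum_sub_mul hψ (fun x => (π x : ℝ))]
  simp only [lowFlow, Nat.cast_sum]
  rw [← Finset.sum_sub_distrib, Finset.mul_sum]
  refine Finset.sum_congr rfl fun v _ => ?_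
  rw [← Finset.sum_sub_distrib, Finset.mul_sum]
  refine Finset.sum_congr rfl fun i _ => ?_
  by_cases hc : w v i ∈ C₁
  · simp only [hc, if_true, h₁ _ hc]; ring
  · simp only [hc, if_false]
    by_cases hc' : w v i ∈ C₂
    · rw [h₂ _ hc']; simp
    · have : ψ (.slot v i) = φ (.slot v i) := by
        refine hag _ trivial fun h => ?_
        rcases hd.mem_iff.1 h.2 with h | h
        exacts [hc h, hc' h]
      rw [this]; simp

/-- The reversal of a residual arc; the Boolean tells whether the arc is used forwards. -/
def revArc (r : NetArc U V × Bool) : NetArc U V × Bool := (r.1, !r.2)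

@[simp] theorem resTail_revArc (r : NetArc U V × Bool) :
    (semiMatchingNetwork E w).resTail (revArc r) = (semiMatchingNetwork E w).resHead r := by
  obtain ⟨a, b⟩ := r; cases b <;> rfl

@[simp] theorem resHead_revArc (r : NetArc U V × Bool) :
    (semiMatchingNetwork E w).resHead (revArc r) = (semiMatchingNetwork E w).resTail r := by
  obtain ⟨a, b⟩ := r; cases b <;> rfl

theorem residual_revArc (hφ : IsFull E w φ) {r : NetArc U V × Bool} (ha : r.1.IsInner)
    (hr : r.1 ∈ (semiMatchingNetwork E w).arcs) :
    (semiMatchingNetwork E w).IsResidual φ (revArc r) ↔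
      ¬ (semiMatchingNetwork E w).IsResidual φ r := by
  have h := hφ.le_one ha
  rw [isResidual_inner h ha, isResidual_inner (r := revArc r) h ha]
  obtain ⟨a, b⟩ := r
  cases b <;> simp_all [revArc] <;> omega

section Blocking

variable {g : Finset (NetArc U V × Bool)} {Y Z : Set (NetVertex U V)}

theorem FlowNetwork.IsBlockingFlow.residual
    (hg : (semiMatchingNetwork E w).IsBlockingFlow S φ Y Z g) {r : NetArc U V × Bool}
    (hr : r ∈ g) : (semiMatchingNetwork E w).IsResidual φ r ∧
      (semiMatchingNetwork E w).resTail r ∈ S ∧ (semiMatchingNetwork E w).resHead r ∈ S := by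
  obtain ⟨p, ⟨⟨y, hy, z, hz, hw⟩, _⟩, hrp⟩ := hg.1 r hr
  exact hw.residual r hrp

theorem FlowNetwork.IsBlockingFlow.isInner (hS : S ⊆ innerVertices E w)
    (hg : (semiMatchingNetwork E w).IsBlockingFlow S φ Y Z g) {r : NetArc U V × Bool}
    (hr : r ∈ g) : r.1.IsInner :=
  isInner_of_mem hS (hg.residual hr).2.1 (hg.residual hr).2.2

theorem FlowNetwork.IsBlockingFlow.revArc_notMem (hS : S ⊆ innerVertices E w) (hφ : IsFull E w φ)
    (hg : (semiMatchingNetwork E w).IsBlockingFlow S φ Y Z g) {r : NetArc U V × Bool}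
    (hr : r ∈ g) : revArc r ∉ g := fun h => by
  have h1 := (hg.residual hr).1
  exact (residual_revArc hφ (hg.isInner hS hr) h1.1).1 (hg.residual h).1 h1

theorem AugmentRound.isFull (hS : S ⊆ innerVertices E w) (hφ : IsFull E w φ)
    (h : AugmentRound E w S C₂ C₁ φ ψ) : IsFull E w ψ := by
  obtain ⟨g, hg, hflow, hval⟩ := h
  refine isFull_iff.2 ⟨hflow, fun u => ?_⟩
  have h1 := hval (.supply u) (by simp)
  have h2 : ∀ b, (NetArc.supply u, b) ∉ g := fun b h => (hg.isInner hS h : False)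
  rw [if_neg (h2 _), if_neg (h2 _), hφ.supply] at h1
  omega

theorem AugmentRound.agreeOff (h : AugmentRound E w S C₂ C₁ φ ψ) : AgreeOff E w S φ ψ := by
  obtain ⟨g, hg, hflow, hval⟩ := h
  intro a ha hn
  have h1 := hval a (by rintro x rfl; exact ha)
  rw [if_neg, if_neg] at h1
  · omega
  · exact fun h => hn ⟨(hg.residual h).2.2, (hg.residual h).2.1⟩
  · exact fun h => hn (hg.residual h).2

/-- A residual arc is reversed by the round exactly when it carries flow of the blocking flow. -/
theorem mem_blocking_iff (hS : S ⊆ innerVertices E w) (hφ : IsFull E w φ) (hψ : IsFull E w ψ)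
    (hg : (semiMatchingNetwork E w).IsBlockingFlow S φ Y Z g)
    (hval : ∀ a : NetArc U V, (∀ x, a ≠ .drain x) →
      (ψ a : ℤ) = φ a + (if (a, true) ∈ g then 1 else 0) - (if (a, false) ∈ g then 1 else 0))
    {r : NetArc U V × Bool} (hr : r.1.IsInner) (har : r.1 ∈ (semiMatchingNetwork E w).arcs) :
    r ∈ g ↔ (semiMatchingNetwork E w).IsResidual φ r ∧
      ¬ (semiMatchingNetwork E w).IsResidual ψ r := by
  have h1 := hval r.1 (by rintro x h; rw [h] at hr; exact hr)
  have h2 := hφ.le_one hr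
  have h3 := hψ.le_one hr
  have h4 := fun h : r ∈ g => hg.revArc_notMem hS hφ h
  have h5 := fun h : r ∈ g => (hg.residual h).1
  rw [isResidual_inner h2 hr] at h5 ⊢
  rw [isResidual_inner h3 hr]
  obtain ⟨a, b⟩ := r
  simp only [har, true_and] at *
  cases b
  · simp only [revArc, Bool.not_false, Bool.false_eq_true, if_false] at *
    constructor
    · intro h; rw [if_neg (h4 h), if_pos h] at h1; have := h5 h; omega
    · rintro ⟨h6, h7⟩; by_contra h; rw [if_neg h] at h1; split_ifs at h1 <;> omega
  · simp only [revArc, Bool.not_true, if_true] at *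
    constructor
    · intro h; rw [if_neg (h4 h), if_pos h] at h1; have := h5 h; omega
    · rintro ⟨h6, h7⟩; by_contra h; rw [if_neg h] at h1; split_ifs at h1 <;> omega

end Blocking

/-- For a change of a full flow, every term of the summation by parts is bounded by the change of
the potential along a residual arc. -/
theorem sub_mul_le {π : NetVertex U V → ℕ} (hφ : IsFull E w φ) (hψ : IsFull E w ψ)
    (hag : AgreeOff E w S φ ψ)
    (hπ : ∀ r, (semiMatchingNetwork E w).IsResidual φ r →
      (semiMatchingNetwork E w).resHead r ∈ S → π ((semiMatchingNetwork E w).resHead r) ≤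
        π ((semiMatchingNetwork E w).resTail r) + 1)
    {a : NetArc U V} (ha : a ∈ innerArcs E w) :
    ((ψ a : ℝ) - φ a) * ((π ((semiMatchingNetwork E w).head a) : ℝ) -
      π ((semiMatchingNetwork E w).tail a)) ≤ ((φ a + ψ a : ℕ) : ℝ) := by
  obtain ⟨haN, hai⟩ := mem_innerArcs.1 ha
  have h2 := hφ.le_one hai
  have h3 := hψ.le_one hai
  by_cases hS : (semiMatchingNetwork E w).tail a ∈ S ∧ (semiMatchingNetwork E w).head a ∈ S
  · rcases lt_trichotomy (φ a) (ψ a) with h | h | h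
    · have h4 : φ a = 0 := by omega
      have h5 : ψ a = 1 := by omega
      have := hπ (a, true) ((isResidual_inner h2 hai).2 ⟨haN, h4⟩) hS.2
      simp only [FlowNetwork.resHead, FlowNetwork.resTail, if_true] at this
      rw [h4, h5]
      have h6 : ((π ((semiMatchingNetwork E w).head a) : ℕ) : ℝ) ≤
        ((π ((semiMatchingNetwork E w).tail a) + 1 : ℕ) : ℝ) := by exact_mod_cast this
      push_cast at h6 ⊢; linarith
    · rw [h]; simp
    · have h4 : φ a = 1 := by omega
      have h5 : ψ a = 0 := by omega
      have := hπ (a, false) ((isResidual_inner h2 hai).2 ⟨haN, h4⟩) hS.1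
      simp only [FlowNetwork.resHead, FlowNetwork.resTail, Bool.false_eq_true, if_false] at this
      rw [h4, h5]
      have h6 : ((π ((semiMatchingNetwork E w).tail a) : ℕ) : ℝ) ≤
        ((π ((semiMatchingNetwork E w).head a) + 1 : ℕ) : ℝ) := by exact_mod_cast this
      push_cast at h6 ⊢; linarith
  · rw [hag a hai hS]; simp

/-- If all residual paths from `C₂` to `C₁` have length at least `D`, then every unit of flow that
can still be moved from `C₂` to `C₁` uses `D` arcs, and there are at most `4 |U|` of them. -/
theorem IsDivision.mul_lowFlow_le (hd : IsDivision E w S C₁ C₂) (hφ : IsFull E w φ)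
    (hψ : IsFull E w ψ) (hag : AgreeOff E w S φ ψ) {D : ℕ}
    (hD : ∀ p, (semiMatchingNetwork E w).IsWalkBetween S φ (centerSet C₂) (centerSet C₁) p →
      D ≤ p.length) :
    D * lowFlow E w C₁ ψ ≤ D * lowFlow E w C₁ φ + 4 * Fintype.card U := by
  have h1 := hd.sum_sub_mul hφ hψ hag
    ((semiMatchingNetwork E w).level S φ (centerSet C₂) D) D
    (fun x hx => FlowNetwork.level_target hD (by simpa using hx))
    (fun x hx => FlowNetwork.level_source (by simpa using hx) (hd.mem_iff.2 (Or.inr hx)))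
  have h2 := Finset.sum_le_sum fun a (ha : a ∈ innerArcs E w) =>
    sub_mul_le hφ hψ hag
      (fun r hr hS => FlowNetwork.level_step (Y := centerSet C₂) (D := D) hr hS) ha
  rw [h1, ← Nat.cast_sum, Finset.sum_add_distrib, hφ.sum_innerArcs, hψ.sum_innerArcs] at h2
  have h3 : (D * lowFlow E w C₁ ψ : ℝ) ≤ D * lowFlow E w C₁ φ + 4 * Fintype.card U := by
    push_cast at h2; linarith
  exact_mod_cast h3

/-- A round moves at least one unit of flow from `C₂` to `C₁`: in the summation by parts with the
distances from `C₂`, every arc of the blocking flow contributes exactly one. -/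
theorem AugmentRound.lowFlow_lt (hd : IsDivision E w S C₁ C₂) (hφ : IsFull E w φ)
    (h : AugmentRound E w S C₂ C₁ φ ψ)
    (hp : ∃ p, (semiMatchingNetwork E w).IsWalkBetween S φ (centerSet C₂) (centerSet C₁) p) :
    lowFlow E w C₁ φ < lowFlow E w C₁ ψ := by
  have hψ := h.isFull hd.sub hφ
  have hag := h.agreeOff
  obtain ⟨g, hg, hflow, hval⟩ := h
  obtain ⟨p, hp⟩ := FlowNetwork.exists_isShortest hp
  have hlen : ∀ q, (semiMatchingNetwork E w).IsShortest S φ (centerSet C₂) (centerSet C₁) q →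
    q.length = p.length := fun q hq => le_antisymm (hq.2 _ hp.1) (hp.2 _ hq.1)
  obtain ⟨r₀, hr₀p, hr₀⟩ := hg.2.2 p hp
  have h1 := hd.sum_sub_mul hφ hψ hag
    ((semiMatchingNetwork E w).level S φ (centerSet C₂) p.length) p.length
    (fun x hx => FlowNetwork.level_target hp.2 (by simpa using hx))
    (fun x hx => FlowNetwork.level_source (by simpa using hx) (hd.mem_iff.2 (Or.inr hx)))
  set π := (semiMatchingNetwork E w).level S φ (centerSet C₂) p.length with hπ
  have hstep : ∀ r ∈ g, π ((semiMatchingNetwork E w).resHead r) =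
      π ((semiMatchingNetwork E w).resTail r) + 1 := by
    intro r hr
    obtain ⟨q, hq, hrq⟩ := hg.1 r hr
    have := FlowNetwork.level_tight hq hrq
    rwa [hlen q hq] at this
  have key : ∀ a ∈ innerArcs E w, ((ψ a : ℝ) - φ a) *
      ((π ((semiMatchingNetwork E w).head a) : ℝ) - π ((semiMatchingNetwork E w).tail a)) =
      if (a, true) ∈ g ∨ (a, false) ∈ g then 1 else 0 := by
    intro a ha
    obtain ⟨haN, hai⟩ := mem_innerArcs.1 ha
    have h2 := hval a (by rintro x rfl; exact hai)
    have h2' : (ψ a : ℝ) = φ a + (if (a, true) ∈ g then 1 else 0) -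
      (if (a, false) ∈ g then 1 else 0) := by exact_mod_cast h2
    by_cases ht : (a, true) ∈ g
    · have hf : (a, false) ∉ g := hg.revArc_notMem hd.sub hφ ht
      have h3 := hstep _ ht
      simp only [FlowNetwork.resHead, FlowNetwork.resTail, if_true] at h3
      rw [h2', h3]; simp [ht, hf]
    · by_cases hf : (a, false) ∈ g
      · have h3 := hstep _ hf
        simp only [FlowNetwork.resHead, FlowNetwork.resTail, Bool.false_eq_true, if_false] at h3
        rw [h2', h3]; simp [ht, hf]
      · rw [h2']; simp [ht, hf]
  rw [Finset.sum_congr rfl key] at h1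
  have hpos : 0 < ∑ a ∈ innerArcs E w, if (a, true) ∈ g ∨ (a, false) ∈ g then (1 : ℝ) else 0 := by
    refine Finset.sum_pos' (fun a _ => by split_ifs <;> simp) ⟨r₀.1, ?_, ?_⟩
    · exact mem_innerArcs.2 ⟨(hg.residual hr₀).1.1, hg.isInner hd.sub hr₀⟩
    · rw [if_pos]; · simp
      obtain ⟨a, b⟩ := r₀; cases b
      · exact Or.inr hr₀
      · exact Or.inl hr₀
  rw [h1] at hpos
  have := pos_of_mul_pos_right hpos (Nat.cast_nonneg _)
  exact_mod_cast sub_pos.1 this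

/-- A round increases the length of the shortest residual paths from `C₂` to `C₁`. Along the arcs
that the round creates, the distance from `C₂` before the round decreases; a new path of the old
length would therefore consist of old arcs, and it would avoid the blocking flow. -/
theorem AugmentRound.length_lt (hd : IsDivision E w S C₁ C₂) (hφ : IsFull E w φ)
    (h : AugmentRound E w S C₂ C₁ φ ψ) {p q : List (NetArc U V × Bool)}
    (hp : (semiMatchingNetwork E w).IsShortest S φ (centerSet C₂) (centerSet C₁) p)
    (hq : (semiMatchingNetwork E w).IsWalkBetween S ψ (centerSet C₂) (centerSet C₁) q) :
    p.length < q.length := by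
  have hψ := h.isFull hd.sub hφ
  obtain ⟨g, hg, hflow, hval⟩ := h
  have hlen : ∀ q, (semiMatchingNetwork E w).IsShortest S φ (centerSet C₂) (centerSet C₁) q →
    q.length = p.length := fun q hq => le_antisymm (hq.2 _ hp.1) (hp.2 _ hq.1)
  set π := (semiMatchingNetwork E w).level S φ (centerSet C₂) p.length with hπ
  obtain ⟨y, hy, z, hz, hw⟩ := hq
  have hy0 : π y = 0 := FlowNetwork.level_source hy hw.start_mem
  have hzD : π z = p.length := FlowNetwork.level_target hp.2 hz
  have hmem : ∀ r ∈ q, r.1.IsInner ∧ r.1 ∈ (semiMatchingNetwork E w).arcs := fun r hr =>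
    ⟨isInner_of_mem hd.sub (hw.residual r hr).2.1 (hw.residual r hr).2.2, (hw.residual r hr).1.1⟩
  have hnew : ∀ r ∈ q, ¬ (semiMatchingNetwork E w).IsResidual φ r →
      π ((semiMatchingNetwork E w).resTail r) = π ((semiMatchingNetwork E w).resHead r) + 1 := by
    intro r hr hn
    have h1 := (residual_revArc hφ (hmem r hr).1 (hmem r hr).2).2 hn
    have h2 : revArc r ∈ g := by
      refine (mem_blocking_iff hd.sub hφ hψ hg hval (r := revArc r) (hmem r hr).1
        (hmem r hr).2).2 ⟨h1, ?_⟩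
      rw [residual_revArc hψ (hmem r hr).1 (hmem r hr).2, not_not]
      exact (hw.residual r hr).1
    obtain ⟨p', hp', hrp⟩ := hg.1 _ h2
    have := FlowNetwork.level_tight hp' hrp
    rw [hlen p' hp', resHead_revArc, resTail_revArc] at this
    exact this
  have hstep : ∀ r ∈ q, π ((semiMatchingNetwork E w).resHead r) ≤
      π ((semiMatchingNetwork E w).resTail r) + 1 := by
    intro r hr
    by_cases hn : (semiMatchingNetwork E w).IsResidual φ r
    · exact FlowNetwork.level_step hn (hw.residual r hr).2.2
    · have := hnew r hr hn; omega
  have hle := hw.potential_le hstep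
  by_contra hlt
  have heq : p.length = q.length := by omega
  have htight := hw.potential_tight hstep (by omega)
  have hres : ∀ r ∈ q, (semiMatchingNetwork E w).IsResidual φ r := by
    intro r hr
    by_contra hn
    have := hnew r hr hn
    have := htight r hr
    omega
  have hsh : (semiMatchingNetwork E w).IsShortest S φ (centerSet C₂) (centerSet C₁) q :=
    ⟨⟨y, hy, z, hz, hw.congr hres⟩, fun q' hq' => heq ▸ hp.2 q' hq'⟩
  obtain ⟨r, hrq, hrg⟩ := hg.2.2 q hsh
  exact ((mem_blocking_iff hd.sub hφ hψ hg hval (hmem r hrq).1 (hmem r hrq).2).1 hrg).2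
    (hw.residual r hrq).1

variable (E w S C₂ C₁) in
/-- `k` consecutive rounds of Cancel, not necessarily the last ones, turn `φ` into `ψ`. -/
inductive Rounds (φ : NetArc U V → ℕ) : (NetArc U V → ℕ) → ℕ → Prop
  | zero : Rounds φ φ 0
  | succ (ψ χ : NetArc U V → ℕ) (k : ℕ) (hrounds : Rounds φ ψ k)
      (h : ∃ p, (semiMatchingNetwork E w).IsWalkBetween S ψ (centerSet C₂) (centerSet C₁) p)
      (hround : AugmentRound E w S C₂ C₁ ψ χ) : Rounds φ χ (k + 1)

theorem Rounds.cons {k : ℕ}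
    (h : ∃ p, (semiMatchingNetwork E w).IsWalkBetween S φ (centerSet C₂) (centerSet C₁) p)
    (hround : AugmentRound E w S C₂ C₁ φ ψ) (hr : Rounds E w S C₁ C₂ ψ χ k) :
    Rounds E w S C₁ C₂ φ χ (k + 1) := by
  induction hr with
  | zero => exact .succ _ _ _ .zero h hround
  | succ _ _ _ _ h' hround' ih => exact .succ _ _ _ ih h' hround'

theorem Cancel.rounds {k : ℕ} (h : Cancel E w S C₂ C₁ φ ψ k) :
    Rounds E w S C₁ C₂ φ ψ k ∧
      ¬ ∃ p, (semiMatchingNetwork E w).IsWalkBetween S ψ (centerSet C₂) (centerSet C₁) p := by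
  induction h with
  | done _ h => exact ⟨.zero, h⟩
  | round _ _ _ _ h hround _ ih => exact ⟨ih.1.cons h hround, ih.2⟩

theorem Rounds.cancel_append {k l : ℕ} (h : Rounds E w S C₁ C₂ φ ψ k)
    (hc : Cancel E w S C₂ C₁ ψ χ l) : Cancel E w S C₂ C₁ φ χ (k + l) := by
  induction h generalizing l with
  | zero => simpa using hc
  | succ _ _ k _ h' hround ih =>
    have := ih (.round _ _ _ _ h' hround hc)
    rwa [show k + 1 + l = k + (l + 1) by ring]

theorem Rounds.cancel {k : ℕ} (h : Rounds E w S C₁ C₂ φ ψ k)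
    (hn : ¬ ∃ p, (semiMatchingNetwork E w).IsWalkBetween S ψ (centerSet C₂) (centerSet C₁) p) :
    Cancel E w S C₂ C₁ φ ψ k :=
  h.cancel_append (.done _ hn)

/-- After `k` rounds at least `k` units of flow have been moved from `C₂` to `C₁`, and the residual
paths from `C₂` to `C₁` have length at least `k`. -/
theorem Rounds.basic {k : ℕ} (hd : IsDivision E w S C₁ C₂) (hφ : IsFull E w φ)
    (h : Rounds E w S C₁ C₂ φ ψ k) : IsFull E w ψ ∧ AgreeOff E w S φ ψ ∧
      lowFlow E w C₁ φ + k ≤ lowFlow E w C₁ ψ ∧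
      ∀ p, (semiMatchingNetwork E w).IsWalkBetween S ψ (centerSet C₂) (centerSet C₁) p →
        k ≤ p.length := by
  induction h with
  | zero => exact ⟨hφ, fun _ _ _ => rfl, le_rfl, fun _ _ => Nat.zero_le _⟩
  | succ _ _ k _ h' hround ih =>
    obtain ⟨h1, h2, h3, h4⟩ := ih
    refine ⟨hround.isFull hd.sub h1, h2.trans hround.agreeOff, ?_, fun q hq => ?_⟩
    · have := hround.lowFlow_lt hd h1 h'; omega
    · obtain ⟨p, hp⟩ := FlowNetwork.exists_isShortest h'
      have := hround.length_lt hd h1 hp hq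
      have := h4 p hp.1
      omega

theorem Rounds.split {k l : ℕ} (h : Rounds E w S C₁ C₂ φ ψ (k + l)) :
    ∃ χ, Rounds E w S C₁ C₂ φ χ k ∧ Rounds E w S C₁ C₂ χ ψ l := by
  induction l generalizing ψ with
  | zero => exact ⟨ψ, h, .zero⟩
  | succ l ih =>
    cases h with
    | succ ψ' _ _ hr h' hround =>
      obtain ⟨χ, h1, h2⟩ := ih hr
      exact ⟨χ, h1, .succ _ _ _ h2 h' hround⟩

/-- After half of the rounds the residual paths are long, so that only few units of flow can still
be moved. -/
theorem Rounds.sq_le {k : ℕ} (hd : IsDivision E w S C₁ C₂) (hφ : IsFull E w φ)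
    (h : Rounds E w S C₁ C₂ φ ψ k) : (k / 2) ^ 2 ≤ 4 * Fintype.card U := by
  obtain ⟨χ, h1, h2⟩ := Rounds.split (k := k / 2) (l := k - k / 2)
    (by rwa [show k / 2 + (k - k / 2) = k by omega])
  obtain ⟨hχ, _, _, hlen⟩ := h1.basic hd hφ
  obtain ⟨hψ, hag, hlow, _⟩ := h2.basic hd hχ
  have h3 := hd.mul_lowFlow_le hχ hψ hag hlen
  have h4 : k / 2 * (lowFlow E w C₁ χ + k / 2) ≤ k / 2 * lowFlow E w C₁ ψ :=
    Nat.mul_le_mul_left _ (by omega)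
  rw [mul_add] at h4
  rw [sq]; omega

theorem Rounds.le_sqrt {k : ℕ} (hd : IsDivision E w S C₁ C₂) (hφ : IsFull E w φ)
    (h : Rounds E w S C₁ C₂ φ ψ k) : k ≤ 2 * Nat.sqrt (4 * Fintype.card U) + 1 := by
  have := Nat.le_sqrt'.2 (h.sq_le hd hφ)
  omega

end Rounds

/-! ### Existence of runs -/

namespace FlowNetwork

variable {X A : Type} {N : FlowNetwork X A} {S : Set X} {φ : A → ℕ}

theorem IsWalk.nodup {f : X → ℕ} {x y : X} {p : List (A × Bool)} (h : N.IsWalk S φ x p y)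
    (hf : ∀ r ∈ p, f (N.resHead r) = f (N.resTail r) + 1) :
    p.Nodup ∧ ∀ r ∈ p, f x ≤ f (N.resTail r) := by
  induction p generalizing x with
  | nil => simp
  | cons r p ih =>
    obtain ⟨h1, h2⟩ := ih h.2.2.2 fun r' h' => hf r' (by simp [h'])
    have h3 := hf r (by simp)
    refine ⟨List.nodup_cons.2 ⟨fun hr => ?_, h1⟩, fun r' hr' => ?_⟩
    · have := h2 r hr; omega
    · rcases List.mem_cons.1 hr' with rfl | hr'
      · rw [h.2.2.1]
      · have := h2 r' hr'; rw [← h.2.2.1]; omega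

theorem IsWalk.countP_balance {x y : X} {p : List (A × Bool)} (h : N.IsWalk S φ x p y) (z : X) :
    p.countP (fun r => decide (N.resHead r = z)) + (if x = z then 1 else 0) =
      p.countP (fun r => decide (N.resTail r = z)) + (if y = z then 1 else 0) := by
  induction p generalizing x with
  | nil => simp [h.2]
  | cons r p ih =>
    have := ih h.2.2.2
    rw [List.countP_cons, List.countP_cons, h.2.2.1]
    simp only [decide_eq_true_eq]
    omega

theorem card_filter_toFinset {α : Type*} [DecidableEq α] {p : List α} (hp : p.Nodup)
    (P : α → Prop) :
    (p.toFinset.filter P).card = p.countP (fun r => decide (P r)) := by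
  rw [List.countP_eq_length_filter, ← List.toFinset_card_of_nodup (hp.filter _),
    List.toFinset_filter]
  congr 1
  ext; simp

/-- A set of residual arcs that satisfies the first two conditions on a blocking flow, and that has
the largest size among these sets, is a blocking flow: otherwise a shortest path that avoids it
could be added. -/
theorem exists_isBlockingFlow (N : FlowNetwork X A) (S : Set X) (φ : A → ℕ) {Y Z : Set X}
    (hYZ : Disjoint Y Z) : ∃ g, N.IsBlockingFlow S φ Y Z g := by
  let G : Finset (Finset (A × Bool)) := (N.arcs ×ˢ Finset.univ).powerset.filter fun g =>
    (∀ r ∈ g, ∃ p, N.IsShortest S φ Y Z p ∧ r ∈ p) ∧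
    (∀ x : X, x ∉ Y → x ∉ Z →
      (g.filter fun r => N.resHead r = x).card = (g.filter fun r => N.resTail r = x).card)
  obtain ⟨g, hgG, hmax⟩ := Finset.exists_max_image G Finset.card ⟨∅, by simp [G]⟩
  simp only [G, Finset.mem_filter, Finset.mem_powerset] at hgG hmax
  obtain ⟨hsub, h1, h2⟩ := hgG
  refine ⟨g, h1, h2, fun p hp => ?_⟩
  by_contra hcon
  push Not at hcon
  obtain ⟨⟨y, hy, z, hz, hw⟩, hmin⟩ := id hp
  have hnd := (hw.nodup fun r hr => level_tight hp hr).1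
  have hdisj : Disjoint g p.toFinset := by
    rw [Finset.disjoint_right]; intro r hr; exact hcon r (by simpa using hr)
  have := hmax (g ∪ p.toFinset) ⟨?_, ?_, ?_⟩
  · rw [Finset.card_union_of_disjoint hdisj] at this
    have hne : p ≠ [] := by
      rintro rfl
      exact Set.disjoint_left.1 hYZ hy (hw.2 ▸ hz)
    have h0 : p.toFinset.card = 0 := by omega
    rw [Finset.card_eq_zero, List.toFinset_eq_empty_iff] at h0
    exact hne h0
  · refine Finset.union_subset hsub fun r hr => ?_
    simp only [Finset.mem_product, Finset.mem_univ, and_true]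
    exact (hw.residual r (by simpa using hr)).1.1
  · intro r hr
    rcases Finset.mem_union.1 hr with hr | hr
    · exact h1 r hr
    · exact ⟨p, hp, by simpa using hr⟩
  · intro x hxY hxZ
    rw [Finset.filter_union, Finset.filter_union, Finset.card_union_of_disjoint,
      Finset.card_union_of_disjoint, h2 x hxY hxZ, card_filter_toFinset hnd,
      card_filter_toFinset hnd]
    · have := hw.countP_balance x
      rw [if_neg (by rintro rfl; exact hxY hy), if_neg (by rintro rfl; exact hxZ hz)] at this
      omega
    · exact hdisj.mono (Finset.filter_subset _ _) (Finset.filter_subset _ _)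
    · exact hdisj.mono (Finset.filter_subset _ _) (Finset.filter_subset _ _)

end FlowNetwork

section Existence

variable {U V : Type} [Fintype U] [Fintype V] {E : Finset (U × V)} {w : V → ℕ → ℝ}
variable {S : Set (NetVertex U V)} {C₁ C₂ : Finset ℝ} {φ ψ χ : NetArc U V → ℕ}

theorem card_filter_eq_sum {g : Finset (NetArc U V × Bool)} (P : NetArc U V × Bool → Prop)
    (hg : ∀ r ∈ g, r.1 ∈ innerArcs E w) :
    (g.filter P).card = ∑ a ∈ innerArcs E w,
      ((if (a, true) ∈ g ∧ P (a, true) then 1 else 0) +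
        if (a, false) ∈ g ∧ P (a, false) then 1 else 0) := by
  have : g.filter P = (innerArcs E w ×ˢ Finset.univ).filter fun r => r ∈ g ∧ P r := by
    ext r
    simp only [Finset.mem_filter, Finset.mem_product, Finset.mem_univ, and_true]
    exact ⟨fun h => ⟨hg r h.1, h⟩, fun h => h.2⟩
  rw [this, Finset.card_filter, Finset.sum_product]
  exact Finset.sum_congr rfl fun a _ => Fintype.sum_bool _

variable (E w) in
/-- The flow `φ`, augmented by the set `g` of residual arcs; the flow from the cost centers to the
sink is determined by conservation. -/
noncomputable def augment (φ : NetArc U V → ℕ) (g : Finset (NetArc U V × Bool)) : NetArc U V → ℕ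
  | .drain x => if x ∈ centers E w then
      ∑ v, ∑ i ∈ Finset.range (machineDegree E v), (if w v i = x then
        (φ (.slot v i) + (if (.slot v i, true) ∈ g then 1 else 0)) -
          (if (.slot v i, false) ∈ g then 1 else 0) else 0) else 0
  | a => (φ a + (if (a, true) ∈ g then 1 else 0)) - (if (a, false) ∈ g then 1 else 0)

theorem exists_augmentRound (hd : IsDivision E w S C₁ C₂) (hφ : IsFull E w φ) :
    ∃ ψ, AugmentRound E w S C₂ C₁ φ ψ := by
  obtain ⟨g, hg⟩ := (semiMatchingNetwork E w).exists_isBlockingFlow S φ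
    (Y := centerSet C₂) (Z := centerSet C₁) (by
      rw [Set.disjoint_left]
      rintro _ ⟨x, hx, rfl⟩ h
      exact hd.notMem (center_mem_centerSet.1 h) hx)
  have hin : ∀ r ∈ g, r.1 ∈ innerArcs E w := fun r hr =>
    mem_innerArcs.2 ⟨(hg.residual hr).1.1, hg.isInner hd.sub hr⟩
  have hone : ∀ a, (a, true) ∈ g → φ a = 0 ∧ (a, false) ∉ g := fun a ha =>
    ⟨((isResidual_inner (hφ.le_one (hg.isInner hd.sub ha)) (hg.isInner hd.sub ha)).1
      (hg.residual ha).1).2, hg.revArc_notMem hd.sub hφ ha⟩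
  have hzero : ∀ a, (a, false) ∈ g → φ a = 1 := fun a ha =>
    ((isResidual_inner (hφ.le_one (hg.isInner hd.sub ha)) (hg.isInner hd.sub ha)).1
      (hg.residual ha).1).2
  have hval : ∀ a : NetArc U V, (∀ x, a ≠ .drain x) → (augment E w φ g a : ℤ) =
      φ a + (if (a, true) ∈ g then 1 else 0) - (if (a, false) ∈ g then 1 else 0) := by
    intro a ha
    have h1 : augment E w φ g a = (φ a + (if (a, true) ∈ g then 1 else 0)) -
        (if (a, false) ∈ g then 1 else 0) := by
      rcases a with u | ⟨u, v⟩ | ⟨v, i⟩ | x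
      · rfl
      · rfl
      · rfl
      · exact absurd rfl (ha x)
    rw [h1]
    have h2 := hone a
    have h3 := hzero a
    split_ifs with h4 h5 h5
    · exact absurd h5 (h2 h4).2
    · simp
    · have := h3 h5; simp [this]
    · simp
  have hnot : ∀ a, ¬ a.IsInner → ∀ b, (a, b) ∉ g := fun a ha b h => ha (hg.isInner hd.sub h)
  have hle : ∀ a : NetArc U V, a.IsInner → augment E w φ g a ≤ 1 := by
    intro a ha
    have h1 := hval a (by rintro x rfl; exact ha)
    have h2 := hone a
    have h3 := hφ.le_one ha
    split_ifs at h1 with h4 h5 h5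
    · exact absurd h5 (h2 h4).2
    · have := (h2 h4).1; omega
    · omega
    · omega
  -- The blocking flow obeys conservation at the jobs and machines.
  have hbal : ∀ x : NetVertex U V, (∀ c, x ≠ .center c) →
      ∑ a ∈ innerArcs E w, (if (semiMatchingNetwork E w).head a = x then
        (augment E w φ g a : ℤ) - φ a else 0) =
      ∑ a ∈ innerArcs E w, (if (semiMatchingNetwork E w).tail a = x then
        (augment E w φ g a : ℤ) - φ a else 0) := by
    intro x hx
    have h1 := hg.2.1 x (by rintro ⟨c, _, h⟩; exact hx c h) (by rintro ⟨c, _, h⟩; exact hx c h)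
    rw [card_filter_eq_sum _ hin, card_filter_eq_sum _ hin] at h1
    have h1' : ((∑ a ∈ innerArcs E w, _ : ℕ) : ℤ) = ((∑ a ∈ innerArcs E w, _ : ℕ) : ℤ) :=
      congrArg Nat.cast h1
    push_cast at h1'
    rw [← sub_eq_zero, ← Finset.sum_sub_distrib] at h1' ⊢
    refine (Finset.sum_congr rfl fun a ha => ?_).trans h1'
    rw [hval a (by rintro x rfl; exact (mem_innerArcs.1 ha).2)]
    simp only [FlowNetwork.resHead, FlowNetwork.resTail, if_true, Bool.false_eq_true, if_false]
    clear h1 h1'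
    by_cases h2 : (a, true) ∈ g <;> by_cases h3 : (a, false) ∈ g <;>
      by_cases h4 : (semiMatchingNetwork E w).head a = x <;>
      by_cases h5 : (semiMatchingNetwork E w).tail a = x <;> simp [h2, h3, h4, h5]
  refine ⟨augment E w φ g, g, hg, (isFull_iff.1 (⟨?_, ?_, ?_, ?_, ?_, ?_, ?_⟩ : IsFull E w _)).1,
    hval⟩
  · intro u
    have := hval (.supply u) (by simp)
    rw [if_neg (hnot _ id _), if_neg (hnot _ id _), hφ.supply] at this
    omega
  · exact fun u v => hle _ trivial
  · exact fun v i => hle _ trivial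
  · intro a ha
    by_cases hdr : ∀ x, a ≠ .drain x
    · have h1 := hval a hdr
      have h2 : ∀ b, (a, b) ∉ g := fun b h => ha (hg.residual h).1.1
      rw [if_neg (h2 _), if_neg (h2 _), hφ.zero a ha] at h1
      omega
    · push Not at hdr
      obtain ⟨x, rfl⟩ := hdr
      simp only [drain_mem_arcs] at ha
      simp [augment, ha]
  · intro u
    have h1 := hbal (.job u) (by simp)
    rw [sum_innerArcs, sum_innerArcs] at h1
    have h2 := hφ.job u
    rw [Finset.sum_filter] at h2 ⊢
    simp [semiMatchingNetwork] at h1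
    rw [← Finset.sum_filter, Finset.sum_sub_distrib, Finset.sum_filter, Finset.sum_filter] at h1
    zify at h2 ⊢
    linarith
  · intro v
    have h1 := hbal (.machine v) (by simp)
    rw [sum_innerArcs, sum_innerArcs] at h1
    have h2 := hφ.machine v
    rw [Finset.sum_filter] at h2 ⊢
    simp [semiMatchingNetwork] at h1
    rw [← Finset.sum_filter, Finset.sum_sub_distrib, Finset.sum_filter, Finset.sum_filter] at h1
    zify at h2 ⊢
    linarith
  · intro x hx
    simp only [augment, hx, if_true]

theorem exists_cancel (hd : IsDivision E w S C₁ C₂) (hφ : IsFull E w φ) :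
    ∃ ψ k, Cancel E w S C₂ C₁ φ ψ k := by
  induction hn : Fintype.card U - lowFlow E w C₁ φ using Nat.strong_induction_on generalizing φ with
  | _ n ih =>
    by_cases hp : ∃ p, (semiMatchingNetwork E w).IsWalkBetween S φ (centerSet C₂) (centerSet C₁) p
    · obtain ⟨ψ, hψ⟩ := exists_augmentRound hd hφ
      have h1 := hψ.isFull hd.sub hφ
      have h2 := hψ.lowFlow_lt hd hφ hp
      have h3 := h1.lowFlow_le (C₁ := C₁)
      obtain ⟨χ, k, hc⟩ := ih (Fintype.card U - lowFlow E w C₁ ψ) (by omega) h1 rfl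
      exact ⟨χ, k + 1, .round _ _ _ _ hp hψ hc⟩
    · exact ⟨φ, 0, .done _ hp⟩

theorem exists_lower_part (C : Finset ℝ) {k : ℕ} (hk : k ≤ C.card) :
    ∃ C₁ ⊆ C, C₁.card = k ∧ ∀ x ∈ C₁, ∀ y ∈ C \ C₁, x < y := by
  induction k with
  | zero => exact ⟨∅, by simp⟩
  | succ k ih =>
    obtain ⟨C₁, hsub, hcard, hlt⟩ := ih (by omega)
    have hne : (C \ C₁).Nonempty := by
      rw [← Finset.card_pos, Finset.card_sdiff_of_subset hsub]; omega
    have hmin := Finset.min'_mem _ hne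
    refine ⟨insert ((C \ C₁).min' hne) C₁, ?_, ?_, ?_⟩
    · exact Finset.insert_subset (Finset.mem_sdiff.1 hmin).1 hsub
    · rw [Finset.card_insert_of_notMem (Finset.mem_sdiff.1 hmin).2, hcard]
    · intro x hx y hy
      simp only [Finset.mem_sdiff, Finset.mem_insert, not_or] at hx hy
      have hyC : y ∈ C \ C₁ := Finset.mem_sdiff.2 ⟨hy.1, hy.2.2⟩
      rcases hx with rfl | hx
      · exact lt_of_le_of_ne (Finset.min'_le _ _ hyC) (Ne.symm hy.2.1)
      · exact hlt x hx y hyC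

/-! ### Correctness of CancelAll -/

theorem reachable_subset {N : FlowNetwork (NetVertex U V) (NetArc U V)} {Y : Set (NetVertex U V)} :
    N.reachable S φ Y ⊆ S := by
  rintro x ⟨y, _, p, hp⟩; exact hp.end_mem

namespace IsDivision

variable (hd : IsDivision E w S C₁ C₂)
  (hn : ¬ ∃ p, (semiMatchingNetwork E w).IsWalkBetween S φ (centerSet C₂) (centerSet C₁) p)
include hd hn

/-- The cost centers reachable from `C₂` are those in `C₂`. -/
theorem center_mem_reachable {x : ℝ} :
    .center x ∈ (semiMatchingNetwork E w).reachable S φ (centerSet C₂) ↔ x ∈ C₂ := by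
  constructor
  · rintro ⟨y, hy, p, hp⟩
    rcases hd.mem_iff.1 hp.end_mem with h | h
    · exact absurd ⟨p, y, hy, _, by simpa using h, hp⟩ hn
    · exact h
  · exact fun h => ⟨_, by simpa using h, [], hd.mem_iff.2 (Or.inr h), rfl⟩

theorem centersIn_reachable :
    centersIn E w ((semiMatchingNetwork E w).reachable S φ (centerSet C₂)) = C₂ := by
  ext x
  rw [mem_centersIn (reachable_subset.trans hd.sub), hd.center_mem_reachable hn]

theorem centersIn_diff :
    centersIn E w (S \ (semiMatchingNetwork E w).reachable S φ (centerSet C₂)) = C₁ := by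
  ext x
  rw [mem_centersIn (Set.sdiff_subset.trans hd.sub), Set.mem_sdiff, hd.center_mem_reachable hn,
    hd.mem_iff]
  constructor
  · rintro ⟨h | h, h'⟩
    exacts [h, absurd h h']
  · exact fun h => ⟨Or.inl h, fun h' => hd.notMem h h'⟩

end IsDivision

/-- CancelAll terminates, since both parts of a division have fewer cost centers. -/
theorem exists_cancelAll (hS : S ⊆ innerVertices E w) (hφ : IsFull E w φ) :
    ∃ ψ t, CancelAll E w S φ ψ t ∧ IsFull E w ψ := by
  induction hn : (centersIn E w S).card using Nat.strong_induction_on generalizing S φ with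
  | _ n ih =>
    by_cases hc : (centersIn E w S).card ≤ 1
    · exact ⟨φ, 1, .halt S φ hc, hφ⟩
    · obtain ⟨C₁, hsub, hcard, hlt⟩ := exists_lower_part (centersIn E w S)
        (k := (centersIn E w S).card / 2) (by omega)
      have hd : IsDivision E w S C₁ (centersIn E w S \ C₁) :=
        ⟨hS, Finset.union_sdiff_of_subset hsub, hlt⟩
      have hcard₂ := Finset.card_sdiff_of_subset hsub
      obtain ⟨ψ, k, hk⟩ := exists_cancel hd hφ
      obtain ⟨hr, hno⟩ := hk.rounds
      have hψ := (hr.basic hd hφ).1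
      obtain ⟨χ₁, t₁, h₁, hf₁⟩ := ih _ (by rw [hd.centersIn_diff hno]; omega)
        (Set.sdiff_subset.trans hS) hψ rfl
      obtain ⟨χ₂, t₂, h₂, hf₂⟩ := ih _ (by rw [hd.centersIn_reachable hno]; omega)
        (reachable_subset.trans hS) hf₁ rfl
      exact ⟨χ₂, _, .divide S _ C₁ _ φ ψ χ₁ χ₂ k t₁ t₂ (by omega) hd.union hlt
        (by omega) (by omega) hk rfl h₁ h₂, hf₂⟩

variable (E w S φ) in
/-- The residual graph induced by `S` has no path from a cost center to a smaller one. -/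
def NoDescent : Prop :=
  ∀ x y p, (semiMatchingNetwork E w).IsWalk S φ (.center y) p (.center x) → y ≤ x

theorem FlowNetwork.IsWalk.restrict {X A : Type} {N : FlowNetwork X A} {S T : Set X} {φ : A → ℕ}
    {x y : X} {p : List (A × Bool)} (h : N.IsWalk S φ x p y) (hx : x ∈ T)
    (hT : ∀ r, N.IsResidual φ r → N.resTail r ∈ T → N.resHead r ∈ S → N.resHead r ∈ T) :
    N.IsWalk T φ x p y := by
  induction p generalizing x with
  | nil => exact ⟨hx, h.2⟩
  | cons r p ih =>
    obtain ⟨h1, h2, h3, h4⟩ := h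
    exact ⟨hx, h2, h3, ih h4 (hT r h2 (h3 ▸ hx) h4.start_mem)⟩

theorem FlowNetwork.IsWalk.restrict_end {X A : Type} {N : FlowNetwork X A} {S T : Set X}
    {φ : A → ℕ} {x y : X} {p : List (A × Bool)} (h : N.IsWalk S φ x p y) (hy : y ∉ T)
    (hT : ∀ r, N.IsResidual φ r → N.resTail r ∈ T → N.resHead r ∈ S → N.resHead r ∈ T) :
    N.IsWalk (S \ T) φ x p y := by
  induction p generalizing x with
  | nil => exact ⟨⟨h.1, h.2 ▸ hy⟩, h.2⟩
  | cons r p ih =>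
    obtain ⟨h1, h2, h3, h4⟩ := h
    have h5 := ih h4
    exact ⟨⟨h1, fun hx => h5.start_mem.2 (hT r h2 (h3 ▸ hx) h4.start_mem)⟩, h2, h3, h5⟩

theorem isResidual_congr {r : NetArc U V × Bool} (h : ψ r.1 = φ r.1) :
    (semiMatchingNetwork E w).IsResidual ψ r ↔ (semiMatchingNetwork E w).IsResidual φ r := by
  rw [FlowNetwork.IsResidual, FlowNetwork.IsResidual, h]

/-- CancelAll leaves no descending path. A residual path cannot leave the set `S₂` reached from
`C₂`, since neither recursive call touches the arcs between `S₂` and its complement; a descending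
path would thus lie in one of the two parts, or lead from `C₂` to `C₁`. -/
theorem CancelAll.basic {t : ℕ} (h : CancelAll E w S φ ψ t) (hS : S ⊆ innerVertices E w)
    (hφ : IsFull E w φ) : IsFull E w ψ ∧ AgreeOff E w S φ ψ ∧ NoDescent E w S ψ := by
  induction h with
  | halt S φ h =>
    refine ⟨hφ, fun _ _ _ => rfl, fun x y p hp => ?_⟩
    exact (Finset.card_le_one.1 h y ((mem_centersIn hS).2 hp.start_mem) x
      ((mem_centersIn hS).2 hp.end_mem)).le
  | divide S S₂ C₁ C₂ φ φ₁ φ₂ φ₃ k t₁ t₂ h hunion horder hs₁ hs₂ hcancel hreach _ _ ih₁ ih₂ =>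
    have hd : IsDivision E w S C₁ C₂ := ⟨hS, hunion, horder⟩
    obtain ⟨hr, hno⟩ := hcancel.rounds
    obtain ⟨hφ₁, hag₁, -, -⟩ := hr.basic hd hφ
    have hS₂ : S₂ ⊆ S := hreach ▸ reachable_subset
    obtain ⟨hφ₂, hag₂, hnd₂⟩ := ih₁ (Set.sdiff_subset.trans hS) hφ₁
    obtain ⟨hφ₃, hag₃, hnd₃⟩ := ih₂ (hS₂.trans hS) hφ₂
    have hcen : ∀ x, NetVertex.center x ∈ S₂ ↔ x ∈ C₂ := fun x =>
      hreach ▸ hd.center_mem_reachable hno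
    refine ⟨hφ₃, ?_, ?_⟩
    · intro a ha hn
      rw [hag₃ a ha fun h => hn ⟨hS₂ h.1, hS₂ h.2⟩, hag₂ a ha fun h => hn ⟨h.1.1, h.2.1⟩,
        hag₁ a ha hn]
    · -- No residual arc leaves `S₂`, since the later calls do not change the crossing arcs.
      have hcl : ∀ r, (semiMatchingNetwork E w).IsResidual φ₃ r →
          (semiMatchingNetwork E w).resTail r ∈ S₂ → (semiMatchingNetwork E w).resHead r ∈ S →
          (semiMatchingNetwork E w).resHead r ∈ S₂ := by
        intro r hr ht hh
        by_contra hcon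
        have hi := isInner_of_mem hS (hS₂ ht) hh
        have h1 : φ₃ r.1 = φ₁ r.1 := by
          obtain ⟨a, b⟩ := r
          rw [hag₃ _ hi, hag₂ _ hi]
          · cases b
            · exact fun h => h.2.2 ht
            · exact fun h => h.1.2 ht
          · cases b
            · exact fun h => hcon h.1
            · exact fun h => hcon h.2
        rw [isResidual_congr h1] at hr
        subst hreach
        exact hcon (FlowNetwork.mem_reachable_of_residual ht hr hh)
      intro x y p hp
      by_cases hy : y ∈ C₂
      · exact hnd₃ x y p (hp.restrict ((hcen y).2 hy) hcl)
      · have hy₁ : y ∈ C₁ := (hd.mem_iff.1 hp.start_mem).resolve_right hy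
        by_cases hx : x ∈ C₂
        · exact (horder y hy₁ x hx).le
        · have hp' := hp.restrict_end (fun h => hx ((hcen x).1 h)) hcl
          refine hnd₂ x y p (hp'.congr fun r hr => ?_)
          obtain ⟨h1, h2, h3⟩ := hp'.residual r hr
          refine (isResidual_congr (hag₃ r.1 (isInner_of_mem hS h2.1 h3.1) fun h => ?_)).1 h1
          obtain ⟨a, b⟩ := r
          cases b
          · exact h3.2 h.1
          · exact h2.2 h.1

/-- A full flow without descending residual paths has minimum cost. The dual potentials are, for
every vertex, the largest cost center from which the vertex is reachable; they do not decrease along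
residual arcs, and at a cost center `c` the potential is `c` itself. -/
theorem NoDescent.flowCost_le (hn : NoDescent E w (innerVertices E w) φ) (hφ : IsFull E w φ)
    (hψ : IsFull E w ψ) :
    (semiMatchingNetwork E w).flowCost φ ≤ (semiMatchingNetwork E w).flowCost ψ := by
  -- The lower bound `B` is the potential of the vertices that no cost center reaches.
  obtain ⟨B, hB⟩ := (centers E w).bddBelow
  let R : NetVertex U V → Finset ℝ := fun x => insert B ((centers E w).filter fun c =>
    ∃ p, (semiMatchingNetwork E w).IsWalk (innerVertices E w) φ (.center c) p x)
  have hR : ∀ x, (R x).Nonempty := fun x => Finset.insert_nonempty _ _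
  let π : NetVertex U V → ℝ := fun x => (R x).max' (hR x)
  have hmono : ∀ r : NetArc U V × Bool, r.1.IsInner →
      (semiMatchingNetwork E w).IsResidual φ r →
      π ((semiMatchingNetwork E w).resTail r) ≤ π ((semiMatchingNetwork E w).resHead r) := by
    intro r hi hr
    refine Finset.max'_subset _ fun c hc => ?_
    simp only [R, Finset.mem_insert, Finset.mem_filter] at hc ⊢
    refine hc.imp_right fun ⟨h1, p, hp⟩ => ⟨h1, _, hp.snoc hr ?_⟩
    obtain ⟨u | ⟨u, v⟩ | ⟨v, i⟩ | x, b⟩ := r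
    · exact hi.elim
    · cases b <;> trivial
    · cases b
      · trivial
      · exact mem_centers.2 ⟨v, i, by simpa using hr.1, rfl⟩
    · exact hi.elim
  have hcen : ∀ c ∈ centers E w, π (.center c) = c := by
    intro c hc
    refine le_antisymm (Finset.max'_le _ _ _ fun c' hc' => ?_) (Finset.le_max' _ _ ?_)
    · simp only [R, Finset.mem_insert, Finset.mem_filter] at hc'
      rcases hc' with rfl | ⟨h1, p, hp⟩
      · exact hB hc
      · exact hn _ _ _ hp
    · simp only [R, Finset.mem_insert, Finset.mem_filter]
      exact Or.inr ⟨hc, [], hc, rfl⟩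
  -- The difference of the costs is the sum over the arcs on which `φ` and `ψ` differ, and each term
  -- is nonnegative, since such an arc is residual for `φ` in the direction of the change.
  have h1 := hφ.sum_sub_mul hψ π
  have h2 : 0 ≤ ∑ a ∈ innerArcs E w, ((ψ a : ℝ) - φ a) *
      (π ((semiMatchingNetwork E w).head a) - π ((semiMatchingNetwork E w).tail a)) := by
    refine Finset.sum_nonneg fun a ha => ?_
    obtain ⟨haN, hai⟩ := mem_innerArcs.1 ha
    have h3 := hφ.le_one hai
    have h4 := hψ.le_one hai
    rcases lt_trichotomy (φ a) (ψ a) with h | h | h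
    · have := hmono (a, true) hai ((isResidual_inner h3 hai).2 ⟨haN, by simp; omega⟩)
      simp only [FlowNetwork.resHead, FlowNetwork.resTail, if_true] at this
      have h5 : (φ a : ℝ) < ψ a := by exact_mod_cast h
      exact mul_nonneg (by linarith) (by linarith)
    · simp [h]
    · have := hmono (a, false) hai ((isResidual_inner h3 hai).2 ⟨haN, by simp; omega⟩)
      simp only [FlowNetwork.resHead, FlowNetwork.resTail, Bool.false_eq_true, if_false] at this
      have h5 : (ψ a : ℝ) < φ a := by exact_mod_cast h
      exact mul_nonneg_of_nonpos_of_nonpos (by linarith) (by linarith)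
  rw [h1] at h2
  rw [flowCost_eq, flowCost_eq, ← sub_nonneg, ← Finset.sum_sub_distrib]
  refine h2.trans_eq (Finset.sum_congr rfl fun v _ => ?_)
  rw [← Finset.sum_sub_distrib]
  refine Finset.sum_congr rfl fun i hi => ?_
  rw [hcen _ (mem_centers.2 ⟨v, i, by simpa using hi, rfl⟩)]
  ring

/-! ### Costs of semi-matchings -/

/-- Of all sets of `d` slots of a machine, the first `d` ones have the least cost. -/
theorem sum_range_card_le {g : ℕ → ℝ} (hg : Monotone g) (I : Finset ℕ) :
    ∑ i ∈ Finset.range I.card, g i ≤ ∑ i ∈ I, g i := by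
  induction hn : I.card generalizing I with
  | zero => simp [Finset.card_eq_zero.1 hn]
  | succ n ih =>
    have hne : I.Nonempty := by rw [← Finset.card_pos]; omega
    have hmax := I.max'_mem hne
    rw [Finset.sum_range_succ, ← Finset.sum_erase_add _ _ hmax]
    have hcard : (I.erase (I.max' hne)).card = n := by rw [Finset.card_erase_of_mem hmax]; omega
    have h1 := ih _ hcard
    have h2 : n ≤ I.max' hne := by
      have : I ⊆ Finset.range (I.max' hne + 1) := fun i hi => by
        have := I.le_max' i hi; simp; omega
      have := Finset.card_le_card this
      simp at this; omega
    have := hg h2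
    linarith

/-- The cost of a semi-matching that occupies the first slots of every machine. -/
noncomputable def slotCost (w : V → ℕ → ℝ) (M : Finset (U × V)) : ℝ :=
  ∑ v, ∑ i ∈ Finset.range (machineDegree M v), w v i

theorem flowCost_flowOf {M : Finset (U × V)} (hM : M ⊆ E) :
    (semiMatchingNetwork E w).flowCost (flowOf w M) = slotCost w M := by
  rw [flowCost_eq, slotCost]
  refine Finset.sum_congr rfl fun v _ => ?_
  simp only [flowOf, Nat.cast_ite, Nat.cast_one, Nat.cast_zero, mul_ite, mul_one, mul_zero]
  rw [← Finset.sum_filter]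
  refine Finset.sum_congr ?_ fun _ _ => rfl
  ext i; have := machineDegree_mono hM v; simp; omega

/-- A full flow that uses `d` of the arcs of a machine costs at least as much as the first `d` arcs.
-/
theorem slotCost_flowEdges_le (hw : ∀ v, Monotone (w v)) (hφ : IsFull E w φ) :
    slotCost w (flowEdges E φ) ≤ (semiMatchingNetwork E w).flowCost φ := by
  rw [flowCost_eq, slotCost]
  refine Finset.sum_le_sum fun v _ => ?_
  have h1 : machineDegree (flowEdges E φ) v =
      ((Finset.range (machineDegree E v)).filter fun i => φ (.slot v i) ≠ 0).card := by
    have h2 := hφ.machine v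
    have h3 : ∀ u, φ (.assign u v) = if φ (.assign u v) ≠ 0 then 1 else 0 := fun u => by
      have := hφ.assign_le u v; split_ifs <;> omega
    have h4 : ∀ i, φ (.slot v i) = if φ (.slot v i) ≠ 0 then 1 else 0 := fun i => by
      have := hφ.slot_le v i; split_ifs <;> omega
    rw [Finset.card_filter, ← Finset.sum_congr rfl fun i _ => h4 i, ← h2, machineDegree, flowEdges,
      Finset.filter_filter, Finset.card_filter, Finset.sum_filter]
    refine Finset.sum_congr rfl fun e _ => ?_
    have := hφ.assign_le e.1 e.2
    split_ifs <;> first | omega | tauto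
  rw [h1]
  refine (sum_range_card_le (hw v) _).trans_eq ?_
  rw [Finset.sum_filter]
  refine Finset.sum_congr rfl fun i _ => ?_
  have := hφ.slot_le v i
  split_ifs with h
  · rw [show φ (.slot v i) = 1 by omega]; simp
  · rw [not_not.1 h]; simp

theorem machineCost_eq (f : V → ℕ → ℝ) (M : Finset (U × V)) :
    machineCost f M = slotCost (marginalSlot f) M + ∑ v, f v 0 := by
  rw [machineCost, slotCost, ← Finset.sum_add_distrib]
  refine Finset.sum_congr rfl fun v _ => ?_
  simp only [marginalSlot]
  rw [Finset.sum_range_sub]; ring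

theorem IsDiscreteConvex.monotone {g : ℕ → ℝ} (hg : IsDiscreteConvex g) :
    Monotone fun i => g (i + 1) - g i :=
  monotone_nat_of_le_succ fun i => hg i

theorem CancelAll.isMinCostFlow {t : ℕ} (hE : ∀ u, ∃ v, (u, v) ∈ E)
    (h : CancelAll E w (innerVertices E w) φ ψ t) (hφ : IsFull E w φ) :
    (semiMatchingNetwork E w).IsMinCostFlow ψ := by
  obtain ⟨h1, -, h2⟩ := h.basic subset_rfl hφ
  exact ⟨(isMaxFlow_iff hE).2 h1, fun χ hχ => h2.flowCost_le h1 ((isMaxFlow_iff hE).1 hχ)⟩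

theorem CancelAll.isOptimal {f : V → ℕ → ℝ} {t : ℕ} (hf : ∀ v, IsDiscreteConvex (f v))
    (h : CancelAll E (marginalSlot f) (innerVertices E (marginalSlot f)) φ ψ t)
    (hφ : IsFull E (marginalSlot f) φ) :
    IsOptimalSemiMatching (machineCost f) E (flowEdges E ψ) := by
  obtain ⟨h1, -, h2⟩ := h.basic subset_rfl hφ
  refine ⟨h1.isSemiMatching, fun M hM => ?_⟩
  rw [machineCost_eq, machineCost_eq]
  have h3 := slotCost_flowEdges_le (w := marginalSlot f) (fun v => (hf v).monotone) h1
  have h4 := h2.flowCost_le h1 hM.isFull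
  rw [flowCost_flowOf hM.1] at h4
  linarith

end Existence

/-! ### The work of CancelAll -/

section Work

variable {U V : Type} [Fintype U] [Fintype V] {E : Finset (U × V)} {w : V → ℕ → ℝ}
variable {S : Set (NetVertex U V)} {φ ψ : NetArc U V → ℕ}

theorem numArcs_add_le {T : Set (NetVertex U V)} (hT : T ⊆ S) :
    (semiMatchingNetwork E w).numArcs (S \ T) + (semiMatchingNetwork E w).numArcs T ≤
      (semiMatchingNetwork E w).numArcs S := by
  rw [FlowNetwork.numArcs, FlowNetwork.numArcs, FlowNetwork.numArcs,
    ← Finset.card_union_of_disjoint]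
  · refine Finset.card_le_card fun a ha => ?_
    simp only [Finset.mem_union, Finset.mem_filter] at ha ⊢
    rcases ha with ⟨h1, h2, h3⟩ | ⟨h1, h2, h3⟩
    · exact ⟨h1, h2.1, h3.1⟩
    · exact ⟨h1, hT h2, hT h3⟩
  · rw [Finset.disjoint_left]
    intro a ha hb
    simp only [Finset.mem_filter] at ha hb
    exact ha.2.1.2 hb.2.1

theorem clog_half {p q : ℕ} (hp : 1 < p) (hq : q ≤ (p + 1) / 2) :
    Nat.clog 2 q + 1 ≤ Nat.clog 2 p := by
  rw [Nat.clog_of_two_le (b := 2) one_lt_two (n := p) hp]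
  exact Nat.succ_le_succ (Nat.clog_mono_right 2 (by simpa using hq))

/-- The work of a run. The subnetworks of one level of the recursion are disjoint and the number of
cost centers is halved at each level, so that every arc is counted at most `⌈log₂ p⌉` times for `p`
cost centers. The summand `K` on the left and the factor `2` on the right pay for the divisions, of
which there are at most `p - 1`, and for the calls that halt at once. -/
theorem CancelAll.work_le {t K : ℕ} (h : CancelAll E w S φ ψ t) (hS : S ⊆ innerVertices E w)
    (hφ : IsFull E w φ) (hK : 2 * Nat.sqrt (4 * Fintype.card U) + 2 ≤ K)
    (hne : 1 ≤ (centersIn E w S).card) :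
    t + K ≤ K * ((semiMatchingNetwork E w).numArcs S * Nat.clog 2 (centersIn E w S).card +
      2 * (centersIn E w S).card) := by
  induction h with
  | halt S φ h =>
    have : (centersIn E w S).card = 1 := le_antisymm h hne
    rw [this]
    simp only [Nat.clog_one_right, mul_zero, zero_add, mul_one]
    omega
  | divide S S₂ C₁ C₂ φ φ₁ φ₂ φ₃ k t₁ t₂ h hunion horder hs₁ hs₂ hcancel hreach hr₁ hr₂ ih₁ ih₂ =>
    have hd : IsDivision E w S C₁ C₂ := ⟨hS, hunion, horder⟩
    obtain ⟨hr, hno⟩ := hcancel.rounds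
    have hφ₁ := (hr.basic hd hφ).1
    have hk := hr.le_sqrt hd hφ
    have hS₂ : S₂ ⊆ S := hreach ▸ reachable_subset
    have hφ₂ := (hr₁.basic (Set.sdiff_subset.trans hS) hφ₁).1
    have hc₁ : centersIn E w (S \ S₂) = C₁ := hreach ▸ hd.centersIn_diff hno
    have hc₂ : centersIn E w S₂ = C₂ := hreach ▸ hd.centersIn_reachable hno
    have hcard : (centersIn E w S).card = C₁.card + C₂.card := by
      rw [← hunion, Finset.card_union_of_disjoint]
      rw [Finset.disjoint_left]; exact fun x h₁ h₂ => hd.notMem h₁ h₂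
    have i₁ := ih₁ (Set.sdiff_subset.trans hS) hφ₁ (by rw [hc₁]; omega)
    have i₂ := ih₂ (hS₂.trans hS) hφ₂ (by rw [hc₂]; omega)
    rw [hc₁] at i₁
    rw [hc₂] at i₂
    have hlog₁ := clog_half (p := (centersIn E w S).card) (q := C₁.card) h (by omega)
    have hlog₂ := clog_half (p := (centersIn E w S).card) (q := C₂.card) h (by omega)
    have harcs := numArcs_add_le (E := E) (w := w) hS₂
    set p := (centersIn E w S).card
    set L := Nat.clog 2 p
    set e := (semiMatchingNetwork E w).numArcs S
    set e₁ := (semiMatchingNetwork E w).numArcs (S \ S₂)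
    set e₂ := (semiMatchingNetwork E w).numArcs S₂
    obtain ⟨L', hL'⟩ : ∃ L', L = L' + 1 := ⟨L - 1, by omega⟩
    have b₁ : e₁ * Nat.clog 2 C₁.card ≤ e₁ * L' := Nat.mul_le_mul_left _ (by omega)
    have b₂ : e₂ * Nat.clog 2 C₂.card ≤ e₂ * L' := Nat.mul_le_mul_left _ (by omega)
    have b₃ : (e₁ + e₂) * L' ≤ e * L' := Nat.mul_le_mul_right _ harcs
    have b₄ : (k + 1) * (e + 1) ≤ K * (e + 1) := Nat.mul_le_mul_right _ (by omega)
    have b₅ : K * ((e₁ * Nat.clog 2 C₁.card + 2 * C₁.card) +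
        (e₂ * Nat.clog 2 C₂.card + 2 * C₂.card)) ≤ K * (e * L' + 2 * p) :=
      Nat.mul_le_mul_left _ (by rw [add_mul] at b₃; omega)
    rw [hL']
    nlinarith

theorem sum_machineDegree : ∑ v, machineDegree E v = E.card := by
  rw [Finset.card_eq_sum_card_fiberwise (f := Prod.snd) (t := Finset.univ) (by simp)]
  rfl

theorem card_centers_le : (centers E w).card ≤ E.card := by
  rw [← sum_machineDegree]
  refine Finset.card_biUnion_le.trans (Finset.sum_le_sum fun v _ => ?_)
  exact Finset.card_image_le.trans (by simp)

theorem card_centers_pos (hE : E.Nonempty) : 0 < (centers E w).card := by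
  obtain ⟨e, he⟩ := hE
  refine Finset.card_pos.2 ⟨w e.2 0, mem_centers.2 ⟨e.2, 0, ?_, rfl⟩⟩
  exact Finset.card_pos.2 ⟨e, by simp [he]⟩

theorem numArcs_inner_le :
    (semiMatchingNetwork E w).numArcs (innerVertices E w) ≤ 2 * E.card := by
  have : (semiMatchingNetwork E w).numArcs (innerVertices E w) ≤ (innerArcs E w).card := by
    refine Finset.card_le_card fun a ha => ?_
    simp only [Finset.mem_filter] at ha
    refine mem_innerArcs.2 ⟨ha.1, ?_⟩
    rcases a with u | ⟨u, v⟩ | ⟨v, i⟩ | x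
    · exact ha.2.1.elim
    · trivial
    · trivial
    · exact ha.2.2.elim
  refine this.trans ?_
  rw [Finset.card_eq_sum_ones, sum_innerArcs]
  simp [sum_machineDegree]; omega

theorem centersIn_inner : centersIn E w (innerVertices E w) = centers E w := by
  ext x
  simp only [centersIn, Finset.mem_filter, and_iff_left_iff_imp]
  exact fun h => h

theorem CancelAll.work_le_total {t : ℕ} (h : CancelAll E w (innerVertices E w) φ ψ t)
    (hφ : IsFull E w φ) (hE : E.Nonempty) :
    t ≤ (2 * Nat.sqrt (4 * Fintype.card U) + 2) *
      (2 * E.card * (Nat.clog 2 E.card + 1)) := by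
  have h1 := h.work_le subset_rfl hφ le_rfl (by rw [centersIn_inner]; exact card_centers_pos hE)
  rw [centersIn_inner] at h1
  refine (Nat.le_add_right _ _).trans (h1.trans (Nat.mul_le_mul_left _ ?_))
  have h2 := card_centers_le (E := E) (w := w)
  have h3 := Nat.mul_le_mul (numArcs_inner_le (E := E) (w := w)) (Nat.clog_mono_right 2 h2)
  rw [mul_add]; omega

end Work

/-! ### Estimates -/

theorem clog_le_log {n m : ℕ} (hn : 2 ≤ n) (hm : m ≤ n ^ 2) :
    (Nat.clog 2 m : ℝ) + 1 ≤ 6 * Real.log n := by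
  have hl : (0.69 : ℝ) < Real.log 2 := by have := Real.log_two_gt_d9; linarith
  have hn' : Real.log 2 ≤ Real.log n := Real.log_le_log (by norm_num) (by exact_mod_cast hn)
  by_cases h : m ≤ 1
  · rw [Nat.clog_of_right_le_one h]; push_cast; linarith
  · have h1 : 2 ^ (Nat.clog 2 m).pred < m := Nat.pow_pred_clog_lt_self one_lt_two (by omega)
    have h2 : ((2 : ℝ) ^ (Nat.clog 2 m).pred) ≤ (n : ℝ) ^ 2 := by
      exact_mod_cast (h1.le.trans hm)
    have h3 := Real.log_le_log (by positivity) h2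
    rw [Real.log_pow, Real.log_pow] at h3
    have h4 : 0 < Nat.clog 2 m := Nat.clog_pos one_lt_two (by omega)
    have h5 : ((Nat.clog 2 m).pred : ℝ) = Nat.clog 2 m - 1 := by
      rw [Nat.pred_eq_sub_one, Nat.cast_sub h4]; simp
    rw [h5] at h3
    have h6 : (1 : ℝ) ≤ Nat.clog 2 m := by exact_mod_cast h4
    push_cast at h3
    have h7 : ((Nat.clog 2 m : ℝ) - 1) * 0.69 ≤ (Nat.clog 2 m - 1) * Real.log 2 :=
      mul_le_mul_of_nonneg_left hl.le (by linarith)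
    linarith

theorem sqrt_le_sqrt_add {n u : ℕ} (hn : 1 ≤ n) (hu : u ≤ n) :
    ((2 * Nat.sqrt (4 * u) + 2 : ℕ) : ℝ) ≤ 6 * Real.sqrt n := by
  have h1 : ((Nat.sqrt (4 * u) : ℕ) : ℝ) ≤ Real.sqrt ((4 * n : ℕ) : ℝ) :=
    Real.nat_sqrt_le_real_sqrt.trans
      (Real.sqrt_le_sqrt (by exact_mod_cast Nat.mul_le_mul_left 4 hu))
  have h2 : Real.sqrt ((4 * n : ℕ) : ℝ) = 2 * Real.sqrt n := by
    push_cast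
    rw [Real.sqrt_mul (by norm_num), show (4 : ℝ) = 2 ^ 2 by norm_num, Real.sqrt_sq (by norm_num)]
  have h3 : (1 : ℝ) ≤ Real.sqrt n := Real.one_le_sqrt.2 (by exact_mod_cast hn)
  push_cast; linarith

/-- The bounds on the rounds and on the levels combine to `O(√n m log n)`, since `log m ≤ 2 log n`.
-/
theorem bound_le_timeBound {n u m : ℕ} (hn : 2 ≤ n) (hu : u ≤ n) (hm : m ≤ n ^ 2) :
    (((2 * Nat.sqrt (4 * u) + 2) * (m * (Nat.clog 2 m + 1)) : ℕ) : ℝ) ≤ 36 * timeBound n m := by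
  have h1 := sqrt_le_sqrt_add (by omega : 1 ≤ n) hu
  have h2 := clog_le_log hn hm
  rw [Nat.cast_mul, Nat.cast_mul, timeBound]
  calc _ ≤ (6 * Real.sqrt n) * (m * (6 * Real.log n)) := by
        push_cast at h1 h2 ⊢
        gcongr
    _ = _ := by ring

theorem card_edges_le {nU nV : ℕ} (E : Finset (Fin nU × Fin nV)) : E.card ≤ (nU + nV) ^ 2 := by
  have := Finset.card_le_univ E
  simp only [Fintype.card_prod, Fintype.card_fin] at this
  nlinarith [Nat.zero_le nU, Nat.zero_le nV]

theorem two_le_of_nonempty {nU nV : ℕ} {E : Finset (Fin nU × Fin nV)} (h : E.Nonempty) :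
    2 ≤ nU + nV := by
  obtain ⟨⟨u, v⟩, _⟩ := h
  have := u.pos; have := v.pos; omega

/-- Correctness and work of CancelAll for convex cost functions. -/
theorem cancelAll_convex {nU nV : ℕ} (E : Finset (Fin nU × Fin nV)) (f : Fin nV → ℕ → ℝ)
    (hne : E.Nonempty) (hE : ∀ u, ∃ v, (u, v) ∈ E) (hf : ∀ v, IsDiscreteConvex (f v))
    {φ : NetArc (Fin nU) (Fin nV) → ℕ}
    (hφ : (semiMatchingNetwork E (marginalSlot f)).IsMaxFlow φ) :
    (∃ φ' t, CancelAll E (marginalSlot f) (innerVertices E (marginalSlot f)) φ φ' t) ∧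
    ∀ φ' t, CancelAll E (marginalSlot f) (innerVertices E (marginalSlot f)) φ φ' t →
      (semiMatchingNetwork E (marginalSlot f)).IsMinCostFlow φ' ∧
      IsOptimalSemiMatching (machineCost f) E (flowEdges E φ') ∧
      (t : ℝ) ≤ 72 * timeBound (nU + nV) E.card := by
  have hfull := (isMaxFlow_iff hE).1 hφ
  refine ⟨?_, fun φ' t h => ⟨h.isMinCostFlow hE hfull, h.isOptimal hf hfull, ?_⟩⟩
  · obtain ⟨ψ, t, h, -⟩ := exists_cancelAll (w := marginalSlot f) subset_rfl hfull
    exact ⟨ψ, t, h⟩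
  · have h1 := h.work_le_total hfull hne
    have h2 := bound_le_timeBound (u := nU) (m := E.card) (two_le_of_nonempty hne) (by omega)
      (card_edges_le E)
    rw [Fintype.card_fin] at h1
    have h3 : (t : ℝ) ≤ (((2 * Nat.sqrt (4 * nU) + 2) *
        (2 * E.card * (Nat.clog 2 E.card + 1)) : ℕ) : ℝ) := by exact_mod_cast h1
    push_cast at h2 h3
    linarith

/-- The cost function `d (d + 1) / 2` of the unweighted problem. -/
noncomputable def triangularCost {V : Type} : V → ℕ → ℝ := fun _ i => (i : ℝ) * (i + 1) / 2

theorem isDiscreteConvex_triangularCost {V : Type} (v : V) :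
    IsDiscreteConvex (triangularCost v) := by
  intro i; simp only [triangularCost]; push_cast; linarith

theorem marginalSlot_triangularCost {V : Type} :
    marginalSlot (triangularCost (V := V)) = unweightedSlot := by
  funext v i; simp only [marginalSlot, triangularCost, unweightedSlot]; push_cast; ring

theorem machineCost_triangularCost {U V : Type} [Fintype U] [Fintype V] (M : Finset (U × V)) :
    machineCost triangularCost M = (unweightedCost M : ℝ) := by
  rw [machineCost, unweightedCost, Nat.cast_sum]
  refine Finset.sum_congr rfl fun v _ => ?_
  simp only [triangularCost]
  rw [Nat.cast_div (Nat.even_mul_succ_self _).two_dvd (by norm_num)]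
  push_cast; ring

theorem isOptimal_unweighted_iff {U V : Type} [Fintype U] [Fintype V] {E M : Finset (U × V)} :
    IsOptimalSemiMatching unweightedCost E M ↔
      IsOptimalSemiMatching (machineCost triangularCost) E M := by
  simp only [IsOptimalSemiMatching, machineCost_triangularCost, Nat.cast_le]

/-! ### Execution of programs -/

namespace RAM

@[simp] theorem reg_setReg (σ : State) (x n y : ℕ) :
    (σ.setReg x n).reg y = if y = x then n else σ.reg y := by
  simp [State.setReg, Function.update_apply]

@[simp] theorem mem_setReg (σ : State) (x n : ℕ) : (σ.setReg x n).mem = σ.mem := rfl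

@[simp] theorem realMem_setReg (σ : State) (x n : ℕ) : (σ.setReg x n).realMem = σ.realMem := rfl

@[simp] theorem reg_setMem (σ : State) (a i n : ℕ) : (σ.setMem a i n).reg = σ.reg := rfl

@[simp] theorem realMem_setMem (σ : State) (a i n : ℕ) :
    (σ.setMem a i n).realMem = σ.realMem := rfl

@[simp] theorem mem_setMem (σ : State) (a i n b : ℕ) :
    (σ.setMem a i n).mem b = if b = a then Function.update (σ.mem a) i n else σ.mem b := by
  simp [State.setMem, Function.update_apply]

@[simp] theorem reg_setRealMem (σ : State) (a i : ℕ) (r : ℝ) :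
    (σ.setRealMem a i r).reg = σ.reg := rfl

@[simp] theorem mem_setRealMem (σ : State) (a i : ℕ) (r : ℝ) :
    (σ.setRealMem a i r).mem = σ.mem := rfl

@[simp] theorem realMem_setRealMem (σ : State) (a i : ℕ) (r : ℝ) (b : ℕ) :
    (σ.setRealMem a i r).realMem b =
      if b = a then Function.update (σ.realMem a) i r else σ.realMem b := by
  simp [State.setRealMem, Function.update_apply]

/-- The program `p`, started in `σ`, halts within `B` steps in a state that satisfies `Q`. -/
def Runs (W : ℕ) (F : ℕ → ℕ → ℝ) (p : Program) (σ : State) (B : ℕ) (Q : State → Prop) : Prop :=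
  ∃ σ' t, Exec W F p σ σ' t ∧ t ≤ B ∧ Q σ'

variable {W : ℕ} {F : ℕ → ℕ → ℝ} {p q : Program} {σ : State} {B B' : ℕ} {Q R : State → Prop}

theorem Runs.mono (h : Runs W F p σ B Q) (hB : B ≤ B') (hQ : ∀ σ', Q σ' → R σ') :
    Runs W F p σ B' R := by
  obtain ⟨σ', t, h1, h2, h3⟩ := h
  exact ⟨σ', t, h1, h2.trans hB, hQ _ h3⟩

theorem Runs.seq (hp : Runs W F p σ B Q) (hq : ∀ σ', Q σ' → Runs W F q σ' B' R) :
    Runs W F (.seq p q) σ (B + B') R := by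
  obtain ⟨σ', t, h1, h2, h3⟩ := hp
  obtain ⟨σ'', t', h4, h5, h6⟩ := hq _ h3
  exact ⟨σ'', t + t', .seq _ _ _ _ _ _ _ h1 h4, by omega, h6⟩

theorem Runs.ite {b : Test} (ht : b.Holds F σ → Runs W F p σ B R)
    (hf : ¬ b.Holds F σ → Runs W F q σ B R) : Runs W F (.ite b p q) σ (b.steps + B) R := by
  by_cases hb : b.Holds F σ
  · obtain ⟨σ', t, h1, h2, h3⟩ := ht hb
    exact ⟨σ', _, .iteTrue _ _ _ _ _ _ hb h1, by omega, h3⟩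
  · obtain ⟨σ', t, h1, h2, h3⟩ := hf hb
    exact ⟨σ', _, .iteFalse _ _ _ _ _ _ hb h1, by omega, h3⟩

/-- The amortized analysis of a loop: every iteration, including its test, is paid for by a
decrease of the potential `f`. -/
theorem Runs.loop {b : Test} (I : State → Prop) (f : State → ℕ) (c : ℕ)
    (hI : I σ)
    (hbody : ∀ σ, I σ → b.Holds F σ → ∃ B, Runs W F p σ B fun σ' =>
      I σ' ∧ b.steps + B + c * f σ' ≤ c * f σ) :
    Runs W F (.loop b p) σ (c * f σ + b.steps) fun σ' => I σ' ∧ ¬ b.Holds F σ' := by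
  induction hn : c * f σ using Nat.strong_induction_on generalizing σ with
  | _ n ih =>
    by_cases hb : b.Holds F σ
    · obtain ⟨B, σ', t, h1, h2, h3, h4⟩ := hbody σ hI hb
      have hpos : 0 < b.steps := by cases b <;> simp [Test.steps]
      obtain ⟨σ'', t', h5, h6, h7⟩ := ih (c * f σ') (by omega) h3 rfl
      exact ⟨σ'', _, .loopStep _ _ _ _ _ _ _ hb h1 h5, by omega, h7⟩
    · exact ⟨σ, _, .loopDone _ _ _ hb, by omega, hI, hb⟩

/-- A bound on the steps of a program without loops; the value at a loop is irrelevant, since `size`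
is only used together with `Program.Wp`. -/
def Program.size : Program → ℕ
  | .nop => 1
  | .letWord _ e => e.steps + 1
  | .putWord _ i e => i.steps + e.steps + 1
  | .letReal _ r => r.steps + 1
  | .putReal _ i r => i.steps + r.steps + 1
  | .seq p q => p.size + q.size
  | .ite b p q => b.steps + max p.size q.size
  | .loop _ _ => 0

/-- The weakest precondition of a program without loops; it is `False` for a loop. -/
def Program.Wp (W : ℕ) (F : ℕ → ℕ → ℝ) : Program → State → (State → Prop) → Prop
  | .nop, σ, Q => Q σ
  | .letWord x e, σ, Q => e.eval σ ≤ W ∧ Q (σ.setReg x (e.eval σ))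
  | .putWord a i e, σ, Q => i.eval σ ≤ W ∧ e.eval σ ≤ W ∧ Q (σ.setMem a (i.eval σ) (e.eval σ))
  | .letReal x r, σ, Q => Q (σ.setRealReg x (r.eval F σ))
  | .putReal a i r, σ, Q => i.eval σ ≤ W ∧ Q (σ.setRealMem a (i.eval σ) (r.eval F σ))
  | .seq p q, σ, Q => p.Wp W F σ fun σ' => q.Wp W F σ' Q
  | .ite b p q, σ, Q => (b.Holds F σ → p.Wp W F σ Q) ∧ (¬ b.Holds F σ → q.Wp W F σ Q)
  | .loop _ _, _, _ => False

theorem Program.Wp.runs {p : Program} {σ : State} {Q : State → Prop} (h : p.Wp W F σ Q) :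
    Runs W F p σ p.size Q := by
  induction p generalizing σ Q with
  | nop => exact ⟨σ, 1, .nop _, le_rfl, h⟩
  | letWord x e => exact ⟨_, _, .letWord _ _ _ h.1, le_rfl, h.2⟩
  | putWord a i e => exact ⟨_, _, .putWord _ _ _ _ h.1 h.2.1, le_rfl, h.2.2⟩
  | letReal x r => exact ⟨_, _, .letReal _ _ _, le_rfl, h⟩
  | putReal a i r => exact ⟨_, _, .putReal _ _ _ _ h.1, le_rfl, h.2⟩
  | seq p q ihp ihq => exact (ihp h).seq fun σ' h' => ihq h'
  | ite b p q ihp ihq =>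
    exact Runs.ite (fun hb => (ihp (h.1 hb)).mono (le_max_left _ _) fun _ => id)
      (fun hb => (ihq (h.2 hb)).mono (le_max_right _ _) fun _ => id)
  | loop b p => exact h.elim

theorem Runs.and {P : State → Prop} (h : Runs W F p σ B Q)
    (hP : ∀ σ' t, Exec W F p σ σ' t → P σ') : Runs W F p σ B fun σ' => Q σ' ∧ P σ' := by
  obtain ⟨σ', t, h1, h2, h3⟩ := h
  exact ⟨σ', t, h1, h2, h3, hP _ _ h1⟩

/-- The arrays of words that a program writes to. -/
def Program.writes : Program → List ℕ
  | .putWord a _ _ => [a]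
  | .seq p q => p.writes ++ q.writes
  | .ite _ p q => p.writes ++ q.writes
  | .loop _ p => p.writes
  | _ => []

/-- The word registers that a program writes to. -/
def Program.sets : Program → List ℕ
  | .letWord x _ => [x]
  | .seq p q => p.sets ++ q.sets
  | .ite _ p q => p.sets ++ q.sets
  | .loop _ p => p.sets
  | _ => []

theorem Exec.mem_eq {σ' : State} {t : ℕ} (h : Exec W F p σ σ' t) {a : ℕ} (ha : a ∉ p.writes) :
    σ'.mem a = σ.mem a := by
  induction h with
  | nop => rfl
  | letWord => rfl
  | putWord σ b i e _ _ =>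
    simp only [Program.writes, List.mem_singleton] at ha
    rw [mem_setMem, if_neg ha]
  | letReal => rfl
  | putReal => rfl
  | seq p q σ σ' σ'' t t' _ _ ih₁ ih₂ =>
    simp only [Program.writes, List.mem_append, not_or] at ha
    rw [ih₂ ha.2, ih₁ ha.1]
  | iteTrue b p q σ σ' t _ _ ih =>
    simp only [Program.writes, List.mem_append, not_or] at ha
    exact ih ha.1
  | iteFalse b p q σ σ' t _ _ ih =>
    simp only [Program.writes, List.mem_append, not_or] at ha
    exact ih ha.2
  | loopDone => rfl
  | loopStep b p σ σ' σ'' t t' _ _ _ ih₁ ih₂ =>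
    rw [ih₂ ha]; exact ih₁ ha

theorem Exec.reg_eq {σ' : State} {t : ℕ} (h : Exec W F p σ σ' t) {x : ℕ} (hx : x ∉ p.sets) :
    σ'.reg x = σ.reg x := by
  induction h with
  | nop => rfl
  | letWord σ y e _ =>
    simp only [Program.sets, List.mem_singleton] at hx
    rw [reg_setReg, if_neg hx]
  | putWord => rfl
  | letReal => rfl
  | putReal => rfl
  | seq p q σ σ' σ'' t t' _ _ ih₁ ih₂ =>
    simp only [Program.sets, List.mem_append, not_or] at hx
    rw [ih₂ hx.2, ih₁ hx.1]
  | iteTrue b p q σ σ' t _ _ ih =>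
    simp only [Program.sets, List.mem_append, not_or] at hx
    exact ih hx.1
  | iteFalse b p q σ σ' t _ _ ih =>
    simp only [Program.sets, List.mem_append, not_or] at hx
    exact ih hx.2
  | loopDone => rfl
  | loopStep b p σ σ' σ'' t t' _ _ _ ih₁ ih₂ =>
    rw [ih₂ hx]; exact ih₁ hx

end RAM

/-! ### Rounds in terms of assignments of jobs to machines -/

theorem FlowNetwork.IsWalk.potential_eq_of_tight {X A : Type} {N : FlowNetwork X A} {S : Set X}
    {φ : A → ℕ} {f : X → ℕ} {x y : X} {p : List (A × Bool)} (h : N.IsWalk S φ x p y)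
    (hf : ∀ r ∈ p, f (N.resHead r) = f (N.resTail r) + 1) : f y = f x + p.length := by
  induction p generalizing x with
  | nil => simp [h.2]
  | cons r p ih =>
    have := ih h.2.2.2 fun r' h' => hf r' (by simp [h'])
    have h1 := hf r (by simp)
    rw [h.2.2.1] at h1
    simp only [List.length_cons]; omega

section Assignment

variable {U V : Type} [Fintype U] [Fintype V] {E : Finset (U × V)} {w : V → ℕ → ℝ}
variable {ν ν' : U → V} {P : V → Prop} {C₁ C₂ : Finset ℝ} {T d : V → ℕ} {D : ℕ}

/-- The semi-matching that assigns the job `u` to the machine `ν u`. -/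
noncomputable def graphOf (ν : U → V) : Finset (U × V) := Finset.univ.image fun u => (u, ν u)

@[simp] theorem mem_graphOf {u : U} {v : V} : (u, v) ∈ graphOf ν ↔ ν u = v := by
  simp [graphOf]

/-- The number of jobs on the machine `v`. -/
noncomputable def load (ν : U → V) (v : V) : ℕ := machineDegree (graphOf ν) v

theorem load_eq (v : V) : load ν v = (Finset.univ.filter fun u => ν u = v).card := by
  rw [load, machineDegree]
  refine Finset.card_bij (fun e _ => e.1) ?_ ?_ ?_
  · rintro ⟨u, v'⟩ h
    simp only [Finset.mem_filter, mem_graphOf] at h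
    simp [h.1, h.2]
  · rintro ⟨u, v₁⟩ h₁ ⟨u', v₂⟩ h₂ h
    simp only [Finset.mem_filter, mem_graphOf] at h₁ h₂ h
    rw [Prod.mk.injEq]; exact ⟨h, h₁.2.trans h₂.2.symm⟩
  · intro u hu
    exact ⟨(u, v), by simpa using hu, rfl⟩

theorem graphOf_isSemiMatching (h : ∀ u, (u, ν u) ∈ E) : IsSemiMatching E (graphOf ν) := by
  refine ⟨?_, fun u => ⟨ν u, by simp, by simp [eq_comm]⟩⟩
  rintro ⟨u, v⟩ he
  rw [mem_graphOf] at he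
  exact he ▸ h u

theorem load_le (h : ∀ u, (u, ν u) ∈ E) (v : V) : load ν v ≤ machineDegree E v :=
  machineDegree_mono (graphOf_isSemiMatching h).1 v

theorem load_congr (h : ∀ u, ν u ≠ ν' u → ν u ≠ v ∧ ν' u ≠ v) : load ν' v = load ν v := by
  rw [load_eq, load_eq]
  congr 1; ext u
  simp only [Finset.mem_filter, Finset.mem_univ, true_and]
  by_cases hu : ν u = ν' u
  · rw [hu]
  · exact ⟨fun h' => absurd h' (h u hu).2, fun h' => absurd h' (h u hu).1⟩

/-- The flow of the assignment `ν`. -/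
noncomputable abbrev assignFlow (w : V → ℕ → ℝ) (ν : U → V) : NetArc U V → ℕ :=
  flowOf w (graphOf ν)

theorem flowEdges_assignFlow (h : ∀ u, (u, ν u) ∈ E) :
    flowEdges E (assignFlow w ν) = graphOf ν := by
  ext ⟨u, v⟩
  simp only [flowEdges, flowOf, Finset.mem_filter, mem_graphOf, ne_eq, ite_eq_right_iff,
    one_ne_zero, imp_false, not_not, and_iff_right_iff_imp]
  rintro rfl; exact h u

theorem residual_assign_true {u : U} {v : V} :
    (semiMatchingNetwork E w).IsResidual (assignFlow w ν) (.assign u v, true) ↔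
      (u, v) ∈ E ∧ ν u ≠ v := by
  simp only [FlowNetwork.IsResidual, assign_mem_arcs, if_true, cap_inner (a := .assign u v) trivial,
    flowOf, mem_graphOf]
  split_ifs with h <;> simp [h]

theorem residual_assign_false {u : U} {v : V} :
    (semiMatchingNetwork E w).IsResidual (assignFlow w ν) (.assign u v, false) ↔
      (u, v) ∈ E ∧ ν u = v := by
  simp only [FlowNetwork.IsResidual, assign_mem_arcs, flowOf, mem_graphOf, Bool.false_eq_true,
    if_false]
  split_ifs with h <;> simp [h]

theorem residual_slot_true {v : V} {i : ℕ} :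
    (semiMatchingNetwork E w).IsResidual (assignFlow w ν) (.slot v i, true) ↔
      i < machineDegree E v ∧ load ν v ≤ i := by
  simp only [FlowNetwork.IsResidual, slot_mem_arcs, if_true, cap_inner (a := .slot v i) trivial,
    flowOf]
  rw [← load]
  split_ifs with h
  · simp [h]
  · simp; omega

theorem residual_slot_false {v : V} {i : ℕ} :
    (semiMatchingNetwork E w).IsResidual (assignFlow w ν) (.slot v i, false) ↔
      i < machineDegree E v ∧ i < load ν v := by
  simp only [FlowNetwork.IsResidual, slot_mem_arcs, flowOf, Bool.false_eq_true, if_false]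
  rw [← load]
  split_ifs with h <;> simp [h]

/-- The vertices of a subnetwork: the machines that satisfy `P`, the jobs assigned to them, and the
cost centers in `C`. -/
def partSet (P : V → Prop) (ν : U → V) (C : Finset ℝ) : Set (NetVertex U V) :=
  {x | match x with
    | .source => False
    | .sink => False
    | .job u => P (ν u)
    | .machine v => P v
    | .center c => c ∈ C}

variable (E w ν P C₁ C₂ T) in
/-- The state of a subnetwork whose cost centers are divided into `C₁` and `C₂`, and whose flow is
the flow of the assignment `ν`. The first `T v` slots of the machine `v` lead to centers up to those
in `C₁`, and every slot between `T v` and the load of `v` leads to a center of the subnetwork. A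
machine with more than `T v` jobs (an overloaded one) thus has a residual arc from `C₂`, and a
machine with less than `T v` jobs (an underloaded one) has a residual arc to `C₁`. -/
structure PartState : Prop where
  edge : ∀ u, (u, ν u) ∈ E
  sub : C₁ ∪ C₂ ⊆ centers E w
  lt : ∀ x ∈ C₁, ∀ y ∈ C₂, x < y
  low : ∀ v, P v → ∀ i < machineDegree E v, w v i ∈ C₁ → i < T v
  high : ∀ v, P v → ∀ i < machineDegree E v, w v i ∈ C₂ → T v ≤ i
  le : ∀ v, P v → T v ≤ machineDegree E v
  mem_high : ∀ v, P v → ∀ i, T v ≤ i → i < load ν v → w v i ∈ C₂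
  mem_low : ∀ v, P v → ∀ i, load ν v ≤ i → i < T v → w v i ∈ C₁

theorem partSet_subset {C : Finset ℝ} (hC : C ⊆ centers E w) :
    partSet P ν C ⊆ innerVertices E w := by
  rintro (_ | _ | u | v | c) hx
  · exact hx.elim
  · exact hx.elim
  · trivial
  · trivial
  · exact hC hx

theorem PartState.isDivision (h : PartState E w ν P C₁ C₂ T) :
    IsDivision E w (partSet P ν (C₁ ∪ C₂)) C₁ C₂ := by
  refine ⟨partSet_subset h.sub, ?_, h.lt⟩
  ext x
  rw [mem_centersIn (partSet_subset h.sub)]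
  rfl

variable (E ν P d) in
/-- `d` labels the machines that are reached from the overloaded ones. -/
structure Labels (T : V → ℕ) : Prop where
  one_iff : ∀ v, P v → (d v = 1 ↔ T v < load ν v)
  pred : ∀ v, P v → 1 < d v → ∃ u, (u, v) ∈ E ∧ P (ν u) ∧ d (ν u) ≠ 0 ∧ d (ν u) + 1 = d v

/-- A labelled machine is reached from `C₂` by a walk whose length is given by its label. -/
theorem PartState.exists_walk_to (h : PartState E w ν P C₁ C₂ T) (hl : Labels E ν P d T) {v : V}
    (hv : P v) (hd : d v ≠ 0) : ∃ y ∈ centerSet C₂, ∃ p,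
      (semiMatchingNetwork E w).IsWalk (partSet P ν (C₁ ∪ C₂)) (assignFlow w ν) y p (.machine v) ∧
      p.length + 1 = 2 * d v := by
  induction hn : d v using Nat.strong_induction_on generalizing v with
  | _ n ih =>
    rcases Nat.lt_or_ge 1 (d v) with h1 | h1
    · obtain ⟨u, hu, hP, hne, hdu⟩ := hl.pred v hv h1
      obtain ⟨y, hy, p, hp, hlen⟩ := ih (d (ν u)) (by omega) hP hne rfl
      have h2 := hp.snoc (r := (NetArc.assign u (ν u), false))
        (residual_assign_false.2 ⟨h.edge u, rfl⟩) hP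
      have h3 := h2.snoc (r := (NetArc.assign u v, true)) (residual_assign_true.2 ⟨hu, by
        rintro rfl; omega⟩) hv
      refine ⟨y, hy, _, h3, ?_⟩
      simp only [List.length_append, List.length_singleton]; omega
    · have h1 : d v = 1 := by omega
      have h2 := (hl.one_iff v hv).1 h1
      have h3 := h.mem_high v hv (T v) le_rfl h2
      refine ⟨.center (w v (T v)), by simpa using h3, [(.slot v (T v), false)], ?_, by simp; omega⟩
      exact ⟨Finset.mem_union_right _ h3, residual_slot_false.2
        ⟨lt_of_lt_of_le h2 (load_le h.edge v), h2⟩, rfl, hv, rfl⟩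

variable (E ν P T d) in
/-- The machines from which an underloaded machine is reached along increasing labels. -/
inductive LeadsDown : V → Prop
  | base (v : V) (hP : P v) (hd : d v ≠ 0) (hT : load ν v < T v) : LeadsDown v
  | step (u : U) (v : V) (hu : (u, v) ∈ E) (hP : P (ν u)) (hPv : P v) (hne : d (ν u) ≠ 0)
      (hd : d v = d (ν u) + 1) (hv : LeadsDown v) : LeadsDown (ν u)

/-- The label of a machine on such a path determines the length of the rest of the path. -/
theorem LeadsDown.exists_walk {v : V} (hv : LeadsDown E ν P T d v)
    (h : PartState E w ν P C₁ C₂ T) (hdef : ∀ v, P v → d v ≠ 0 → load ν v < T v → d v = D) :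
    ∃ z ∈ centerSet C₁, ∃ p, (semiMatchingNetwork E w).IsWalk (partSet P ν (C₁ ∪ C₂))
      (assignFlow w ν) (.machine v) p z ∧ p.length + 2 * d v = 2 * D + 1 := by
  induction hv with
  | base v hP hd hT =>
    have h3 := h.mem_low v hP _ le_rfl hT
    refine ⟨.center (w v (load ν v)), by simpa using h3, [(.slot v (load ν v), true)], ?_, ?_⟩
    · exact ⟨hP, residual_slot_true.2 ⟨lt_of_lt_of_le hT (h.le v hP), le_rfl⟩, rfl,
        Finset.mem_union_left _ h3, rfl⟩
    · rw [hdef v hP hd hT]; simp; omega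
  | step u v hu hP hPv hne hd hv ih =>
    obtain ⟨z, hz, p, hp, hlen⟩ := ih
    refine ⟨z, hz, (.assign u (ν u), false) :: (.assign u v, true) :: p, ?_, ?_⟩
    · exact ⟨hP, residual_assign_false.2 ⟨h.edge u, rfl⟩, rfl, hP,
        residual_assign_true.2 ⟨hu, by rintro rfl; omega⟩, rfl, hp⟩
    · simp only [List.length_cons]; omega

/-- The distance from `C₂` to a vertex, computed from the labels of the machines; machines without
a label are beyond the last layer. -/
noncomputable def labelPotential (ν : U → V) (C₂ : Finset ℝ) (d : V → ℕ) (D : ℕ) :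
    NetVertex U V → ℕ
  | .source => 0
  | .sink => 0
  | .job u => 2 * (if d (ν u) = 0 then D + 1 else d (ν u))
  | .machine v => 2 * (if d v = 0 then D + 1 else d v) - 1
  | .center c => if c ∈ C₂ then 0 else 2 * D

variable (E ν P d D) in
/-- `d` is a breadth-first labelling that stops at the layer `D` of the first underloaded
machines. -/
structure Layers (T : V → ℕ) : Prop extends Labels E ν P d T where
  closed : ∀ u v, P (ν u) → (u, v) ∈ E → P v → d (ν u) ≠ 0 → d (ν u) < D →
    d v ≠ 0 ∧ d v ≤ d (ν u) + 1
  deficit : ∀ v, P v → d v ≠ 0 → load ν v < T v → d v = D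
  le : ∀ v, P v → d v ≤ D

/-- The label potential grows by at most one along a residual arc, so that it bounds distances from
below. -/
theorem PartState.labelPotential_le (h : PartState E w ν P C₁ C₂ T) (hl : Layers E ν P d D T)
    {r : NetArc U V × Bool}
    (hr : (semiMatchingNetwork E w).IsResidual (assignFlow w ν) r)
    (ht : (semiMatchingNetwork E w).resTail r ∈ partSet P ν (C₁ ∪ C₂))
    (hh : (semiMatchingNetwork E w).resHead r ∈ partSet P ν (C₁ ∪ C₂)) :
    labelPotential ν C₂ d D ((semiMatchingNetwork E w).resHead r) ≤
      labelPotential ν C₂ d D ((semiMatchingNetwork E w).resTail r) + 1 := by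
  obtain ⟨u | ⟨u, v⟩ | ⟨v, i⟩ | x, b⟩ := r
  · cases b
    · exact hh.elim
    · exact ht.elim
  · cases b
    · obtain ⟨h1, rfl⟩ := residual_assign_false.1 hr
      change 2 * _ ≤ 2 * _ - 1 + 1
      omega
    · obtain ⟨h1, h2⟩ := residual_assign_true.1 hr
      change P (ν u) at ht
      change P v at hh
      change 2 * (if d v = 0 then D + 1 else d v) - 1 ≤
        2 * (if d (ν u) = 0 then D + 1 else d (ν u)) + 1
      have h3 := hl.closed u v ht h1 hh
      have h4 := hl.le v hh
      have h5 := hl.le _ ht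
      split_ifs <;> omega
  · cases b
    · obtain ⟨h1, h2⟩ := residual_slot_false.1 hr
      change P v at hh
      change w v i ∈ C₁ ∪ C₂ at ht
      change 2 * (if d v = 0 then D + 1 else d v) - 1 ≤ (if w v i ∈ C₂ then 0 else 2 * D) + 1
      have h4 := hl.le v hh
      by_cases hc : w v i ∈ C₂
      · have h5 := (hl.one_iff v hh).2 (lt_of_le_of_lt (h.high v hh i h1 hc) h2)
        simp [hc, h5]
      · rw [if_neg hc]; split_ifs <;> omega
    · obtain ⟨h1, h2⟩ := residual_slot_true.1 hr
      change P v at ht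
      change w v i ∈ C₁ ∪ C₂ at hh
      change (if w v i ∈ C₂ then 0 else 2 * D) ≤ 2 * (if d v = 0 then D + 1 else d v) - 1 + 1
      by_cases hc : w v i ∈ C₂
      · simp [hc]
      · have hc₁ := (Finset.mem_union.1 hh).resolve_right hc
        have h5 := h.low v ht i h1 hc₁
        have h6 := hl.deficit v ht
        rw [if_neg hc]; split_ifs <;> omega
  · cases b
    · exact ht.elim
    · exact hh.elim

variable (E ν ν' P T d) in
/-- The jobs that change their machines do so along the layers, and they block all shortest paths:
a machine that satisfies `Dead` has no remaining path to an underloaded machine. -/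
structure LayerFlow : Prop where
  edge' : ∀ u, (u, ν' u) ∈ E
  job : ∀ u, ν' u = ν u ∨ (P (ν u) ∧ P (ν' u) ∧ d (ν u) ≠ 0 ∧ d (ν' u) = d (ν u) + 1 ∧
    LeadsDown E ν P T d (ν' u))
  down : ∀ v, P v → load ν' v < load ν v → T v ≤ load ν' v ∧ LeadsDown E ν P T d v
  up : ∀ v, P v → load ν v < load ν' v → load ν' v ≤ T v ∧ d v ≠ 0
  blocked : ∃ Dead : V → Prop, (∀ v, P v → d v = 1 → T v < load ν' v → Dead v) ∧
    (∀ u v, (u, v) ∈ E → P (ν u) → P v → Dead (ν u) → ν' u = ν u → d v = d (ν u) + 1 → Dead v) ∧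
    ∀ v, P v → Dead v → T v ≤ load ν' v

theorem LayerFlow.load_eq (hf : LayerFlow E ν ν' P T d) {v : V} (hv : ¬ P v) :
    load ν' v = load ν v := by
  refine load_congr fun u hu => ?_
  rcases hf.job u with h | h
  · exact absurd h.symm hu
  · exact ⟨by rintro rfl; exact hv h.1, by rintro rfl; exact hv h.2.1⟩

/-- The residual arcs that are reversed when the flow of `ν` is replaced by the flow of `ν'`. -/
noncomputable def changedArcs (E : Finset (U × V)) (w : V → ℕ → ℝ) (ν ν' : U → V) :
    Finset (NetArc U V × Bool) :=
  (innerArcs E w ×ˢ Finset.univ).filter fun r =>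
    (semiMatchingNetwork E w).IsResidual (assignFlow w ν) r ∧
      ¬ (semiMatchingNetwork E w).IsResidual (assignFlow w ν') r

theorem mem_changedArcs {r : NetArc U V × Bool} (hr : r.1.IsInner) :
    r ∈ changedArcs E w ν ν' ↔ (semiMatchingNetwork E w).IsResidual (assignFlow w ν) r ∧
      ¬ (semiMatchingNetwork E w).IsResidual (assignFlow w ν') r := by
  simp only [changedArcs, Finset.mem_filter, Finset.mem_product, Finset.mem_univ, and_true,
    mem_innerArcs, and_iff_right_iff_imp]
  exact fun h => ⟨h.1.1, hr⟩

theorem changedArcs_val (hν : ∀ u, (u, ν u) ∈ E) (hν' : ∀ u, (u, ν' u) ∈ E) (a : NetArc U V)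
    (ha : ∀ x, a ≠ .drain x) :
    (assignFlow w ν' a : ℤ) = assignFlow w ν a +
      (if (a, true) ∈ changedArcs E w ν ν' then 1 else 0) -
      (if (a, false) ∈ changedArcs E w ν ν' then 1 else 0) := by
  have hf := (graphOf_isSemiMatching hν).isFull (w := w)
  have hf' := (graphOf_isSemiMatching hν').isFull (w := w)
  have key : ∀ a : NetArc U V, a.IsInner → (assignFlow w ν' a : ℤ) = assignFlow w ν a +
      (if (a, true) ∈ changedArcs E w ν ν' then 1 else 0) -
      (if (a, false) ∈ changedArcs E w ν ν' then 1 else 0) := by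
    intro a hi
    have h1 : assignFlow w ν a ≤ 1 := hf.le_one hi
    have h2 : assignFlow w ν' a ≤ 1 := hf'.le_one hi
    simp only [mem_changedArcs (r := (a, true)) hi, mem_changedArcs (r := (a, false)) hi,
      isResidual_inner (r := (a, true)) h1 hi, isResidual_inner (r := (a, true)) h2 hi,
      isResidual_inner (r := (a, false)) h1 hi, isResidual_inner (r := (a, false)) h2 hi]
    by_cases haN : a ∈ (semiMatchingNetwork E w).arcs
    · simp only [haN, true_and, if_true, Bool.false_eq_true, if_false]
      split_ifs <;> omega
    · simp [hf.zero a haN, hf'.zero a haN, haN]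
  rcases a with u | ⟨u, v⟩ | ⟨v, i⟩ | x
  · have : ∀ b, (NetArc.supply u, b) ∉ changedArcs E w ν ν' := by
      intro b h
      simp only [changedArcs, Finset.mem_filter, Finset.mem_product, mem_innerArcs] at h
      exact h.1.1.2
    rw [if_neg (this _), if_neg (this _)]; simp [flowOf]
  · exact key _ trivial
  · exact key _ trivial
  · exact absurd rfl (ha x)

/-- The difference of two full flows is conserved at jobs and machines. -/
theorem changedArcs_balance (hν : ∀ u, (u, ν u) ∈ E) (hν' : ∀ u, (u, ν' u) ∈ E)
    (x : NetVertex U V) (hx : ∀ c, x ≠ .center c) :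
    ((changedArcs E w ν ν').filter fun r => (semiMatchingNetwork E w).resHead r = x).card =
      ((changedArcs E w ν ν').filter fun r => (semiMatchingNetwork E w).resTail r = x).card := by
  have hf := (graphOf_isSemiMatching hν).isFull (w := w)
  have hf' := (graphOf_isSemiMatching hν').isFull (w := w)
  have hin : ∀ r ∈ changedArcs E w ν ν', r.1 ∈ innerArcs E w := by
    intro r hr
    simp only [changedArcs, Finset.mem_filter, Finset.mem_product] at hr
    exact hr.1.1
  rw [card_filter_eq_sum _ hin, card_filter_eq_sum _ hin]
  have hbal : ∑ a ∈ innerArcs E w, (if (semiMatchingNetwork E w).head a = x then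
        (assignFlow w ν' a : ℤ) - assignFlow w ν a else 0) =
      ∑ a ∈ innerArcs E w, (if (semiMatchingNetwork E w).tail a = x then
        (assignFlow w ν' a : ℤ) - assignFlow w ν a else 0) := by
    rw [sum_innerArcs, sum_innerArcs]
    rcases x with _ | _ | u | v | c
    · simp [semiMatchingNetwork]
    · simp [semiMatchingNetwork]
    · have h1 := hf.job u
      have h2 := hf'.job u
      simp only [semiMatchingNetwork, reduceCtorEq, if_false, Finset.sum_const_zero, add_zero,
        NetVertex.job.injEq]
      rw [← Finset.sum_filter, Finset.sum_sub_distrib]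
      zify at h1 h2
      rw [h1, h2]; simp
    · have h1 := hf.machine v
      have h2 := hf'.machine v
      simp only [semiMatchingNetwork, reduceCtorEq, if_false, Finset.sum_const_zero, add_zero,
        NetVertex.machine.injEq, ← Finset.ite_sum_zero, zero_add, Finset.sum_ite_eq',
        Finset.mem_univ, if_true]
      rw [← Finset.sum_filter, Finset.sum_sub_distrib, Finset.sum_sub_distrib]
      zify at h1 h2
      rw [h1, h2]
    · exact absurd rfl (hx c)
  zify
  rw [← sub_eq_zero, ← Finset.sum_sub_distrib] at hbal ⊢
  refine (Finset.sum_congr rfl fun a ha => ?_).trans hbal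
  have h1 := changedArcs_val (w := w) hν hν' a (by rintro x rfl; exact (mem_innerArcs.1 ha).2)
  rw [h1]
  simp only [FlowNetwork.resHead, FlowNetwork.resTail, if_true, Bool.false_eq_true, if_false]
  clear h1 hbal
  by_cases h2 : (a, true) ∈ changedArcs E w ν ν' <;>
    by_cases h3 : (a, false) ∈ changedArcs E w ν ν' <;>
    by_cases h4 : (semiMatchingNetwork E w).head a = x <;>
    by_cases h5 : (semiMatchingNetwork E w).tail a = x <;> simp [h2, h3, h4, h5]

/-- A change of the assignment along the layers is a round of Cancel: the arcs that it reverses form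
a blocking flow. All paths from `C₂` to `C₁` have length at least `2 * D` by the label potential,
and the changed arcs lie on paths of this length. -/
theorem PartState.augmentRound (h : PartState E w ν P C₁ C₂ T) (hl : Layers E ν P d D T)
    (hD : D ≠ 0) (hfound : ∃ v, P v ∧ d v = D ∧ load ν v < T v)
    (hf : LayerFlow E ν ν' P T d) :
    AugmentRound E w (partSet P ν (C₁ ∪ C₂)) C₂ C₁ (assignFlow w ν) (assignFlow w ν') ∧
      ∃ p, (semiMatchingNetwork E w).IsWalkBetween (partSet P ν (C₁ ∪ C₂)) (assignFlow w ν)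
        (centerSet C₂) (centerSet C₁) p := by
  set N := semiMatchingNetwork E w with hN
  set S := partSet P ν (C₁ ∪ C₂) with hS
  set φ := assignFlow w ν with hφ
  set π := labelPotential ν C₂ d D with hπ
  have hd := h.isDivision
  have hπ₁ : ∀ z ∈ centerSet C₁, π z = 2 * D := by
    rintro _ ⟨c, hc, rfl⟩
    exact if_neg fun h' => hd.notMem hc h'
  have hπ₂ : ∀ y ∈ centerSet C₂, π y = 0 := by
    rintro _ ⟨c, hc, rfl⟩
    exact if_pos hc
  have hstep : ∀ {x y p}, N.IsWalk S φ x p y → ∀ r ∈ p, π (N.resHead r) ≤ π (N.resTail r) + 1 :=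
    fun hp r hr => h.labelPotential_le hl (hp.residual r hr).1 (hp.residual r hr).2.1
      (hp.residual r hr).2.2
  have hlen : ∀ p, N.IsWalkBetween S φ (centerSet C₂) (centerSet C₁) p → 2 * D ≤ p.length := by
    rintro p ⟨y, hy, z, hz, hp⟩
    have := hp.potential_le (hstep hp)
    rw [hπ₁ z hz, hπ₂ y hy] at this
    omega
  have hshort : ∀ p, N.IsWalkBetween S φ (centerSet C₂) (centerSet C₁) p → p.length = 2 * D →
      N.IsShortest S φ (centerSet C₂) (centerSet C₁) p :=
    fun p hp hl => ⟨hp, fun q hq => hl ▸ hlen q hq⟩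
  obtain ⟨v₀, hv₀P, hv₀d, hv₀⟩ := hfound
  obtain ⟨p₀, hp₀, hp₀l⟩ : ∃ p, N.IsWalkBetween S φ (centerSet C₂) (centerSet C₁) p ∧
      p.length = 2 * D := by
    obtain ⟨y, hy, p, hp, h1⟩ := h.exists_walk_to hl.toLabels hv₀P (by omega)
    obtain ⟨z, hz, q, hq, h2⟩ := (LeadsDown.base (E := E) v₀ hv₀P (by omega) hv₀).exists_walk h
      hl.deficit
    exact ⟨p ++ q, ⟨y, hy, z, hz, hp.append hq⟩, by rw [List.length_append]; omega⟩
  refine ⟨⟨changedArcs E w ν ν', ⟨?_, ?_, ?_⟩, ?_, changedArcs_val h.edge hf.edge'⟩, p₀, hp₀⟩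
  · -- Every changed arc lies on a shortest path.
    have hjob : ∀ u, ν' u ≠ ν u → ∃ p, N.IsShortest S φ (centerSet C₂) (centerSet C₁) p ∧
        (NetArc.assign u (ν u), false) ∈ p ∧ (NetArc.assign u (ν' u), true) ∈ p := by
      intro u hu
      obtain ⟨h1, h2, h3, h4, h5⟩ := (hf.job u).resolve_left hu
      obtain ⟨y, hy, p, hp, h6⟩ := h.exists_walk_to hl.toLabels h1 h3
      obtain ⟨z, hz, q, hq, h7⟩ := h5.exists_walk h hl.deficit
      refine ⟨p ++ ((.assign u (ν u), false) :: (.assign u (ν' u), true) :: q),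
        hshort _ ⟨y, hy, z, hz, hp.append ?_⟩ ?_, by simp, by simp⟩
      · exact ⟨h1, residual_assign_false.2 ⟨h.edge u, rfl⟩, rfl, h1,
          residual_assign_true.2 ⟨hf.edge' u, hu.symm⟩, rfl, hq⟩
      · simp only [List.length_append, List.length_cons]; omega
    intro r hr
    have hi : r.1.IsInner := by
      simp only [changedArcs, Finset.mem_filter, Finset.mem_product, mem_innerArcs] at hr
      exact hr.1.1.2
    rw [mem_changedArcs hi] at hr
    obtain ⟨u | ⟨u, v⟩ | ⟨v, i⟩ | x, b⟩ := r
    · exact hi.elim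
    · cases b
      · rw [residual_assign_false, residual_assign_false] at hr
        obtain ⟨⟨h1, rfl⟩, h2⟩ := hr
        obtain ⟨p, h3, h4, h5⟩ := hjob u fun h' => h2 ⟨h1, h'⟩
        exact ⟨p, h3, h4⟩
      · rw [residual_assign_true, residual_assign_true] at hr
        obtain ⟨⟨h1, h2⟩, h3⟩ := hr
        have h4 : ν' u = v := by by_contra h'; exact h3 ⟨h1, h'⟩
        subst h4
        obtain ⟨p, h3, h4, h5⟩ := hjob u (Ne.symm h2)
        exact ⟨p, h3, h5⟩
    · cases b
      · rw [residual_slot_false, residual_slot_false] at hr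
        obtain ⟨⟨h1, h2⟩, h3⟩ := hr
        have h4 : load ν' v ≤ i := by by_contra h'; exact h3 ⟨h1, by omega⟩
        have hP : P v := by
          by_contra hP; have := hf.load_eq hP; omega
        obtain ⟨h5, h6⟩ := hf.down v hP (by omega)
        obtain ⟨z, hz, q, hq, h7⟩ := h6.exists_walk h hl.deficit
        have h8 := h.mem_high v hP i (by omega) h2
        have h9 := (hl.one_iff v hP).2 (by omega)
        refine ⟨(.slot v i, false) :: q, hshort _ ⟨.center (w v i), by simpa using h8, z, hz, ?_⟩
          ?_, by simp⟩
        · exact ⟨Finset.mem_union_right _ h8, residual_slot_false.2 ⟨h1, h2⟩, rfl, hq⟩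
        · simp only [List.length_cons]; omega
      · rw [residual_slot_true, residual_slot_true] at hr
        obtain ⟨⟨h1, h2⟩, h3⟩ := hr
        have h4 : i < load ν' v := by by_contra h'; exact h3 ⟨h1, by omega⟩
        have hP : P v := by
          by_contra hP; have := hf.load_eq hP; omega
        obtain ⟨h5, h6⟩ := hf.up v hP (by omega)
        obtain ⟨y, hy, p, hp, h7⟩ := h.exists_walk_to hl.toLabels hP h6
        have h8 := h.mem_low v hP i h2 (by omega)
        have h9 := hl.deficit v hP h6 (by omega)
        refine ⟨p ++ [(.slot v i, true)], hshort _ ⟨y, hy, .center (w v i), by simpa using h8,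
          hp.snoc (r := (NetArc.slot v i, true)) (residual_slot_true.2 ⟨h1, h2⟩)
            (Finset.mem_union_left _ h8)⟩ ?_, by simp⟩
        simp only [List.length_append, List.length_singleton]; omega
    · exact hi.elim
  · -- Conservation at each vertex.
    intro x hx₂ hx₁
    by_cases hx : ∀ c, x ≠ .center c
    · exact changedArcs_balance h.edge hf.edge' x hx
    · push Not at hx
      obtain ⟨c, rfl⟩ := hx
      -- The slots that lead to other cost centers are not changed.
      rw [Finset.filter_false_of_mem, Finset.filter_false_of_mem]
      · rintro ⟨u | ⟨u, v⟩ | ⟨v, i⟩ | x, b⟩ hr h'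
        · cases b <;> cases h'
        · cases b <;> cases h'
        · cases b
          · cases h'
            rw [mem_changedArcs (r := (NetArc.slot v i, false)) trivial, residual_slot_false,
              residual_slot_false] at hr
            have h4 : load ν' v ≤ i := by by_contra h'; exact hr.2 ⟨hr.1.1, by omega⟩
            have hP : P v := by
              by_contra hP; have := hf.load_eq hP; omega
            have := (hf.down v hP (by omega)).1
            exact hx₂ (by simpa using h.mem_high v hP i (by omega) hr.1.2)
          · cases h'
        · simp only [changedArcs, Finset.mem_filter, Finset.mem_product, mem_innerArcs] at hr
          exact hr.1.1.2
      · rintro ⟨u | ⟨u, v⟩ | ⟨v, i⟩ | x, b⟩ hr h'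
        · cases b <;> cases h'
        · cases b <;> cases h'
        · cases b
          · cases h'
          · cases h'
            rw [mem_changedArcs (r := (NetArc.slot v i, true)) trivial, residual_slot_true,
              residual_slot_true] at hr
            have h4 : i < load ν' v := by by_contra h'; exact hr.2 ⟨hr.1.1, by omega⟩
            have hP : P v := by
              by_contra hP; have := hf.load_eq hP; omega
            have := (hf.up v hP (by omega)).1
            exact hx₁ (by simpa using h.mem_low v hP i hr.1.2 (by omega))
        · simp only [changedArcs, Finset.mem_filter, Finset.mem_product, mem_innerArcs] at hr
          exact hr.1.1.2
  · -- A shortest path without changed arcs would only visit dead machines.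
    intro p hp
    by_contra hcon
    push Not at hcon
    obtain ⟨Dead, hb₁, hb₂, hb₃⟩ := hf.blocked
    have hpl : p.length = 2 * D := le_antisymm (hp₀l ▸ hp.2 _ hp₀) (hlen _ hp.1)
    obtain ⟨⟨y, hy, z, hz, hw⟩, -⟩ := hp
    have htight := hw.potential_tight (hstep hw) (by rw [hπ₁ z hz, hπ₂ y hy, hpl]; omega)
    have hres := hw.residual
    -- The property `Q` holds at the start of the path, is kept along its arcs, and fails in `C₁`.
    let Q : NetVertex U V → Prop := fun x => match x with
      | .source => True
      | .sink => True
      | .job u => P (ν u) → d (ν u) ≠ 0 ∧ Dead (ν u) ∧ ν' u = ν u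
      | .machine v => P v → d v ≠ 0 ∧ Dead v
      | .center c => c ∈ C₂
    have key : ∀ (q : List (NetArc U V × Bool)) (x : NetVertex U V), Q x → N.IsWalk S φ x q z →
        (∀ r ∈ q, r ∈ p) → Q z := by
      intro q
      induction q with
      | nil => intro x hx hq _; exact hq.2 ▸ hx
      | cons r q ih =>
        intro x hx hq hsub
        have hrp := hsub r (by simp)
        refine ih (N.resHead r) ?_ hq.2.2.2 fun r' h' => hsub r' (by simp [h'])
        have ht := htight r hrp
        obtain ⟨h1, h2, h3⟩ := hres r hrp
        have hnc := hcon r hrp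
        have hrest := hq.2.2.2.potential_le
          (fun r' h' => hstep hw r' (hsub r' (by simp [h'])))
        rw [hπ₁ z hz] at hrest
        have hend : π (N.resHead r) ≤ 2 * D := by
          have := FlowNetwork.IsWalk.potential_eq_of_tight hq.2.2.2
            (fun r' h' => htight r' (hsub r' (by simp [h'])))
          rw [hπ₁ z hz] at this; omega
        rw [← hq.2.2.1] at hx
        have hi := isInner_of_mem hd.sub h2 h3
        rw [mem_changedArcs hi, not_and, not_not] at hnc
        have hnc := hnc h1
        clear hrest ih hq hsub
        obtain ⟨u | ⟨u, v⟩ | ⟨v, i⟩ | x, b⟩ := r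
        · exact hi.elim
        · cases b
          · rw [residual_assign_false] at h1 hnc
            obtain ⟨h1, rfl⟩ := h1
            intro hP
            have := hx hP
            exact ⟨this.1, this.2, hnc.2⟩
          · rw [residual_assign_true] at h1
            intro hP
            change P (ν u) at h2
            change P v at h3
            obtain ⟨h4, h5, h6⟩ := hx h2
            change 2 * (if d v = 0 then D + 1 else d v) - 1 =
              2 * (if d (ν u) = 0 then D + 1 else d (ν u)) + 1 at ht
            change 2 * (if d v = 0 then D + 1 else d v) - 1 ≤ 2 * D at hend
            rw [if_neg h4] at ht
            have h7 : d v ≠ 0 := by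
              intro h7; rw [if_pos h7] at hend; omega
            rw [if_neg h7] at ht
            exact ⟨h7, hb₂ u v h1.1 h2 h3 h5 h6 (by omega)⟩
        · cases b
          · rw [residual_slot_false] at h1 hnc
            intro hP
            have h4 := h.high v hP i h1.1 hx
            have h5 := (hl.one_iff v hP).2 (by omega)
            exact ⟨by omega, hb₁ v hP h5 (by omega)⟩
          · rw [residual_slot_true] at h1 hnc
            change P v at h2
            obtain ⟨h4, h5⟩ := hx h2
            by_contra hc
            have hc₁ := (Finset.mem_union.1 h3).resolve_right hc
            have h6 := h.low v h2 i h1.1 hc₁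
            have h7 := hb₃ v h2 h5
            omega
        · exact hi.elim
    have hQy : Q y := by
      obtain ⟨c, hc, rfl⟩ := hy; exact hc
    have hQz := key p y hQy hw fun _ => id
    obtain ⟨c, hc, rfl⟩ := hz
    exact hd.notMem hc hQz
  · exact (isFull_iff.1 ((graphOf_isSemiMatching hf.edge').isFull (w := w))).1

/-- When the search labels no underloaded machine, the labelled machines are the reachable ones. -/
theorem PartState.reachable_eq (h : PartState E w ν P C₁ C₂ T) (hl : Labels E ν P d T)
    (hclosed : ∀ u v, P (ν u) → (u, v) ∈ E → P v → d (ν u) ≠ 0 → d v ≠ 0)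
    (hdef : ∀ v, P v → d v ≠ 0 → T v ≤ load ν v) :
    (semiMatchingNetwork E w).reachable (partSet P ν (C₁ ∪ C₂)) (assignFlow w ν) (centerSet C₂) =
      partSet (fun v => P v ∧ d v ≠ 0) ν C₂ := by
  have hd := h.isDivision
  apply Set.Subset.antisymm
  · rintro x ⟨y, hy, p, hp⟩
    have key : ∀ (p : List (NetArc U V × Bool)) (y : NetVertex U V),
        y ∈ partSet (fun v => P v ∧ d v ≠ 0) ν C₂ →
        (semiMatchingNetwork E w).IsWalk (partSet P ν (C₁ ∪ C₂)) (assignFlow w ν) y p x →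
        x ∈ partSet (fun v => P v ∧ d v ≠ 0) ν C₂ := by
      intro p
      induction p with
      | nil => intro y hy hp; exact hp.2 ▸ hy
      | cons r p ih =>
        intro y hy hp
        obtain ⟨h1, h2, rfl, h4⟩ := hp
        refine ih _ ?_ h4
        have h3 := h4.start_mem
        clear h4 ih
        obtain ⟨u | ⟨u, v⟩ | ⟨v, i⟩ | x, b⟩ := r
        · cases b
          · exact h3.elim
          · exact h1.elim
        · cases b
          · obtain ⟨h5, rfl⟩ := residual_assign_false.1 h2
            exact hy
          · obtain ⟨h5, h6⟩ := residual_assign_true.1 h2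
            exact ⟨h3, hclosed u v h1 h5 h3 hy.2⟩
        · cases b
          · obtain ⟨h5, h6⟩ := residual_slot_false.1 h2
            have h7 := (hl.one_iff v h3).2 (lt_of_le_of_lt (h.high v h3 i h5 hy) h6)
            exact ⟨h3, by omega⟩
          · obtain ⟨h5, h6⟩ := residual_slot_true.1 h2
            change w v i ∈ C₂
            by_contra hc
            have := h.low v h1 i h5 ((Finset.mem_union.1 h3).resolve_right hc)
            have := hdef v h1 hy.2
            omega
        · cases b
          · exact h1.elim
          · exact h3.elim
    refine key p y ?_ hp
    obtain ⟨c, hc, rfl⟩ := hy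
    exact hc
  · have hmach : ∀ v, P v → d v ≠ 0 → NetVertex.machine v ∈ (semiMatchingNetwork E w).reachable
        (partSet P ν (C₁ ∪ C₂)) (assignFlow w ν) (centerSet C₂) := by
      intro v hv hdv
      obtain ⟨y, hy, p, hp, -⟩ := h.exists_walk_to hl hv hdv
      exact ⟨y, hy, p, hp⟩
    rintro (_ | _ | u | v | c) hx
    · exact hx.elim
    · exact hx.elim
    · exact FlowNetwork.mem_reachable_of_residual (r := (NetArc.assign u (ν u), false))
        (hmach _ hx.1 hx.2) (residual_assign_false.2 ⟨h.edge u, rfl⟩) hx.1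
    · exact hmach v hx.1 hx.2
    · exact ⟨_, center_mem_centerSet.2 hx, [], Finset.mem_union_right _ hx, rfl⟩

end Assignment

/-! ### Processing all subnetworks of one level of the recursion at the same time -/

section Levels

variable {U V : Type} [Fintype U] [Fintype V] {E : Finset (U × V)} {w : V → ℕ → ℝ}

variable (E w) in
/-- The number of cost centers below `x`. -/
noncomputable def centerRank (x : ℝ) : ℕ := ((centers E w).filter fun c => c < x).card

variable (E w) in
/-- The cost centers whose ranks lie in the interval `[a, b)`. -/
noncomputable def centersBetween (a b : ℕ) : Finset ℝ :=
  (centers E w).filter fun c => a ≤ centerRank E w c ∧ centerRank E w c < b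

variable (E w) in
/-- The number of slots of the machine `v` whose cost centers have ranks below `x`. -/
noncomputable def slotCut (v : V) (x : ℕ) : ℕ :=
  ((Finset.range (machineDegree E v)).filter fun i => centerRank E w (w v i) < x).card

theorem centerRank_mono : Monotone (centerRank E w) := fun x y h =>
  Finset.card_le_card fun c hc => by
    simp only [Finset.mem_filter] at hc ⊢; exact ⟨hc.1, hc.2.trans_le h⟩

theorem centerRank_lt {x y : ℝ} (hx : x ∈ centers E w) (h : x < y) :
    centerRank E w x < centerRank E w y := by
  refine Finset.card_lt_card ⟨fun c hc => ?_, fun hsub => ?_⟩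
  · simp only [Finset.mem_filter] at hc ⊢; exact ⟨hc.1, hc.2.trans h⟩
  · have := hsub (Finset.mem_filter.2 ⟨hx, h⟩)
    simp at this

theorem centerRank_lt_iff {x y : ℝ} (hx : x ∈ centers E w) :
    centerRank E w x < centerRank E w y ↔ x < y :=
  ⟨fun h => lt_of_not_ge fun h' => absurd (centerRank_mono (E := E) (w := w) h') (by omega),
    centerRank_lt hx⟩

theorem centerRank_lt_card {x : ℝ} (hx : x ∈ centers E w) :
    centerRank E w x < (centers E w).card :=
  Finset.card_lt_card ⟨Finset.filter_subset _ _, fun hsub => by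
    have := hsub hx; simp at this⟩

theorem card_centersBetween {a b : ℕ} (hb : b ≤ (centers E w).card) :
    (centersBetween E w a b).card = b - a := by
  have hinj : Set.InjOn (centerRank E w) (centers E w : Set ℝ) := by
    intro x hx y hy h
    rcases lt_trichotomy x y with h' | h' | h'
    · have := centerRank_lt hx h'; omega
    · exact h'
    · have := centerRank_lt hy h'; omega
  have himg : (centers E w).image (centerRank E w) = Finset.range (centers E w).card := by
    refine Finset.eq_of_subset_of_card_le ?_ ?_
    · intro n hn
      obtain ⟨x, hx, rfl⟩ := Finset.mem_image.1 hn
      simpa using centerRank_lt_card hx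
    · rw [Finset.card_image_of_injOn hinj]; simp
  have h1 : (centersBetween E w a b).image (centerRank E w) = Finset.Ico a b := by
    ext n
    simp only [Finset.mem_image, centersBetween, Finset.mem_filter, Finset.mem_Ico]
    constructor
    · rintro ⟨x, ⟨_, h⟩, rfl⟩; exact h
    · intro h
      have : n ∈ (centers E w).image (centerRank E w) := by rw [himg]; simp; omega
      obtain ⟨x, hx, rfl⟩ := Finset.mem_image.1 this
      exact ⟨x, ⟨hx, h⟩, rfl⟩
  rw [← Nat.card_Ico, ← h1, Finset.card_image_of_injOn]
  exact hinj.mono fun x hx => (Finset.mem_filter.1 hx).1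

theorem slotCut_le (v : V) (x : ℕ) : slotCut E w v x ≤ machineDegree E v :=
  (Finset.card_filter_le _ _).trans (by simp)

theorem slotCut_mono (v : V) : Monotone (slotCut E w v) := fun x y h =>
  Finset.card_le_card fun i hi => by
    simp only [Finset.mem_filter] at hi ⊢; exact ⟨hi.1, hi.2.trans_le h⟩

theorem lt_slotCut_iff (hw : ∀ v, Monotone (w v)) {v : V} {i x : ℕ} (hi : i < machineDegree E v) :
    i < slotCut E w v x ↔ centerRank E w (w v i) < x := by
  set I := (Finset.range (machineDegree E v)).filter fun i => centerRank E w (w v i) < x with hI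
  have hdown : ∀ j ∈ I, ∀ k ≤ j, k ∈ I := by
    intro j hj k hk
    simp only [hI, Finset.mem_filter, Finset.mem_range] at hj ⊢
    exact ⟨by omega, (centerRank_mono (hw v hk)).trans_lt hj.2⟩
  have hmem : i ∈ I ↔ centerRank E w (w v i) < x := by simp [hI, hi]
  rw [← hmem, slotCut, ← hI]
  constructor
  · intro h
    by_contra hn
    have : I ⊆ Finset.range i := fun j hj => by
      simp only [Finset.mem_range]; by_contra h'; exact hn (hdown j hj i (by omega))
    have := Finset.card_le_card this
    simp at this; omega
  · intro h
    have : Finset.range (i + 1) ⊆ I := fun j hj => hdown i h j (by simp at hj; omega)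
    have := Finset.card_le_card this
    simp at this; omega

/-- The first center rank of the upper half of the interval `[a, b)`; the lower half is not smaller
than the upper one, so that an interval of length one is not divided. -/
def midRank (a b : ℕ) : ℕ := (a + b + 1) / 2

variable (E w) in
/-- The state of all subnetworks of one level. The machine `v` belongs to the subnetwork of the
centers with ranks in `[lo v, hi v)`, and machines without edges belong to the lowest one. A job
belongs to the subnetwork of its machine. -/
structure LevelState (μ : U → V) (lo hi : V → ℕ) : Prop where
  edge : ∀ u, (u, μ u) ∈ E
  isolated : ∀ v, machineDegree E v = 0 → lo v = 0
  lt : ∀ v, machineDegree E v ≠ 0 → lo v < hi v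
  le : ∀ v, machineDegree E v ≠ 0 → hi v ≤ (centers E w).card
  disj : ∀ v v', machineDegree E v ≠ 0 → machineDegree E v' ≠ 0 →
    (lo v = lo v' ∧ hi v = hi v') ∨ hi v ≤ lo v' ∨ hi v' ≤ lo v
  low : ∀ v, slotCut E w v (lo v) ≤ load μ v
  high : ∀ v, load μ v ≤ slotCut E w v (hi v)

variable (E w) in
/-- `[a, b)` is the interval of one of the subnetworks, which may contain no machines. -/
structure IsNode (lo hi : V → ℕ) (a b : ℕ) : Prop where
  lt : a < b
  le : b ≤ (centers E w).card
  disj : ∀ v, machineDegree E v ≠ 0 → (lo v = a ∧ hi v = b) ∨ hi v ≤ a ∨ b ≤ lo v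

variable (E) in
/-- The assignment `ν` agrees with `μ` in the subnetwork of the machines with `lo v = a`. A run of
CancelAll treats the subnetworks one after the other, while the machine treats all subnetworks of a
level at the same time; `ν` is the assignment of the run, `μ` the one in the memory. -/
structure Agrees (lo : V → ℕ) (a : ℕ) (μ ν : U → V) : Prop where
  edge : ∀ u, (u, ν u) ∈ E
  iff : ∀ u, lo (ν u) = a ↔ lo (μ u) = a
  eq : ∀ u, lo (μ u) = a → ν u = μ u

/-- The assignment `ν`, replaced by `μ'` on the subnetwork `a` of the assignment `μ`. -/
noncomputable def patch (lo : V → ℕ) (a : ℕ) (μ μ' ν : U → V) : U → V := fun u =>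
  if lo (μ u) = a then μ' u else ν u

variable (E w) in
/-- The vertices of the subnetwork of the interval `[a, b)`. -/
noncomputable def nodeSet (lo : V → ℕ) (ν : U → V) (a b : ℕ) : Set (NetVertex U V) :=
  partSet (fun v => lo v = a) ν (centersBetween E w a b)

variable {μ μ' ν : U → V} {lo hi T d : V → ℕ} {D : ℕ → ℕ} {a b : ℕ}

theorem machineDegree_ne_zero {u : U} {v : V} (h : (u, v) ∈ E) : machineDegree E v ≠ 0 :=
  (Finset.card_pos.2 ⟨(u, v), by simp [h]⟩).ne'

theorem Agrees.load_eq (h : Agrees E lo a μ ν) {v : V} (hv : lo v = a) : load ν v = load μ v := by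
  rw [_root_.load_eq, _root_.load_eq]
  congr 1; ext u
  simp only [Finset.mem_filter, Finset.mem_univ, true_and]
  constructor
  · rintro rfl; exact (h.eq u ((h.iff u).1 hv)).symm
  · rintro rfl; exact h.eq u hv

theorem IsNode.hi_eq (hn : IsNode E w lo hi a b) (hs : LevelState E w μ lo hi) {v : V}
    (hv : machineDegree E v ≠ 0) (ha : lo v = a) : hi v = b := by
  have := hn.disj v hv; have := hs.lt v hv; have := hn.lt; omega

theorem midRank_bounds (h : a < b) : a < midRank a b ∧ midRank a b ≤ b := by
  simp only [midRank]; omega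

theorem centersBetween_union (h : a < b) :
    centersBetween E w a (midRank a b) ∪ centersBetween E w (midRank a b) b =
      centersBetween E w a b := by
  have := midRank_bounds h
  ext x
  simp only [centersBetween, Finset.mem_union, Finset.mem_filter]
  constructor
  · rintro (⟨h1, h2⟩ | ⟨h1, h2⟩) <;> exact ⟨h1, by omega, by omega⟩
  · rintro ⟨h1, h2⟩
    by_cases h' : centerRank E w x < midRank a b
    · exact Or.inl ⟨h1, by omega, by omega⟩
    · exact Or.inr ⟨h1, by omega, by omega⟩

theorem LevelState.partState (hs : LevelState E w μ lo hi) (hw : ∀ v, Monotone (w v))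
    (hT : ∀ v, T v = slotCut E w v (midRank (lo v) (hi v))) (hn : IsNode E w lo hi a b)
    (hν : Agrees E lo a μ ν) :
    PartState E w ν (fun v => lo v = a) (centersBetween E w a (midRank a b))
      (centersBetween E w (midRank a b) b) T := by
  have hmid : ∀ v, lo v = a → machineDegree E v ≠ 0 → midRank (lo v) (hi v) = midRank a b :=
    fun v hv h => by rw [hv, hn.hi_eq hs h hv]
  refine ⟨hν.edge, ?_, ?_, ?_, ?_, ?_, ?_, ?_⟩
  · rw [centersBetween_union hn.lt]; exact Finset.filter_subset _ _
  · intro x hx y hy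
    simp only [centersBetween, Finset.mem_filter] at hx hy
    exact (centerRank_lt_iff hx.1).1 (by omega)
  · intro v hv i hi' hc
    simp only [centersBetween, Finset.mem_filter] at hc
    rw [hT, lt_slotCut_iff hw hi', hmid v hv (by omega)]
    exact hc.2.2
  · intro v hv i hi' hc
    simp only [centersBetween, Finset.mem_filter] at hc
    rw [hT, ← not_lt, lt_slotCut_iff hw hi', hmid v hv (by omega)]
    omega
  · intro v _; rw [hT]; exact slotCut_le _ _
  · intro v hv i h1 h2
    rw [hν.load_eq hv] at h2
    have hi' : i < machineDegree E v := h2.trans_le (load_le hs.edge v)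
    have h3 := h2.trans_le (hs.high v)
    rw [hT, ← not_lt, lt_slotCut_iff hw hi', hmid v hv (by omega)] at h1
    rw [lt_slotCut_iff hw hi', hn.hi_eq hs (by omega) hv] at h3
    exact Finset.mem_filter.2 ⟨mem_centers.2 ⟨v, i, hi', rfl⟩, by omega, h3⟩
  · intro v hv i h1 h2
    rw [hν.load_eq hv] at h1
    have hi' : i < machineDegree E v := h2.trans_le (hT v ▸ slotCut_le _ _)
    have h3 := (hs.low v).trans h1
    rw [hT, lt_slotCut_iff hw hi', hmid v hv (by omega)] at h2
    rw [← not_lt, lt_slotCut_iff hw hi', hv, not_lt] at h3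
    exact Finset.mem_filter.2 ⟨mem_centers.2 ⟨v, i, hi', rfl⟩, h3, h2⟩

variable (E μ lo T d D) in
/-- `d` is the labelling of a breadth-first search in all subnetworks, which stops in the
subnetwork `a` at the layer `D a` if an underloaded machine is found there (`D a = 0` if none is
found). -/
structure SearchResult : Prop where
  one_iff : ∀ v, d v = 1 ↔ T v < load μ v
  pred : ∀ v, 1 < d v → ∃ u, (u, v) ∈ E ∧ lo (μ u) = lo v ∧ d (μ u) ≠ 0 ∧ d (μ u) + 1 = d v
  closed : ∀ u v, (u, v) ∈ E → lo (μ u) = lo v → d (μ u) ≠ 0 →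
    (D (lo v) = 0 ∨ d (μ u) < D (lo v)) → d v ≠ 0 ∧ d v ≤ d (μ u) + 1
  deficit : ∀ v, d v ≠ 0 → load μ v < T v → D (lo v) = d v
  found : ∀ v, d v ≠ 0 → D (lo v) ≠ 0 → ∃ v', lo v' = lo v ∧ d v' = D (lo v) ∧ load μ v' < T v'
  le : ∀ v, d v ≠ 0 → D (lo v) ≠ 0 → d v ≤ D (lo v)

variable (E μ μ' lo T d) in
/-- The assignment `μ'` results from `μ` by blocking sets of augmenting paths along the layers of
all subnetworks. -/
structure BlockingChange : Prop where
  job : ∀ u, μ' u = μ u ∨ ((u, μ' u) ∈ E ∧ lo (μ' u) = lo (μ u) ∧ d (μ u) ≠ 0 ∧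
    d (μ' u) = d (μ u) + 1 ∧ LeadsDown E μ (fun v => lo v = lo (μ u)) T d (μ' u))
  down : ∀ v, load μ' v < load μ v →
    T v ≤ load μ' v ∧ LeadsDown E μ (fun x => lo x = lo v) T d v
  up : ∀ v, load μ v < load μ' v → load μ' v ≤ T v ∧ d v ≠ 0
  blocked : ∃ Dead : V → Prop, (∀ v, d v = 1 → T v < load μ' v → Dead v) ∧
    (∀ u v, (u, v) ∈ E → lo (μ u) = lo v → Dead (μ u) → μ' u = μ u → d v = d (μ u) + 1 → Dead v) ∧
    ∀ v, Dead v → T v ≤ load μ' v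

theorem LeadsDown.transfer (hν : Agrees E lo a μ ν) {v : V}
    (h : LeadsDown E μ (fun x => lo x = a) T d v) : LeadsDown E ν (fun x => lo x = a) T d v := by
  induction h with
  | base v hP hd hT => exact .base v hP hd (by rwa [hν.load_eq hP])
  | step u v hu hP hPv hne hd _ ih =>
    have := hν.eq u hP
    have h1 := LeadsDown.step (ν := ν) (P := fun x => lo x = a) (T := T) u v hu
      (by rw [this]; exact hP) hPv (by rwa [this]) (by rwa [this]) ih
    rwa [this] at h1

theorem LeadsDown.exists_deficit {P : V → Prop} {v : V} (h : LeadsDown E ν P T d v) :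
    ∃ x, P x ∧ d x ≠ 0 ∧ load ν x < T x := by
  induction h with
  | base v hP hd hT => exact ⟨v, hP, hd, hT⟩
  | step _ _ _ _ _ _ _ _ ih => exact ih

theorem BlockingChange.lo_eq (h : BlockingChange E μ μ' lo T d) (u : U) :
    lo (μ' u) = lo (μ u) := by
  rcases h.job u with h | h
  · rw [h]
  · exact h.2.1

/-- Jobs do not move between the subnetworks. -/
theorem Agrees.patch (hν : Agrees E lo a μ ν) (hlo : ∀ u, lo (μ' u) = lo (μ u))
    (hedge : ∀ u, (u, μ' u) ∈ E) : Agrees E lo a μ' (patch lo a μ μ' ν) := by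
  refine ⟨fun u => ?_, fun u => ?_, fun u hu => ?_⟩
  · simp only [_root_.patch]; split_ifs
    exacts [hedge u, hν.edge u]
  · simp only [_root_.patch]; split_ifs with h
    · rfl
    · rw [hν.iff, hlo]
  · rw [hlo] at hu; simp [_root_.patch, hu]

theorem SearchResult.labels (hr : SearchResult E μ lo T d D) (hν : Agrees E lo a μ ν) :
    Labels E ν (fun v => lo v = a) d T := by
  refine ⟨fun v hv => ?_, fun v hv h1 => ?_⟩
  · rw [hν.load_eq hv]; exact hr.one_iff v
  · obtain ⟨u, h2, h3, h4, h5⟩ := hr.pred v h1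
    have h6 := hν.eq u (h3.trans hv)
    exact ⟨u, h2, by rw [h6]; exact h3.trans hv, by rwa [h6], by rwa [h6]⟩

theorem nodeSet_congr {ν' : U → V} (h : ∀ u, lo (ν u) = a ↔ lo (ν' u) = a) :
    nodeSet E w lo ν a b = nodeSet E w lo ν' a b := by
  ext x
  rcases x with _ | _ | u | v | c
  · rfl
  · rfl
  · exact h u
  · rfl
  · rfl

theorem BlockingChange.layerFlow (hs : LevelState E w μ lo hi)
    (hc : BlockingChange E μ μ' lo T d) (hν : Agrees E lo a μ ν) :
    LayerFlow E ν (patch lo a μ μ' ν) (fun v => lo v = a) T d := by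
  have hedge' : ∀ u, (u, μ' u) ∈ E := fun u => by
    rcases hc.job u with h | h
    · rw [h]; exact hs.edge u
    · exact h.1
  have hag := hν.patch hc.lo_eq hedge'
  have hload : ∀ v, lo v = a → load (patch lo a μ μ' ν) v = load μ' v := fun v hv => hag.load_eq hv
  refine ⟨hag.edge, fun u => ?_, fun v hv => ?_, fun v hv => ?_, ?_⟩
  · by_cases hu : lo (μ u) = a
    · have h1 := hν.eq u hu
      have h2 : patch lo a μ μ' ν u = μ' u := by simp [patch, hu]
      rw [h1, h2]
      refine (hc.job u).imp_right fun ⟨h3, h4, h5, h6, h7⟩ => ⟨hu, h4.trans hu, h5, h6, ?_⟩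
      rw [hu] at h7
      exact h7.transfer hν
    · exact Or.inl (by simp [patch, hu])
  · rw [hload v hv, hν.load_eq hv]
    intro h
    obtain ⟨h1, h2⟩ := hc.down v h
    rw [hv] at h2
    exact ⟨h1, h2.transfer hν⟩
  · rw [hload v hv, hν.load_eq hv]
    exact hc.up v
  · obtain ⟨Dead, h1, h2, h3⟩ := hc.blocked
    refine ⟨Dead, fun v hv h4 h5 => h1 v h4 (by rwa [hload v hv] at h5),
      fun u v h4 h5 h6 h7 h8 h9 => ?_, fun v hv h4 => by rw [hload v hv]; exact h3 v h4⟩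
    have h10 := (hν.iff u).1 h5
    have h11 := hν.eq u h10
    rw [h11] at h7 h8 h9
    have h12 : patch lo a μ μ' ν u = μ' u := by simp [patch, h10]
    rw [h12] at h8
    exact h2 u v h4 (h10.trans h6.symm) h7 h8 h9

/-- The effect of one simultaneous round on a single subnetwork: it is a round of Cancel, or Cancel
has already stopped there and nothing changes. -/
theorem LevelState.round (hs : LevelState E w μ lo hi) (hw : ∀ v, Monotone (w v))
    (hT : ∀ v, T v = slotCut E w v (midRank (lo v) (hi v)))
    (hr : SearchResult E μ lo T d D) (hc : BlockingChange E μ μ' lo T d)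
    (hn : IsNode E w lo hi a b) (hν : Agrees E lo a μ ν) :
    (AugmentRound E w (nodeSet E w lo ν a b) (centersBetween E w (midRank a b) b)
        (centersBetween E w a (midRank a b)) (assignFlow w ν)
        (assignFlow w (patch lo a μ μ' ν)) ∧
      (∃ v, lo v = a ∧ d v ≠ 0 ∧ load μ v < T v) ∧
      ∃ p, (semiMatchingNetwork E w).IsWalkBetween (nodeSet E w lo ν a b) (assignFlow w ν)
        (centerSet (centersBetween E w (midRank a b) b))
        (centerSet (centersBetween E w a (midRank a b))) p) ∨
    (patch lo a μ μ' ν = ν ∧ ¬ ∃ v, lo v = a ∧ d v ≠ 0 ∧ load μ v < T v) := by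
  have hp := hs.partState hw hT hn hν
  have hlf := hc.layerFlow hs hν
  rw [nodeSet, ← centersBetween_union hn.lt]
  by_cases hdef : ∃ v, lo v = a ∧ d v ≠ 0 ∧ load μ v < T v
  · left
    obtain ⟨v, hv, hd, hl⟩ := hdef
    have hD := hr.deficit v hd hl
    rw [hv] at hD
    have hlay : Layers E ν (fun v => lo v = a) d (D a) T := by
      refine ⟨hr.labels hν, fun u v h1 h2 h3 h4 h5 => ?_, fun v h1 h2 h3 => ?_, fun v h1 => ?_⟩
      · have h6 := (hν.iff u).1 h1
        have h7 := hν.eq u h6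
        rw [h7] at h4 h5 ⊢
        exact hr.closed u v h2 (h6.trans h3.symm) h4 (Or.inr (by rwa [h3]))
      · rw [hν.load_eq h1] at h3
        have := hr.deficit v h2 h3
        rw [h1] at this; exact this.symm
      · by_cases h2 : d v = 0
        · omega
        · have := hr.le v h2 (by rw [h1]; omega)
          rwa [h1] at this
    obtain ⟨h1, h2⟩ := hp.augmentRound hlay (by omega) ⟨v, hv, hD.symm, by rwa [hν.load_eq hv]⟩ hlf
    exact ⟨h1, ⟨v, hv, hd, hl⟩, h2⟩
  · right
    refine ⟨funext fun u => ?_, hdef⟩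
    by_contra hne
    obtain ⟨h1, h2, h3, h4, h5⟩ := (hlf.job u).resolve_left hne
    obtain ⟨x, h6, h7, h8⟩ := h5.exists_deficit
    rw [hν.load_eq h6] at h8
    exact hdef ⟨x, h6, h7, h8⟩

/-- When the search finds no underloaded machine in a subnetwork, its labels give the reachable
vertices. -/
theorem LevelState.reachable_eq (hs : LevelState E w μ lo hi) (hw : ∀ v, Monotone (w v))
    (hT : ∀ v, T v = slotCut E w v (midRank (lo v) (hi v)))
    (hr : SearchResult E μ lo T d D) (hn : IsNode E w lo hi a b) (hν : Agrees E lo a μ ν)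
    (hdef : ¬ ∃ v, lo v = a ∧ d v ≠ 0 ∧ load μ v < T v) :
    (semiMatchingNetwork E w).reachable (nodeSet E w lo ν a b) (assignFlow w ν)
      (centerSet (centersBetween E w (midRank a b) b)) =
      partSet (fun v => lo v = a ∧ d v ≠ 0) ν (centersBetween E w (midRank a b) b) := by
  have hp := hs.partState hw hT hn hν
  rw [nodeSet, ← centersBetween_union hn.lt]
  refine hp.reachable_eq (hr.labels hν) (fun u v h1 h2 h3 h4 => ?_) fun v h1 h2 => ?_
  · have h6 := (hν.iff u).1 h1
    have h7 := hν.eq u h6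
    rw [h7] at h4
    refine (hr.closed u v h2 (h6.trans h3.symm) h4 (Or.inl ?_)).1
    by_contra hD
    obtain ⟨v', h8, h9, h10⟩ := hr.found (μ u) h4 (by rwa [h6, ← h3])
    exact hdef ⟨v', h8.trans h6, by rw [h9, h6, ← h3]; exact hD, h10⟩
  · rw [hν.load_eq h1]
    by_contra h3
    exact hdef ⟨v, h1, h2, by omega⟩

/-- When the search finds no underloaded machine in a subnetwork, Cancel stops there. -/
theorem LevelState.no_walk (hs : LevelState E w μ lo hi) (hw : ∀ v, Monotone (w v))
    (hT : ∀ v, T v = slotCut E w v (midRank (lo v) (hi v)))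
    (hr : SearchResult E μ lo T d D) (hn : IsNode E w lo hi a b) (hν : Agrees E lo a μ ν)
    (hdef : ¬ ∃ v, lo v = a ∧ d v ≠ 0 ∧ load μ v < T v) :
    ¬ ∃ p, (semiMatchingNetwork E w).IsWalkBetween (nodeSet E w lo ν a b) (assignFlow w ν)
        (centerSet (centersBetween E w (midRank a b) b))
        (centerSet (centersBetween E w a (midRank a b))) p := by
  rintro ⟨p, y, hy, z, hz, hp⟩
  have h1 : z ∈ (semiMatchingNetwork E w).reachable (nodeSet E w lo ν a b) (assignFlow w ν)
      (centerSet (centersBetween E w (midRank a b) b)) := ⟨y, hy, p, hp⟩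
  rw [hs.reachable_eq hw hT hr hn hν hdef] at h1
  obtain ⟨c, hc, rfl⟩ := hz
  exact (hs.partState hw hT hn hν).isDivision.notMem hc h1

theorem BlockingChange.levelState (hs : LevelState E w μ lo hi)
    (hT : ∀ v, T v = slotCut E w v (midRank (lo v) (hi v)))
    (hc : BlockingChange E μ μ' lo T d) : LevelState E w μ' lo hi := by
  have hmid : ∀ v, slotCut E w v (lo v) ≤ T v ∧ T v ≤ slotCut E w v (hi v) := by
    intro v
    rw [hT]
    by_cases hv : machineDegree E v = 0
    · have := fun x => slotCut_le (E := E) (w := w) v x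
      rw [hv] at this
      have h1 := this (lo v); have h2 := this (midRank (lo v) (hi v))
      omega
    · have := midRank_bounds (hs.lt v hv)
      exact ⟨slotCut_mono v this.1.le, slotCut_mono v this.2⟩
  refine ⟨fun u => ?_, hs.isolated, hs.lt, hs.le, hs.disj, fun v => ?_, fun v => ?_⟩
  · rcases hc.job u with h | h
    · rw [h]; exact hs.edge u
    · exact h.1
  · have h1 := hs.low v
    have h2 := hmid v
    by_cases h : load μ' v < load μ v
    · have := (hc.down v h).1; omega
    · omega
  · have h1 := hs.high v
    have h2 := hmid v
    by_cases h : load μ v < load μ' v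
    · have := (hc.up v h).1; omega
    · omega

variable (E w) in
/-- `r` simultaneous rounds of one level have turned the assignment `μ` into `μ'`: every subnetwork
has performed `r` rounds of Cancel, or fewer if Cancel has stopped there. -/
structure RoundsDone (lo hi : V → ℕ) (μ μ' : U → V) (r : ℕ) : Prop where
  state : LevelState E w μ' lo hi
  lo_eq : ∀ u, lo (μ' u) = lo (μ u)
  rounds : ∀ a b, IsNode E w lo hi a b → ∀ ν, Agrees E lo a μ ν → ∃ k,
    Rounds E w (nodeSet E w lo ν a b) (centersBetween E w a (midRank a b))
      (centersBetween E w (midRank a b) b) (assignFlow w ν)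
      (assignFlow w (patch lo a μ μ' ν)) k ∧
    (k = r ∨ ¬ ∃ p, (semiMatchingNetwork E w).IsWalkBetween (nodeSet E w lo ν a b)
        (assignFlow w (patch lo a μ μ' ν))
        (centerSet (centersBetween E w (midRank a b) b))
        (centerSet (centersBetween E w a (midRank a b))) p)

theorem RoundsDone.zero (hs : LevelState E w μ lo hi) : RoundsDone E w lo hi μ μ 0 := by
  refine ⟨hs, fun _ => rfl, fun a b _ ν hν => ⟨0, ?_, Or.inl rfl⟩⟩
  have : patch lo a μ μ ν = ν := by
    funext u; simp only [patch]; split_ifs with h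
    · exact (hν.eq u h).symm
    · rfl
  rw [this]; exact .zero

theorem RoundsDone.patch_patch {μ'' : U → V} (hlo : ∀ u, lo (μ' u) = lo (μ u)) :
    patch lo a μ' μ'' (patch lo a μ μ' ν) = patch lo a μ μ'' ν := by
  funext u; simp only [patch, hlo]; split_ifs <;> rfl

theorem RoundsDone.nodeSet_eq (h : ∀ u, lo (μ' u) = lo (μ u)) (hν : Agrees E lo a μ ν) :
    nodeSet E w lo (patch lo a μ μ' ν) a b = nodeSet E w lo ν a b := by
  refine nodeSet_congr fun u => ?_
  simp only [patch]; split_ifs with h'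
  · rw [h, hν.iff]
  · rfl

theorem RoundsDone.succ {μ'' : U → V} {r : ℕ} (h : RoundsDone E w lo hi μ μ' r)
    (hw : ∀ v, Monotone (w v)) (hT : ∀ v, T v = slotCut E w v (midRank (lo v) (hi v)))
    (hr : SearchResult E μ' lo T d D) (hc : BlockingChange E μ' μ'' lo T d) :
    RoundsDone E w lo hi μ μ'' (r + 1) := by
  refine ⟨hc.levelState h.state hT, fun u => (hc.lo_eq u).trans (h.lo_eq u), fun a b hn ν hν => ?_⟩
  obtain ⟨k, hk, hor⟩ := h.rounds a b hn ν hν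
  have hν' := hν.patch h.lo_eq h.state.edge
  have h1 := h.state.round hw hT hr hc hn hν'
  rw [RoundsDone.patch_patch h.lo_eq, RoundsDone.nodeSet_eq h.lo_eq hν] at h1
  rcases h1 with ⟨h2, -, h3⟩ | ⟨h2, h3⟩
  · rcases hor with rfl | hor
    · exact ⟨k + 1, .succ _ _ _ hk h3 h2, Or.inl rfl⟩
    · exact absurd h3 hor
  · rw [h2]
    have h4 := h.state.no_walk hw hT hr hn hν' h3
    rw [RoundsDone.nodeSet_eq h.lo_eq hν] at h4
    exact ⟨k, hk, Or.inr h4⟩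

theorem LevelState.isNode (hs : LevelState E w μ lo hi) {v : V} (hv : machineDegree E v ≠ 0) :
    IsNode E w lo hi (lo v) (hi v) := by
  refine ⟨hs.lt v hv, hs.le v hv, fun v' hv' => ?_⟩
  have := hs.disj v v' hv hv'
  omega

/-- As long as a round finds an underloaded machine, the number of rounds is bounded by the number
of rounds of Cancel in its subnetwork. -/
theorem RoundsDone.le_sqrt {r : ℕ} (h : RoundsDone E w lo hi μ μ' r)
    (hs : LevelState E w μ lo hi)
    (hw : ∀ v, Monotone (w v)) (hT : ∀ v, T v = slotCut E w v (midRank (lo v) (hi v)))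
    (hr : SearchResult E μ' lo T d D) {μ'' : U → V} (hc : BlockingChange E μ' μ'' lo T d)
    (hdef : ∃ v, d v ≠ 0 ∧ load μ' v < T v) :
    r + 1 ≤ 2 * Nat.sqrt (4 * Fintype.card U) + 1 := by
  obtain ⟨v, hd, hv⟩ := hdef
  have hv0 : machineDegree E v ≠ 0 := by
    intro h0
    have := slotCut_le (E := E) (w := w) v (midRank (lo v) (hi v))
    rw [← hT, h0] at this; omega
  have hn := hs.isNode hv0
  have hμ : Agrees E lo (lo v) μ μ := ⟨hs.edge, fun _ => Iff.rfl, fun _ _ => rfl⟩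
  have hν' := hμ.patch h.lo_eq h.state.edge
  obtain ⟨k, hk, hor⟩ := h.rounds _ _ hn μ hμ
  have h1 := h.state.round hw hT hr hc hn hν'
  rw [RoundsDone.nodeSet_eq h.lo_eq hμ] at h1
  rcases h1 with ⟨h2, -, h3⟩ | ⟨h2, h3⟩
  · rcases hor with rfl | hor
    · have hd := (hs.partState hw hT hn hμ).isDivision
      rw [centersBetween_union hn.lt] at hd
      exact (Rounds.succ _ _ _ hk h3 h2).le_sqrt hd (graphOf_isSemiMatching hs.edge).isFull
    · exact absurd h3 hor
  · exact absurd ⟨v, rfl, hd, hv⟩ h3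

/-- The lower ends of the intervals of the next level. -/
def nextLo (lo hi d : V → ℕ) (v : V) : ℕ := if d v = 0 then lo v else midRank (lo v) (hi v)

/-- The upper ends of the intervals of the next level. -/
def nextHi (lo hi d : V → ℕ) (v : V) : ℕ := if d v = 0 then midRank (lo v) (hi v) else hi v

variable (E w) in
/-- One level of the recursion: Cancel has been run in every subnetwork, and the labels `d` give the
vertices that are reachable from the larger half of the cost centers. -/
structure LevelStep (lo hi d : V → ℕ) (μ μ' : U → V) : Prop where
  state : LevelState E w μ' lo hi
  next : LevelState E w μ' (nextLo lo hi d) (nextHi lo hi d)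
  lo_eq : ∀ u, lo (μ' u) = lo (μ u)
  two_le : ∀ v, d v ≠ 0 → machineDegree E v ≠ 0 ∧ lo v + 2 ≤ hi v
  cancel : ∀ a b, IsNode E w lo hi a b → ∀ ν, Agrees E lo a μ ν →
    (∃ k, Cancel E w (nodeSet E w lo ν a b) (centersBetween E w (midRank a b) b)
      (centersBetween E w a (midRank a b)) (assignFlow w ν)
      (assignFlow w (patch lo a μ μ' ν)) k) ∧
    (semiMatchingNetwork E w).reachable (nodeSet E w lo ν a b)
      (assignFlow w (patch lo a μ μ' ν)) (centerSet (centersBetween E w (midRank a b) b)) =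
      partSet (fun v => lo v = a ∧ d v ≠ 0) (patch lo a μ μ' ν)
        (centersBetween E w (midRank a b) b)

/-- After the last round, every machine belongs to one of the halves of its interval, according to
whether it is reached: a reached machine is not underloaded, and a machine that is not reached is
not overloaded. -/
theorem RoundsDone.levelStep {r : ℕ} (h : RoundsDone E w lo hi μ μ' r)
    (hw : ∀ v, Monotone (w v))
    (hT : ∀ v, T v = slotCut E w v (midRank (lo v) (hi v)))
    (hr : SearchResult E μ' lo T d D)
    (hdef : ¬ ∃ v, d v ≠ 0 ∧ load μ' v < T v) : LevelStep E w lo hi d μ μ' := by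
  have hs := h.state
  have hiso : ∀ v, machineDegree E v = 0 → d v = 0 := by
    intro v hv
    by_contra hd
    by_cases h1 : d v = 1
    · have := (hr.one_iff v).1 h1
      have := load_le hs.edge v
      omega
    · obtain ⟨u, hu, -⟩ := hr.pred v (by omega)
      exact machineDegree_ne_zero hu hv
  have htwo : ∀ v, d v ≠ 0 → machineDegree E v ≠ 0 ∧ lo v + 2 ≤ hi v := by
    intro v hd
    have hv : machineDegree E v ≠ 0 := fun h => hd (hiso v h)
    refine ⟨hv, ?_⟩
    by_contra hlt
    have h1 := hs.lt v hv
    have hn := hs.isNode hv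
    have hμ : Agrees E lo (lo v) μ' μ' := ⟨hs.edge, fun _ => Iff.rfl, fun _ _ => rfl⟩
    obtain ⟨y, ⟨c, hc, -⟩, -⟩ := (hs.partState hw hT hn hμ).exists_walk_to (hr.labels hμ) rfl hd
    have h2 : (centersBetween E w (midRank (lo v) (hi v)) (hi v)).card = 0 := by
      rw [card_centersBetween hn.le]; simp only [midRank]; omega
    rw [Finset.card_eq_zero] at h2
    rw [h2] at hc
    simp at hc
  refine ⟨hs, ?_, h.lo_eq, htwo, fun a b hn ν hν => ?_⟩
  · have hcase : ∀ v, machineDegree E v ≠ 0 → lo v ≤ nextLo lo hi d v ∧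
        nextHi lo hi d v ≤ hi v ∧ nextLo lo hi d v < nextHi lo hi d v := by
      intro v hv
      have h1 := hs.lt v hv
      have h2 := htwo v
      simp only [nextLo, nextHi, midRank]
      split_ifs with h3
      · omega
      · have := h2 h3; omega
    refine ⟨hs.edge, fun v hv => ?_, fun v hv => (hcase v hv).2.2,
      fun v hv => (hcase v hv).2.1.trans (hs.le v hv), fun v v' hv hv' => ?_, fun v => ?_,
      fun v => ?_⟩
    · simp [nextLo, hiso v hv, hs.isolated v hv]
    · have h1 := hcase v hv
      have h2 := hcase v' hv'
      rcases hs.disj v v' hv hv' with ⟨h3, h4⟩ | h3 | h3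
      · simp only [nextLo, nextHi, midRank, h3, h4] at h1 h2 ⊢
        split_ifs <;> omega
      · right; left; omega
      · right; right; omega
    · by_cases h3 : d v = 0
      · simp only [nextLo, h3, if_true]; exact hs.low v
      · simp only [nextLo, h3, if_false]
        rw [← hT]
        by_contra h4
        exact hdef ⟨v, h3, by omega⟩
    · by_cases h3 : d v = 0
      · simp only [nextHi, h3, if_true]
        rw [← hT]
        by_contra h4
        have := (hr.one_iff v).2 (by omega)
        omega
      · simp only [nextHi, h3, if_false]; exact hs.high v
  · obtain ⟨k, hk, -⟩ := h.rounds a b hn ν hν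
    have hν' := hν.patch h.lo_eq hs.edge
    have hdef' : ¬ ∃ v, lo v = a ∧ d v ≠ 0 ∧ load μ' v < T v :=
      fun ⟨v, _, h⟩ => hdef ⟨v, h⟩
    have h1 := hs.no_walk hw hT hr hn hν' hdef'
    have h2 := hs.reachable_eq hw hT hr hn hν' hdef'
    rw [RoundsDone.nodeSet_eq h.lo_eq hν] at h1 h2
    exact ⟨⟨k, hk.cancel h1⟩, h2⟩

variable (E w) in
/-- The levels of the recursion from a level on whose intervals have length at most `K`. Intervals
of length one are left unchanged by a level. -/
inductive LevelRun : ℕ → (V → ℕ) → (V → ℕ) → (U → V) → (U → V) → Prop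
  | done (K : ℕ) (lo hi : V → ℕ) (μ : U → V) (hK : K ≤ 1) : LevelRun K lo hi μ μ
  | step (K : ℕ) (lo hi d : V → ℕ) (μ μ' μ'' : U → V) (hK : 1 < K)
      (hstep : LevelStep E w lo hi d μ μ')
      (hrest : LevelRun ((K + 1) / 2) (nextLo lo hi d) (nextHi lo hi d) μ' μ'') :
      LevelRun K lo hi μ μ''

/-- The intervals of the next level refine those of the present one. -/
theorem LevelStep.lo_eq_of_nextLo_eq (h : LevelStep E w lo hi d μ μ') {x y : V}
    (hx : machineDegree E x ≠ 0) (hy : machineDegree E y ≠ 0)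
    (hxy : nextLo lo hi d x = nextLo lo hi d y) : lo x = lo y := by
  have h1 := h.state.lt x hx
  have h2 := h.state.lt y hy
  have h3 := h.state.disj x y hx hy
  have h4 := h.two_le x
  have h5 := h.two_le y
  simp only [nextLo, midRank] at hxy
  split_ifs at hxy with h6 h7 h7
  · exact hxy
  · have := h5 h7; omega
  · have := h4 h6; omega
  · have := h5 h7; have := h4 h6; omega

theorem LevelRun.basic {K : ℕ} {μe : U → V} (h : LevelRun E w K lo hi μ μe)
    (hs : LevelState E w μ lo hi) :
    (∀ u, (u, μe u) ∈ E) ∧ ∀ u, lo (μe u) = lo (μ u) := by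
  induction h with
  | done K lo hi μ hK => exact ⟨hs.edge, fun _ => rfl⟩
  | step K lo hi d μ μ' μ'' hK hstep hrest ih =>
    obtain ⟨h1, h2⟩ := ih hstep.next
    refine ⟨h1, fun u => ?_⟩
    rw [← hstep.lo_eq u]
    exact hstep.lo_eq_of_nextLo_eq (machineDegree_ne_zero (h1 u))
      (machineDegree_ne_zero (hstep.state.edge u)) (h2 u)

theorem centersIn_nodeSet : centersIn E w (nodeSet E w lo ν a b) = centersBetween E w a b := by
  ext x
  exact mem_centersIn (partSet_subset (Finset.filter_subset _ _))

/-- Without cost centers in the upper half there is nothing to cancel. -/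
theorem Cancel.eq_of_empty {S : Set (NetVertex U V)} {C₁ : Finset ℝ} {φ ψ : NetArc U V → ℕ}
    {k : ℕ} (h : Cancel E w S ∅ C₁ φ ψ k) : φ = ψ := by
  cases h with
  | done _ h => rfl
  | round _ _ _ _ h' _ _ =>
    obtain ⟨p, y, ⟨c, hc, -⟩, -⟩ := h'
    simp at hc

/-- The simultaneous processing of the levels performs a run of CancelAll in every subnetwork. The
run starts from an assignment `ν` that differs from `μ` outside the subnetwork, since the run on the
upper half starts after the run on the lower half has ended. -/
theorem LevelRun.cancelAll {K : ℕ} {μe : U → V} (h : LevelRun E w K lo hi μ μe)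
    (hs : LevelState E w μ lo hi) (hn : IsNode E w lo hi a b) (hK : b - a ≤ K)
    (hν : Agrees E lo a μ ν) :
    ∃ t, CancelAll E w (nodeSet E w lo ν a b) (assignFlow w ν)
      (assignFlow w (patch lo a μ μe ν)) t := by
  induction h generalizing a b ν with
  | done K lo hi μ hK1 =>
    have : patch lo a μ μ ν = ν := by
      funext u; simp only [patch]; split_ifs with h
      · exact (hν.eq u h).symm
      · rfl
    rw [this]
    exact ⟨1, .halt _ _ (by rw [centersIn_nodeSet, card_centersBetween hn.le]; omega)⟩
  | step K lo hi d μ μ' μe hK1 hstep hrest ih =>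
    obtain ⟨⟨k, hk⟩, hreach⟩ := hstep.cancel a b hn ν hν
    have hν1 := hν.patch hstep.lo_eq hstep.state.edge
    obtain ⟨hedge, hloe⟩ := hrest.basic hstep.next
    set ν1 := patch lo a μ μ' ν with hν1d
    -- A machine whose new interval starts inside `[a, b)` belongs to this subnetwork.
    have hback : ∀ v, machineDegree E v ≠ 0 → a ≤ nextLo lo hi d v → nextLo lo hi d v < b →
        lo v = a ∧ hi v = b := by
      intro v hv h1 h2
      have h3 := hn.disj v hv
      have h4 := hs.lt v hv
      have h5 := hstep.two_le v
      simp only [nextLo, midRank] at h1 h2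
      split_ifs at h1 h2 with h6
      · omega
      · have := h5 h6; omega
    have hmb := midRank_bounds hn.lt
    by_cases hba : b - a ≤ 1
    · -- A single cost center: the level changes nothing here.
      have hmid : midRank a b = b := by have := hn.lt; simp only [midRank]; omega
      have hempty : centersBetween E w (midRank a b) b = ∅ := by
        rw [← Finset.card_eq_zero, card_centersBetween hn.le]; omega
      rw [hempty] at hk hreach
      have hflow : assignFlow w ν = assignFlow w ν1 := hk.eq_of_empty
      have hd0 : ∀ v, lo v = a → d v = 0 := by
        intro v hv
        by_contra hd
        have : NetVertex.machine v ∈ partSet (fun v => lo v = a ∧ d v ≠ 0) ν1 ∅ := ⟨hv, hd⟩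
        rw [← hreach] at this
        obtain ⟨y, ⟨c, hc, -⟩, -⟩ := this
        simp at hc
      have hlo : ∀ v, nextLo lo hi d v = a ↔ lo v = a := by
        intro v
        constructor
        · intro h1
          by_cases hv : machineDegree E v = 0
          · rw [← h1, nextLo]
            have : d v = 0 := by by_contra h; exact (hstep.two_le v h).1 hv
            simp [this]
          · exact (hback v hv h1.ge (h1 ▸ hn.lt)).1
        · intro h1; simp [nextLo, hd0 v h1, h1]
      have hn' : IsNode E w (nextLo lo hi d) (nextHi lo hi d) a b := by
        refine ⟨hn.lt, hn.le, fun v hv => ?_⟩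
        have h2 := hs.lt v hv
        rcases hn.disj v hv with ⟨h1, h1'⟩ | h1
        · left
          rw [nextHi, hd0 v h1, if_pos rfl, h1, h1']
          exact ⟨(hlo v).2 h1, hmid⟩
        · right
          have := hstep.two_le v
          simp only [nextLo, nextHi, midRank]
          split_ifs <;> omega
      have hag : Agrees E (nextLo lo hi d) a μ' ν1 :=
        ⟨hν1.edge, fun u => by rw [hlo, hlo]; exact hν1.iff u, fun u hu => hν1.eq u ((hlo _).1 hu)⟩
      obtain ⟨t, ht⟩ := ih hstep.next hn' (by omega) hag
      refine ⟨t, ?_⟩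
      have e1 : nodeSet E w (nextLo lo hi d) ν1 a b = nodeSet E w lo ν a b := by
        rw [← RoundsDone.nodeSet_eq hstep.lo_eq hν]
        simp only [nodeSet, hlo]; rfl
      have e2 : patch (nextLo lo hi d) a μ' μe ν1 = patch lo a μ μe ν := by
        funext u
        simp only [patch, hlo, hstep.lo_eq, hν1d]
        split_ifs <;> rfl
      rwa [e1, e2, ← hflow] at ht
    · have hlt : a < midRank a b ∧ midRank a b < b := by simp only [midRank]; omega
      set mid := midRank a b with hmid
      have hlo₂ : ∀ v, nextLo lo hi d v = mid ↔ lo v = a ∧ d v ≠ 0 := by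
        intro v
        constructor
        · intro h1
          have hv : machineDegree E v ≠ 0 := by
            intro hv
            have := hstep.next.isolated v hv; omega
          obtain ⟨h2, h3⟩ := hback v hv (by omega) (by omega)
          refine ⟨h2, fun h4 => ?_⟩
          rw [nextLo, if_pos h4] at h1; omega
        · rintro ⟨h1, h2⟩
          rw [nextLo, if_neg h2, h1, hn.hi_eq hs (hstep.two_le v h2).1 h1]
      have hlo₁ : ∀ v, nextLo lo hi d v = a ↔ lo v = a ∧ d v = 0 := by
        intro v
        constructor
        · intro h1
          by_cases hv : machineDegree E v = 0
          · have : d v = 0 := by by_contra h; exact (hstep.two_le v h).1 hv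
            rw [nextLo, if_pos this] at h1
            exact ⟨h1, this⟩
          · obtain ⟨h2, h3⟩ := hback v hv (by omega) (by omega)
            refine ⟨h2, ?_⟩
            by_contra h4
            have := (hlo₂ v).2 ⟨h2, h4⟩
            omega
        · rintro ⟨h1, h2⟩; rw [nextLo, if_pos h2, h1]
      have hnode : ∀ v, machineDegree E v ≠ 0 → (lo v = a ∧ hi v = b) ∨
          nextHi lo hi d v ≤ a ∨ b ≤ nextLo lo hi d v := by
        intro v hv
        have h2 := hs.lt v hv
        refine (hn.disj v hv).imp_right fun h1 => ?_
        have := hstep.two_le v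
        simp only [nextLo, nextHi, midRank]
        split_ifs <;> omega
      have hn₁ : IsNode E w (nextLo lo hi d) (nextHi lo hi d) a mid := by
        refine ⟨hlt.1, by have := hn.le; omega, fun v hv => ?_⟩
        rcases hnode v hv with ⟨h1, h2⟩ | h1
        · by_cases hd : d v = 0
          · left; exact ⟨(hlo₁ v).2 ⟨h1, hd⟩, by rw [nextHi, if_pos hd, h1, h2]⟩
          · right; right; rw [(hlo₂ v).2 ⟨h1, hd⟩]
        · right; omega
      have hn₂ : IsNode E w (nextLo lo hi d) (nextHi lo hi d) mid b := by
        refine ⟨hlt.2, hn.le, fun v hv => ?_⟩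
        rcases hnode v hv with ⟨h1, h2⟩ | h1
        · by_cases hd : d v = 0
          · right; left; rw [nextHi, if_pos hd, h1, h2]
          · left; exact ⟨(hlo₂ v).2 ⟨h1, hd⟩, by rw [nextHi, if_neg hd, h2]⟩
        · right; omega
      have hag₁ : Agrees E (nextLo lo hi d) a μ' ν1 := by
        refine ⟨hν1.edge, fun u => ?_, fun u hu => hν1.eq u ((hlo₁ _).1 hu).1⟩
        rw [hlo₁, hlo₁]
        constructor
        · rintro ⟨h1, h2⟩; have h3 := (hν1.iff u).1 h1; rw [hν1.eq u h3] at h2; exact ⟨h3, h2⟩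
        · rintro ⟨h1, h2⟩; rw [hν1.eq u h1]; exact ⟨h1, h2⟩
      -- The run on the lower half turns `ν1` into `ν2`, where the run on the upper half starts.
      obtain ⟨t₁, ht₁⟩ := ih hstep.next hn₁ (by simp only [hmid, midRank]; omega) hag₁
      set ν2 := patch (nextLo lo hi d) a μ' μe ν1 with hν2d
      have hlo_ν2 : ∀ u, nextLo lo hi d (ν2 u) = mid ↔ nextLo lo hi d (ν1 u) = mid := by
        intro u
        simp only [hν2d, patch]
        split_ifs with h1
        · rw [hloe, h1, hν1.eq u ((hlo₁ _).1 h1).1, h1]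
        · rfl
      have hag₂ : Agrees E (nextLo lo hi d) mid μ' ν2 := by
        refine ⟨fun u => ?_, fun u => ?_, fun u hu => ?_⟩
        · simp only [hν2d, patch]; split_ifs
          exacts [hedge u, hν1.edge u]
        · rw [hlo_ν2, hlo₂, hlo₂]
          constructor
          · rintro ⟨h1, h2⟩; have h3 := (hν1.iff u).1 h1; rw [hν1.eq u h3] at h2; exact ⟨h3, h2⟩
          · rintro ⟨h1, h2⟩; rw [hν1.eq u h1]; exact ⟨h1, h2⟩
        · have h1 : nextLo lo hi d (μ' u) ≠ a := by omega
          simp only [hν2d, patch, h1, if_false]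
          exact hν1.eq u ((hlo₂ _).1 hu).1
      obtain ⟨t₂, ht₂⟩ := ih hstep.next hn₂ (by simp only [hmid, midRank]; omega) hag₂
      -- The sets of the two recursive calls.
      have hS₂ : nodeSet E w (nextLo lo hi d) ν2 mid b =
          partSet (fun v => lo v = a ∧ d v ≠ 0) ν1 (centersBetween E w mid b) := by
        rw [nodeSet_congr hlo_ν2, nodeSet]
        simp only [hlo₂]
      have hS₁ : nodeSet E w (nextLo lo hi d) ν1 a mid = nodeSet E w lo ν a b \
          partSet (fun v => lo v = a ∧ d v ≠ 0) ν1 (centersBetween E w mid b) := by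
        rw [← RoundsDone.nodeSet_eq hstep.lo_eq hν]
        ext x
        rw [Set.mem_sdiff]
        rcases x with _ | _ | u | v | c
        · exact ⟨fun h => h.elim, fun h => h.1.elim⟩
        · exact ⟨fun h => h.elim, fun h => h.1.elim⟩
        · change nextLo lo hi d (ν1 u) = a ↔ lo (ν1 u) = a ∧ ¬ (lo (ν1 u) = a ∧ d (ν1 u) ≠ 0)
          rw [hlo₁]; tauto
        · change nextLo lo hi d v = a ↔ lo v = a ∧ ¬ (lo v = a ∧ d v ≠ 0)
          rw [hlo₁]; tauto
        · change c ∈ centersBetween E w a mid ↔ c ∈ centersBetween E w a b ∧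
            c ∉ centersBetween E w mid b
          simp only [centersBetween, Finset.mem_filter]
          constructor
          · rintro ⟨h1, h2, h3⟩; exact ⟨⟨h1, h2, by omega⟩, fun h => by omega⟩
          · rintro ⟨⟨h1, h2, h3⟩, h4⟩
            refine ⟨h1, h2, ?_⟩
            by_contra h5; exact h4 ⟨h1, by omega, h3⟩
      rw [hS₁] at ht₁
      rw [hS₂] at ht₂
      have hfin : patch (nextLo lo hi d) mid μ' μe ν2 = patch lo a μ μe ν := by
        funext u
        simp only [patch, hν2d, hν1d, hlo₁, hlo₂, hstep.lo_eq]
        by_cases h1 : lo (μ u) = a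
        · by_cases h2 : d (μ' u) = 0 <;> simp [h1, h2]
        · simp [h1]
      rw [hfin] at ht₂
      have hlt' : ∀ x ∈ centersBetween E w a mid, ∀ y ∈ centersBetween E w mid b, x < y := by
        intro x hx y hy
        simp only [centersBetween, Finset.mem_filter] at hx hy
        exact (centerRank_lt_iff hx.1).1 (by omega)
      have hc₁ := card_centersBetween (E := E) (w := w) (a := a) hn₁.le
      have hc₂ := card_centersBetween (E := E) (w := w) (a := mid) hn.le
      refine ⟨_, .divide _ _ (centersBetween E w a mid) (centersBetween E w mid b) _ _ _ _ k t₁ t₂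
        ?_ ?_ hlt' ?_ ?_ hk hreach.symm ht₁ ht₂⟩
      · rw [centersIn_nodeSet, card_centersBetween hn.le]; omega
      · rw [centersIn_nodeSet, centersBetween_union hn.lt]
      · rw [hc₁, hc₂, hmid]; simp only [midRank]; omega
      · rw [hc₁, hc₂, hmid]; simp only [midRank]; omega

end Levels

/-! ### Loops and their frames -/

namespace RAM

variable {W : ℕ} {F : ℕ → ℕ → ℝ} {p q : Program} {σ σ₀ : State} {B B' : ℕ} {Q R : State → Prop}

/-- `σ` agrees with `σ₀` on the arrays and registers that `p` does not write to. -/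
structure Frame (p : Program) (σ₀ σ : State) : Prop where
  mem : ∀ a, a ∉ p.writes → σ.mem a = σ₀.mem a
  reg : ∀ x, x ∉ p.sets → σ.reg x = σ₀.reg x

theorem Frame.refl (p : Program) (σ : State) : Frame p σ σ := ⟨fun _ _ => rfl, fun _ _ => rfl⟩

theorem Frame.trans {σ₁ σ₂ : State} (h : Frame p σ₀ σ₁) (h' : Frame p σ₁ σ₂) : Frame p σ₀ σ₂ :=
  ⟨fun a ha => (h'.mem a ha).trans (h.mem a ha), fun x hx => (h'.reg x hx).trans (h.reg x hx)⟩

theorem Exec.frame {σ' : State} {t : ℕ} (h : Exec W F p σ σ' t) : Frame p σ σ' :=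
  ⟨fun _ ha => h.mem_eq ha, fun _ hx => h.reg_eq hx⟩

theorem Runs.frame (h : Runs W F p σ B Q) : Runs W F p σ B fun σ' => Q σ' ∧ Frame p σ σ' :=
  h.and fun _ _ h => h.frame

theorem Runs.loopFrame {b : Test} (I : State → Prop) (f : State → ℕ) (c : ℕ) (hI : I σ₀)
    (hbody : ∀ σ, Frame p σ₀ σ → I σ → b.Holds F σ → ∃ B, Runs W F p σ B fun σ' =>
      I σ' ∧ b.steps + B + c * f σ' ≤ c * f σ) :
    Runs W F (.loop b p) σ₀ (c * f σ₀ + b.steps) fun σ' =>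
      Frame p σ₀ σ' ∧ I σ' ∧ ¬ b.Holds F σ' := by
  refine (Runs.loop (fun σ => Frame p σ₀ σ ∧ I σ) f c ⟨Frame.refl _ _, hI⟩ ?_).mono le_rfl
    fun σ' h => ⟨h.1.1, h.1.2, h.2⟩
  rintro σ ⟨hf, hi⟩ hb
  obtain ⟨B, hB⟩ := hbody σ hf hi hb
  exact ⟨B, hB.frame.mono le_rfl fun σ' h => ⟨⟨hf.trans h.2, h.1.1⟩, h.1.2⟩⟩

theorem Runs.loopWp {b : Test} (I : State → Prop) (f : State → ℕ) (hI : I σ₀)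
    (hbody : ∀ σ, Frame p σ₀ σ → I σ → b.Holds F σ → p.Wp W F σ fun σ' => I σ' ∧ f σ' < f σ) :
    Runs W F (.loop b p) σ₀ ((b.steps + p.size) * f σ₀ + b.steps) fun σ' =>
      Frame p σ₀ σ' ∧ I σ' ∧ ¬ b.Holds F σ' := by
  refine Runs.loopFrame I f _ hI fun σ hf hi hb => ⟨_, (hbody σ hf hi hb).runs.mono le_rfl ?_⟩
  rintro σ' ⟨h1, h2⟩
  refine ⟨h1, ?_⟩
  calc b.steps + p.size + (b.steps + p.size) * f σ' = (b.steps + p.size) * (f σ' + 1) := by ring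
    _ ≤ _ := Nat.mul_le_mul_left _ h2

/-- The loop in which the register `x` runs from zero to the value of the register `n`. -/
def forLoop (x n : ℕ) (p : Program) : Program :=
  .seq (.letWord x (.lit 0))
    (.loop (.wordLt (.reg x) (.reg n)) (.seq p (.letWord x (.plus (.reg x) (.lit 1)))))

theorem Runs.forLoop {x n : ℕ} {c : ℕ} (hx : x ∉ p.sets) (hn : n ∉ p.sets) (hxn : x ≠ n)
    (hW : σ₀.reg n ≤ W) (I : ℕ → State → Prop) (hI : I 0 (σ₀.setReg x 0))
    (hbody : ∀ k σ, k < σ₀.reg n → σ.reg x = k → Frame (forLoop x n p) σ₀ σ → I k σ →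
      Runs W F p σ c fun σ' => I (k + 1) (σ'.setReg x (k + 1))) :
    Runs W F (forLoop x n p) σ₀ ((c + 7) * σ₀.reg n + 5) fun σ' =>
      Frame (forLoop x n p) σ₀ σ' ∧ I (σ₀.reg n) σ' := by
  have h1 : Runs W F (.letWord x (.lit 0)) σ₀ 2 fun σ => σ = σ₀.setReg x 0 :=
    ⟨_, _, .letWord _ _ _ (Nat.zero_le _), le_rfl, rfl⟩
  have h2 := h1.seq (q := .loop (.wordLt (.reg x) (.reg n))
    (.seq p (.letWord x (.plus (.reg x) (.lit 1)))))
    (R := fun σ' => I (σ₀.reg n) σ') (B' := (c + 7) * σ₀.reg n + 3) ?_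
  · exact (h2.mono (B' := (c + 7) * σ₀.reg n + 5) (by omega) fun _ h => h).frame.mono le_rfl
      fun σ' h => ⟨h.2, h.1⟩
  rintro _ rfl
  have hreg : ∀ σ, Frame (.seq p (.letWord x (.plus (.reg x) (.lit 1)))) (σ₀.setReg x 0) σ →
      σ.reg n = σ₀.reg n := by
    intro σ h
    rw [h.reg n (by simp [Program.sets, hn, hxn.symm])]; simp [hxn.symm]
  refine (Runs.loopFrame (fun σ => σ.reg x ≤ σ₀.reg n ∧ I (σ.reg x) σ)
    (fun σ => σ₀.reg n - σ.reg x) (c + 7) ⟨by simp, by simpa using hI⟩ ?_).mono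
      (by simp [Test.steps, WordExp.steps]) ?_
  · rintro σ hf ⟨hle, hi⟩ hb
    simp only [Test.Holds, WordExp.eval] at hb
    rw [hreg σ hf] at hb
    refine ⟨c + 4, ((hbody _ σ hb rfl ⟨fun a ha => ?_, fun y hy => ?_⟩ hi).frame.seq
      (R := fun σ' => (σ'.reg x ≤ σ₀.reg n ∧ I (σ'.reg x) σ') ∧ σ'.reg x = σ.reg x + 1)
      (B' := 4) ?_).mono le_rfl ?_⟩
    · rw [hf.mem a (by simpa [RAM.forLoop, Program.writes] using ha)]; rfl
    · simp only [RAM.forLoop, Program.sets, List.mem_append, List.mem_singleton, not_or] at hy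
      rw [hf.reg y (by simp [Program.sets, hy])]; simp [hy.1]
    · rintro σ' ⟨hi', hf'⟩
      have hx' : σ'.reg x = σ.reg x := hf'.reg x hx
      refine ⟨_, _, .letWord _ _ _ (by simp only [WordExp.eval, hx']; omega), le_rfl, ?_⟩
      simp only [WordExp.eval, hx']
      refine ⟨⟨by simp; omega, ?_⟩, by simp⟩
      simpa using hi'
    · rintro σ' ⟨h3, h4⟩
      refine ⟨h3, ?_⟩
      simp only [Test.steps, WordExp.steps, h4]
      obtain ⟨a, ha⟩ : ∃ a, σ₀.reg n - σ.reg x = a + 1 := ⟨σ₀.reg n - σ.reg x - 1, by omega⟩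
      have hb : σ₀.reg n - (σ.reg x + 1) = a := by omega
      rw [ha, hb]; ring_nf; omega
  · rintro σ' ⟨hf, ⟨h3, h4⟩, h5⟩
    simp only [Test.Holds, WordExp.eval, hreg σ' hf] at h5
    rwa [show σ'.reg x = σ₀.reg n by omega] at h4

theorem Runs.forLoopWp {x n : ℕ} (hx : x ∉ p.sets) (hn : n ∉ p.sets) (hxn : x ≠ n)
    (hW : σ₀.reg n ≤ W) (I : ℕ → State → Prop) (hI : I 0 (σ₀.setReg x 0))
    (hbody : ∀ k σ, k < σ₀.reg n → σ.reg x = k → Frame (RAM.forLoop x n p) σ₀ σ → I k σ →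
      p.Wp W F σ fun σ' => I (k + 1) (σ'.setReg x (k + 1))) :
    Runs W F (RAM.forLoop x n p) σ₀ ((p.size + 7) * σ₀.reg n + 5) fun σ' =>
      Frame (RAM.forLoop x n p) σ₀ σ' ∧ I (σ₀.reg n) σ' :=
  Runs.forLoop hx hn hxn hW I hI fun k σ h1 h2 h3 h4 => (hbody k σ h1 h2 h3 h4).runs

/-! ### Linked lists of the edges that leave the machines -/

/-- The lists of the edges with the same source. The list of a source runs through its edges in
decreasing order; the edge `j` is followed by the edge `nxt j - 1`, or by none if `nxt j = 0`. -/
structure Links (m : ℕ) (src nxt : ℕ → ℕ) : Prop where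
  le : ∀ j < m, nxt j ≤ j
  src_eq : ∀ j < m, nxt j ≠ 0 → src (nxt j - 1) = src j
  gap : ∀ j < m, ∀ i, nxt j ≤ i → i < j → src i ≠ src j

/-- The edges that have not been removed from the fronts of the lists, the list of `x` starting with
the edge `hd x - 1`. -/
def remaining (m : ℕ) (src hd : ℕ → ℕ) : Finset ℕ :=
  (Finset.range m).filter fun j => j < hd (src j)

/-- `hd x` is the head of the list of `x`. -/
def IsHead (m : ℕ) (src hd : ℕ → ℕ) (x : ℕ) : Prop :=
  hd x ≤ m ∧ (hd x ≠ 0 → src (hd x - 1) = x)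

variable {m : ℕ} {src nxt hd : ℕ → ℕ}

theorem Links.lt_update_iff (hl : Links m src nxt) {x j i : ℕ} (hx : IsHead m src hd x)
    (hj : hd x = j + 1) :
    i < Function.update hd x (nxt j) (src i) ↔ i < hd (src i) ∧ i ≠ j := by
  have h1 : src j = x := by have := hx.2 (by omega); rwa [hj] at this
  have h2 := hx.1
  have h3 := hl.le j (by omega)
  by_cases hi : src i = x
  · rw [hi, Function.update_self, hj]
    have := hl.gap j (by omega) i
    rw [h1] at this
    constructor
    · intro h; omega
    · intro h; by_contra h'; exact this (by omega) (by omega) hi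
  · rw [Function.update_of_ne hi]
    refine ⟨fun h => ⟨h, ?_⟩, fun h => h.1⟩
    rintro rfl; exact hi h1

theorem Links.card_remaining (hl : Links m src nxt) {x j : ℕ} (hx : IsHead m src hd x)
    (hj : hd x = j + 1) :
    (remaining m src (Function.update hd x (nxt j))).card + 1 = (remaining m src hd).card := by
  have h1 : src j = x := by have := hx.2 (by omega); rwa [hj] at this
  have h2 := hx.1
  have : remaining m src (Function.update hd x (nxt j)) = (remaining m src hd).erase j := by
    ext i
    simp only [remaining, Finset.mem_filter, Finset.mem_erase, hl.lt_update_iff hx hj]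
    tauto
  rw [this, Finset.card_erase_add_one]
  simp only [remaining, Finset.mem_filter, Finset.mem_range, h1]
  omega

theorem Links.isHead_update (hl : Links m src nxt) {x j y : ℕ} (hx : IsHead m src hd x)
    (hj : hd x = j + 1) (hy : IsHead m src hd y) :
    IsHead m src (Function.update hd x (nxt j)) y := by
  have h1 : src j = x := by have := hx.2 (by omega); rwa [hj] at this
  have h2 := hx.1
  by_cases h : y = x
  · subst h
    rw [IsHead, Function.update_self]
    have := hl.le j (by omega)
    exact ⟨by omega, fun h => (hl.src_eq j (by omega) h).trans h1⟩
  · rwa [IsHead, Function.update_of_ne h]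

/-- The edges of a graph, with jobs and machines numbered from zero, and the word bound `W` of a
run. -/
structure EdgeData (W nU m : ℕ) (eu ev : ℕ → ℕ) (σ : State) : Prop where
  reg0 : σ.reg 0 = nU
  reg2 : σ.reg 2 = m
  job : σ.mem 0 = eu
  machine : σ.mem 1 = ev
  job_lt : ∀ j < m, eu j < nU
  machine_le : ∀ j < m, ev j ≤ W
  bound : 2 * m + nU + 10 ≤ W

variable {nU : ℕ} {eu ev : ℕ → ℕ}

theorem EdgeData.of_frame (h : EdgeData W nU m eu ev σ₀) (hf : Frame p σ₀ σ)
    (h0 : 0 ∉ p.writes) (h1 : 1 ∉ p.writes) (h2 : 2 ∉ p.sets) (h3 : 0 ∉ p.sets) :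
    EdgeData W nU m eu ev σ :=
  ⟨(hf.reg 0 h3).trans h.reg0, (hf.reg 2 h2).trans h.reg2, (hf.mem 0 h0).trans h.job,
    (hf.mem 1 h1).trans h.machine, h.job_lt, h.machine_le, h.bound⟩

/-! The programs use the following registers and arrays of words. Registers: 0 the number of jobs, 1
the number of machines, 2 the number of edges, 3 the loop variable, 4 and 5 the current machines, 6
the current edge, 7 and 8 the ends of the queue, 9 the number of roots (overloaded machines), 10
whether an underloaded machine has been found, 11 the height of the stack, 12 the current root, 13 a
bound on the lengths of the intervals, 14 the number of cost centers, 15, 16 and 17 temporary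
values; during the computation of the ranks, registers 4 to 7 hold nodes of the tournament tree.
Arrays indexed by edges: 0 the jobs, 1 the machines, 3 the ranks of the cost centers of the slots,
11 the successors in the lists. Arrays indexed by jobs: 2 the assignment. Arrays indexed by
machines: 4 a counter of edges, 5 and 6 the interval of ranks, 7 the number of slots below its
middle, 8 the number of jobs, 9 the labels, 10 and 18 the heads of the lists for the depth-first and
the breadth-first search, 15 the middle of the interval. Others: 12 the depths of the subnetworks,
indexed by the lower ends of their intervals, 13 the queue, 14 and 19 the edges and the machines on
the path of the depth-first search, 17 the tournament tree. Array 0 of reals holds the costs of the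
slots.

The time bounds have the form `∃ c, c = 27 ∧ …`: the constant is explicit for the arithmetic, and
destructuring substitutes it. -/

/-- Clears the labels, the lists and the depths of the subnetworks. Only the entries that belong to
edges are visited, so that the time is `O(m)`. -/
def resetSearch : Program :=
  forLoop 3 2
    (.seq (.letWord 4 (.mem 1 (.reg 3)))
    (.seq (.putWord 9 (.reg 4) (.lit 0))
    (.seq (.putWord 10 (.reg 4) (.lit 0))
    (.seq (.putWord 18 (.reg 4) (.lit 0))
      (.putWord 12 (.mem 5 (.reg 4)) (.lit 0))))))

theorem resetSearch_runs (he : EdgeData W nU m eu ev σ)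
    (hlo : ∀ j < m, σ.mem 5 (ev j) ≤ W) : ∃ c, c = 27 ∧
    Runs W F resetSearch σ (c * (m + 1)) fun σ' => Frame resetSearch σ σ' ∧
      (∀ j < m, σ'.mem 9 (ev j) = 0 ∧ σ'.mem 10 (ev j) = 0 ∧ σ'.mem 18 (ev j) = 0 ∧
        σ'.mem 12 (σ.mem 5 (ev j)) = 0) ∧
      ∀ v, (∀ j < m, ev j ≠ v) → σ'.mem 9 v = σ.mem 9 v := by
  refine ⟨_, rfl, ?_⟩
  have hb := he.bound
  refine (Runs.forLoopWp (by decide) (by decide) (by decide) (by rw [he.reg2]; omega)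
    (fun k σ' => (∀ j < k, σ'.mem 9 (ev j) = 0 ∧ σ'.mem 10 (ev j) = 0 ∧ σ'.mem 18 (ev j) = 0 ∧
        σ'.mem 12 (σ.mem 5 (ev j)) = 0) ∧
      ∀ v, (∀ j < m, ev j ≠ v) → σ'.mem 9 v = σ.mem 9 v) ?_ ?_).mono ?_ ?_
  · simp
  · intro k σ' hk hk' hf hi
    rw [he.reg2] at hk
    have he' := he.of_frame hf (by decide) (by decide) (by decide) (by decide)
    have h5 : σ'.mem 5 = σ.mem 5 := hf.mem 5 (by decide)
    have := he.machine_le k hk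
    have := hlo k hk
    simp only [Program.Wp, WordExp.eval, hk', he'.machine, mem_setReg, mem_setMem, reg_setMem,
      reg_setReg]
    simp only [h5]
    norm_num
    refine ⟨by assumption, by assumption, fun j hj => ?_, fun v hv => ?_⟩
    · simp only [Function.update_apply]
      rcases Nat.lt_or_eq_of_le hj with h | rfl
      · have := hi.1 j h
        simp only [this]; simp
      · simp
    · rw [Function.update_of_ne (fun h => hv k hk h.symm)]; exact hi.2 v hv
  · rw [he.reg2]; simp only [Program.size, WordExp.steps]; omega
  · rintro σ' ⟨h1, h2⟩
    rw [he.reg2] at h2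
    exact ⟨h1, h2⟩

end RAM

namespace RAM

variable {W : ℕ} {F : ℕ → ℕ → ℝ} {σ : State} {m nU : ℕ} {eu ev : ℕ → ℕ}

/-- Builds the lists of the edges that leave the machines, where an edge leaves the machine to which
its job is assigned. -/
def buildLists : Program :=
  forLoop 3 2
    (.seq (.letWord 4 (.mem 2 (.mem 0 (.reg 3))))
    (.seq (.putWord 11 (.reg 3) (.mem 10 (.reg 4)))
    (.seq (.letWord 15 (.plus (.reg 3) (.lit 1)))
    (.seq (.putWord 10 (.reg 4) (.reg 15))
      (.putWord 18 (.reg 4) (.reg 15))))))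

theorem buildLists_runs {src : ℕ → ℕ} (he : EdgeData W nU m eu ev σ)
    (hsrc : ∀ j < m, σ.mem 2 (eu j) = src j) (hev : ∀ j < m, ∃ i < m, ev i = src j)
    (h0 : ∀ j < m, σ.mem 10 (ev j) = 0 ∧ σ.mem 18 (ev j) = 0) : ∃ c, c = 28 ∧
    Runs W F buildLists σ (c * (m + 1)) fun σ' => Frame buildLists σ σ' ∧
      Links m src (σ'.mem 11) ∧
      (∀ j < m, IsHead m src (σ'.mem 10) (ev j) ∧ σ'.mem 18 (ev j) = σ'.mem 10 (ev j)) ∧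
      ∀ j < m, j < σ'.mem 10 (src j) := by
  refine ⟨_, rfl, ?_⟩
  have hb := he.bound
  refine (Runs.forLoopWp (by decide) (by decide) (by decide) (by rw [he.reg2]; omega)
    (fun k σ' => Links k src (σ'.mem 11) ∧
      (∀ j < m, IsHead k src (σ'.mem 10) (ev j) ∧ σ'.mem 18 (ev j) = σ'.mem 10 (ev j)) ∧
      ∀ j < k, j < σ'.mem 10 (src j)) ?_ ?_).mono ?_ ?_
  · refine ⟨⟨by simp, by simp, by simp⟩, fun j hj => ?_, by simp⟩
    simp [IsHead, h0 j hj]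
  · intro k σ' hk hk' hf hi
    rw [he.reg2] at hk
    have he' := he.of_frame hf (by decide) (by decide) (by decide) (by decide)
    have h2 : σ'.mem 2 = σ.mem 2 := hf.mem 2 (by decide)
    obtain ⟨i, him, hie⟩ := hev k hk
    have := he.machine_le i him
    obtain ⟨hl, hh, hr⟩ := hi
    have hhi := hh i him
    rw [hie] at hhi
    have h3 := hhi.1.1
    simp only [Program.Wp, WordExp.eval, hk', he'.job, mem_setReg, mem_setMem, reg_setMem,
      reg_setReg, h2, hsrc k hk, if_true]
    norm_num
    refine ⟨by omega, by omega, by omega, by omega, by omega, by omega, by omega, by omega,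
      ?_, ?_, ?_⟩
    · refine ⟨fun j hj => ?_, fun j hj => ?_, fun j hj => ?_⟩
      · rcases Nat.lt_succ_iff_lt_or_eq.1 hj with h | rfl
        · rw [Function.update_of_ne h.ne]; exact hl.le j h
        · rw [Function.update_self]; exact h3
      · rcases Nat.lt_succ_iff_lt_or_eq.1 hj with h | rfl
        · rw [Function.update_of_ne h.ne]; exact hl.src_eq j h
        · rw [Function.update_self]; exact hhi.1.2
      · rcases Nat.lt_succ_iff_lt_or_eq.1 hj with h | rfl
        · rw [Function.update_of_ne h.ne]; exact hl.gap j h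
        · rw [Function.update_self]
          intro i' h4 h5 h6
          have := hr i' h5
          rw [h6] at this; omega
    · intro j hj
      obtain ⟨h4, h5⟩ := hh j hj
      rw [IsHead] at h4 ⊢
      by_cases h : ev j = src k
      · simp [h]
      · simp only [Function.update_of_ne h]
        exact ⟨⟨by omega, h4.2⟩, h5⟩
    · intro j hj
      by_cases h : src j = src k
      · rw [h, Function.update_self]; omega
      · rw [Function.update_of_ne h]
        refine hr j ?_
        rcases Nat.lt_or_eq_of_le hj with h' | rfl
        · exact h'
        · exact absurd rfl h
  · rw [he.reg2]; simp only [Program.size, WordExp.steps]; omega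
  · rintro σ' ⟨h1, h2⟩
    rw [he.reg2] at h2
    exact ⟨h1, h2⟩

/-! ### Breadth-first search -/

/-- The invariant of the search: `q` is the queue, in which the machines at the positions below `qh`
have been processed, and the edges that have been scanned are removed from the lists. The search
labels a machine when it enters the queue, and records in `Dm a` the depth of the first underloaded
machine of the subnetwork `a`. Here `src j` is the machine that the edge `j` leaves, `T` the number
of jobs that a machine should have and `deg` the number that it has. -/
structure SearchInv (m : ℕ) (ev src lo T deg : ℕ → ℕ) (d q hd Dm : ℕ → ℕ) (qh qt found : ℕ) :
    Prop where
  le : qh ≤ qt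
  queued : ∀ k < qt, d (q k) ≠ 0 ∧ (∃ j < m, ev j = q k) ∧ d (q k) ≤ k + 1
  mem_queue : ∀ v, d v ≠ 0 → ∃ k < qt, q k = v
  mono : ∀ k k', k ≤ k' → k' < qt → d (q k) ≤ d (q k')
  near : qh < qt → ∀ k < qt, d (q k) ≤ d (q qh) + 1
  one_iff : ∀ v, d v = 1 ↔ T v < deg v
  pred : ∀ v, 1 < d v → ∃ j < m, ev j = v ∧ lo (src j) = lo v ∧ d (src j) ≠ 0 ∧ d (src j) + 1 = d v
  head : ∀ j < m, IsHead m src hd (ev j)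
  scanned : ∀ j < m, hd (src j) ≤ j → d (src j) ≠ 0 ∧
    (lo (src j) = lo (ev j) → d (ev j) ≠ 0 ∧ d (ev j) ≤ d (src j) + 1)
  done : ∀ k < qh, hd (q k) = 0 ∨ (Dm (lo (q k)) ≠ 0 ∧ Dm (lo (q k)) ≤ d (q k))
  deficit : ∀ v, d v ≠ 0 → deg v < T v → Dm (lo v) = d v
  depth : ∀ j < m, Dm (lo (ev j)) ≠ 0 →
    ∃ v, d v ≠ 0 ∧ lo v = lo (ev j) ∧ d v = Dm (lo (ev j)) ∧ deg v < T v
  label_le : ∀ v, d v ≠ 0 → Dm (lo v) ≠ 0 → d v ≤ Dm (lo v)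
  found_iff : found ≠ 0 ↔ ∃ v, d v ≠ 0 ∧ deg v < T v

variable {src nxt lo T deg d q hd Dm : ℕ → ℕ} {qh qt found j : ℕ}

theorem SearchInv.next (h : SearchInv m ev src lo T deg d q hd Dm qh qt found) (hq : qh < qt)
    (hx : hd (q qh) = 0 ∨ (Dm (lo (q qh)) ≠ 0 ∧ Dm (lo (q qh)) ≤ d (q qh))) :
    SearchInv m ev src lo T deg d q hd Dm (qh + 1) qt found :=
  { h with
    le := hq
    near := fun h' k hk => (h.near hq k hk).trans
      (Nat.add_le_add_right (h.mono qh (qh + 1) (by omega) h') 1)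
    done := fun k hk => by
      rcases Nat.lt_succ_iff_lt_or_eq.1 hk with h' | rfl
      exacts [h.done k h', hx] }

theorem SearchInv.head_eq (h : SearchInv m ev src lo T deg d q hd Dm qh qt found) (hq : qh < qt)
    (hj : hd (q qh) = j + 1) : IsHead m src hd (q qh) ∧ j < m ∧ src j = q qh := by
  obtain ⟨-, ⟨i, hi, hie⟩, -⟩ := h.queued qh hq
  have h1 := h.head i hi
  rw [hie] at h1
  have h2 := h1.2 (by omega)
  rw [hj] at h2
  exact ⟨h1, by have := h1.1; omega, h2⟩

/-- An edge to another subnetwork or to a labelled machine is dropped. -/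
theorem SearchInv.skip (h : SearchInv m ev src lo T deg d q hd Dm qh qt found)
    (hl : Links m src nxt) (hq : qh < qt) (hj : hd (q qh) = j + 1)
    (hy : lo (ev j) = lo (q qh) → d (ev j) ≠ 0) :
    SearchInv m ev src lo T deg d q (Function.update hd (q qh) (nxt j)) Dm qh qt found := by
  obtain ⟨hx, hjm, hsj⟩ := h.head_eq hq hj
  refine { h with
    head := fun i hi => hl.isHead_update hx hj (h.head i hi)
    scanned := fun i hi h1 => ?_
    done := fun k hk => ?_ }
  · by_cases h2 : i = j
    · subst h2
      rw [hsj]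
      refine ⟨(h.queued qh hq).1, fun h3 => ⟨hy h3.symm, ?_⟩⟩
      obtain ⟨k, hk, hk'⟩ := h.mem_queue _ (hy h3.symm)
      rw [← hk']; exact h.near hq k hk
    · refine h.scanned i hi ?_
      by_contra h3
      exact absurd ((hl.lt_update_iff hx hj).2 ⟨by omega, h2⟩) (by omega)
  · have := h.done k hk
    by_cases h1 : q k = q qh
    · rw [h1] at this ⊢
      exact Or.inr (this.resolve_left (by omega))
    · rwa [Function.update_of_ne h1]

/-- A new machine enters the queue. -/
theorem SearchInv.push (h : SearchInv m ev src lo T deg d q hd Dm qh qt found)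
    (hl : Links m src nxt) (hq : qh < qt) (hj : hd (q qh) = j + 1)
    (hD : Dm (lo (q qh)) = 0 ∨ d (q qh) < Dm (lo (q qh)))
    (hy : lo (ev j) = lo (q qh)) (hd0 : d (ev j) = 0) :
    SearchInv m ev src lo T deg (Function.update d (ev j) (d (q qh) + 1))
      (Function.update q qt (ev j)) (Function.update hd (q qh) (nxt j))
      (if deg (ev j) < T (ev j) then Function.update Dm (lo (ev j)) (d (q qh) + 1) else Dm)
      qh (qt + 1) (if deg (ev j) < T (ev j) then 1 else found) := by
  obtain ⟨hx, hjm, hsj⟩ := h.head_eq hq hj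
  set y := ev j with hyd
  set x := q qh with hxd
  have hdx := h.queued qh hq
  rw [← hxd] at hdx
  have hne : ∀ v, d v ≠ 0 → v ≠ y := by rintro v hv rfl; exact hv hd0
  have hdv : ∀ v, d v ≠ 0 → Function.update d y (d x + 1) v = d v := fun v hv =>
    Function.update_of_ne (hne v hv) _ _
  have hmax : ∀ v, d v ≠ 0 → d v ≤ d x + 1 := fun v hv => by
    obtain ⟨k, hk, hk'⟩ := h.mem_queue v hv
    rw [← hk']; exact h.near hq k hk
  have hqk : ∀ k < qt, Function.update q qt y k = q k := fun k hk => Function.update_of_ne hk.ne _ _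
  have hDx : Dm (lo y) ≠ 0 → Dm (lo y) = d x + 1 := by
    intro h1
    obtain ⟨v, h2, h3, h4, h5⟩ := h.depth j hjm h1
    have := hmax v h2
    rw [hy] at h1 h4 ⊢
    have := hD.resolve_left h1
    omega
  -- Recording a second underloaded machine does not change the depth.
  set Dm' := if deg y < T y then Function.update Dm (lo y) (d x + 1) else Dm with hDm'
  have hD' : ∀ a, Dm a ≠ 0 → Dm' a = Dm a := by
    intro a ha
    rw [hDm']
    split_ifs with h1
    · by_cases h2 : a = lo y
      · subst h2; rw [Function.update_self, hDx ha]
      · rw [Function.update_of_ne h2]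
    · rfl
  have hD'' : ∀ a, Dm' a ≠ 0 → Dm' a = Dm a ∨ (a = lo y ∧ Dm' a = d x + 1 ∧ deg y < T y) := by
    intro a ha
    rw [hDm'] at ha ⊢
    split_ifs with h1
    · by_cases h2 : a = lo y
      · subst h2; right; rw [Function.update_self]; exact ⟨rfl, rfl, h1⟩
      · rw [Function.update_of_ne h2]; exact Or.inl rfl
    · exact Or.inl rfl
  have hTy : ¬ T y < deg y := fun h1 => by have := (h.one_iff y).2 h1; omega
  refine ⟨by have := h.le; omega, fun k hk => ?_, fun v hv => ?_, fun k k' hk hk' => ?_,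
    fun _ k hk => ?_, fun v => ?_, fun v hv => ?_,
    fun i hi => hl.isHead_update hx hj (h.head i hi), fun i hi h1 => ?_, fun k hk => ?_,
    fun v hv h1 => ?_, fun i hi h1 => ?_, fun v hv h1 => ?_, ?_⟩
  · rcases Nat.lt_succ_iff_lt_or_eq.1 hk with h' | rfl
    · have := h.queued k h'
      rwa [hqk k h', hdv _ this.1]
    · rw [Function.update_self, Function.update_self]
      exact ⟨by omega, ⟨j, hjm, rfl⟩, by omega⟩
  · by_cases h1 : v = y
    · exact ⟨qt, by omega, by rw [Function.update_self, h1]⟩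
    · rw [Function.update_of_ne h1] at hv
      obtain ⟨k, hk, hk'⟩ := h.mem_queue v hv
      exact ⟨k, by omega, by rwa [hqk k hk]⟩
  · rcases Nat.lt_succ_iff_lt_or_eq.1 hk' with h' | rfl
    · rw [hqk k (by omega), hqk k' h', hdv _ (h.queued k (by omega)).1, hdv _ (h.queued k' h').1]
      exact h.mono k k' hk h'
    · rw [Function.update_self, Function.update_self]
      rcases Nat.lt_or_eq_of_le hk with h' | rfl
      · rw [hqk k h', hdv _ (h.queued k h').1]; exact hmax _ (h.queued k h').1
      · rw [Function.update_self, Function.update_self]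
  · rw [hqk qh hq, ← hxd, hdv x hdx.1]
    rcases Nat.lt_succ_iff_lt_or_eq.1 hk with h' | rfl
    · rw [hqk k h', hdv _ (h.queued k h').1]; exact hmax _ (h.queued k h').1
    · rw [Function.update_self, Function.update_self]
  · by_cases h1 : v = y
    · subst h1; rw [Function.update_self]
      exact ⟨fun h => by have := hdx.1; omega, fun h => absurd h hTy⟩
    · rw [Function.update_of_ne h1]; exact h.one_iff v
  · by_cases h1 : v = y
    · subst h1
      refine ⟨j, hjm, rfl, ?_, ?_, ?_⟩
      · rw [hsj]; exact hy.symm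
      · rw [hsj, hdv x hdx.1]; exact hdx.1
      · rw [hsj, hdv x hdx.1, Function.update_self]
    · rw [Function.update_of_ne h1] at hv ⊢
      obtain ⟨i, h2, h3, h4, h5, h6⟩ := h.pred v hv
      exact ⟨i, h2, h3, h4, by rwa [hdv _ h5], by rwa [hdv _ h5]⟩
  · by_cases h2 : i = j
    · subst h2
      rw [hsj, hdv x hdx.1, Function.update_self]
      exact ⟨hdx.1, fun _ => ⟨by omega, le_rfl⟩⟩
    · obtain ⟨h3, h4⟩ := h.scanned i hi (by
        by_contra h3
        exact absurd ((hl.lt_update_iff hx hj).2 ⟨by omega, h2⟩) (by omega))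
      rw [hdv _ h3]
      refine ⟨h3, fun h5 => ?_⟩
      obtain ⟨h6, h7⟩ := h4 h5
      rw [hdv _ h6]; exact ⟨h6, h7⟩
  · have h1 := h.done k hk
    have h2 := h.queued k (by omega)
    rw [hqk k (by omega), hdv _ h2.1]
    by_cases h3 : q k = x
    · rw [h3] at h1 ⊢
      obtain ⟨h4, h5⟩ := h1.resolve_left (by omega)
      right; rw [hD' _ h4]; exact ⟨h4, h5⟩
    · rw [Function.update_of_ne h3]
      refine h1.imp_right fun ⟨h4, h5⟩ => ?_
      rw [hD' _ h4]; exact ⟨h4, h5⟩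
  · by_cases h2 : v = y
    · subst h2; rw [hDm', if_pos h1, Function.update_self, Function.update_self]
    · rw [Function.update_of_ne h2] at hv ⊢
      have := h.deficit v hv h1
      rw [hD' _ (by omega), this]
  · rcases hD'' _ h1 with h2 | ⟨h2, h3, h4⟩
    · rw [h2] at h1 ⊢
      obtain ⟨v, h5, h6, h7, h8⟩ := h.depth i hi h1
      exact ⟨v, by rwa [hdv v h5], h6, by rwa [hdv v h5], h8⟩
    · exact ⟨y, by rw [Function.update_self]; omega, h2.symm, by rw [Function.update_self, h3], h4⟩
  · by_cases h2 : v = y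
    · subst h2
      rw [Function.update_self]
      rcases hD'' _ h1 with h3 | ⟨-, h3, -⟩
      · rw [h3] at h1 ⊢; rw [hDx h1]
      · rw [h3]
    · rw [Function.update_of_ne h2] at hv ⊢
      rcases hD'' _ h1 with h3 | ⟨-, h3, -⟩
      · rw [h3] at h1 ⊢; exact h.label_le v hv h1
      · rw [h3]; exact hmax v hv
  · split_ifs with h1
    · exact ⟨fun _ => ⟨y, by rw [Function.update_self]; omega, h1⟩, fun _ => one_ne_zero⟩
    · rw [h.found_iff]
      constructor
      · rintro ⟨v, h2, h3⟩; exact ⟨v, by rwa [hdv v h2], h3⟩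
      · rintro ⟨v, h2, h3⟩
        have h4 : v ≠ y := by rintro rfl; exact h1 h3
        rw [Function.update_of_ne h4] at h2
        exact ⟨v, h2, h3⟩

end RAM

namespace RAM

variable {W : ℕ} {F : ℕ → ℕ → ℝ} {σ : State} {m nU : ℕ} {eu ev src lo T deg nxt : ℕ → ℕ}

/-- The machines with label one are those at the first `r` positions of the queue. -/
def IsRoots (d q : ℕ → ℕ) (r : ℕ) : Prop :=
  (∀ k < r, d (q k) = 1) ∧ ∀ v, d v = 1 → ∃ k < r, q k = v

theorem IsRoots.push {d q : ℕ → ℕ} {r x y qt : ℕ} (h : IsRoots d q r) (hr : r ≤ qt) (hx : d x ≠ 0)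
    (hy : d y = 0) : IsRoots (Function.update d y (d x + 1)) (Function.update q qt y) r := by
  have hq : ∀ k < r, Function.update q qt y k = q k := fun k hk =>
    Function.update_of_ne (by omega) _ _
  refine ⟨fun k hk => ?_, fun v hv => ?_⟩
  · rw [hq k hk, Function.update_of_ne]
    · exact h.1 k hk
    · intro h'; have := h.1 k hk; rw [h', hy] at this; omega
  · by_cases h' : v = y
    · rw [h', Function.update_self] at hv; omega
    · rw [Function.update_of_ne h'] at hv
      obtain ⟨k, hk, hk'⟩ := h.2 v hv
      exact ⟨k, hk, by rw [hq k hk, hk']⟩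

/-- Puts the overloaded machines into the queue. -/
def initSearch : Program :=
  .seq (.letWord 8 (.lit 0))
  (.seq (forLoop 3 2
    (.seq (.letWord 4 (.mem 1 (.reg 3)))
      (.ite (.wordLt (.mem 7 (.reg 4)) (.mem 8 (.reg 4)))
        (.seq (.putWord 9 (.reg 4) (.lit 1))
        (.seq (.putWord 13 (.reg 8) (.reg 4))
          (.letWord 8 (.plus (.reg 8) (.lit 1)))))
        .nop)))
  (.seq (.letWord 7 (.lit 0))
  (.seq (.letWord 9 (.reg 8))
    (.letWord 10 (.lit 0)))))

theorem initSearch_runs (he : EdgeData W nU m eu ev σ) (hT : σ.mem 7 = T) (hdeg : σ.mem 8 = deg)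
    (hd : ∀ v, σ.mem 9 v = 0) (hover : ∀ v, T v < deg v → ∃ j < m, ev j = v)
    (hhead : ∀ j < m, IsHead m src (σ.mem 18) (ev j)) (hhd : ∀ j < m, j < σ.mem 18 (src j))
    (hD : ∀ j < m, σ.mem 12 (lo (ev j)) = 0) : ∃ c, c = 45 ∧
    Runs W F initSearch σ (c * (m + 1)) fun σ' => Frame initSearch σ σ' ∧
      SearchInv m ev src lo T deg (σ'.mem 9) (σ'.mem 13) (σ'.mem 18) (σ'.mem 12)
        (σ'.reg 7) (σ'.reg 8) (σ'.reg 10) ∧ σ'.reg 7 = 0 ∧ σ'.reg 8 ≤ m ∧ σ'.reg 9 = σ'.reg 8 ∧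
        IsRoots (σ'.mem 9) (σ'.mem 13) (σ'.reg 9) := by
  refine ⟨_, rfl, ?_⟩
  have hb := he.bound
  suffices h : Runs W F initSearch σ (45 * (m + 1)) fun σ' => σ'.reg 8 ≤ m ∧ σ'.reg 7 = 0 ∧
      σ'.reg 9 = σ'.reg 8 ∧ σ'.reg 10 = 0 ∧
      (∀ v, σ'.mem 9 v ≠ 0 → σ'.mem 9 v = 1 ∧ T v < deg v ∧ ∃ k < σ'.reg 8, σ'.mem 13 k = v) ∧
      (∀ k < σ'.reg 8, σ'.mem 9 (σ'.mem 13 k) = 1 ∧ ∃ j < m, ev j = σ'.mem 13 k) ∧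
      ∀ j < m, T (ev j) < deg (ev j) → σ'.mem 9 (ev j) = 1 by
    refine h.frame.mono le_rfl ?_
    rintro σ' ⟨⟨h1, h2, h3, h4, h5, h6, h7⟩, hf⟩
    have e12 : σ'.mem 12 = σ.mem 12 := hf.mem 12 (by decide)
    have e18 : σ'.mem 18 = σ.mem 18 := hf.mem 18 (by decide)
    rw [e12, e18, h2, h4]
    refine ⟨hf, ⟨Nat.zero_le _, fun k hk => ⟨by rw [(h6 k hk).1]; exact one_ne_zero, (h6 k hk).2,
      by rw [(h6 k hk).1]; omega⟩, fun v hv => (h5 v hv).2.2, fun k k' hk hk' => ?_,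
      fun _ k hk => by rw [(h6 k hk).1]; omega, fun v => ?_, fun v hv => ?_, hhead,
      fun j hj h8 => ?_, by simp, fun v hv h8 => ?_, fun j hj h8 => absurd (hD j hj) h8,
      fun v hv h8 => ?_, ?_⟩, rfl, h1, h3, by
        rw [h3]; exact ⟨fun k hk => (h6 k hk).1, fun v hv => (h5 v (by omega)).2.2⟩⟩
    · rw [(h6 k (by omega)).1, (h6 k' hk').1]
    · constructor
      · intro h; exact (h5 v (by omega)).2.1
      · intro h
        obtain ⟨j, hj, rfl⟩ := hover v h
        exact h7 j hj h
    · have := (h5 v (by omega)).1; omega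
    · have := hhd j hj; omega
    · have := (h5 v hv).2.1; omega
    · obtain ⟨-, h9, -⟩ := h5 v hv
      obtain ⟨j, hj, rfl⟩ := hover v h9
      exact absurd (hD j hj) h8
    · simp only [ne_eq, not_true_eq_false, false_iff, not_exists, not_and, not_lt]
      intro v hv; exact (h5 v hv).2.1.le
  have e0 : Runs W F (.letWord 8 (.lit 0)) σ 2 fun σ' => σ' = σ.setReg 8 0 :=
    ⟨_, _, .letWord _ _ _ (Nat.zero_le _), le_rfl, rfl⟩
  refine (e0.seq (B' := 40 * (m + 1)) ?_).mono (by omega) fun _ h => h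
  rintro _ rfl
  have he0 : EdgeData W nU m eu ev (σ.setReg 8 0) :=
    ⟨by simp [he.reg0], by simp [he.reg2], he.job, he.machine, he.job_lt, he.machine_le, he.bound⟩
  have e1 := Runs.forLoopWp (W := W) (F := F) (σ₀ := σ.setReg 8 0) (x := 3) (n := 2) (p :=
    (.seq (.letWord 4 (.mem 1 (.reg 3)))
      (.ite (.wordLt (.mem 7 (.reg 4)) (.mem 8 (.reg 4)))
        (.seq (.putWord 9 (.reg 4) (.lit 1))
        (.seq (.putWord 13 (.reg 8) (.reg 4))
          (.letWord 8 (.plus (.reg 8) (.lit 1)))))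
        .nop))) (by decide) (by decide) (by decide) (by rw [he0.reg2]; omega)
    (fun k σ' => σ'.reg 8 ≤ k ∧
      (∀ v, σ'.mem 9 v ≠ 0 → σ'.mem 9 v = 1 ∧ T v < deg v ∧ ∃ k < σ'.reg 8, σ'.mem 13 k = v) ∧
      (∀ k < σ'.reg 8, σ'.mem 9 (σ'.mem 13 k) = 1 ∧ ∃ j < m, ev j = σ'.mem 13 k) ∧
      ∀ j < k, T (ev j) < deg (ev j) → σ'.mem 9 (ev j) = 1) ?_ ?_
  · refine (e1.seq (B' := 8) (R := fun σ' => _) ?_).mono ?_ fun _ h => h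
    · rintro σ' ⟨hf, h1, h2, h3, h4⟩
      rw [he0.reg2] at h1 h4
      refine Program.Wp.runs (p := .seq (.letWord 7 (.lit 0))
        (.seq (.letWord 9 (.reg 8)) (.letWord 10 (.lit 0)))) ?_ |>.mono (by decide) fun _ h => h
      simp only [Program.Wp, WordExp.eval, reg_setReg]
      norm_num
      exact ⟨by omega, h1, h2, h3, h4⟩
    · rw [he0.reg2]; norm_num [Program.size, WordExp.steps, Test.steps]; omega
  · simp [hd]
  · intro k σ' hk hk' hf ⟨h1, h2, h3, h4⟩
    rw [he0.reg2] at hk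
    have he' := he0.of_frame hf (by decide) (by decide) (by decide) (by decide)
    have e7 : σ'.mem 7 = T := (hf.mem 7 (by decide)).trans hT
    have e8 : σ'.mem 8 = deg := (hf.mem 8 (by decide)).trans hdeg
    have := he.machine_le k hk
    simp only [Program.Wp, Test.Holds, WordExp.eval, hk', he'.machine, mem_setReg, mem_setMem,
      reg_setMem, reg_setReg]
    norm_num
    simp only [e7, e8]
    refine ⟨by assumption, fun h => ⟨by omega, by omega, by omega, by omega, by omega, by omega,
      fun v => ?_, fun i hi => ?_, fun j hj => ?_⟩, fun h => ⟨by omega, h2, h3, fun j hj => ?_⟩⟩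
    · simp only [Function.update_apply]
      split_ifs with h5
      · subst h5
        refine fun _ => ⟨rfl, h, σ'.reg 8, by omega, by simp⟩
      · intro h6
        obtain ⟨h7, h8, i, h9, h10⟩ := h2 v h6
        refine ⟨h7, h8, i, by omega, ?_⟩
        rw [if_neg (by omega)]; exact h10
    · simp only [Function.update_apply]
      rcases Nat.lt_or_eq_of_le hi with h' | rfl
      · obtain ⟨h5, h6⟩ := h3 i h'
        rw [if_neg h'.ne]
        refine ⟨?_, h6⟩
        split_ifs
        · rfl
        · exact h5
      · rw [if_pos rfl, if_pos rfl]; exact ⟨rfl, k, hk, rfl⟩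
    · simp only [Function.update_apply]
      split_ifs with h5
      · exact fun _ => rfl
      · refine h4 j ?_
        rcases Nat.lt_or_eq_of_le hj with h' | rfl
        · exact h'
        · exact absurd rfl h5
    · rcases Nat.lt_or_eq_of_le hj with h' | rfl
      · exact h4 j h'
      · intro h'; omega

/-- One step of the breadth-first search: the first machine of the queue either scans its next edge
or leaves the queue. Beyond the depth of an underloaded machine nothing is scanned. -/
def searchStep : Program :=
  .seq (.letWord 4 (.mem 13 (.reg 7)))
  (.seq (.letWord 15 (.mem 18 (.reg 4)))
  (.seq (.letWord 16 (.mem 12 (.mem 5 (.reg 4))))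
  (.seq (.letWord 17 (.plus (.mem 9 (.reg 4)) (.lit 1)))
  (.ite (.wordEq (.reg 15) (.lit 0))
    (.letWord 7 (.plus (.reg 7) (.lit 1)))
    (.ite (.wordLt (.lit 0) (.times (.reg 16) (.minus (.reg 17) (.reg 16))))
      (.letWord 7 (.plus (.reg 7) (.lit 1)))
      (.seq (.letWord 6 (.minus (.reg 15) (.lit 1)))
      (.seq (.putWord 18 (.reg 4) (.mem 11 (.reg 6)))
      (.seq (.letWord 5 (.mem 1 (.reg 6)))
      (.ite (.wordEq (.mem 9 (.reg 5)) (.lit 0))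
        (.ite (.wordEq (.mem 5 (.reg 5)) (.mem 5 (.reg 4)))
          (.seq (.putWord 9 (.reg 5) (.reg 17))
          (.seq (.putWord 13 (.reg 8) (.reg 5))
          (.seq (.letWord 8 (.plus (.reg 8) (.lit 1)))
          (.ite (.wordLt (.mem 8 (.reg 5)) (.mem 7 (.reg 5)))
            (.seq (.putWord 12 (.mem 5 (.reg 5)) (.reg 17))
              (.letWord 10 (.lit 1)))
            .nop))))
          .nop)
        .nop)))))))))

/-- The breadth-first search takes time `O(m)`: every step removes a machine from the queue or an
edge from a list, and a removed edge pays for the machine that it may add to the queue. -/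
theorem search_runs {r : ℕ} (he : EdgeData W nU m eu ev σ) (hlo : σ.mem 5 = lo) (hT : σ.mem 7 = T)
    (hdeg : σ.mem 8 = deg) (hnxt : σ.mem 11 = nxt) (hl : Links m src nxt)
    (hloW : ∀ j < m, lo (ev j) ≤ W)
    (hinv : SearchInv m ev src lo T deg (σ.mem 9) (σ.mem 13) (σ.mem 18) (σ.mem 12)
      (σ.reg 7) (σ.reg 8) (σ.reg 10)) (hqt : σ.reg 8 ≤ m) (hr : r ≤ σ.reg 8)
    (hroot : IsRoots (σ.mem 9) (σ.mem 13) r) : ∃ c, c = 210 ∧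
    Runs W F (.loop (.wordLt (.reg 7) (.reg 8)) searchStep) σ (c * (m + 1)) fun σ' =>
      Frame searchStep σ σ' ∧
      SearchInv m ev src lo T deg (σ'.mem 9) (σ'.mem 13) (σ'.mem 18) (σ'.mem 12)
        (σ'.reg 8) (σ'.reg 8) (σ'.reg 10) ∧ r ≤ σ'.reg 8 ∧ IsRoots (σ'.mem 9) (σ'.mem 13) r := by
  refine ⟨_, rfl, ?_⟩
  have hb := he.bound
  have hrem : (remaining m src (σ.mem 18)).card ≤ m :=
    (Finset.card_filter_le _ _).trans (by simp)
  refine (Runs.loopWp (fun σ' => SearchInv m ev src lo T deg (σ'.mem 9) (σ'.mem 13) (σ'.mem 18)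
      (σ'.mem 12) (σ'.reg 7) (σ'.reg 8) (σ'.reg 10) ∧
      σ'.reg 8 + (remaining m src (σ'.mem 18)).card ≤ 2 * m ∧ r ≤ σ'.reg 8 ∧
      IsRoots (σ'.mem 9) (σ'.mem 13) r)
    (fun σ' => σ'.reg 8 - σ'.reg 7 + 2 * (remaining m src (σ'.mem 18)).card)
    ⟨hinv, by omega, hr, hroot⟩ ?_).mono ?_ ?_
  · rintro σ' hf ⟨hi, hq, hr, hro⟩ hlt
    simp only [Test.Holds, WordExp.eval] at hlt
    have he' := he.of_frame hf (by decide) (by decide) (by decide) (by decide)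
    have e5 : σ'.mem 5 = lo := (hf.mem 5 (by decide)).trans hlo
    have e7 : σ'.mem 7 = T := (hf.mem 7 (by decide)).trans hT
    have e8 : σ'.mem 8 = deg := (hf.mem 8 (by decide)).trans hdeg
    have e11 : σ'.mem 11 = nxt := (hf.mem 11 (by decide)).trans hnxt
    obtain ⟨hx0, ⟨i, him, hie⟩, hxk⟩ := hi.queued _ hlt
    have hxW := he.machine_le i him
    rw [hie] at hxW
    have hhx := hi.head i him
    rw [hie] at hhx
    have hhm := hhx.1
    have hDW : σ'.mem 12 (lo (σ'.mem 13 (σ'.reg 7))) ≤ W := by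
      by_cases h0 : σ'.mem 12 (lo (ev i)) = 0
      · rw [hie] at h0; omega
      · obtain ⟨v, h1, h2, h3, h4⟩ := hi.depth i him h0
        obtain ⟨k, h5, h6⟩ := hi.mem_queue v h1
        have := (hi.queued k h5).2.2
        rw [h6, h3, hie] at this; omega
    have hnext : (σ'.mem 18 (σ'.mem 13 (σ'.reg 7)) = 0 ∨
        (σ'.mem 12 (lo (σ'.mem 13 (σ'.reg 7))) ≠ 0 ∧
        σ'.mem 12 (lo (σ'.mem 13 (σ'.reg 7))) ≤ σ'.mem 9 (σ'.mem 13 (σ'.reg 7)))) →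
        SearchInv m ev src lo T deg (σ'.mem 9) (σ'.mem 13) (σ'.mem 18)
        (σ'.mem 12) (σ'.reg 7 + 1) (σ'.reg 8) (σ'.reg 10) := hi.next hlt
    simp only [searchStep, Program.Wp, Test.Holds, WordExp.eval, he'.machine, mem_setReg,
      mem_setMem, reg_setMem, reg_setReg, e5, e7, e8, e11]
    norm_num [e5, e7, e8, e11]
    have hqW : σ'.reg 8 ≤ W := by omega
    refine ⟨hxW, by omega, hDW, by omega, fun h1 => ⟨by omega, ⟨hnext (Or.inl h1), hq, hr, hro⟩,
      by omega⟩, fun h1 => ⟨fun h2 h3 => ⟨by omega, ⟨hnext (Or.inr ⟨by omega, h3⟩), hq, hr, hro⟩,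
      by omega⟩, fun h2 => ?_⟩⟩
    obtain ⟨j, hj⟩ : ∃ j, σ'.mem 18 (σ'.mem 13 (σ'.reg 7)) = j + 1 :=
      ⟨_, (Nat.succ_pred_eq_of_pos (Nat.pos_of_ne_zero h1)).symm⟩
    obtain ⟨-, hjm, hsj⟩ := hi.head_eq hlt hj
    have hcard := hl.card_remaining hhx hj
    have hle := hl.le j hjm
    have hyW := he.machine_le j hjm
    have hlW := hloW j hjm
    simp only [hj, Nat.add_sub_cancel]
    refine ⟨by omega, hxW, by omega, hyW, fun h3 => ⟨fun h4 => ?_, fun h4 => ?_⟩, fun h3 => ?_⟩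
    · have hpush := hi.push hl hlt hj (by omega) h4 h3
      refine ⟨hyW, by omega, hqW, hyW, by omega, fun h5 => ⟨hlW, by omega, by omega,
        ⟨?_, by omega, by omega, hro.push hr hx0 h3⟩, by omega⟩,
        fun h5 => ⟨⟨?_, by omega, by omega, hro.push hr hx0 h3⟩, by omega⟩⟩
      · rwa [if_pos h5, if_pos h5] at hpush
      · rwa [if_neg (by omega), if_neg (by omega)] at hpush
    · exact ⟨⟨hi.skip hl hlt hj fun h => absurd h h4, by omega, hr, hro⟩, by omega⟩
    · exact ⟨⟨hi.skip hl hlt hj fun _ => h3, by omega, hr, hro⟩, by omega⟩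
  · norm_num [searchStep, Program.size, Test.steps, WordExp.steps]; omega
  · rintro σ' ⟨hf, ⟨hi, -, hr, h1⟩, hlt⟩
    simp only [Test.Holds, WordExp.eval] at hlt
    rw [show σ'.reg 7 = σ'.reg 8 by have := hi.le; omega] at hi
    exact ⟨hf, hi, hr, h1⟩

end RAM

namespace RAM

/-! ### Depth-first search for a blocking set of augmenting paths -/

/-- The number of jobs below `nU` that are assigned to the machine `v`. -/
def jobCount (nU : ℕ) (μ : ℕ → ℕ) (v : ℕ) : ℕ := ((Finset.range nU).filter fun u => μ u = v).card

theorem jobCount_le (nU : ℕ) (μ : ℕ → ℕ) (v : ℕ) : jobCount nU μ v ≤ nU :=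
  (Finset.card_filter_le _ _).trans (by simp)

theorem jobCount_update {nU : ℕ} (μ : ℕ → ℕ) {u : ℕ} (hu : u < nU) (y v : ℕ) :
    jobCount nU (Function.update μ u y) v + (if v = μ u then 1 else 0) =
      jobCount nU μ v + (if v = y then 1 else 0) := by
  have hu' : u ∈ Finset.range nU := by simpa using hu
  simp only [jobCount, Finset.card_filter]
  rw [← Finset.add_sum_erase _ _ hu', ← Finset.add_sum_erase (Finset.range nU) _ hu']
  have : ∑ x ∈ (Finset.range nU).erase u, (if Function.update μ u y x = v then 1 else 0) =
      ∑ x ∈ (Finset.range nU).erase u, if μ x = v then 1 else 0 :=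
    Finset.sum_congr rfl fun x hx => by rw [Function.update_of_ne (Finset.ne_of_mem_erase hx)]
  rw [this, Function.update_self]
  split_ifs <;> omega

/-- The invariant of the depth-first search. The edges `st 0, …, st (sp - 1)` form a path from the
root `vx 0 = q i` to the machine `vx sp`, and their jobs have already been moved along the path. The
assignment `ν` is obtained from `μ` by moving these jobs back; it differs from the assignment `μ₀`
before the round by complete paths only. The predicate `Lead` stands for the machines that lead to
an underloaded machine. An edge to the next layer that has been removed from its list lies on the
path, or its job has moved, or it leads to a machine that is dead: its list is empty and it is not
underloaded. -/
structure AugmentInv (m nU : ℕ) (eu ev μ₀ lo T d q : ℕ → ℕ) (Lead : ℕ → Prop) (r : ℕ)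
    (μ deg hd st vx : ℕ → ℕ) (sp i : ℕ) (ν : ℕ → ℕ) : Prop where
  le : i ≤ r
  root : sp ≠ 0 → i < r ∧ vx 0 = q i ∧ T (vx 0) < jobCount nU ν (vx 0)
  load : ∀ v, deg v = jobCount nU μ v
  base : ∀ v, deg v + (if v = vx 0 then 1 else 0) =
    jobCount nU ν v + (if v = vx sp then 1 else 0)
  stack : ∀ k < sp, st k < m ∧ ev (st k) = vx (k + 1) ∧ lo (vx (k + 1)) = lo (vx k) ∧
    ν (eu (st k)) = vx k ∧ μ₀ (eu (st k)) = vx k ∧ μ (eu (st k)) = vx (k + 1)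
  depth : sp ≠ 0 → ∀ k ≤ sp, d (vx k) = k + 1
  off : ∀ u < nU, μ u ≠ ν u → ∃ k < sp, eu (st k) = u
  job : ∀ u < nU, ν u = μ₀ u ∨ ((∃ j < m, eu j = u ∧ ev j = ν u) ∧ lo (ν u) = lo (μ₀ u) ∧
    d (μ₀ u) ≠ 0 ∧ d (ν u) = d (μ₀ u) + 1 ∧ Lead (ν u))
  down : ∀ v, jobCount nU ν v < jobCount nU μ₀ v → T v ≤ jobCount nU ν v ∧ Lead v
  up : ∀ v, jobCount nU μ₀ v < jobCount nU ν v → jobCount nU ν v ≤ T v ∧ d v ≠ 0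
  head : ∀ j < m, IsHead m (fun j => μ₀ (eu j)) hd (ev j)
  done : ∀ j < m, hd (μ₀ (eu j)) ≤ j → (∃ k < sp, st k = j) ∨
    (lo (ev j) = lo (μ₀ (eu j)) → d (ev j) = d (μ₀ (eu j)) + 1 →
      ν (eu j) ≠ μ₀ (eu j) ∨ (hd (ev j) = 0 ∧ T (ev j) ≤ jobCount nU ν (ev j)))
  roots : ∀ k < i, jobCount nU ν (q k) ≤ T (q k) ∨ hd (q k) = 0

variable {m nU : ℕ} {eu ev μ₀ lo T d q nxt : ℕ → ℕ} {Lead : ℕ → Prop} {r : ℕ}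
  {μ deg hd st vx : ℕ → ℕ} {sp i j : ℕ} {ν : ℕ → ℕ}

theorem AugmentInv.setRoot (h : AugmentInv m nU eu ev μ₀ lo T d q Lead r μ deg hd st vx sp i ν) :
    AugmentInv m nU eu ev μ₀ lo T d q Lead r μ deg hd st (Function.update vx 0 (q i)) sp i ν := by
  by_cases hsp : sp = 0
  · subst hsp
    exact { h with
      root := fun h => absurd rfl h
      base := fun v => by have := h.base v; omega
      stack := fun k hk => absurd hk (by omega)
      depth := fun h => absurd rfl h }
  · rwa [← (h.root hsp).2.1, Function.update_eq_self]

theorem AugmentInv.depth' (h : AugmentInv m nU eu ev μ₀ lo T d q Lead r μ deg hd st vx sp i ν)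
    (hr : vx 0 = q i) (hq : d (q i) = 1) : ∀ k ≤ sp, d (vx k) = k + 1 := by
  by_cases hsp : sp = 0
  · intro k hk
    rw [show k = 0 by omega, hr, hq]
  · exact h.depth hsp

theorem AugmentInv.nextRoot (h : AugmentInv m nU eu ev μ₀ lo T d q Lead r μ deg hd st vx 0 i ν)
    (hi : i < r) (hr : vx 0 = q i) (hv : deg (q i) ≤ T (q i) ∨ hd (q i) = 0) :
    AugmentInv m nU eu ev μ₀ lo T d q Lead r μ deg hd st vx 0 (i + 1) ν :=
  { h with
    le := hi
    root := fun h => absurd rfl h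
    roots := fun k hk => by
      rcases Nat.lt_succ_iff_lt_or_eq.1 hk with h' | rfl
      · exact h.roots k h'
      · have := h.base (q k)
        rw [show deg (q k) = jobCount nU ν (q k) by omega] at hv
        exact hv }

/-- The path has reached a machine that was underloaded. The moves of its jobs become permanent. -/
theorem AugmentInv.absorb (h : AugmentInv m nU eu ev μ₀ lo T d q Lead r μ deg hd st vx sp i ν)
    (hjob : ∀ j < m, eu j < nU) (hsp : sp ≠ 0) (hv : deg (vx sp) ≤ T (vx sp))
    (hbase : ∀ v, (∃ j < m, ev j = v) → d v ≠ 0 → jobCount nU μ₀ v < T v → Lead v)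
    (hstep : ∀ j < m, d (μ₀ (eu j)) ≠ 0 → lo (ev j) = lo (μ₀ (eu j)) →
      d (ev j) = d (μ₀ (eu j)) + 1 → Lead (ev j) → Lead (μ₀ (eu j))) :
    AugmentInv m nU eu ev μ₀ lo T d q Lead r μ deg hd st vx 0 i μ := by
  have hdep := h.depth hsp
  obtain ⟨hir, hroot, hTroot⟩ := h.root hsp
  have hne : vx sp ≠ vx 0 := by
    intro h'
    have h1 := hdep sp le_rfl
    have h2 := hdep 0 (by omega)
    rw [h'] at h1; omega
  have hbs : ∀ v, (v = vx 0 ∧ deg v + 1 = jobCount nU ν v) ∨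
      (v = vx sp ∧ deg v = jobCount nU ν v + 1) ∨
      (v ≠ vx 0 ∧ v ≠ vx sp ∧ deg v = jobCount nU ν v) := by
    intro v
    have := h.base v
    by_cases h1 : v = vx 0
    · left; rw [if_pos h1, if_neg (by rw [h1]; exact hne.symm)] at this; exact ⟨h1, this⟩
    · by_cases h2 : v = vx sp
      · right; left; rw [if_neg h1, if_pos h2] at this; exact ⟨h2, this⟩
      · right; right; rw [if_neg h1, if_neg h2] at this; exact ⟨h1, h2, this⟩
  have hlead : ∀ k ≤ sp, Lead (vx (sp - k)) := by
    intro k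
    induction k with
    | zero =>
      intro _
      obtain ⟨k', hk'⟩ : ∃ k', sp = k' + 1 := ⟨sp - 1, by omega⟩
      obtain ⟨h1, h2, -⟩ := h.stack k' (by omega)
      refine hbase _ ⟨st k', h1, by rw [h2, hk']; rfl⟩ ?_ ?_
      · simp only [Nat.sub_zero]; have := hdep sp le_rfl; omega
      · simp only [Nat.sub_zero]
        have h3 := h.base (vx sp)
        rw [if_neg hne, if_pos rfl] at h3
        have h4 := h.down (vx sp)
        omega
    | succ k ih =>
      intro hk
      obtain ⟨h1, h2, h3, h4, h5, h6⟩ := h.stack (sp - (k + 1)) (by omega)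
      have e : sp - (k + 1) + 1 = sp - k := by omega
      rw [e] at h2 h3 h6
      have h7 := hdep (sp - (k + 1)) (by omega)
      have h8 := hdep (sp - k) (by omega)
      have := hstep _ h1
      rw [h2, h5] at this
      exact this (by omega) h3 (by omega) (ih (by omega))
  refine ⟨h.le, fun h => absurd rfl h, h.load, fun v => ?_, fun k hk => absurd hk (by omega),
    fun h => absurd rfl h, fun u _ h => absurd rfl h, fun u hu => ?_, fun v hlt => ?_,
    fun v hlt => ?_, h.head, fun j hj hj' => ?_, fun k hk => ?_⟩
  · rw [h.load]
  · by_cases h1 : μ u = ν u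
    · rw [h1]; exact h.job u hu
    · obtain ⟨k, hk, rfl⟩ := h.off u hu h1
      obtain ⟨h2, h3, h4, h5, h6, h7⟩ := h.stack k hk
      have h8 := hdep k (by omega)
      have h9 := hdep (k + 1) (by omega)
      right
      rw [h6, h7]
      have h10 := hlead (sp - (k + 1)) (by omega)
      rw [show sp - (sp - (k + 1)) = k + 1 by omega] at h10
      exact ⟨⟨_, h2, rfl, h3⟩, h4, by omega, by omega, h10⟩
  · rw [← h.load] at hlt ⊢
    rcases hbs v with ⟨h1, h2⟩ | ⟨h1, h2⟩ | ⟨h1, h1', h2⟩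
    · subst h1
      have := hlead sp le_rfl
      rw [Nat.sub_self] at this
      exact ⟨by omega, this⟩
    · subst h1
      have := (h.down _ (by omega : jobCount nU ν (vx sp) < _)).1
      omega
    · rw [h2] at hlt ⊢; exact h.down v hlt
  · rw [← h.load] at hlt ⊢
    rcases hbs v with ⟨h1, h2⟩ | ⟨h1, h2⟩ | ⟨h1, h1', h2⟩
    · have := h.up v (by omega)
      exact ⟨by omega, this.2⟩
    · subst h1
      exact ⟨hv, by have := hdep sp le_rfl; omega⟩
    · rw [h2] at hlt ⊢; exact h.up v hlt
  · right
    intro h1 h2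
    rcases h.done j hj hj' with ⟨k, hk, rfl⟩ | h3
    · obtain ⟨h4, h5, h6, h7, h8, h9⟩ := h.stack k hk
      left
      rw [h8, h9]
      have h10 := hdep k (by omega)
      have h11 := hdep (k + 1) (by omega)
      intro h12; rw [h12] at h11; omega
    · rcases h3 h1 h2 with h4 | ⟨h4, h5⟩
      · left
        by_cases h6 : μ (eu j) = ν (eu j)
        · rwa [h6]
        · obtain ⟨k, hk, h8⟩ := h.off _ (hjob j hj) h6
          have h9 := h.stack k hk
          rw [h8] at h9
          exact absurd (h9.2.2.2.1.trans h9.2.2.2.2.1.symm) h4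
      · right
        refine ⟨h4, ?_⟩
        rw [← h.load]
        rcases hbs (ev j) with ⟨h6, h7⟩ | ⟨h6, h7⟩ | ⟨-, -, h7⟩
        · rw [h6] at h7 ⊢; omega
        · omega
        · omega
  · rw [← h.load]
    refine (h.roots k hk).imp_left fun h1 => ?_
    rcases hbs (q k) with ⟨h6, h7⟩ | ⟨h6, h7⟩ | ⟨-, -, h7⟩
    · omega
    · rw [h6]; exact hv
    · omega

/-- An edge that cannot extend the path is dropped. -/
theorem AugmentInv.drop (h : AugmentInv m nU eu ev μ₀ lo T d q Lead r μ deg hd st vx sp i ν)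
    (hl : Links m (fun j => μ₀ (eu j)) nxt) (hjob : ∀ j < m, eu j < nU)
    (hdep : ∀ k ≤ sp, d (vx k) = k + 1) (hev : ∃ j < m, ev j = vx sp)
    (hj : hd (vx sp) = j + 1)
    (hno : μ (eu j) = vx sp → lo (ev j) = lo (vx sp) → d (ev j) ≠ d (vx sp) + 1) :
    AugmentInv m nU eu ev μ₀ lo T d q Lead r μ deg (Function.update hd (vx sp) (nxt j)) st vx
      sp i ν := by
  obtain ⟨i₀, hi₀, hie⟩ := hev
  have hx := h.head i₀ hi₀
  rw [hie] at hx
  have hjm : j < m := by have := hx.1; omega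
  have hsj : μ₀ (eu j) = vx sp := by have := hx.2 (by omega); rwa [hj] at this
  have hzero : ∀ v, hd v = 0 → Function.update hd (vx sp) (nxt j) v = 0 := by
    intro v hv
    rw [Function.update_of_ne]
    · exact hv
    · rintro rfl; omega
  refine { h with
    head := fun k hk => hl.isHead_update hx hj (h.head k hk)
    done := fun k hk hk' => ?_
    roots := fun k hk => (h.roots k hk).imp_right (hzero _) }
  by_cases hkj : k = j
  · subst hkj
    right
    intro h1 h2
    rw [hsj] at h1 h2 ⊢
    left
    intro h3
    by_cases h4 : μ (eu k) = ν (eu k)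
    · exact hno (h4.trans h3) h1 h2
    · obtain ⟨l, hl, h5⟩ := h.off _ (hjob k hk) h4
      have h6 := (h.stack l hl).2.2.2.1
      rw [h5, h3] at h6
      have h7 := hdep l (by omega)
      have h8 := hdep sp le_rfl
      rw [h6] at h8; omega
  · refine (h.done k hk ?_).imp_right fun h1 h2 h3 => (h1 h2 h3).imp_right fun h4 =>
      ⟨hzero _ h4.1, h4.2⟩
    by_contra h3
    exact absurd ((hl.lt_update_iff hx hj).2 ⟨by simpa using h3, hkj⟩) (by simpa using hk')

/-- The path is extended by an edge to the next layer. -/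
theorem AugmentInv.advance (h : AugmentInv m nU eu ev μ₀ lo T d q Lead r μ deg hd st vx sp i ν)
    (hl : Links m (fun j => μ₀ (eu j)) nxt) (hjob : ∀ j < m, eu j < nU)
    (hi : i < r) (hr : vx 0 = q i)
    (hdep : ∀ k ≤ sp, d (vx k) = k + 1) (hev : ∃ j < m, ev j = vx sp)
    (hT : T (vx sp) < deg (vx sp))
    (hj : hd (vx sp) = j + 1) (hμ : μ (eu j) = vx sp) (hlo : lo (ev j) = lo (vx sp))
    (hd' : d (ev j) = d (vx sp) + 1) {deg' : ℕ → ℕ}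
    (hdeg : ∀ v, deg' v + (if v = vx sp then 1 else 0) = deg v + (if v = ev j then 1 else 0)) :
    AugmentInv m nU eu ev μ₀ lo T d q Lead r (Function.update μ (eu j) (ev j)) deg'
      (Function.update hd (vx sp) (nxt j)) (Function.update st sp j)
      (Function.update vx (sp + 1) (ev j)) (sp + 1) i ν := by
  obtain ⟨i₀, hi₀, hie⟩ := hev
  have hx := h.head i₀ hi₀
  rw [hie] at hx
  have hjm : j < m := by have := hx.1; omega
  have hsj : μ₀ (eu j) = vx sp := by have := hx.2 (by omega); rwa [hj] at this
  have hzero : ∀ v, hd v = 0 → Function.update hd (vx sp) (nxt j) v = 0 := by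
    intro v hv
    rw [Function.update_of_ne]
    · exact hv
    · rintro rfl; omega
  have hν : ν (eu j) = vx sp := by
    by_contra h3
    obtain ⟨l, hl, h5⟩ := h.off _ (hjob j hjm) (by rw [hμ]; exact fun h => h3 h.symm)
    have h6 := (h.stack l hl).2.2.2.2.1
    rw [h5, hsj] at h6
    have h7 := hdep l (by omega)
    have h8 := hdep sp le_rfl
    rw [h6] at h8; omega
  have hvx : ∀ k ≤ sp, Function.update vx (sp + 1) (ev j) k = vx k := fun k hk =>
    Function.update_of_ne (by omega) _ _
  have hst : ∀ k < sp, Function.update st sp j k = st k := fun k hk =>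
    Function.update_of_ne (by omega) _ _
  have hnej : ∀ k < sp, eu (st k) ≠ eu j := by
    intro k hk h'
    have h6 := (h.stack k hk).2.2.2.1
    rw [h', hν] at h6
    have h7 := hdep k (by omega)
    have h8 := hdep sp le_rfl
    rw [h6] at h8; omega
  refine ⟨h.le, fun _ => ⟨hi, ?_, ?_⟩, fun v => ?_, fun v => ?_, fun k hk => ?_,
    fun _ k hk => ?_, fun u hu h1 => ?_, h.job, h.down, h.up,
    fun k hk => hl.isHead_update hx hj (h.head k hk), fun k hk hk' => ?_,
    fun k hk => (h.roots k hk).imp_right (hzero _)⟩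
  · rw [hvx 0 (by omega), hr]
  · rw [hvx 0 (by omega)]
    by_cases hsp : sp = 0
    · subst hsp
      have := h.base (vx 0)
      omega
    · exact (h.root hsp).2.2
  · have h1 := hdeg v
    have h2 := jobCount_update μ (hjob j hjm) (ev j) v
    rw [hμ] at h2
    have := h.load v
    omega
  · rw [Function.update_self, hvx 0 (by omega)]
    have h1 := hdeg v
    have := h.base v
    omega
  · rcases Nat.lt_succ_iff_lt_or_eq.1 hk with hk' | rfl
    · rw [hst k hk', hvx k (by omega), hvx (k + 1) (by omega), Function.update_of_ne (hnej k hk')]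
      exact h.stack k hk'
    · rw [Function.update_self, Function.update_self, hvx k le_rfl, Function.update_self]
      exact ⟨hjm, rfl, hlo, hν, hsj, rfl⟩
  · rcases Nat.lt_or_eq_of_le hk with hk' | rfl
    · rw [hvx k (by omega)]; exact hdep k (by omega)
    · rw [Function.update_self, hd', hdep sp le_rfl]
  · by_cases hu' : u = eu j
    · exact ⟨sp, by omega, by rw [Function.update_self, hu']⟩
    · rw [Function.update_of_ne hu'] at h1
      obtain ⟨k, hk, hk'⟩ := h.off u hu h1
      exact ⟨k, by omega, by rwa [hst k hk]⟩
  · by_cases hkj : k = j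
    · exact Or.inl ⟨sp, by omega, by rw [Function.update_self, hkj]⟩
    · have h1 := h.done k hk (by
        by_contra h3
        exact absurd ((hl.lt_update_iff hx hj).2 ⟨by simpa using h3, hkj⟩) (by simpa using hk'))
      rcases h1 with ⟨l, hl, h1⟩ | h1
      · exact Or.inl ⟨l, by omega, by rwa [hst l hl]⟩
      · exact Or.inr fun h2 h3 => (h1 h2 h3).imp_right fun h4 => ⟨hzero _ h4.1, h4.2⟩

/-- The last machine of the path has no further edges and is removed from the path. -/
theorem AugmentInv.retreat
    (h : AugmentInv m nU eu ev μ₀ lo T d q Lead r μ deg hd st vx (sp + 1) i ν)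
    (hjob : ∀ j < m, eu j < nU) (hT : T (vx (sp + 1)) < deg (vx (sp + 1)))
    (hhd : hd (vx (sp + 1)) = 0) {deg' : ℕ → ℕ}
    (hdeg : ∀ v, deg' v + (if v = vx (sp + 1) then 1 else 0) =
      deg v + (if v = vx sp then 1 else 0)) :
    AugmentInv m nU eu ev μ₀ lo T d q Lead r (Function.update μ (eu (st sp)) (vx sp)) deg' hd st vx
      sp i ν := by
  have hdep := h.depth (by omega)
  obtain ⟨h1, h2, h3, h4, h5, h6⟩ := h.stack sp (by omega)
  have hinj : ∀ k ≤ sp + 1, ∀ l ≤ sp + 1, vx k = vx l → k = l := by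
    intro k hk l hl h'
    have h7 := hdep k hk
    have h8 := hdep l hl
    rw [h'] at h7; omega
  refine ⟨h.le, fun _ => h.root (by omega), fun v => ?_, fun v => ?_, fun k hk => ?_,
    fun _ k hk => hdep k (by omega), fun u hu h7 => ?_, h.job, h.down, h.up, h.head,
    fun k hk hk' => ?_, h.roots⟩
  · have h7 := hdeg v
    have h8 := jobCount_update μ (hjob _ h1) (vx sp) v
    rw [h6] at h8
    have := h.load v
    omega
  · have h7 := hdeg v
    have := h.base v
    omega
  · have h7 := h.stack k (by omega)
    rw [Function.update_of_ne]
    · exact h7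
    · intro h8
      have h9 := h7.2.2.2.1
      rw [h8, h4] at h9
      have := hinj _ (by omega) _ (by omega) h9
      omega
  · by_cases hu' : u = eu (st sp)
    · rw [hu', Function.update_self, h4] at h7; exact absurd rfl h7
    · rw [Function.update_of_ne hu'] at h7
      obtain ⟨k, hk, hk'⟩ := h.off u hu h7
      rcases Nat.lt_succ_iff_lt_or_eq.1 hk with hk | rfl
      · exact ⟨k, hk, hk'⟩
      · exact absurd hk'.symm hu'
  · rcases h.done k hk hk' with ⟨l, hl, rfl⟩ | h7
    · rcases Nat.lt_succ_iff_lt_or_eq.1 hl with hl | rfl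
      · exact Or.inl ⟨l, hl, rfl⟩
      · right
        intro _ _
        right
        rw [h2]
        refine ⟨hhd, ?_⟩
        have h8 := h.base (vx (l + 1))
        rw [if_pos rfl, if_neg] at h8
        · omega
        · intro h9; have := hinj _ le_rfl _ (by omega) h9; omega
    · exact Or.inr h7

end RAM

namespace RAM

variable {W : ℕ} {F : ℕ → ℕ → ℝ} {σ : State} {m nU : ℕ} {eu ev μ₀ lo T d q nxt : ℕ → ℕ}
  {Lead : ℕ → Prop} {r : ℕ}

/-- One step of the depth-first search. If the last machine of the path is overloaded, it scans its
next edge, which extends the path if it leads to the next layer; if it has no edges left, it leaves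
the path. A last machine that is not overloaded completes the path. A root that has no edges left or
is not overloaded gives way to the next root. -/
def augmentStep : Program :=
  .seq (.putWord 19 (.lit 0) (.mem 13 (.reg 12)))
  (.seq (.letWord 4 (.mem 19 (.reg 11)))
  (.ite (.wordLt (.mem 7 (.reg 4)) (.mem 8 (.reg 4)))
    (.seq (.letWord 15 (.mem 10 (.reg 4)))
    (.ite (.wordEq (.reg 15) (.lit 0))
      (.ite (.wordEq (.reg 11) (.lit 0))
        (.letWord 12 (.plus (.reg 12) (.lit 1)))
        (.seq (.letWord 11 (.minus (.reg 11) (.lit 1)))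
        (.seq (.letWord 5 (.mem 19 (.reg 11)))
        (.seq (.putWord 2 (.mem 0 (.mem 14 (.reg 11))) (.reg 5))
        (.seq (.putWord 8 (.reg 4) (.minus (.mem 8 (.reg 4)) (.lit 1)))
          (.putWord 8 (.reg 5) (.plus (.mem 8 (.reg 5)) (.lit 1))))))))
      (.seq (.letWord 6 (.minus (.reg 15) (.lit 1)))
      (.seq (.putWord 10 (.reg 4) (.mem 11 (.reg 6)))
      (.seq (.letWord 5 (.mem 1 (.reg 6)))
      (.ite (.wordEq (.mem 2 (.mem 0 (.reg 6))) (.reg 4))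
        (.ite (.wordEq (.mem 5 (.reg 5)) (.mem 5 (.reg 4)))
          (.ite (.wordEq (.mem 9 (.reg 5)) (.plus (.mem 9 (.reg 4)) (.lit 1)))
            (.seq (.putWord 14 (.reg 11) (.reg 6))
            (.seq (.letWord 11 (.plus (.reg 11) (.lit 1)))
            (.seq (.putWord 19 (.reg 11) (.reg 5))
            (.seq (.putWord 2 (.mem 0 (.reg 6)) (.reg 5))
            (.seq (.putWord 8 (.reg 4) (.minus (.mem 8 (.reg 4)) (.lit 1)))
              (.putWord 8 (.reg 5) (.plus (.mem 8 (.reg 5)) (.lit 1))))))))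
            .nop)
          .nop)
        .nop))))))
    (.ite (.wordEq (.reg 11) (.lit 0))
      (.letWord 12 (.plus (.reg 12) (.lit 1)))
      (.letWord 11 (.lit 0)))))

theorem update_deg {deg : ℕ → ℕ} {x y : ℕ} (hx : 0 < deg x) (hxy : x ≠ y) (v : ℕ) :
    Function.update (Function.update deg x (deg x - 1)) y
      (Function.update deg x (deg x - 1) y + 1) v + (if v = x then 1 else 0) =
      deg v + (if v = y then 1 else 0) := by
  simp only [Function.update_apply]
  split_ifs with h1 h2 h3 h4 <;> first | omega | (subst_vars; omega)

/-- The depth-first search takes time `O(m)`: every step removes an edge from a list, shortens the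
path or takes the next root, and a removed edge pays for the machine that it may add to the path. -/
theorem augment_runs (he : EdgeData W nU m eu ev σ) (hlo : σ.mem 5 = lo) (hT : σ.mem 7 = T)
    (hd : σ.mem 9 = d) (hnxt : σ.mem 11 = nxt) (hq : σ.mem 13 = q)
    (hl : Links m (fun j => μ₀ (eu j)) nxt) (hr : σ.reg 9 = r) (hrm : r ≤ m) (hnU : nU ≤ m)
    (hroot : ∀ k < r, d (q k) = 1 ∧ ∃ j < m, ev j = q k)
    (hbase : ∀ v, (∃ j < m, ev j = v) → d v ≠ 0 → jobCount nU μ₀ v < T v → Lead v)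
    (hstep : ∀ j < m, d (μ₀ (eu j)) ≠ 0 → lo (ev j) = lo (μ₀ (eu j)) →
      d (ev j) = d (μ₀ (eu j)) + 1 → Lead (ev j) → Lead (μ₀ (eu j)))
    (hinv : AugmentInv m nU eu ev μ₀ lo T d q Lead r (σ.mem 2) (σ.mem 8) (σ.mem 10) (σ.mem 14)
      (σ.mem 19) (σ.reg 11) (σ.reg 12) μ₀) (h11 : σ.reg 11 = 0) (h12 : σ.reg 12 = 0) :
    ∃ c, c = 300 ∧
    Runs W F (.loop (.wordLt (.reg 12) (.reg 9)) augmentStep) σ (c * (m + 1)) fun σ' =>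
      Frame augmentStep σ σ' ∧ ∃ ν, AugmentInv m nU eu ev μ₀ lo T d q Lead r (σ'.mem 2) (σ'.mem 8)
        (σ'.mem 10) (σ'.mem 14) (σ'.mem 19) 0 r ν := by
  refine ⟨_, rfl, ?_⟩
  have hb := he.bound
  have hrem : (remaining m (fun j => μ₀ (eu j)) (σ.mem 10)).card ≤ m :=
    (Finset.card_filter_le _ _).trans (by simp)
  refine (Runs.loopWp (fun σ' => (∃ ν, AugmentInv m nU eu ev μ₀ lo T d q Lead r (σ'.mem 2)
      (σ'.mem 8) (σ'.mem 10) (σ'.mem 14) (σ'.mem 19) (σ'.reg 11) (σ'.reg 12) ν) ∧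
      σ'.reg 11 + (remaining m (fun j => μ₀ (eu j)) (σ'.mem 10)).card ≤ m)
    (fun σ' => σ'.reg 11 + (r - σ'.reg 12) +
      2 * (remaining m (fun j => μ₀ (eu j)) (σ'.mem 10)).card)
    ⟨⟨_, hinv⟩, by omega⟩ ?_).mono ?_ ?_
  · rintro σ' hf ⟨⟨ν, hi⟩, hsr⟩ hlt
    have he' := he.of_frame hf (by decide) (by decide) (by decide) (by decide)
    have e5 : σ'.mem 5 = lo := (hf.mem 5 (by decide)).trans hlo
    have e7 : σ'.mem 7 = T := (hf.mem 7 (by decide)).trans hT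
    have e9 : σ'.mem 9 = d := (hf.mem 9 (by decide)).trans hd
    have e11 : σ'.mem 11 = nxt := (hf.mem 11 (by decide)).trans hnxt
    have e13 : σ'.mem 13 = q := (hf.mem 13 (by decide)).trans hq
    have r9 : σ'.reg 9 = r := (hf.reg 9 (by decide)).trans hr
    simp only [Test.Holds, WordExp.eval, r9] at hlt
    obtain ⟨hq1, iq, hiq, hiqe⟩ := hroot _ hlt
    have hqW := he.machine_le iq hiq
    rw [hiqe] at hqW
    have hi := hi.setRoot
    set vx := Function.update (σ'.mem 19) 0 (q (σ'.reg 12)) with hvx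
    have hvx0 : vx 0 = q (σ'.reg 12) := by rw [hvx, Function.update_self]
    have hdep := hi.depth' hvx0 hq1
    have hev : ∀ k ≤ σ'.reg 11, ∃ j < m, ev j = vx k := by
      intro k hk
      rcases Nat.eq_zero_or_pos k with rfl | hk0
      · exact ⟨iq, hiq, by rw [hvx0, hiqe]⟩
      · obtain ⟨k, rfl⟩ : ∃ k', k = k' + 1 := ⟨k - 1, by omega⟩
        obtain ⟨h1, h2, -⟩ := hi.stack k (by omega)
        exact ⟨_, h1, h2⟩
    have hvW : ∀ k ≤ σ'.reg 11, vx k ≤ W := by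
      intro k hk
      obtain ⟨j, hj, hj'⟩ := hev k hk
      rw [← hj']; exact he.machine_le j hj
    have hvxW := hvW _ le_rfl
    have hdegle : ∀ v, σ'.mem 8 v ≤ nU := fun v => by rw [hi.load]; exact jobCount_le _ _ _
    obtain ⟨i₀, hi₀, hie⟩ := hev _ le_rfl
    have hhx := hi.head i₀ hi₀
    rw [hie] at hhx
    have hhm := hhx.1
    simp only [augmentStep, Program.Wp, Test.Holds, WordExp.eval, he'.machine, he'.job, mem_setReg,
      mem_setMem, reg_setMem, reg_setReg, e5, e7, e9, e11, e13]
    norm_num [e5, e7, e9, e11, e13, he'.machine, he'.job]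
    rw [← hvx]
    generalize hspd : σ'.reg 11 = sp at *
    generalize hid : σ'.reg 12 = i at *
    have hdegW : ∀ x y, Function.update (σ'.mem 8) x (σ'.mem 8 x - 1) y < W := by
      intro x y
      have h1 := hdegle x
      have h2 := hdegle y
      rw [Function.update_apply]; split_ifs <;> omega
    have hdegx := hdegle (vx sp)
    refine ⟨hqW, hvxW, fun h1 => ⟨by omega, fun h2 => ⟨fun h3 => ?_, fun h3 => ?_⟩, fun h2 => ?_⟩,
      fun h1 => ⟨fun h3 => ?_, fun h3 => ?_⟩⟩
    · subst h3
      rw [hvx0] at h1 h2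
      exact ⟨by omega, ⟨⟨ν, hi.nextRoot hlt hvx0 (Or.inr h2)⟩, hsr⟩, by omega⟩
    · obtain ⟨sp, rfl⟩ : ∃ s, sp = s + 1 := ⟨sp - 1, by omega⟩
      simp only [Nat.add_sub_cancel]
      have h4 := hvW sp (by omega)
      have h5 := he.job_lt _ (hi.stack sp (by omega)).1
      refine ⟨by omega, h4, by omega, h4, hvxW, by omega, h4, hdegW _ _,
        ⟨⟨ν, hi.retreat he.job_lt h1 h2 (update_deg (by omega) ?_)⟩, by omega⟩, by omega⟩
      intro h6
      have h7 := hdep (sp + 1) le_rfl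
      have h8 := hdep sp (by omega)
      rw [h6] at h7; omega
    · obtain ⟨j, hj⟩ : ∃ j, σ'.mem 10 (vx sp) = j + 1 :=
        ⟨_, (Nat.succ_pred_eq_of_pos (Nat.pos_of_ne_zero h2)).symm⟩
      have hjm : j < m := by omega
      have hcard := hl.card_remaining hhx hj
      have hle := hl.le j hjm
      have hyW := he.machine_le j hjm
      have hju := he.job_lt j hjm
      have hdrop := fun h => hi.drop hl he.job_lt hdep ⟨i₀, hi₀, hie⟩ hj h
      simp only [hj, Nat.add_sub_cancel]
      refine ⟨by omega, hvxW, by omega, hyW, fun h3 => ⟨fun h4 => ⟨fun h5 => ?_, fun h5 => ?_⟩,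
        fun h4 => ?_⟩, fun h3 => ?_⟩
      · refine ⟨by omega, by omega, by omega, hyW, by omega, hyW, hvxW, by omega, hyW, hdegW _ _,
          ⟨⟨ν, hi.advance hl he.job_lt hlt hvx0 hdep ⟨i₀, hi₀, hie⟩ h1 hj h3 h4 h5
            (update_deg (by omega) ?_)⟩, by omega⟩, by omega⟩
        intro h6
        rw [← h6] at h5; omega
      · exact ⟨⟨⟨ν, hdrop fun _ _ => h5⟩, by omega⟩, by omega⟩
      · exact ⟨⟨⟨ν, hdrop fun _ h => absurd h h4⟩, by omega⟩, by omega⟩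
      · exact ⟨⟨⟨ν, hdrop fun h => absurd h h3⟩, by omega⟩, by omega⟩
    · subst h3
      rw [hvx0] at h1
      exact ⟨by omega, ⟨⟨ν, hi.nextRoot hlt hvx0 (Or.inl h1)⟩, hsr⟩, by omega⟩
    · exact ⟨⟨⟨_, hi.absorb he.job_lt h3 h1 hbase hstep⟩, by omega⟩, by omega⟩
  · norm_num [augmentStep, Program.size, Test.steps, WordExp.steps]
    omega
  · rintro σ' ⟨hf, ⟨⟨ν, hi⟩, -⟩, hlt⟩
    have r9 : σ'.reg 9 = r := (hf.reg 9 (by decide)).trans hr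
    simp only [Test.Holds, WordExp.eval, r9] at hlt
    have h1 : σ'.reg 12 = r := by have := hi.le; omega
    have h2 : σ'.reg 11 = 0 := by
      by_contra h; have := (hi.root h).1; omega
    rw [h1, h2] at hi
    exact ⟨hf, ν, hi⟩

end RAM

namespace RAM

/-! ### One round in all subnetworks -/

variable {W : ℕ} {F : ℕ → ℕ → ℝ} {nU nV m : ℕ} {E : Finset (Fin nU × Fin nV)} {eu ev : ℕ → ℕ}
  {a : ℕ → ℕ} {μ : Fin nU → Fin nV} {σ : State}

/-- `eu` and `ev` list the jobs and the machines of the edges of `E`. -/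
structure EdgeList (E : Finset (Fin nU × Fin nV)) (m : ℕ) (eu ev : ℕ → ℕ) : Prop where
  mem_iff : ∀ u v, (u, v) ∈ E ↔ ∃ j < m, eu j = (u : ℕ) ∧ ev j = (v : ℕ)
  job_lt : ∀ j < m, eu j < nU
  machine_lt : ∀ j < m, ev j < nV

/-- The array `a` holds the assignment `μ`, which uses edges of `E` only. -/
structure Represents (E : Finset (Fin nU × Fin nV)) (μ : Fin nU → Fin nV) (a : ℕ → ℕ) : Prop where
  eq : ∀ u : Fin nU, a u = μ u
  edge : ∀ u, (u, μ u) ∈ E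

theorem Represents.exists_edge (h : Represents E μ a) (he : EdgeList E m eu ev) {u : ℕ}
    (hu : u < nU) : ∃ j < m, eu j = u ∧ ev j = a u := by
  obtain ⟨j, hj, h1, h2⟩ := (he.mem_iff _ _).1 (h.edge ⟨u, hu⟩)
  exact ⟨j, hj, h1, by rw [h2, ← h.eq]⟩

theorem Represents.jobCount_eq (h : Represents E μ a) (v : Fin nV) :
    jobCount nU a v = load μ v := by
  rw [load_eq, jobCount]
  refine (Finset.card_bij (fun (u : Fin nU) _ => (u : ℕ)) ?_ ?_ ?_).symm
  · intro u hu
    simp only [Finset.mem_filter, Finset.mem_univ, true_and] at hu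
    simp [h.eq, hu]
  · intro u _ u' _ h'
    exact Fin.ext h'
  · intro u hu
    simp only [Finset.mem_filter, Finset.mem_range] at hu
    refine ⟨⟨u, hu.1⟩, ?_, rfl⟩
    simp only [Finset.mem_filter, Finset.mem_univ, true_and]
    exact Fin.ext (by rw [← h.eq]; exact hu.2)

theorem Represents.exists_edge_of_jobCount (h : Represents E μ a) (he : EdgeList E m eu ev) {v : ℕ}
    (hv : 0 < jobCount nU a v) : ∃ j < m, ev j = v := by
  obtain ⟨u, hu⟩ := Finset.card_pos.1 hv
  simp only [Finset.mem_filter, Finset.mem_range] at hu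
  obtain ⟨j, hj, -, h2⟩ := h.exists_edge he hu.1
  exact ⟨j, hj, h2.trans hu.2⟩

theorem Represents.le (h : Represents E μ a) (he : EdgeList E m eu ev) : nU ≤ m := by
  have : Finset.range nU ⊆ (Finset.range m).image eu := by
    intro u hu
    obtain ⟨j, hj, h1, -⟩ := h.exists_edge he (Finset.mem_range.1 hu)
    exact Finset.mem_image.2 ⟨j, Finset.mem_range.2 hj, h1⟩
  simpa using (Finset.card_le_card this).trans Finset.card_image_le

variable {lo T deg d q hd D : ℕ → ℕ} {qt found : ℕ}

/-- The breadth-first search is complete when the queue is empty. -/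
theorem SearchInv.searchResult (hr : Represents E μ a) (he : EdgeList E m eu ev)
    (h : SearchInv m ev (fun j => a (eu j)) lo T deg d q hd D qt qt found)
    (hdeg : ∀ v, deg v = jobCount nU a v) :
    SearchResult E μ (fun v => lo v) (fun v => T v) (fun v => d v) D := by
  have hload : ∀ v : Fin nV, deg v = load μ v := fun v => by rw [hdeg, hr.jobCount_eq]
  refine ⟨fun v => ?_, fun v hv => ?_, fun u v huv h1 h2 h3 => ?_, fun v h1 h2 => ?_,
    fun v h1 h2 => ?_, fun v h1 h2 => h.label_le v h1 h2⟩
  · rw [← hload]; exact h.one_iff v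
  · obtain ⟨j, hj, h1, h2, h3, h4⟩ := h.pred v hv
    have hu := he.job_lt j hj
    have h5 := hr.eq ⟨eu j, hu⟩
    simp only at h2 h3 h4 h5
    rw [h5] at h2 h3 h4
    exact ⟨⟨eu j, hu⟩, (he.mem_iff _ _).2 ⟨j, hj, rfl, h1⟩, h2, h3, h4⟩
  · obtain ⟨j, hj, h4, h5⟩ := (he.mem_iff _ _).1 huv
    have h6 : a (eu j) = μ u := by rw [h4, hr.eq]
    have h7 := h.scanned j hj
    simp only [h6, h5] at h7
    obtain ⟨k, hk, hk'⟩ := h.mem_queue _ h2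
    have h8 := h.done k hk
    rw [hk', h1] at h8
    rcases h8 with h8 | ⟨h8, h9⟩
    · exact (h7 (by omega)).2 h1
    · omega
  · rw [← hload] at h2; exact h.deficit v h1 h2
  · obtain ⟨k, hk, hk'⟩ := h.mem_queue v h1
    obtain ⟨-, ⟨j, hj, hj'⟩, -⟩ := h.queued k hk
    rw [hk'] at hj'
    obtain ⟨v', h3, h4, h5, h6⟩ := h.depth j hj (by rwa [hj'])
    obtain ⟨k', hk1, hk2⟩ := h.mem_queue v' h3
    obtain ⟨-, ⟨j', hj1, hj2⟩, -⟩ := h.queued k' hk1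
    have hlt := he.machine_lt j' hj1
    rw [hj2, hk2] at hlt
    have h7 := hload ⟨v', hlt⟩
    simp only at h7
    rw [hj'] at h4 h5
    exact ⟨⟨v', hlt⟩, h4, h5, by rw [← h7]; exact h6⟩

/-- `LeadsDown` within the subnetwork of the machine `v`, for machines given by their numbers. -/
def LeadsTo (E : Finset (Fin nU × Fin nV)) (μ : Fin nU → Fin nV) (lo T d : ℕ → ℕ) (v : ℕ) : Prop :=
  ∃ h : v < nV, LeadsDown E μ (fun x => lo x = lo v) (fun x => T x) (fun x => d x) ⟨v, h⟩

theorem LeadsTo.base (hr : Represents E μ a) (he : EdgeList E m eu ev) (v : ℕ)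
    (hv : ∃ j < m, ev j = v) (hd : d v ≠ 0) (hT : jobCount nU a v < T v) :
    LeadsTo E μ lo T d v := by
  obtain ⟨j, hj, rfl⟩ := hv
  refine ⟨he.machine_lt j hj, .base _ rfl hd ?_⟩
  rwa [← hr.jobCount_eq]

theorem LeadsTo.step (hr : Represents E μ a) (he : EdgeList E m eu ev) (j : ℕ) (hj : j < m)
    (hd : d (a (eu j)) ≠ 0) (hlo : lo (ev j) = lo (a (eu j))) (hs : d (ev j) = d (a (eu j)) + 1)
    (h : LeadsTo E μ lo T d (ev j)) : LeadsTo E μ lo T d (a (eu j)) := by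
  obtain ⟨h1, h2⟩ := h
  have h3 := hr.eq ⟨eu j, he.job_lt j hj⟩
  simp only at h3
  rw [h3] at hd hlo hs ⊢
  rw [hlo] at h2
  exact ⟨(μ _).2, .step _ _ ((he.mem_iff _ _).2 ⟨j, hj, rfl, rfl⟩) rfl hlo hd hs h2⟩

variable {r : ℕ} {a' st vx ν : ℕ → ℕ}

/-- The depth-first search is complete when all roots have been taken. The dead machines are those
whose lists are empty and that are not underloaded. -/
theorem AugmentInv.blockingChange (hr : Represents E μ a) (he : EdgeList E m eu ev)
    (h : AugmentInv m nU eu ev a lo T d q (LeadsTo E μ lo T d) r a' deg hd st vx 0 r ν)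
    (hroot : ∀ v, d v = 1 → ∃ k < r, q k = v) :
    ∃ μ', Represents E μ' a' ∧
      BlockingChange E μ μ' (fun v => lo v) (fun v => T v) (fun v => d v) := by
  have hν : ∀ u < nU, a' u = ν u := by
    intro u hu
    by_contra h1
    obtain ⟨k, hk, -⟩ := h.off u hu h1
    omega
  have hcount : ∀ v, jobCount nU a' v = jobCount nU ν v := by
    intro v
    have := h.base v
    rw [← h.load]; omega
  have hedge : ∀ u < nU, ∃ j < m, eu j = u ∧ ev j = a' u := by
    intro u hu
    rw [hν u hu]
    rcases h.job u hu with h1 | ⟨h1, -⟩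
    · rw [h1]; exact hr.exists_edge he hu
    · exact h1
  have hlt : ∀ u < nU, a' u < nV := by
    intro u hu
    obtain ⟨j, hj, -, h2⟩ := hedge u hu
    rw [← h2]; exact he.machine_lt j hj
  have hr' : Represents E (fun u => ⟨a' u, hlt u u.2⟩) a' := by
    refine ⟨fun u => rfl, fun u => ?_⟩
    obtain ⟨j, hj, h1, h2⟩ := hedge u u.2
    exact (he.mem_iff _ _).2 ⟨j, hj, h1, h2⟩
  refine ⟨_, hr', fun u => ?_, fun v hv => ?_, fun v hv => ?_,
    fun v => hd v = 0 ∧ T v ≤ jobCount nU a' v, fun v h1 h2 => ?_, fun u v huv h1 h2 h3 h4 => ?_,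
    fun v h1 => ?_⟩
  · have h1 := h.job u u.2
    rw [← hν u u.2, hr.eq] at h1
    rcases h1 with h1 | ⟨-, h2, h3, h4, h5, h6⟩
    · exact Or.inl (Fin.ext h1)
    · right
      simp only [h2] at h6
      exact ⟨hr'.edge u, h2, h3, h4, h6⟩
  · rw [← hr'.jobCount_eq, ← hr.jobCount_eq, hcount] at hv
    rw [← hr'.jobCount_eq, hcount]
    obtain ⟨h1, h3, h2⟩ := h.down v hv
    exact ⟨h1, h2⟩
  · rw [← hr'.jobCount_eq, ← hr.jobCount_eq, hcount] at hv
    rw [← hr'.jobCount_eq, hcount]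
    exact h.up v hv
  · rw [← hr'.jobCount_eq] at h2
    obtain ⟨k, hk, hk'⟩ := hroot v h1
    have h3 := h.roots k hk
    rw [hk', ← hcount] at h3
    exact ⟨h3.resolve_left (by omega), h2.le⟩
  · obtain ⟨j, hj, h5, h6⟩ := (he.mem_iff _ _).1 huv
    have h7 : a (eu j) = μ u := by rw [h5, hr.eq]
    have h8 := h.done j hj
    rw [h7, h6, h5, ← hν u u.2, ← hcount] at h8
    rcases h8 (by rw [h2.1]; exact Nat.zero_le _) with ⟨k, hk, -⟩ | h8
    · omega
    · exact (h8 h1.symm h4).resolve_left fun h9 => h9 (congrArg Fin.val h3)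
  · rw [← hr'.jobCount_eq]; exact h1.2

/-- A round of Cancel in all subnetworks. Afterwards register 10 tells whether the breadth-first
search has found an underloaded machine. -/
def round : Program :=
  .seq resetSearch
  (.seq buildLists
  (.seq initSearch
  (.seq (.loop (.wordLt (.reg 7) (.reg 8)) searchStep)
  (.seq (.letWord 11 (.lit 0))
  (.seq (.letWord 12 (.lit 0))
    (.ite (.wordLt (.lit 0) (.reg 10)) (.loop (.wordLt (.reg 12) (.reg 9)) augmentStep) .nop))))))

/-- A round takes time `O(m)`. Either the search finds an underloaded machine and the assignment
changes by blocking sets of paths, or nothing changes. -/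
theorem round_runs (he : EdgeList E m eu ev) (hdat : EdgeData W nU m eu ev σ)
    (hr : Represents E μ (σ.mem 2)) (hlo : ∀ j < m, σ.mem 5 (ev j) ≤ W)
    (hdeg : ∀ v, σ.mem 8 v = jobCount nU (σ.mem 2) v)
    (hd : ∀ v, (∀ j < m, ev j ≠ v) → σ.mem 9 v = 0) : ∃ c, c = 700 ∧
    Runs W F round σ (c * (m + 1)) fun σ' => Frame round σ σ' ∧
      (∀ v, σ'.mem 8 v = jobCount nU (σ'.mem 2) v) ∧
      (∀ v, (∀ j < m, ev j ≠ v) → σ'.mem 9 v = 0) ∧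
      ∃ D μ', SearchResult E μ (fun v => σ.mem 5 v) (fun v => σ.mem 7 v) (fun v => σ'.mem 9 v) D ∧
        Represents E μ' (σ'.mem 2) ∧
        ((σ'.reg 10 = 0 ∧ μ' = μ ∧ ¬ ∃ v : Fin nV, σ'.mem 9 v ≠ 0 ∧ load μ v < σ.mem 7 v) ∨
        (σ'.reg 10 ≠ 0 ∧ (∃ v : Fin nV, σ'.mem 9 v ≠ 0 ∧ load μ v < σ.mem 7 v) ∧
          BlockingChange E μ μ' (fun v => σ.mem 5 v) (fun v => σ.mem 7 v)
            (fun v => σ'.mem 9 v))) := by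
  refine ⟨_, rfl, ?_⟩
  have hnm := hr.le he
  have hsrc : ∀ j < m, ∃ i < m, ev i = σ.mem 2 (eu j) := fun j hj => by
    obtain ⟨i, hi, -, h2⟩ := hr.exists_edge he (he.job_lt j hj)
    exact ⟨i, hi, h2⟩
  obtain ⟨_, rfl, h1⟩ := resetSearch_runs (F := F) hdat hlo
  refine ((h1.seq (B' := 600 * (m + 1)) fun σ₁ h => ?_).frame.mono (by omega)
    fun σ' h => ⟨h.2, h.1⟩)
  obtain ⟨hf₁, hz₁, hu₁⟩ := h
  have hdat₁ := hdat.of_frame hf₁ (by decide) (by decide) (by decide) (by decide)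
  have e₁2 : σ₁.mem 2 = σ.mem 2 := hf₁.mem 2 (by decide)
  obtain ⟨_, rfl, h2⟩ := buildLists_runs (F := F) (src := fun j => σ.mem 2 (eu j)) hdat₁
    (fun j hj => by rw [e₁2]) hsrc fun j hj => ⟨(hz₁ j hj).2.1, (hz₁ j hj).2.2.1⟩
  refine (h2.seq (B' := 570 * (m + 1)) fun σ₂ h => ?_).mono (by omega) fun _ h => h
  obtain ⟨hf₂, hl₂, hh₂, hlt₂⟩ := h
  have hdat₂ := hdat₁.of_frame hf₂ (by decide) (by decide) (by decide) (by decide)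
  have hf₁₂ : ∀ a, a ∉ resetSearch.writes → a ∉ buildLists.writes → σ₂.mem a = σ.mem a :=
    fun a h h' => (hf₂.mem a h').trans (hf₁.mem a h)
  have hd₂ : ∀ v, σ₂.mem 9 v = 0 := by
    intro v
    rw [hf₂.mem 9 (by decide)]
    by_cases hv : ∃ j < m, ev j = v
    · obtain ⟨j, hj, rfl⟩ := hv; exact (hz₁ j hj).1
    · push Not at hv
      rw [hu₁ v hv]; exact hd v hv
  have hhead₂ : ∀ j < m, IsHead m (fun j => σ.mem 2 (eu j)) (σ₂.mem 18) (ev j) := by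
    intro j hj
    have := hh₂ j hj
    rw [IsHead, this.2]; exact this.1
  have hall₂ : ∀ j < m, j < σ₂.mem 18 (σ.mem 2 (eu j)) := by
    intro j hj
    obtain ⟨i, hi, hie⟩ := hsrc j hj
    have h4 := hlt₂ j hj
    rw [← hie] at h4 ⊢
    rw [(hh₂ i hi).2]; exact h4
  obtain ⟨_, rfl, h3⟩ := initSearch_runs (F := F) (src := fun j => σ.mem 2 (eu j)) hdat₂
    (lo := σ.mem 5) (T := σ.mem 7) (deg := σ.mem 8)
    (hf₁₂ 7 (by decide) (by decide)) (hf₁₂ 8 (by decide) (by decide)) hd₂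
    (fun v hv => hr.exists_edge_of_jobCount he (by rw [hdeg] at hv; omega)) hhead₂ hall₂
    (fun j hj => by rw [hf₂.mem 12 (by decide)]; exact (hz₁ j hj).2.2.2)
  refine (h3.seq (B' := 520 * (m + 1)) fun σ₃ h => ?_).mono (by omega) fun _ h => h
  obtain ⟨hf₃, hi₃, h7, h8, h9, hroot₃⟩ := h
  have hdat₃ := hdat₂.of_frame hf₃ (by decide) (by decide) (by decide) (by decide)
  have hf₁₃ : ∀ a, a ∉ resetSearch.writes → a ∉ buildLists.writes → a ∉ initSearch.writes →
      σ₃.mem a = σ.mem a := fun a h h' h'' => (hf₃.mem a h'').trans (hf₁₂ a h h')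
  have e11 : σ₃.mem 11 = σ₂.mem 11 := hf₃.mem 11 (by decide)
  obtain ⟨_, rfl, h4⟩ := search_runs (F := F) (r := σ₃.reg 9) hdat₃
    (hf₁₃ 5 (by decide) (by decide) (by decide)) (hf₁₃ 7 (by decide) (by decide) (by decide))
    (hf₁₃ 8 (by decide) (by decide) (by decide)) e11 hl₂ hlo hi₃ h8 h9.le hroot₃
  refine (h4.seq (B' := 310 * (m + 1)) fun σ₄ h => ?_).mono (by omega) fun _ h => h
  obtain ⟨hf₄, hi₄, hr₄, hroot₄⟩ := h
  have hf₁₄ : ∀ a, a ∉ resetSearch.writes → a ∉ buildLists.writes → a ∉ initSearch.writes →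
      a ∉ searchStep.writes → σ₄.mem a = σ.mem a :=
    fun a h h' h'' h''' => (hf₄.mem a h''').trans (hf₁₃ a h h' h'')
  have hd₄ : ∀ v, (∀ j < m, ev j ≠ v) → σ₄.mem 9 v = 0 := by
    intro v hv
    by_contra h5
    obtain ⟨k, hk, hk'⟩ := hi₄.mem_queue v h5
    obtain ⟨-, ⟨j, hj, hj'⟩, -⟩ := hi₄.queued k hk
    exact hv j hj (hj'.trans hk')
  have hres := hi₄.searchResult hr he hdeg
  have hfound : σ₄.reg 10 ≠ 0 ↔ ∃ v : Fin nV, σ₄.mem 9 v ≠ 0 ∧ load μ v < σ.mem 7 v := by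
    rw [hi₄.found_iff]
    constructor
    · rintro ⟨v, h5, h6⟩
      obtain ⟨k, hk, hk'⟩ := hi₄.mem_queue v h5
      obtain ⟨-, ⟨j, hj, hj'⟩, -⟩ := hi₄.queued k hk
      have hlt := he.machine_lt j hj
      rw [hj', hk'] at hlt
      refine ⟨⟨v, hlt⟩, h5, ?_⟩
      rw [← hr.jobCount_eq, ← hdeg]; exact h6
    · rintro ⟨v, h5, h6⟩
      rw [← hr.jobCount_eq, ← hdeg] at h6
      exact ⟨v, h5, h6⟩
  have h5 : Runs W F (.letWord 11 (.lit 0)) σ₄ 2 fun σ' => σ' = σ₄.setReg 11 0 :=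
    ⟨_, _, .letWord _ _ _ (Nat.zero_le _), le_rfl, rfl⟩
  refine (h5.seq (B' := 306 * (m + 1)) fun σ₅ h => ?_).mono (by omega) fun _ h => h
  subst h
  have h6 : Runs W F (.letWord 12 (.lit 0)) (σ₄.setReg 11 0) 2
      fun σ' => σ' = (σ₄.setReg 11 0).setReg 12 0 :=
    ⟨_, _, .letWord _ _ _ (Nat.zero_le _), le_rfl, rfl⟩
  refine (h6.seq (B' := 304 * (m + 1)) fun σ₆ h => ?_).mono (by omega) fun _ h => h
  subst h
  refine (Runs.ite (B := 300 * (m + 1)) (fun hb => ?_) fun hb => ?_).mono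
    (by simp only [Test.steps, WordExp.steps]; omega) fun _ h => h
  · simp only [Test.Holds, WordExp.eval, reg_setReg] at hb
    norm_num at hb
    have hdat₄ := hdat₃.of_frame hf₄ (by decide) (by decide) (by decide) (by decide)
    have hdat₆ : EdgeData W nU m eu ev ((σ₄.setReg 11 0).setReg 12 0) :=
      ⟨by simp [hdat₄.reg0], by simp [hdat₄.reg2], hdat₄.job, hdat₄.machine, hdat₄.job_lt,
        hdat₄.machine_le, hdat₄.bound⟩
    have e2 := hf₁₄ 2 (by decide) (by decide) (by decide) (by decide)
    have e8 := hf₁₄ 8 (by decide) (by decide) (by decide) (by decide)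
    have e10 : σ₄.mem 10 = σ₂.mem 10 :=
      (hf₄.mem 10 (by decide)).trans (hf₃.mem 10 (by decide))
    have e9 : σ₄.reg 9 = σ₃.reg 9 := hf₄.reg 9 (by decide)
    have hinv : AugmentInv m nU eu ev (σ.mem 2) (σ.mem 5) (σ.mem 7) (σ₄.mem 9) (σ₄.mem 13)
        (LeadsTo E μ (σ.mem 5) (σ.mem 7) (σ₄.mem 9)) (σ₃.reg 9)
        (((σ₄.setReg 11 0).setReg 12 0).mem 2) (((σ₄.setReg 11 0).setReg 12 0).mem 8)
        (((σ₄.setReg 11 0).setReg 12 0).mem 10) (((σ₄.setReg 11 0).setReg 12 0).mem 14)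
        (((σ₄.setReg 11 0).setReg 12 0).mem 19) (((σ₄.setReg 11 0).setReg 12 0).reg 11)
        (((σ₄.setReg 11 0).setReg 12 0).reg 12) (σ.mem 2) := by
      simp only [mem_setReg, reg_setReg, e2, e8, e10]
      refine ⟨by simp, by simp, hdeg, fun v => by rw [hdeg]; simp, by simp, by simp,
        fun u _ h => absurd rfl h, fun u _ => Or.inl rfl, fun v h => absurd h (lt_irrefl _),
        fun v h => absurd h (lt_irrefl _), fun j hj => (hh₂ j hj).1, fun j hj h => ?_, by simp⟩
      have := hlt₂ j hj
      omega
    obtain ⟨_, rfl, h7⟩ := augment_runs (F := F) (μ₀ := σ.mem 2) (lo := σ.mem 5) (T := σ.mem 7)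
      (d := σ₄.mem 9) (nxt := σ₂.mem 11) (q := σ₄.mem 13) (r := σ₃.reg 9)
      (Lead := LeadsTo E μ (σ.mem 5) (σ.mem 7) (σ₄.mem 9))
      hdat₆ (hf₁₄ 5 (by decide) (by decide) (by decide) (by decide))
      (hf₁₄ 7 (by decide) (by decide) (by decide) (by decide)) rfl
      ((hf₄.mem 11 (by decide)).trans e11) rfl hl₂ (by simp [e9]) (by omega) hnm
      (fun k hk => ⟨hroot₄.1 k hk, (hi₄.queued k (by omega)).2.1⟩) (LeadsTo.base hr he)
      (LeadsTo.step hr he) hinv (by simp) (by simp)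
    refine h7.mono le_rfl fun σ' h => ?_
    obtain ⟨hf, ν, hi⟩ := h
    have e9' : σ'.mem 9 = σ₄.mem 9 := hf.mem 9 (by decide)
    have e10' : σ'.reg 10 = σ₄.reg 10 := by rw [hf.reg 10 (by decide)]; simp
    obtain ⟨μ', hr', hc⟩ := hi.blockingChange hr he hroot₄.2
    rw [e9', e10']
    exact ⟨hi.load, hd₄, _, μ', hres, hr', Or.inr ⟨by omega, hfound.1 (by omega), hc⟩⟩
  · simp only [Test.Holds, WordExp.eval, reg_setReg] at hb
    norm_num at hb
    refine ⟨_, _, .nop _, by omega, ?_⟩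
    simp only [mem_setReg, reg_setReg]
    norm_num
    rw [hf₁₄ 2 (by decide) (by decide) (by decide) (by decide),
      hf₁₄ 8 (by decide) (by decide) (by decide) (by decide)]
    refine ⟨hdeg, hd₄, ⟨_, hres⟩, μ, hr, Or.inl ⟨hb, rfl, fun v h5 => ?_⟩⟩
    by_contra h6
    exact hfound.2 ⟨v, h5, not_le.1 h6⟩ hb

end RAM

namespace RAM

/-! ### The levels of the recursion -/

variable {W : ℕ} {F : ℕ → ℕ → ℝ} {σ σ₀ : State} {p : Program}

/-- The analysis of a loop by a budget that every iteration decreases and that need not be computed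
from the state. -/
theorem Runs.loopBudget {b : Test} {B n : ℕ} (I : ℕ → State → Prop) (hI : I n σ₀)
    (hbody : ∀ n σ, Frame p σ₀ σ → I n σ → b.Holds F σ →
      Runs W F p σ B fun σ' => ∃ n' < n, I n' σ') :
    Runs W F (.loop b p) σ₀ ((b.steps + B) * n + b.steps) fun σ' =>
      Frame p σ₀ σ' ∧ (∃ n, I n σ') ∧ ¬ b.Holds F σ' := by
  suffices h : ∀ n σ, Frame p σ₀ σ → I n σ → Runs W F (.loop b p) σ ((b.steps + B) * n + b.steps)
      fun σ' => Frame p σ₀ σ' ∧ (∃ n, I n σ') ∧ ¬ b.Holds F σ' from h n σ₀ (Frame.refl _ _) hI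
  intro n
  induction n using Nat.strong_induction_on with
  | _ n ih =>
    intro σ hf hi
    by_cases hb : b.Holds F σ
    · obtain ⟨σ', t, h1, h2, n', h3, h4⟩ := hbody n σ hf hi hb
      obtain ⟨σ'', t', h5, h6, h7⟩ := ih n' h3 σ' (hf.trans h1.frame) h4
      refine ⟨σ'', _, .loopStep _ _ _ _ _ _ _ hb h1 h5, ?_, h7⟩
      calc b.steps + t + t' ≤ b.steps + B + ((b.steps + B) * n' + b.steps) := by omega
        _ = (b.steps + B) * (n' + 1) + b.steps := by ring
        _ ≤ (b.steps + B) * n + b.steps := by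
          have := Nat.mul_le_mul_left (b.steps + B) (show n' + 1 ≤ n from h3)
          omega
    · exact ⟨σ, _, .loopDone _ _ _ hb, by omega, hf, ⟨n, hi⟩, hb⟩

variable {nU nV m : ℕ} {E : Finset (Fin nU × Fin nV)} {w : Fin nV → ℕ → ℝ} {eu ev cidx : ℕ → ℕ}
  {μ : Fin nU → Fin nV}

/-- Computes the middle of the interval of every machine and the number of slots below it. -/
def setThresholds : Program :=
  .seq (forLoop 3 2
    (.seq (.letWord 4 (.mem 1 (.reg 3)))
    (.seq (.putWord 7 (.reg 4) (.lit 0))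
      (.putWord 15 (.reg 4)
        (.quot (.plus (.plus (.mem 5 (.reg 4)) (.mem 6 (.reg 4))) (.lit 1)) (.lit 2))))))
  (forLoop 3 2
    (.seq (.letWord 4 (.mem 1 (.reg 3)))
      (.ite (.wordLt (.mem 3 (.reg 3)) (.mem 15 (.reg 4)))
        (.putWord 7 (.reg 4) (.plus (.mem 7 (.reg 4)) (.lit 1)))
        .nop)))

theorem setThresholds_runs (he : EdgeData W nU m eu ev σ)
    (hle : ∀ j < m, σ.mem 5 (ev j) ≤ m ∧ σ.mem 6 (ev j) ≤ m)
    (hidle : ∀ v, (∀ j < m, ev j ≠ v) → σ.mem 7 v = 0) : ∃ c, c = 70 ∧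
    Runs W F setThresholds σ (c * (m + 1)) fun σ' => Frame setThresholds σ σ' ∧
      (∀ j < m, σ'.mem 15 (ev j) = midRank (σ.mem 5 (ev j)) (σ.mem 6 (ev j))) ∧
      ∀ v, σ'.mem 7 v = ((Finset.range m).filter fun j =>
        ev j = v ∧ σ.mem 3 j < midRank (σ.mem 5 v) (σ.mem 6 v)).card := by
  refine ⟨_, rfl, ?_⟩
  have hb := he.bound
  have h1 := Runs.forLoopWp (W := W) (F := F) (σ₀ := σ) (x := 3) (n := 2) (p :=
    (.seq (.letWord 4 (.mem 1 (.reg 3)))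
    (.seq (.putWord 7 (.reg 4) (.lit 0))
      (.putWord 15 (.reg 4)
        (.quot (.plus (.plus (.mem 5 (.reg 4)) (.mem 6 (.reg 4))) (.lit 1)) (.lit 2))))))
    (by decide) (by decide) (by decide) (by rw [he.reg2]; omega)
    (fun k σ' => (∀ j < k, σ'.mem 7 (ev j) = 0 ∧
      σ'.mem 15 (ev j) = midRank (σ.mem 5 (ev j)) (σ.mem 6 (ev j))) ∧
      ∀ v, (∀ j < m, ev j ≠ v) → σ'.mem 7 v = 0) ?_ ?_
  · refine ((h1.seq (B' := 40 * (m + 1)) (R := fun σ' => _) ?_).mono ?_ fun _ h => h).frame.mono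
      le_rfl fun σ' h => ⟨h.2, h.1⟩
    · rintro σ₁ ⟨hf, h2, h3⟩
      rw [he.reg2] at h2
      have he₁ := he.of_frame hf (by decide) (by decide) (by decide) (by decide)
      have e5 : σ₁.mem 5 = σ.mem 5 := hf.mem 5 (by decide)
      have e6 : σ₁.mem 6 = σ.mem 6 := hf.mem 6 (by decide)
      have e3 : σ₁.mem 3 = σ.mem 3 := hf.mem 3 (by decide)
      have h4 := Runs.forLoopWp (W := W) (F := F) (σ₀ := σ₁) (x := 3) (n := 2) (p :=
        (.seq (.letWord 4 (.mem 1 (.reg 3)))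
          (.ite (.wordLt (.mem 3 (.reg 3)) (.mem 15 (.reg 4)))
            (.putWord 7 (.reg 4) (.plus (.mem 7 (.reg 4)) (.lit 1)))
            .nop))) (by decide) (by decide) (by decide) (by rw [he₁.reg2]; omega)
        (fun k σ' => ∀ v, σ'.mem 7 v = ((Finset.range k).filter fun j =>
          ev j = v ∧ σ.mem 3 j < midRank (σ.mem 5 v) (σ.mem 6 v)).card) ?_ ?_
      · refine h4.mono ?_ ?_
        · rw [he₁.reg2]; norm_num [Program.size, WordExp.steps, Test.steps]; omega
        · rintro σ' ⟨hf', h5⟩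
          rw [he₁.reg2] at h5
          have e15 : σ'.mem 15 = σ₁.mem 15 := hf'.mem 15 (by decide)
          rw [e15]
          exact ⟨fun j hj => (h2 j hj).2, h5⟩
      · intro v
        simp only [mem_setReg, Finset.range_zero, Finset.filter_empty, Finset.card_empty]
        by_cases hv : ∃ j < m, ev j = v
        · obtain ⟨j, hj, rfl⟩ := hv; exact (h2 j hj).1
        · push Not at hv; exact h3 v hv
      · intro k σ' hk hk' hf' hi
        rw [he₁.reg2] at hk
        have he' := he₁.of_frame hf' (by decide) (by decide) (by decide) (by decide)
        have e3' : σ'.mem 3 = σ.mem 3 := (hf'.mem 3 (by decide)).trans e3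
        have e15 : σ'.mem 15 = σ₁.mem 15 := hf'.mem 15 (by decide)
        have := he.machine_le k hk
        have hle : σ'.mem 7 (ev k) ≤ k := by
          rw [hi]; exact (Finset.card_filter_le _ _).trans (by simp)
        simp only [Program.Wp, Test.Holds, WordExp.eval, hk', he'.machine, mem_setReg, mem_setMem,
          reg_setMem, reg_setReg]
        norm_num
        simp only [e3', e15, (h2 k hk).2]
        simp only [Finset.range_add_one, Finset.filter_insert]
        refine ⟨by assumption, fun h5 => ⟨by omega, by omega, fun v => ?_⟩, fun h5 v => ?_⟩
        · by_cases hv : v = ev k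
          · subst hv
            rw [Function.update_self, if_pos ⟨rfl, h5⟩, Finset.card_insert_of_notMem (by simp), hi]
          · rw [Function.update_of_ne hv, if_neg (fun h => hv h.1.symm), hi]
        · rw [if_neg, hi]
          rintro ⟨rfl, h6⟩; omega
    · rw [he.reg2]; norm_num [Program.size, WordExp.steps, Test.steps]; omega
  · refine ⟨by simp, hidle⟩
  · intro k σ' hk hk' hf hi
    rw [he.reg2] at hk
    have he' := he.of_frame hf (by decide) (by decide) (by decide) (by decide)
    have e5 : σ'.mem 5 = σ.mem 5 := hf.mem 5 (by decide)
    have e6 : σ'.mem 6 = σ.mem 6 := hf.mem 6 (by decide)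
    have := he.machine_le k hk
    have := hle k hk
    simp only [Program.Wp, WordExp.eval, hk', he'.machine, mem_setReg, mem_setMem, reg_setMem,
      reg_setReg]
    norm_num
    simp only [e5, e6]
    refine ⟨by omega, by omega, fun j hj => ?_, fun v hv => ?_⟩
    · simp only [Function.update_apply]
      rcases Nat.lt_or_eq_of_le hj with h | rfl
      · have := hi.1 j h
        split_ifs with h'
        · rw [h']; exact ⟨rfl, rfl⟩
        · exact this
      · simp [midRank]
    · rw [Function.update_of_ne (fun h => hv k hk h.symm)]; exact hi.2 v hv

/-- Replaces the interval of every machine by one of its halves. -/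
def updateIntervals : Program :=
  forLoop 3 2
    (.seq (.letWord 4 (.mem 1 (.reg 3)))
      (.ite (.wordLt (.lit 0) (.mem 9 (.reg 4)))
        (.putWord 5 (.reg 4) (.mem 15 (.reg 4)))
        (.putWord 6 (.reg 4) (.mem 15 (.reg 4)))))

theorem updateIntervals_runs (he : EdgeData W nU m eu ev σ)
    (hmid : ∀ j < m, σ.mem 15 (ev j) = midRank (σ.mem 5 (ev j)) (σ.mem 6 (ev j)))
    (hle : ∀ j < m, σ.mem 15 (ev j) ≤ W)
    (hidle : ∀ v, (∀ j < m, ev j ≠ v) → σ.mem 5 v = 0 ∧ σ.mem 6 v = 0 ∧ σ.mem 9 v = 0) :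
    ∃ c, c = 30 ∧
    Runs W F updateIntervals σ (c * (m + 1)) fun σ' => Frame updateIntervals σ σ' ∧
      ∀ v, σ'.mem 5 v = nextLo (σ.mem 5) (σ.mem 6) (σ.mem 9) v ∧
        σ'.mem 6 v = nextHi (σ.mem 5) (σ.mem 6) (σ.mem 9) v := by
  refine ⟨_, rfl, ?_⟩
  have hb := he.bound
  refine (Runs.forLoopWp (by decide) (by decide) (by decide) (by rw [he.reg2]; omega)
    (fun k σ' => (∀ v, (∃ j < k, ev j = v) → σ'.mem 5 v = nextLo (σ.mem 5) (σ.mem 6) (σ.mem 9) v ∧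
        σ'.mem 6 v = nextHi (σ.mem 5) (σ.mem 6) (σ.mem 9) v) ∧
      ∀ v, (∀ j < k, ev j ≠ v) → σ'.mem 5 v = σ.mem 5 v ∧ σ'.mem 6 v = σ.mem 6 v) ?_ ?_).mono ?_ ?_
  · simp
  · rintro k σ' hk hk' hf ⟨h1, h2⟩
    rw [he.reg2] at hk
    have he' := he.of_frame hf (by decide) (by decide) (by decide) (by decide)
    have e9 : σ'.mem 9 = σ.mem 9 := hf.mem 9 (by decide)
    have e15 : σ'.mem 15 = σ.mem 15 := hf.mem 15 (by decide)
    have := he.machine_le k hk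
    have := hle k hk
    have hm := hmid k hk
    have hold : (∀ v, (∃ j < k + 1, ev j = v) ↔ (∃ j < k, ev j = v) ∨ ev k = v) ∧
        ∀ v, (∀ j < k + 1, ev j ≠ v) ↔ (∀ j < k, ev j ≠ v) ∧ ev k ≠ v := by
      refine ⟨fun v => ?_, fun v => ?_⟩
      · constructor
        · rintro ⟨j, hj, rfl⟩
          rcases Nat.lt_succ_iff_lt_or_eq.1 hj with h | rfl
          exacts [Or.inl ⟨j, h, rfl⟩, Or.inr rfl]
        · rintro (⟨j, hj, rfl⟩ | rfl)
          exacts [⟨j, by omega, rfl⟩, ⟨k, by omega, rfl⟩]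
      · exact ⟨fun h => ⟨fun j hj => h j (by omega), h k (by omega)⟩, fun h j hj => by
          rcases Nat.lt_succ_iff_lt_or_eq.1 hj with h' | rfl
          exacts [h.1 j h', h.2]⟩
    have hcur : (σ'.mem 5 (ev k) = nextLo (σ.mem 5) (σ.mem 6) (σ.mem 9) (ev k) ∧
        σ'.mem 6 (ev k) = nextHi (σ.mem 5) (σ.mem 6) (σ.mem 9) (ev k)) ∨
        (σ'.mem 5 (ev k) = σ.mem 5 (ev k) ∧ σ'.mem 6 (ev k) = σ.mem 6 (ev k)) := by
      by_cases h : ∃ j < k, ev j = ev k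
      · exact Or.inl (h1 _ h)
      · push Not at h; exact Or.inr (h2 _ h)
    simp only [nextLo, nextHi, ← hm] at hcur
    simp only [Program.Wp, Test.Holds, WordExp.eval, hk', he'.machine, mem_setReg, mem_setMem,
      reg_setMem, reg_setReg, hold.1, hold.2]
    norm_num
    simp only [e9, e15]
    refine ⟨by assumption, fun h3 => ⟨by omega, by omega, fun v hv => ?_, fun v hv hv' => ?_⟩,
      fun h3 => ⟨by omega, by omega, fun v hv => ?_, fun v hv hv' => ?_⟩⟩
    · by_cases h4 : v = ev k
      · subst h4
        rw [Function.update_self]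
        simp only [nextLo, nextHi, ← hm, show σ.mem 9 (ev k) ≠ 0 by omega, if_false] at hcur ⊢
        rcases hcur with h | h <;> simp [h.1, h.2]
      · rw [Function.update_of_ne h4]
        exact h1 v (hv.resolve_right fun h => h4 h.symm)
    · rw [Function.update_of_ne (fun h => hv' h.symm)]; exact h2 v hv
    · by_cases h4 : v = ev k
      · subst h4
        rw [Function.update_self]
        simp only [nextLo, nextHi, ← hm, h3, if_true] at hcur ⊢
        rcases hcur with h | h <;> simp [h.1, h.2]
      · rw [Function.update_of_ne h4]
        exact h1 v (hv.resolve_right fun h => h4 h.symm)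
    · rw [Function.update_of_ne (fun h => hv' h.symm)]; exact h2 v hv
  · rw [he.reg2]; norm_num [Program.size, WordExp.steps, Test.steps]; omega
  · rintro σ' ⟨hf, h1, h2⟩
    rw [he.reg2] at h1 h2
    refine ⟨hf, fun v => ?_⟩
    by_cases hv : ∃ j < m, ev j = v
    · exact h1 v hv
    · push Not at hv
      obtain ⟨h3, h4, h5⟩ := hidle v hv
      rw [(h2 v hv).1, (h2 v hv).2, nextLo, nextHi, h3, h4, h5]
      exact ⟨rfl, rfl⟩

/-- The memory during the levels of the recursion; machines without edges are never visited. -/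
structure LevelMem (E : Finset (Fin nU × Fin nV)) (m : ℕ) (ev : ℕ → ℕ) (μ : Fin nU → Fin nV)
    (σ : State) : Prop where
  rep : Represents E μ (σ.mem 2)
  deg : ∀ v, σ.mem 8 v = jobCount nU (σ.mem 2) v
  idle : ∀ v, (∀ j < m, ev j ≠ v) →
    σ.mem 5 v = 0 ∧ σ.mem 6 v = 0 ∧ σ.mem 7 v = 0 ∧ σ.mem 9 v = 0

/-- One level of the recursion: rounds are performed until the search finds no underloaded machine,
and the labels of the last search give the intervals of the next level. -/
def level : Program :=
  .seq setThresholds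
  (.seq (.letWord 10 (.lit 1))
  (.seq (.loop (.wordLt (.lit 0) (.reg 10)) round)
  (.seq updateIntervals
    (.letWord 13 (.quot (.plus (.reg 13) (.lit 1)) (.lit 2))))))

/-- A level consists of at most `2 √(4 |U|) + 2` rounds. -/
theorem level_runs (he : EdgeList E m eu ev) (hdat : EdgeData W nU m eu ev σ)
    (hw : ∀ v, Monotone (w v)) (hcard : (centers E w).card ≤ m)
    (hslot : ∀ (v : Fin nV) x, ((Finset.range m).filter fun j =>
      ev j = v ∧ σ.mem 3 j < x).card = slotCut E w v x)
    (hmem : LevelMem E m ev μ σ)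
    (hs : LevelState E w μ (fun v => σ.mem 5 v) (fun v => σ.mem 6 v)) (hK : σ.reg 13 ≤ m) :
    ∃ c, c = 1000 ∧ Runs W F level σ (c * (2 * Nat.sqrt (4 * nU) + 2) * (m + 1)) fun σ' =>
      Frame level σ σ' ∧ σ'.reg 13 = (σ.reg 13 + 1) / 2 ∧ ∃ μ', LevelMem E m ev μ' σ' ∧
        ∃ d : Fin nV → ℕ, LevelStep E w (fun v => σ.mem 5 v) (fun v => σ.mem 6 v) d μ μ' ∧
          (fun v : Fin nV => σ'.mem 5 v) =
            nextLo (fun v : Fin nV => σ.mem 5 v) (fun v => σ.mem 6 v) d ∧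
          (fun v : Fin nV => σ'.mem 6 v) =
            nextHi (fun v : Fin nV => σ.mem 5 v) (fun v => σ.mem 6 v) d := by
  refine ⟨_, rfl, ?_⟩
  have hb := hdat.bound
  set R := 2 * Nat.sqrt (4 * nU) + 2 with hR
  have hedge : ∀ j < m, ∀ h : ev j < nV, machineDegree E ⟨ev j, h⟩ ≠ 0 := fun j hj h =>
    machineDegree_ne_zero (u := ⟨eu j, he.job_lt j hj⟩) ((he.mem_iff _ _).2 ⟨j, hj, rfl, rfl⟩)
  have hle : ∀ j < m, σ.mem 5 (ev j) ≤ m ∧ σ.mem 6 (ev j) ≤ m := by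
    intro j hj
    have h := hedge j hj (he.machine_lt j hj)
    have h1 := hs.lt _ h
    have h2 := hs.le _ h
    simp only at h1 h2
    omega
  obtain ⟨_, rfl, h1⟩ := setThresholds_runs (F := F) hdat hle fun v hv => (hmem.idle v hv).2.2.1
  refine ((h1.seq (B' := 920 * R * (m + 1)) fun σ₁ h => ?_).mono ?_ fun _ h => h).frame.mono le_rfl
    fun σ' h => ⟨h.2, h.1⟩
  swap
  · nlinarith [Nat.mul_le_mul_right (m + 1) (show 1 ≤ R by omega)]
  obtain ⟨hf₁, hmid₁, hT₁⟩ := h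
  have h2 : Runs W F (.letWord 10 (.lit 1)) σ₁ 2 fun σ' => σ' = σ₁.setReg 10 1 :=
    ⟨_, _, .letWord _ _ _ (show 1 ≤ W by omega), le_rfl, rfl⟩
  refine (h2.seq (B' := 900 * R * (m + 1)) fun σ₂ h => ?_).mono ?_ fun _ h => h
  swap
  · nlinarith [Nat.mul_le_mul_right (m + 1) (show 1 ≤ R by omega)]
  subst h
  have hdat₁ := hdat.of_frame hf₁ (by decide) (by decide) (by decide) (by decide)
  have hdat₂ : EdgeData W nU m eu ev (σ₁.setReg 10 1) :=
    ⟨by simp [hdat₁.reg0], by simp [hdat₁.reg2], hdat₁.job, hdat₁.machine, hdat₁.job_lt,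
      hdat₁.machine_le, hdat₁.bound⟩
  have e5 : σ₁.mem 5 = σ.mem 5 := hf₁.mem 5 (by decide)
  have e6 : σ₁.mem 6 = σ.mem 6 := hf₁.mem 6 (by decide)
  set lo : Fin nV → ℕ := fun v => σ.mem 5 v with hlo
  set hi : Fin nV → ℕ := fun v => σ.mem 6 v with hhi
  set T : Fin nV → ℕ := fun v => σ₁.mem 7 v with hTd
  have hT : ∀ v, T v = slotCut E w v (midRank (lo v) (hi v)) := fun v => by
    rw [← hslot]; exact hT₁ v
  have hidleT : ∀ v, (∀ j < m, ev j ≠ v) → σ₁.mem 7 v = 0 := by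
    intro v hv
    rw [hT₁, Finset.card_eq_zero, Finset.filter_eq_empty_iff]
    intro j hj h
    exact hv j (Finset.mem_range.1 hj) h.1
  -- The budget bounds the number of rounds that remain. By `RoundsDone.le_sqrt` it is not exhausted
  -- before the last round, which finds nothing.
  have h3 := Runs.loopBudget (W := W) (F := F) (σ₀ := σ₁.setReg 10 1) (p := round)
    (b := .wordLt (.lit 0) (.reg 10)) (B := 700 * (m + 1)) (n := R)
    (fun n σ' => (∀ v, σ'.mem 8 v = jobCount nU (σ'.mem 2) v) ∧
      (∀ v, (∀ j < m, ev j ≠ v) → σ'.mem 9 v = 0) ∧ ∃ μ', Represents E μ' (σ'.mem 2) ∧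
      ((σ'.reg 10 ≠ 0 ∧ 0 < n ∧ ∃ r, r + n = R ∧ RoundsDone E w lo hi μ μ' r) ∨
        (σ'.reg 10 = 0 ∧ LevelStep E w lo hi (fun v => σ'.mem 9 v) μ μ'))) ?_ ?_
  · refine (h3.seq (B' := 40 * (m + 1)) fun σ₃ h => ?_).mono ?_ fun _ h => h
    · obtain ⟨hf₃, ⟨n, hdeg₃, hidle₃, μ', hrep₃, hor⟩, hb₃⟩ := h
      simp only [Test.Holds, WordExp.eval] at hb₃
      have hstep : LevelStep E w lo hi (fun v => σ₃.mem 9 v) μ μ' := by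
        rcases hor with ⟨h4, -⟩ | ⟨-, h4⟩
        · omega
        · exact h4
      have hdat₃ := hdat₂.of_frame hf₃ (by decide) (by decide) (by decide) (by decide)
      have e5₃ : σ₃.mem 5 = σ.mem 5 := (hf₃.mem 5 (by decide)).trans e5
      have e6₃ : σ₃.mem 6 = σ.mem 6 := (hf₃.mem 6 (by decide)).trans e6
      have e7₃ : σ₃.mem 7 = σ₁.mem 7 := hf₃.mem 7 (by decide)
      have e15₃ : σ₃.mem 15 = σ₁.mem 15 := hf₃.mem 15 (by decide)
      have e13₃ : σ₃.reg 13 = σ.reg 13 := by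
        rw [hf₃.reg 13 (by decide), reg_setReg, if_neg (by decide), hf₁.reg 13 (by decide)]
      obtain ⟨_, rfl, h4⟩ := updateIntervals_runs (F := F) hdat₃
        (fun j hj => by rw [e15₃, e5₃, e6₃]; exact hmid₁ j hj)
        (fun j hj => by
          rw [e15₃, hmid₁ j hj, midRank]
          have := hle j hj
          omega)
        (fun v hv => by
          rw [e5₃, e6₃]
          exact ⟨(hmem.idle v hv).1, (hmem.idle v hv).2.1, hidle₃ v hv⟩)
      refine (h4.seq (B' := 6) fun σ₄ h => ?_).mono (by omega) fun _ h => h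
      obtain ⟨hf₄, hint⟩ := h
      have e13₄ : σ₄.reg 13 = σ.reg 13 := (hf₄.reg 13 (by decide)).trans e13₃
      have e2₄ : σ₄.mem 2 = σ₃.mem 2 := hf₄.mem 2 (by decide)
      have e7₄ : σ₄.mem 7 = σ₁.mem 7 := (hf₄.mem 7 (by decide)).trans e7₃
      have e8₄ : σ₄.mem 8 = σ₃.mem 8 := hf₄.mem 8 (by decide)
      have e9₄ : σ₄.mem 9 = σ₃.mem 9 := hf₄.mem 9 (by decide)
      rw [e5₃, e6₃] at hint
      refine ⟨_, _, .letWord _ _ _ (by simp only [WordExp.eval, e13₄]; omega), le_rfl, ?_⟩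
      simp only [WordExp.eval, e13₄, reg_setReg, if_true, mem_setReg, true_and]
      refine ⟨μ', ⟨by simpa [e2₄] using hrep₃, by simpa [e2₄, e8₄] using hdeg₃, fun v hv => ?_⟩,
        _, hstep, funext fun v => (hint v).1, funext fun v => (hint v).2⟩
      simp only [mem_setReg, e7₄, e9₄]
      obtain ⟨h5, h6, -⟩ := hmem.idle v hv
      refine ⟨?_, ?_, hidleT v hv, hidle₃ v hv⟩
      · rw [(hint v).1, nextLo, if_pos (hidle₃ v hv), h5]
      · rw [(hint v).2, nextHi, if_pos (hidle₃ v hv), h5, h6]; rfl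
    · simp only [Test.steps, WordExp.steps]
      nlinarith [Nat.mul_le_mul_right (m + 1) (show 1 ≤ R by omega)]
  · have e2 : σ₁.mem 2 = σ.mem 2 := hf₁.mem 2 (by decide)
    have e8 : σ₁.mem 8 = σ.mem 8 := hf₁.mem 8 (by decide)
    have e9 : σ₁.mem 9 = σ.mem 9 := hf₁.mem 9 (by decide)
    simp only [mem_setReg, e2, e8, e9]
    exact ⟨hmem.deg, fun v hv => (hmem.idle v hv).2.2.2, μ, hmem.rep,
      Or.inl ⟨by simp, by omega, 0, by omega, RoundsDone.zero hs⟩⟩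
  · rintro n σ' hf ⟨hdeg', hidle', μ', hrep', hor⟩ hb'
    simp only [Test.Holds, WordExp.eval] at hb'
    obtain ⟨-, hn, r, hrn, hdone⟩ := hor.resolve_right fun h => by omega
    have hdat' := hdat₂.of_frame hf (by decide) (by decide) (by decide) (by decide)
    have e5' : σ'.mem 5 = σ.mem 5 := (hf.mem 5 (by decide)).trans e5
    have e7' : σ'.mem 7 = σ₁.mem 7 := hf.mem 7 (by decide)
    obtain ⟨_, rfl, h4⟩ := round_runs (F := F) he hdat' hrep'
      (fun j hj => by rw [e5']; have := (hle j hj).1; omega) hdeg' hidle'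
    refine h4.mono le_rfl fun σ'' h => ?_
    obtain ⟨hf'', hdeg'', hidle'', D, μ'', hres, hrep'', hor'⟩ := h
    rw [e5', e7'] at hres hor'
    rcases hor' with ⟨h5, rfl, h6⟩ | ⟨h5, h6, h7⟩
    · exact ⟨0, hn, hdeg'', hidle'', μ'', hrep'',
        Or.inr ⟨h5, hdone.levelStep hw hT hres h6⟩⟩
    · have h8 := hdone.le_sqrt hs hw hT hres h7 h6
      rw [Fintype.card_fin] at h8
      exact ⟨n - 1, by omega, hdeg'', hidle'', μ'', hrep'',
        Or.inl ⟨h5, by omega, r + 1, by omega, hdone.succ hw hT hres h7⟩⟩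

end RAM

section Levels

variable {U V : Type} [Fintype U] [Fintype V] {E : Finset (U × V)} {w : V → ℕ → ℝ} {μ μe : U → V}

variable (E w) in
/-- The upper ends of the intervals of the first level, which consists of the whole network. -/
noncomputable def initialHi (v : V) : ℕ := if machineDegree E v = 0 then 0 else (centers E w).card

theorem centers_nonempty {v : V} (hv : machineDegree E v ≠ 0) : 0 < (centers E w).card :=
  Finset.card_pos.2 ⟨w v 0, mem_centers.2 ⟨v, 0, Nat.pos_of_ne_zero hv, rfl⟩⟩

theorem LevelState.initial (hμ : ∀ u, (u, μ u) ∈ E) :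
    LevelState E w μ (fun _ => 0) (initialHi E w) where
  edge := hμ
  isolated _ _ := rfl
  lt v hv := by simpa [initialHi, hv] using centers_nonempty hv
  le v hv := by simp [initialHi, hv]
  disj v v' hv hv' := by simp [initialHi, hv, hv']
  low v := by simp [slotCut]
  high v := by
    refine (load_le hμ v).trans ?_
    by_cases hv : machineDegree E v = 0
    · simp [hv]
    rw [slotCut, Finset.filter_true_of_mem, Finset.card_range]
    intro i hi
    rw [initialHi, if_neg hv]
    exact centerRank_lt_card (mem_centers.2 ⟨v, i, Finset.mem_range.1 hi, rfl⟩)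

/-- From the first level on, the levels make up a run of CancelAll on the whole network. -/
theorem LevelRun.cancelAll_initial (hμ : ∀ u, (u, μ u) ∈ E) (hp : 0 < (centers E w).card)
    (h : LevelRun E w (centers E w).card (fun _ => 0) (initialHi E w) μ μe) :
    ∃ t, CancelAll E w (innerVertices E w) (assignFlow w μ) (assignFlow w μe) t := by
  obtain ⟨t, ht⟩ := h.cancelAll (a := 0) (b := (centers E w).card) (ν := μ) (.initial hμ)
    ⟨hp, le_rfl, fun v hv => Or.inl ⟨rfl, by simp [initialHi, hv]⟩⟩ (by omega)
    ⟨hμ, fun _ => Iff.rfl, fun _ _ => rfl⟩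
  have h1 : patch (fun _ => 0) 0 μ μe μ = μe := by funext u; simp [patch]
  have h2 : nodeSet E w (fun _ => 0) μ 0 (centers E w).card = innerVertices E w := by
    ext x
    cases x <;> simp [nodeSet, partSet, innerVertices, centersBetween]
    exact centerRank_lt_card
  rw [h1, h2] at ht
  exact ⟨t, ht⟩

end Levels

namespace RAM

/-! ### The program for CancelAll, given the ranks of the cost centers of the slots -/

variable {W : ℕ} {F : ℕ → ℕ → ℝ} {σ : State} {nU nV m : ℕ} {E : Finset (Fin nU × Fin nV)}
  {w : Fin nV → ℕ → ℝ} {eu ev : ℕ → ℕ} {μ : Fin nU → Fin nV}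

/-- Assigns every job to the machine of its first edge, since edges with smaller indices are
processed later, and initializes the intervals of the machines and their numbers of jobs. -/
def initialAssignment : Program :=
  .seq (forLoop 3 2
    (.seq (.letWord 4 (.minus (.minus (.reg 2) (.lit 1)) (.reg 3)))
    (.seq (.putWord 2 (.mem 0 (.reg 4)) (.mem 1 (.reg 4)))
      (.putWord 6 (.mem 1 (.reg 4)) (.reg 14)))))
  (.seq (forLoop 3 0
    (.seq (.letWord 4 (.mem 2 (.reg 3)))
      (.putWord 8 (.reg 4) (.plus (.mem 8 (.reg 4)) (.lit 1)))))
    (.letWord 13 (.reg 14)))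

theorem initialAssignment_runs (hdat : EdgeData W nU m eu ev σ)
    (hμ : ∀ u : Fin nU, ∃ j < m, eu j = u ∧ ev j = μ u ∧ ∀ i < j, eu i ≠ u)
    (h14 : σ.reg 14 ≤ m) (hzero : ∀ a ∈ [6, 8], ∀ i, σ.mem a i = 0) : ∃ c, c = 60 ∧
    Runs W F initialAssignment σ (c * (m + nU + 1)) fun σ' => Frame initialAssignment σ σ' ∧
      σ'.reg 13 = σ.reg 14 ∧ (∀ u : Fin nU, σ'.mem 2 u = μ u) ∧
      (∀ v, σ'.mem 8 v = jobCount nU (σ'.mem 2) v) ∧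
      (∀ j < m, σ'.mem 6 (ev j) = σ.reg 14) ∧ ∀ v, (∀ j < m, ev j ≠ v) → σ'.mem 6 v = 0 := by
  refine ⟨_, rfl, ?_⟩
  have hb := hdat.bound
  have h1 := Runs.forLoopWp (W := W) (F := F) (σ₀ := σ) (x := 3) (n := 2) (p :=
    (.seq (.letWord 4 (.minus (.minus (.reg 2) (.lit 1)) (.reg 3)))
    (.seq (.putWord 2 (.mem 0 (.reg 4)) (.mem 1 (.reg 4)))
      (.putWord 6 (.mem 1 (.reg 4)) (.reg 14)))))
    (by decide) (by decide) (by decide) (by rw [hdat.reg2]; omega)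
    (fun k σ' => (∀ j < m, m ≤ j + k → (∀ i < j, m ≤ i + k → eu i ≠ eu j) →
        σ'.mem 2 (eu j) = ev j) ∧ (∀ j < m, m ≤ j + k → σ'.mem 6 (ev j) = σ.reg 14) ∧
        ∀ v, (∀ j < m, ev j ≠ v) → σ'.mem 6 v = 0) ?_ ?_
  · refine ((h1.seq (B' := 20 * nU + 10) fun σ₁ h => ?_).mono ?_ fun _ h => h).frame.mono
      le_rfl fun σ' h => ⟨h.2, h.1⟩
    · obtain ⟨hf, h2, h3, h4⟩ := h
      rw [hdat.reg2] at h2 h3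
      have hd₁ := hdat.of_frame hf (by decide) (by decide) (by decide) (by decide)
      have e8 : σ₁.mem 8 = σ.mem 8 := hf.mem 8 (by decide)
      have e14 : σ₁.reg 14 = σ.reg 14 := hf.reg 14 (by decide)
      have hμ₁ : ∀ u : Fin nU, σ₁.mem 2 u = μ u := by
        intro u
        obtain ⟨j, hj, h5, h6, h7⟩ := hμ u
        rw [← h5, ← h6]
        exact h2 j hj (by omega) fun i hi _ => by rw [h5]; exact h7 i hi
      have h5 := Runs.forLoopWp (W := W) (F := F) (σ₀ := σ₁) (x := 3) (n := 0) (p :=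
        (.seq (.letWord 4 (.mem 2 (.reg 3)))
          (.putWord 8 (.reg 4) (.plus (.mem 8 (.reg 4)) (.lit 1)))))
        (by decide) (by decide) (by decide) (by rw [hd₁.reg0]; omega)
        (fun k σ' => ∀ v, σ'.mem 8 v = jobCount k (σ₁.mem 2) v) ?_ ?_
      · refine (h5.seq (B' := 2) fun σ₂ h => ?_).mono ?_ fun _ h => h
        · obtain ⟨hf₂, h6⟩ := h
          rw [hd₁.reg0] at h6
          have e14' : σ₂.reg 14 = σ.reg 14 := (hf₂.reg 14 (by decide)).trans e14
          have e2 : σ₂.mem 2 = σ₁.mem 2 := hf₂.mem 2 (by decide)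
          have e6 : σ₂.mem 6 = σ₁.mem 6 := hf₂.mem 6 (by decide)
          refine ⟨_, _, .letWord _ _ _ (by simp only [WordExp.eval, e14']; omega), le_rfl, ?_⟩
          simp only [WordExp.eval, reg_setReg, mem_setReg, e2, e6, if_true]
          exact ⟨e14', hμ₁, h6, fun j hj => h3 j hj (by omega), h4⟩
        · rw [hd₁.reg0]; norm_num [Program.size, WordExp.steps]; omega
      · intro v; simp [e8, hzero, jobCount]
      · intro k σ' hk hk' hf' hi
        rw [hd₁.reg0] at hk
        have e2 : σ'.mem 2 = σ₁.mem 2 := hf'.mem 2 (by decide)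
        have hW : σ₁.mem 2 k ≤ W := by
          rw [hμ₁ ⟨k, hk⟩]
          obtain ⟨j, hj, -, h6, -⟩ := hμ ⟨k, hk⟩
          rw [← h6]; exact hdat.machine_le j hj
        have hle := jobCount_le k (σ₁.mem 2) (σ₁.mem 2 k)
        simp only [Program.Wp, WordExp.eval, hk', mem_setReg, mem_setMem, reg_setMem, reg_setReg]
        norm_num
        simp only [e2, hi]
        refine ⟨by omega, by omega, fun v => ?_⟩
        simp only [Function.update_apply, jobCount, Finset.range_add_one, Finset.filter_insert]
        by_cases hv : v = σ₁.mem 2 k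
        · rw [if_pos hv, hv, if_pos rfl, Finset.card_insert_of_notMem (by simp)]
        · rw [if_neg hv, if_neg (Ne.symm hv)]; exact hi v
    · rw [hdat.reg2]; norm_num [Program.size, WordExp.steps]; omega
  · refine ⟨fun j hj h => by omega, fun j hj h => by omega, fun v _ => by simp [hzero]⟩
  · rintro k σ' hk hk' hf ⟨h2, h3, h4⟩
    rw [hdat.reg2] at hk
    have hd := hdat.of_frame hf (by decide) (by decide) (by decide) (by decide)
    have e14 : σ'.reg 14 = σ.reg 14 := hf.reg 14 (by decide)
    have hlt : m - 1 - k < m := by omega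
    have hu := hdat.job_lt _ hlt
    have hv := hdat.machine_le _ hlt
    simp only [Program.Wp, WordExp.eval, hk', hd.machine, hd.job, hd.reg2, mem_setReg, mem_setMem,
      reg_setMem, reg_setReg]
    norm_num
    simp only [e14, hd.machine, hd.job]
    refine ⟨by omega, by omega, by omega, by omega, fun j hj h hfirst => ?_, fun j hj h => ?_,
      fun v hv => ?_⟩
    · rw [Function.update_apply]
      split_ifs with h5
      · by_contra h6
        exact hfirst (m - 1 - k) (by
          have : m - 1 - k ≠ j := by rintro rfl; exact h6 rfl
          omega) (by omega) h5.symm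
      · exact h2 j hj (by
          have : j ≠ m - 1 - k := by rintro rfl; exact h5 rfl
          omega) fun i hi h6 => hfirst i hi (by omega)
    · rw [Function.update_apply]
      split_ifs with h5
      · rfl
      · exact h3 j hj (by
          have : j ≠ m - 1 - k := by rintro rfl; exact h5 rfl
          omega)
    · rw [Function.update_of_ne (fun h => hv _ hlt h.symm)]; exact h4 v hv

/-- CancelAll for the assignment along the first edges. -/
def cancelAll : Program :=
  .seq initialAssignment (.loop (.wordLt (.lit 1) (.reg 13)) level)

/-- The result of the computation of the ranks of the cost centers: register 14 holds their number,
and the entries of array 3 at the edges of a machine are the ranks of its slots, in some order. -/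
structure Prepared (E : Finset (Fin nU × Fin nV)) (w : Fin nV → ℕ → ℝ) (W m : ℕ) (eu ev : ℕ → ℕ)
    (σ : State) : Prop where
  data : EdgeData W nU m eu ev σ
  card : σ.reg 14 = (centers E w).card
  slot : ∀ (v : Fin nV) x, ((Finset.range m).filter fun j =>
    ev j = v ∧ σ.mem 3 j < x).card = slotCut E w v x
  zero : ∀ a ∈ [5, 6, 7, 8, 9], ∀ i, σ.mem a i = 0

/-- The program runs through at most `⌈log₂ m⌉` levels, since each level halves the intervals. -/
theorem cancelAll_runs (he : EdgeList E m eu ev) (h : Prepared E w W m eu ev σ)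
    (hw : ∀ v, Monotone (w v)) (hcard : (centers E w).card ≤ m) (hpos : 0 < (centers E w).card)
    (hμ : ∀ u : Fin nU, ∃ j < m, eu j = u ∧ ev j = μ u ∧ ∀ i < j, eu i ≠ u) : ∃ c, c = 3000 ∧
    Runs W F cancelAll σ (c * ((2 * Nat.sqrt (4 * nU) + 2) * (m * (Nat.clog 2 m + 1)))) fun σ' =>
      ∃ μe, Represents E μe (σ'.mem 2) ∧ ∃ t, CancelAll E w (innerVertices E w)
        (assignFlow w μ) (assignFlow w μe) t := by
  refine ⟨_, rfl, ?_⟩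
  set R := 2 * Nat.sqrt (4 * nU) + 2 with hR
  have hμE : ∀ u, (u, μ u) ∈ E := fun u => by
    obtain ⟨j, hj, h1, h2, -⟩ := hμ u
    exact (he.mem_iff _ _).2 ⟨j, hj, h1, h2⟩
  have hzero := h.zero
  simp only [List.mem_cons, List.not_mem_nil, or_false, forall_eq_or_imp, forall_eq] at hzero
  obtain ⟨z5, z6, z7, z8, z9⟩ := hzero
  obtain ⟨_, rfl, h1⟩ := initialAssignment_runs (F := F) h.data hμ (h.card ▸ hcard)
    (by simp [z6, z8])
  have hfinal : 120 * (m + 1) + ((3 + 1000 * R * (m + 1)) *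
      Nat.clog 2 (centers E w).card + 3) ≤ 3000 * (R * (m * (Nat.clog 2 m + 1))) := by
    have h2 : Nat.clog 2 (centers E w).card ≤ Nat.clog 2 m := Nat.clog_mono_right 2 hcard
    have h3 : m + 1 ≤ 2 * m := by omega
    have h4 : 2 ≤ R := by omega
    calc _ ≤ 120 * (2 * m) + ((3 + 1000 * R * (2 * m)) * Nat.clog 2 m + 3) := by gcongr
      _ ≤ _ := by
        nlinarith [Nat.mul_le_mul h4 (show 1 ≤ m by omega),
          Nat.mul_le_mul_right (Nat.clog 2 m) (Nat.mul_le_mul h4 (show 1 ≤ m by omega))]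
  have hedge : ∀ v : Fin nV, machineDegree E v ≠ 0 → ∃ j < m, ev j = v := by
    intro v hv
    obtain ⟨⟨u, v'⟩, hu⟩ := Finset.card_pos.1 (Nat.pos_of_ne_zero hv)
    simp only [Finset.mem_filter] at hu
    obtain ⟨j, hj, -, h2⟩ := (he.mem_iff u v).1 (hu.2 ▸ hu.1)
    exact ⟨j, hj, h2⟩
  refine (h1.seq (B' := (3 + 1000 * R * (m + 1)) * Nat.clog 2 (centers E w).card + 3)
    fun σ₁ h2 => ?_).mono ?_ fun _ h => h
  · obtain ⟨hf₁, h13, hμ₁, h8, h6, h6'⟩ := h2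
    have hd₁ := h.data.of_frame hf₁ (by decide) (by decide) (by decide) (by decide)
    have e3 : σ₁.mem 3 = σ.mem 3 := hf₁.mem 3 (by decide)
    have e5 : σ₁.mem 5 = σ.mem 5 := hf₁.mem 5 (by decide)
    have e7 : σ₁.mem 7 = σ.mem 7 := hf₁.mem 7 (by decide)
    have e9 : σ₁.mem 9 = σ.mem 9 := hf₁.mem 9 (by decide)
    have hlo : (fun v : Fin nV => σ₁.mem 5 v) = fun _ => 0 := by funext v; rw [e5, z5]
    have hhi : (fun v : Fin nV => σ₁.mem 6 v) = initialHi E w := by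
      funext v
      by_cases hv : machineDegree E v = 0
      · rw [initialHi, if_pos hv]
        refine h6' v fun j hj h3 => ?_
        exact machineDegree_ne_zero ((he.mem_iff ⟨eu j, he.job_lt j hj⟩ v).2 ⟨j, hj, rfl, h3⟩) hv
      · obtain ⟨j, hj, h3⟩ := hedge v hv
        rw [initialHi, if_neg hv, ← h3, h6 j hj, h.card]
    refine (Runs.loopBudget (n := Nat.clog 2 (centers E w).card) (B := 1000 * R * (m + 1))
      (fun n σ' => ∃ μ', LevelMem E m ev μ' σ' ∧
        LevelState E w μ' (fun v => σ'.mem 5 v) (fun v => σ'.mem 6 v) ∧ σ'.reg 13 ≤ m ∧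
        Nat.clog 2 (σ'.reg 13) ≤ n ∧
        ∀ μe, LevelRun E w (σ'.reg 13) (fun v => σ'.mem 5 v) (fun v => σ'.mem 6 v) μ' μe →
          LevelRun E w (centers E w).card (fun _ => 0) (initialHi E w) μ μe) ?_ ?_).mono
      (by simp [Test.steps, WordExp.steps]) ?_
    · rw [hlo, hhi, h13, h.card]
      refine ⟨μ, ⟨⟨hμ₁, hμE⟩, h8, fun v hv => ⟨by rw [e5, z5], h6' v hv, by rw [e7, z7],
        by rw [e9, z9]⟩⟩, .initial hμE, hcard, le_rfl, fun _ h => h⟩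
    · rintro n σ' hf ⟨μ', hmem, hs, hK, hn, hrun⟩ hb
      simp only [Test.Holds, WordExp.eval] at hb
      have hd := hd₁.of_frame hf (by decide) (by decide) (by decide) (by decide)
      have e3' : σ'.mem 3 = σ.mem 3 := (hf.mem 3 (by decide)).trans e3
      obtain ⟨_, rfl, h3⟩ := level_runs (F := F) he hd hw hcard (by rw [e3']; exact h.slot) hmem
        hs hK
      refine h3.mono le_rfl ?_
      rintro σ'' ⟨-, h13', μ'', hmem', d, hstep, hlo', hhi'⟩
      rw [Nat.clog_of_two_le (by norm_num) hb] at hn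
      refine ⟨n - 1, by omega, μ'', hmem', ?_, by omega, ?_, fun μe h4 => hrun μe ?_⟩
      · rw [hlo', hhi']; exact hstep.next
      · rw [h13']
        have : σ'.reg 13 + 2 - 1 = σ'.reg 13 + 1 := by omega
        rw [this] at hn; omega
      · rw [hlo', hhi', h13'] at h4
        exact .step _ _ _ d _ μ'' _ hb hstep h4
    · rintro σ' ⟨-, ⟨n, μ', hmem, hs, -, -, hrun⟩, hb⟩
      simp only [Test.Holds, WordExp.eval, not_lt] at hb
      exact ⟨μ', hmem.rep, (hrun μ' (.done _ _ _ _ hb)).cancelAll_initial hμE hpos⟩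
  · have h3 : nU ≤ m := (⟨fun u => by simp, hμE⟩ : Represents E μ fun u =>
      if h : u < nU then (μ ⟨u, h⟩ : ℕ) else 0).le he
    exact le_trans (by omega) hfinal

end RAM

/-! ### Reading the slots off the list of edges -/

/-- The number of edges before the edge `j` at its machine. The edge `j` stands for the slot with
this index. -/
def edgeRank (ev : ℕ → ℕ) (j : ℕ) : ℕ := ((Finset.range j).filter fun i => ev i = ev j).card

theorem edgeRank_le (ev : ℕ → ℕ) (j : ℕ) : edgeRank ev j ≤ j :=
  (Finset.card_filter_le _ _).trans (by simp)

/-- The edges at a machine number its slots. -/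
theorem card_edgeRank (ev : ℕ → ℕ) (v : ℕ) (P : ℕ → Prop) [DecidablePred P] (m : ℕ) :
    ((Finset.range m).filter fun j => ev j = v ∧ P (edgeRank ev j)).card =
      ((Finset.range ((Finset.range m).filter fun j => ev j = v).card).filter P).card := by
  induction m with
  | zero => simp
  | succ m ih =>
    simp only [Finset.range_add_one, Finset.filter_insert]
    by_cases hv : ev m = v
    · have hr : ((Finset.range m).filter fun j => ev j = v).card = edgeRank ev m := by
        rw [edgeRank, hv]
      rw [hr] at ih
      rw [if_pos hv, Finset.card_insert_of_notMem (by simp), hr, Finset.range_add_one,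
        Finset.filter_insert]
      by_cases hP : P (edgeRank ev m)
      · rw [if_pos ⟨hv, hP⟩, if_pos hP, Finset.card_insert_of_notMem (by simp),
          Finset.card_insert_of_notMem (by simp), ih]
      · rw [if_neg (fun h => hP h.2), if_neg hP, ih]
    · rw [if_neg hv, if_neg (fun h => hv h.1), ih]

namespace RAM

variable {nU nV m : ℕ} {E : Finset (Fin nU × Fin nV)} {w : Fin nV → ℕ → ℝ} {eu ev : ℕ → ℕ}

/-- The degree of a machine is the number of its occurrences in the list `ev`, that is, no edge is
listed twice. -/
def CountsDegrees (E : Finset (Fin nU × Fin nV)) (m : ℕ) (ev : ℕ → ℕ) : Prop :=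
  ∀ v : Fin nV, machineDegree E v = ((Finset.range m).filter fun j => ev j = v).card

theorem CountsDegrees.slotCut_eq (hd : CountsDegrees E m ev) (v : Fin nV) (x : ℕ) :
    slotCut E w v x = ((Finset.range m).filter fun j =>
      ev j = v ∧ centerRank E w (w v (edgeRank ev j)) < x).card := by
  rw [card_edgeRank ev v fun i => centerRank E w (w v i) < x, slotCut, hd]

theorem CountsDegrees.lt_iff (hd : CountsDegrees E m ev) (v : Fin nV) (i : ℕ) :
    i < machineDegree E v ↔ ∃ j < m, ev j = v ∧ edgeRank ev j = i := by
  have h := card_edgeRank ev v (fun k => k = i) m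
  rw [← hd] at h
  constructor
  · intro hi
    simp only [Finset.filter_eq', if_pos (Finset.mem_range.2 hi), Finset.card_singleton] at h
    obtain ⟨j, hj⟩ := Finset.card_pos.1 (h ▸ Nat.one_pos)
    simp only [Finset.mem_filter, Finset.mem_range] at hj
    exact ⟨j, hj⟩
  · rintro ⟨j, hj, h1⟩
    have h2 : 0 < ((Finset.range m).filter fun j => ev j = v ∧ edgeRank ev j = i).card :=
      Finset.card_pos.2 ⟨j, by simp [hj, h1]⟩
    rw [h, Finset.card_pos] at h2
    obtain ⟨k, hk⟩ := h2
    simp only [Finset.mem_filter, Finset.mem_range] at hk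
    omega

theorem CountsDegrees.mem_centers_iff (hd : CountsDegrees E m ev) (x : ℝ) :
    x ∈ centers E w ↔ ∃ (v : Fin nV) (j : ℕ), j < m ∧ ev j = v ∧ w v (edgeRank ev j) = x := by
  rw [mem_centers]
  constructor
  · rintro ⟨v, i, hi, rfl⟩
    obtain ⟨j, hj, h1, rfl⟩ := (hd.lt_iff v i).1 hi
    exact ⟨v, j, hj, h1, rfl⟩
  · rintro ⟨v, j, hj, h1, rfl⟩
    exact ⟨v, _, (hd.lt_iff v _).2 ⟨j, hj, h1, rfl⟩, rfl⟩

/-! ### The ranks of the cost centers in the unweighted problem -/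

variable {W : ℕ} {F : ℕ → ℕ → ℝ} {σ : State}

/-- Computes the ranks of the slots in the unweighted problem and the maximum degree, which is the
number of cost centers. The rank of the slot `i` is `i` itself. -/
def unweightedRanks : Program :=
  forLoop 3 2
    (.seq (.letWord 4 (.mem 1 (.reg 3)))
    (.seq (.putWord 3 (.reg 3) (.mem 4 (.reg 4)))
    (.seq (.putWord 4 (.reg 4) (.plus (.mem 4 (.reg 4)) (.lit 1)))
      (.ite (.wordLt (.reg 14) (.mem 4 (.reg 4)))
        (.letWord 14 (.mem 4 (.reg 4)))
        .nop))))

theorem unweightedRanks_runs (hdat : EdgeData W nU m eu ev σ) (h4 : ∀ v, σ.mem 4 v = 0)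
    (h14 : σ.reg 14 = 0) : ∃ c, c = 30 ∧
    Runs W F unweightedRanks σ (c * (m + 1)) fun σ' => Frame unweightedRanks σ σ' ∧
      (∀ j < m, σ'.mem 3 j = edgeRank ev j) ∧ ∀ i, i < σ'.reg 14 ↔ ∃ j < m, i ≤ edgeRank ev j := by
  refine ⟨_, rfl, ?_⟩
  have hb := hdat.bound
  refine (Runs.forLoopWp (by decide) (by decide) (by decide) (by rw [hdat.reg2]; omega)
    (fun k σ' => (∀ v, σ'.mem 4 v = ((Finset.range k).filter fun j => ev j = v).card) ∧
      (∀ j < k, σ'.mem 3 j = edgeRank ev j) ∧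
      ∀ i, i < σ'.reg 14 ↔ ∃ j < k, i ≤ edgeRank ev j) ?_ ?_).mono ?_ ?_
  · simp [h4, h14]
  · rintro k σ' hk hk' hf ⟨h1, h2, h3⟩
    rw [hdat.reg2] at hk
    have hd := hdat.of_frame hf (by decide) (by decide) (by decide) (by decide)
    have := hdat.machine_le k hk
    have hr : σ'.mem 4 (ev k) = edgeRank ev k := h1 _
    have hle := edgeRank_le ev k
    simp only [Program.Wp, Test.Holds, WordExp.eval, hk', hd.machine, mem_setReg, mem_setMem,
      reg_setMem, reg_setReg]
    norm_num
    simp only [hr]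
    have h4' : ∀ v, Function.update (σ'.mem 4) (ev k) (edgeRank ev k + 1) v =
        ((Finset.range (k + 1)).filter fun j => ev j = v).card := by
      intro v
      rw [Finset.range_add_one, Finset.filter_insert, Function.update_apply]
      by_cases hv : v = ev k
      · rw [if_pos hv, if_pos hv.symm, Finset.card_insert_of_notMem (by simp), hv, edgeRank]
      · rw [if_neg hv, if_neg (Ne.symm hv), h1]
    have h3' : ∀ j < k + 1, Function.update (σ'.mem 3) k (edgeRank ev k) j = edgeRank ev j := by
      intro j hj
      rw [Function.update_apply]
      split_ifs with h
      · rw [h]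
      · exact h2 j (by omega)
    have hnew : ∀ i, (∃ j < k + 1, i ≤ edgeRank ev j) ↔
        (∃ j < k, i ≤ edgeRank ev j) ∨ i ≤ edgeRank ev k := by
      intro i
      constructor
      · rintro ⟨j, hj, h⟩
        rcases Nat.lt_succ_iff_lt_or_eq.1 hj with h' | rfl
        exacts [Or.inl ⟨j, h', h⟩, Or.inr h]
      · rintro (⟨j, hj, h⟩ | h)
        exacts [⟨j, by omega, h⟩, ⟨k, by omega, h⟩]
    simp only [← Nat.lt_add_one_iff (n := k), hnew, ← h3]
    exact ⟨by omega, by omega, by omega, by omega, by omega,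
      fun h5 => ⟨by omega, h4', h3', fun i => by omega⟩,
      fun h5 => ⟨h4', h3', fun i => by omega⟩⟩
  · rw [hdat.reg2]; norm_num [Program.size, WordExp.steps, Test.steps]; omega
  · rintro σ' ⟨h1, -, h3⟩
    rw [hdat.reg2] at h3
    exact ⟨h1, h3⟩

theorem Prepared.unweighted {σ' : State} (hdat : EdgeData W nU m eu ev σ)
    (hd : CountsDegrees E m ev) (he : EdgeList E m eu ev) (hf : Frame unweightedRanks σ σ')
    (hzero : ∀ a ∈ [5, 6, 7, 8, 9], ∀ i, σ.mem a i = 0)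
    (h3 : ∀ j < m, σ'.mem 3 j = edgeRank ev j)
    (h14 : ∀ i, i < σ'.reg 14 ↔ ∃ j < m, i ≤ edgeRank ev j) :
    Prepared E unweightedSlot W m eu ev σ' := by
  have hc : centers E unweightedSlot =
      (Finset.range (σ'.reg 14)).image fun i : ℕ => (i : ℝ) + 1 := by
    ext x
    simp only [hd.mem_centers_iff, unweightedSlot, Finset.mem_image, Finset.mem_range]
    constructor
    · rintro ⟨v, j, hj, -, rfl⟩
      exact ⟨_, (h14 _).2 ⟨j, hj, le_rfl⟩, rfl⟩
    · rintro ⟨i, hi, rfl⟩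
      obtain ⟨j, hj, hij⟩ := (h14 i).1 hi
      have h5 := (hd.lt_iff ⟨ev j, he.machine_lt j hj⟩ _).2 ⟨j, hj, rfl, rfl⟩
      obtain ⟨k, hk, h6, rfl⟩ := (hd.lt_iff ⟨ev j, he.machine_lt j hj⟩ i).1 (by omega)
      exact ⟨_, k, hk, h6, rfl⟩
  have hinj : Function.Injective fun i : ℕ => (i : ℝ) + 1 := fun i j h => by simpa using h
  refine ⟨hdat.of_frame hf (by decide) (by decide) (by decide) (by decide), ?_, fun v x => ?_,
    fun a ha i => ?_⟩
  · rw [hc, Finset.card_image_of_injective _ hinj, Finset.card_range]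
  · rw [hd.slotCut_eq]
    congr 1
    refine Finset.filter_congr fun j hj => and_congr_right fun _ => ?_
    rw [Finset.mem_range] at hj
    suffices h : centerRank E unweightedSlot (unweightedSlot v (edgeRank ev j)) = edgeRank ev j by
      rw [h, h3 j hj]
    have h5 := (h14 (edgeRank ev j)).2 ⟨j, hj, le_rfl⟩
    rw [centerRank, hc, Finset.filter_image, Finset.card_image_of_injective _ hinj]
    have : (Finset.range (σ'.reg 14)).filter (fun i : ℕ => (i : ℝ) + 1 <
        unweightedSlot v (edgeRank ev j)) = Finset.range (edgeRank ev j) := by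
      ext i
      simp only [unweightedSlot, Finset.mem_filter, Finset.mem_range, add_lt_add_iff_right,
        Nat.cast_lt]
      omega
    rw [this, Finset.card_range]
  · rw [← hzero a ha i, hf.mem a]
    simp only [List.mem_cons, List.not_mem_nil, or_false] at ha
    rcases ha with rfl | rfl | rfl | rfl | rfl <;> decide

end RAM

/-! ### Tournament trees -/

/-- The candidate with the smaller value; zero stands for no candidate. -/
noncomputable def winner (val : ℕ → ℝ) (a b : ℕ) : ℕ :=
  if a = 0 then b else if b = 0 then a else if val b < val a then b else a

theorem winner_eq_or (val : ℕ → ℝ) (a b : ℕ) : winner val a b = a ∨ winner val a b = b := by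
  unfold winner; split_ifs <;> simp

theorem winner_left {val : ℕ → ℝ} {a b : ℕ} (ha : a ≠ 0) :
    winner val a b ≠ 0 ∧ val (winner val a b) ≤ val a := by
  rw [winner, if_neg ha]; split_ifs with h1 h2
  exacts [⟨ha, le_rfl⟩, ⟨h1, h2.le⟩, ⟨ha, le_rfl⟩]

theorem winner_right {val : ℕ → ℝ} {a b : ℕ} (hb : b ≠ 0) :
    winner val a b ≠ 0 ∧ val (winner val a b) ≤ val b := by
  unfold winner; split_ifs with h1 h2
  exacts [⟨hb, le_rfl⟩, ⟨hb, le_rfl⟩, ⟨h1, not_lt.1 h2⟩]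

/-- The inner node `y` of a tree with the children `2 * y` and `2 * y + 1` holds its winner. -/
def IsWon (val : ℕ → ℝ) (tree : ℕ → ℕ) (y : ℕ) : Prop :=
  tree y = winner val (tree (2 * y)) (tree (2 * y + 1))

/-- The leaves `m, …, 2 * m - 1` hold themselves or, after their removal, nothing. -/
def HasLeaves (m : ℕ) (tree : ℕ → ℕ) : Prop :=
  ∀ x, m ≤ x → x < 2 * m → tree x = x ∨ tree x = 0

variable {val : ℕ → ℝ} {tree : ℕ → ℕ} {m : ℕ}

/-- The winner at the root is at least as good as every node. -/
theorem root_le (h : ∀ y, 1 ≤ y → y < m → IsWon val tree y) {k : ℕ} (hk : 1 ≤ k) (hk' : k < 2 * m)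
    (h0 : tree k ≠ 0) : tree 1 ≠ 0 ∧ val (tree 1) ≤ val (tree k) := by
  induction k using Nat.strong_induction_on with
  | _ k ih =>
    rcases Nat.lt_or_eq_of_le hk with h1 | rfl
    · have h2 := h (k / 2) (by omega) (by omega)
      have h3 : tree (k / 2) ≠ 0 ∧ val (tree (k / 2)) ≤ val (tree k) := by
        rw [h2]
        rcases Nat.even_or_odd' k with ⟨c, hc | hc⟩
        · rw [show 2 * (k / 2) = k by omega]; exact winner_left h0
        · rw [show 2 * (k / 2) + 1 = k by omega]; exact winner_right h0
      obtain ⟨h4, h5⟩ := ih (k / 2) (by omega) (by omega) (by omega) h3.1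
      exact ⟨h4, h5.trans h3.2⟩
    · exact ⟨h0, le_rfl⟩

/-- A nonempty node holds a leaf that has not been removed. -/
theorem node_leaf (h : ∀ y, 1 ≤ y → y < m → IsWon val tree y) (hl : HasLeaves m tree) {k : ℕ}
    (hk : 1 ≤ k) (hk' : k < 2 * m) (h0 : tree k ≠ 0) :
    m ≤ tree k ∧ tree k < 2 * m ∧ tree (tree k) = tree k := by
  induction hn : 2 * m - k using Nat.strong_induction_on generalizing k with
  | _ n ih =>
    by_cases hm : m ≤ k
    · have := (hl k hm hk').resolve_right h0
      rw [this]; exact ⟨hm, hk', this⟩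
    · have h2 := h k hk (by omega)
      rcases winner_eq_or val (tree (2 * k)) (tree (2 * k + 1)) with h3 | h3
      all_goals
        rw [IsWon, h3] at h2
        rw [h2] at h0 ⊢
        exact ih _ (by omega) (by omega) (by omega) h0 rfl

/-- After the node `k` has been recomputed, only its proper ancestors may be wrong. -/
theorem IsWon.update {k : ℕ}
    (h : ∀ y, 1 ≤ y → y < m → (∀ t, y ≠ k / 2 ^ t) → IsWon val tree y) (y : ℕ) (hy : 1 ≤ y)
    (hm : y < m) (hanc : ∀ t, y ≠ k / 2 / 2 ^ t) :
    IsWon val (Function.update tree k (winner val (tree (2 * k)) (tree (2 * k + 1)))) y := by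
  have h1 := hanc 0
  rw [pow_zero, Nat.div_one] at h1
  rw [IsWon, Function.update_of_ne (show 2 * y ≠ k by omega),
    Function.update_of_ne (show 2 * y + 1 ≠ k by omega)]
  by_cases hyk : y = k
  · rw [hyk, Function.update_self]
  · rw [Function.update_of_ne hyk]
    refine h y hy hm fun t => ?_
    cases t with
    | zero => simpa using hyk
    | succ t => rw [pow_succ', ← Nat.div_div_eq_div_mul]; exact hanc t

/-- The removal of the leaf `x` affects its ancestors only. -/
theorem IsWon.remove {x : ℕ} (h : ∀ y, 1 ≤ y → y < m → IsWon val tree y) (hx : m ≤ x) (y : ℕ)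
    (hy : 1 ≤ y) (hm : y < m) (hanc : ∀ t, y ≠ x / 2 / 2 ^ t) :
    IsWon val (Function.update tree x 0) y := by
  have h1 := hanc 0
  rw [pow_zero, Nat.div_one] at h1
  rw [IsWon, Function.update_of_ne (show 2 * y ≠ x by omega),
    Function.update_of_ne (show 2 * y + 1 ≠ x by omega), Function.update_of_ne (by omega)]
  exact h y hy hm

/-! ### Counting the smaller values while a set grows in increasing order -/

/-- The number of distinct values of `val` on `D` below `c`. -/
noncomputable def valuesBelow (val : ℕ → ℝ) (D : Finset ℕ) (c : ℝ) : ℕ :=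
  ((D.image val).filter fun z => z < c).card

theorem valuesBelow_insert_of_le {D : Finset ℕ} {x : ℕ} {c : ℝ} (h : c ≤ val x) :
    valuesBelow val (insert x D) c = valuesBelow val D c := by
  rw [valuesBelow, Finset.image_insert, Finset.filter_insert, if_neg (not_lt.2 h), valuesBelow]

theorem valuesBelow_insert_self {D : Finset ℕ} {x : ℕ} (h : ∀ y ∈ D, val y ≤ val x) :
    valuesBelow val (insert x D) (val x) = ((insert x D).image val).card - 1 := by
  rw [valuesBelow, ← Finset.card_erase_of_mem
    (Finset.mem_image_of_mem val (Finset.mem_insert_self x D))]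
  congr 1; ext z
  simp only [Finset.mem_filter, Finset.mem_image, Finset.mem_insert, Finset.mem_erase, ne_eq]
  constructor
  · rintro ⟨h1, h2⟩; exact ⟨h2.ne, h1⟩
  · rintro ⟨h1, y, h2, rfl⟩
    refine ⟨⟨y, h2, rfl⟩, lt_of_le_of_ne ?_ h1⟩
    rcases h2 with rfl | h2
    exacts [le_rfl, h y h2]

/-- The number of values after the addition of a value that is not below the largest one. -/
theorem card_image_insert {D : Finset ℕ} {x p : ℕ} (hp : p ∈ D) (hmax : ∀ y ∈ D, val y ≤ val p)
    (h : val p ≤ val x) : ((insert x D).image val).card =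
      if val p < val x then (D.image val).card + 1 else (D.image val).card := by
  rw [Finset.image_insert]
  split_ifs with h1
  · rw [Finset.card_insert_of_notMem]
    intro h2
    obtain ⟨y, hy, h3⟩ := Finset.mem_image.1 h2
    have := hmax y hy; linarith
  · rw [Finset.insert_eq_of_mem (Finset.mem_image.2 ⟨p, hp, le_antisymm h (not_lt.1 h1)⟩)]

namespace RAM

/-! ### The ranks of the cost centers for convex cost functions -/

variable {W : ℕ} {F : ℕ → ℕ → ℝ} {σ : State} {nU nV : ℕ} {E : Finset (Fin nU × Fin nV)}
  {w : Fin nV → ℕ → ℝ} {eu ev : ℕ → ℕ}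

/-- Reads the costs of the slots from the cost functions. The slot of the edge `j` is the leaf
`m + j` of the tournament tree. -/
def readSlots : Program :=
  forLoop 3 2
    (.seq (.letWord 4 (.mem 1 (.reg 3)))
    (.seq (.putReal 0 (.plus (.reg 2) (.reg 3))
      (.minus (.query (.reg 4) (.plus (.mem 4 (.reg 4)) (.lit 1)))
        (.query (.reg 4) (.mem 4 (.reg 4)))))
    (.seq (.putWord 4 (.reg 4) (.plus (.mem 4 (.reg 4)) (.lit 1)))
      (.putWord 17 (.plus (.reg 2) (.reg 3)) (.plus (.reg 2) (.reg 3))))))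

theorem readSlots_runs (hdat : EdgeData W nU m eu ev σ) (h4 : ∀ v, σ.mem 4 v = 0)
    (h17 : ∀ y, σ.mem 17 y = 0) : ∃ c, c = 50 ∧
    Runs W F readSlots σ (c * (m + 1)) fun σ' => Frame readSlots σ σ' ∧
      (∀ j < m, σ'.realMem 0 (m + j) =
        F (ev j) (edgeRank ev j + 1) - F (ev j) (edgeRank ev j)) ∧
      ∀ y, σ'.mem 17 y = if m ≤ y ∧ y < 2 * m then y else 0 := by
  refine ⟨_, rfl, ?_⟩
  have hb := hdat.bound
  refine (Runs.forLoopWp (by decide) (by decide) (by decide) (by rw [hdat.reg2]; omega)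
    (fun k σ' => (∀ v, σ'.mem 4 v = ((Finset.range k).filter fun j => ev j = v).card) ∧
      (∀ j < k, σ'.realMem 0 (m + j) =
        F (ev j) (edgeRank ev j + 1) - F (ev j) (edgeRank ev j)) ∧
      ∀ y, σ'.mem 17 y = if m ≤ y ∧ y < m + k then y else 0) ?_ ?_).mono ?_ ?_
  · refine ⟨by simp [h4], by simp, fun y => ?_⟩
    rw [if_neg (by omega)]; exact h17 y
  · rintro k σ' hk hk' hf ⟨h1, h2, h3⟩
    rw [hdat.reg2] at hk
    have hd := hdat.of_frame hf (by decide) (by decide) (by decide) (by decide)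
    have := hdat.machine_le k hk
    have hr : σ'.mem 4 (ev k) = edgeRank ev k := h1 _
    have hle := edgeRank_le ev k
    have h4' : ∀ v, Function.update (σ'.mem 4) (ev k) (edgeRank ev k + 1) v =
        ((Finset.range (k + 1)).filter fun j => ev j = v).card := by
      intro v
      rw [Finset.range_add_one, Finset.filter_insert, Function.update_apply]
      by_cases hv : v = ev k
      · rw [if_pos hv, if_pos hv.symm, Finset.card_insert_of_notMem (by simp), hv, edgeRank]
      · rw [if_neg hv, if_neg (Ne.symm hv), h1]
    have hval : ∀ j < k + 1, Function.update (σ'.realMem 0) (m + k)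
        (F (ev k) (edgeRank ev k + 1) - F (ev k) (edgeRank ev k)) (m + j) =
        F (ev j) (edgeRank ev j + 1) - F (ev j) (edgeRank ev j) := by
      intro j hj
      rw [Function.update_apply]
      split_ifs with h
      · rw [show j = k by omega]
      · exact h2 j (by omega)
    have htree : ∀ y, Function.update (σ'.mem 17) (m + k) (m + k) y =
        if m ≤ y ∧ y < m + (k + 1) then y else 0 := by
      intro y
      rw [Function.update_apply, h3]
      split_ifs <;> omega
    simp only [Program.Wp, WordExp.eval, RealExp.eval, hk', hd.machine, hd.reg2, mem_setReg,
      mem_setMem, mem_setRealMem, reg_setMem, reg_setReg, reg_setRealMem, realMem_setReg,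
      realMem_setMem, realMem_setRealMem]
    norm_num
    simp only [hr, ← Nat.lt_add_one_iff (n := k), hd.machine, hd.reg2]
    exact ⟨by omega, by omega, by omega, by omega, by omega, h4', hval, htree⟩
  · rw [hdat.reg2]; norm_num [Program.size, WordExp.steps, RealExp.steps]; omega
  · rintro σ' ⟨h1, -, h2, h3⟩
    rw [hdat.reg2] at h2 h3
    exact ⟨h1, h2, fun y => by rw [h3]; congr 1; simp only [eq_iff_iff]; omega⟩

/-- Recomputes the node in register 4 of the tournament tree. -/
def recompute : Program :=
  .seq (.letWord 5 (.mem 17 (.times (.lit 2) (.reg 4))))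
  (.seq (.letWord 6 (.mem 17 (.plus (.times (.lit 2) (.reg 4)) (.lit 1))))
  (.ite (.wordEq (.reg 5) (.lit 0))
    (.putWord 17 (.reg 4) (.reg 6))
    (.ite (.wordEq (.reg 6) (.lit 0))
      (.putWord 17 (.reg 4) (.reg 5))
      (.ite (.realLt (.mem 0 (.reg 6)) (.mem 0 (.reg 5)))
        (.putWord 17 (.reg 4) (.reg 6))
        (.putWord 17 (.reg 4) (.reg 5))))))

theorem recompute_wp {Q : State → Prop} (h4 : σ.reg 4 ≤ W) (hle : ∀ y, σ.mem 17 y ≤ W)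
    (h : Q (((σ.setReg 5 (σ.mem 17 (2 * σ.reg 4))).setReg 6 (σ.mem 17 (2 * σ.reg 4 + 1))).setMem 17
      (σ.reg 4) (winner (σ.realMem 0) (σ.mem 17 (2 * σ.reg 4)) (σ.mem 17 (2 * σ.reg 4 + 1))))) :
    recompute.Wp W F σ Q := by
  have h1 := hle (2 * σ.reg 4)
  have h2 := hle (2 * σ.reg 4 + 1)
  simp only [recompute, Program.Wp, Test.Holds, WordExp.eval, RealExp.eval, mem_setReg,
    realMem_setReg, reg_setReg]
  norm_num
  refine ⟨h1, h2, fun h3 => ⟨h4, h2, ?_⟩, fun h3 => ⟨fun h5 => ⟨h4, h1, ?_⟩, fun h5 =>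
    ⟨fun h6 => ⟨h4, h2, ?_⟩, fun h6 => ⟨h4, h1, ?_⟩⟩⟩⟩
  · simpa only [winner, if_pos h3] using h
  · simpa only [winner, if_neg h3, if_pos h5] using h
  · simpa only [winner, if_neg h3, if_neg h5, if_pos h6] using h
  · simpa only [winner, if_neg h3, if_neg h5, if_neg (not_lt.2 h6)] using h

/-- Builds the tournament tree from the leaves to the root. -/
def buildTree : Program :=
  forLoop 3 2 (.seq (.letWord 4 (.minus (.minus (.reg 2) (.lit 1)) (.reg 3))) recompute)

/-- The tree `σ.mem 17` is a tournament tree with the alive leaves `x`, `tree x = x`. -/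
structure TreeState (m : ℕ) (val : ℕ → ℝ) (σ : State) : Prop where
  real : σ.realMem 0 = val
  won : ∀ y, 1 ≤ y → y < m → IsWon val (σ.mem 17) y
  leaves : HasLeaves m (σ.mem 17)
  lt : ∀ y, σ.mem 17 y < 2 * m

theorem buildTree_runs (hdat : EdgeData W nU m eu ev σ) (hm : 0 < m)
    (h17 : ∀ y, σ.mem 17 y = if m ≤ y ∧ y < 2 * m then y else 0) : ∃ c, c = 50 ∧
    Runs W F buildTree σ (c * (m + 1)) fun σ' => Frame buildTree σ σ' ∧
      TreeState m (σ.realMem 0) σ' ∧ ∀ y, m ≤ y → y < 2 * m → σ'.mem 17 y = y := by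
  refine ⟨_, rfl, ?_⟩
  have hb := hdat.bound
  refine (Runs.forLoopWp (by decide) (by decide) (by decide) (by rw [hdat.reg2]; omega)
    (fun k σ' => σ'.realMem 0 = σ.realMem 0 ∧
      (∀ y, 1 ≤ y → y < m → m ≤ y + k → IsWon (σ.realMem 0) (σ'.mem 17) y) ∧
      (∀ y, m ≤ y → y < 2 * m → σ'.mem 17 y = y) ∧ ∀ y, σ'.mem 17 y < 2 * m) ?_ ?_).mono ?_ ?_
  · refine ⟨rfl, fun y _ _ _ => by omega, fun y h1 h2 => ?_, fun y => ?_⟩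
    · rw [mem_setReg, h17, if_pos ⟨h1, h2⟩]
    · rw [mem_setReg, h17]; split_ifs <;> omega
  · rintro k σ' hk hk' hf ⟨h1, h2, h3, h4⟩
    rw [hdat.reg2] at hk
    have hd := hdat.of_frame hf (by decide) (by decide) (by decide) (by decide)
    refine ⟨by simp only [WordExp.eval, hd.reg2, hk']; omega, recompute_wp ?_ ?_ ?_⟩
    · simp only [WordExp.eval, hd.reg2, hk', reg_setReg, if_true]; omega
    · intro y; rw [mem_setReg]; have := h4 y; omega
    · simp only [WordExp.eval, hd.reg2, hk', reg_setReg, if_true, mem_setReg, mem_setMem,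
        realMem_setReg, realMem_setMem, h1]
      refine ⟨trivial, fun y hy hym hyk => ?_, fun y hy hy' => ?_, fun y => ?_⟩
      · have h5 := fun hy' => h2 y hy hym hy'
        by_cases hyk' : y = m - 1 - k
        · subst hyk'
          rw [IsWon, Function.update_self, Function.update_of_ne (by omega),
            Function.update_of_ne (by omega)]
        · rw [IsWon, Function.update_of_ne hyk', Function.update_of_ne (by omega),
            Function.update_of_ne (by omega)]
          exact h5 (by omega)
      · rw [Function.update_of_ne (by omega)]; exact h3 y hy hy'
      · rw [Function.update_apply]
        split_ifs
        · rcases winner_eq_or (σ.realMem 0) (σ'.mem 17 (2 * (m - 1 - k)))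
            (σ'.mem 17 (2 * (m - 1 - k) + 1)) with h | h <;> rw [h] <;> exact h4 _
        · exact h4 y
  · rw [hdat.reg2]
    norm_num [recompute, Program.size, WordExp.steps, Test.steps, RealExp.steps]
    omega
  · rintro σ' ⟨hf, h1, h2, h3, h4⟩
    rw [hdat.reg2] at h2
    exact ⟨hf, ⟨h1, fun y hy hym => h2 y hy hym (by omega), fun x hx hx' => Or.inl (h3 x hx hx'),
      h4⟩, h3⟩

end RAM

namespace RAM

variable {W : ℕ} {F : ℕ → ℕ → ℝ} {σ : State} {nU nV m : ℕ} {E : Finset (Fin nU × Fin nV)}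
  {w : Fin nV → ℕ → ℝ} {eu ev : ℕ → ℕ} {val : ℕ → ℝ} {D : Finset ℕ}

/-- Recomputes the nodes from the one in register 4 up to the root. -/
def pullUp : Program :=
  .loop (.wordLt (.lit 0) (.reg 4)) (.seq recompute (.letWord 4 (.quot (.reg 4) (.lit 2))))

theorem pullUp_runs (hreal : σ.realMem 0 = val) (h4 : σ.reg 4 < m) (hW : 2 * m ≤ W)
    (hwon : ∀ y, 1 ≤ y → y < m → (∀ t, y ≠ σ.reg 4 / 2 ^ t) → IsWon val (σ.mem 17) y)
    (hlt : ∀ y, σ.mem 17 y < 2 * m) : ∃ c, c = 50 ∧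
    Runs W F pullUp σ (c * (Nat.clog 2 m + 1)) fun σ' => Frame pullUp σ σ' ∧
      σ'.realMem 0 = val ∧ (∀ y, 1 ≤ y → y < m → IsWon val (σ'.mem 17) y) ∧
      (∀ y, m ≤ y → σ'.mem 17 y = σ.mem 17 y) ∧ ∀ y, σ'.mem 17 y < 2 * m := by
  refine ⟨_, rfl, ?_⟩
  refine (Runs.loopBudget (n := Nat.clog 2 m) (B := 45) (fun n σ' => σ'.reg 4 < 2 ^ n ∧
    σ'.reg 4 < m ∧ σ'.realMem 0 = val ∧
    (∀ y, 1 ≤ y → y < m → (∀ t, y ≠ σ'.reg 4 / 2 ^ t) → IsWon val (σ'.mem 17) y) ∧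
    (∀ y, m ≤ y → σ'.mem 17 y = σ.mem 17 y) ∧ ∀ y, σ'.mem 17 y < 2 * m) ?_ ?_).mono ?_ ?_
  · exact ⟨h4.trans_le (Nat.le_pow_clog (by norm_num) m), h4, hreal, hwon, fun _ _ => rfl, hlt⟩
  · rintro n σ' hf ⟨h1, h2, h3, h5, h6, h7⟩ hb
    simp only [Test.Holds, WordExp.eval] at hb
    have hn : n ≠ 0 := by rintro rfl; simp at h1; omega
    have hwp : (Program.seq recompute (.letWord 4 (.quot (.reg 4) (.lit 2)))).Wp W F σ' fun σ'' =>
        ∃ n' < n, σ''.reg 4 < 2 ^ n' ∧ σ''.reg 4 < m ∧ σ''.realMem 0 = val ∧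
        (∀ y, 1 ≤ y → y < m → (∀ t, y ≠ σ''.reg 4 / 2 ^ t) → IsWon val (σ''.mem 17) y) ∧
        (∀ y, m ≤ y → σ''.mem 17 y = σ.mem 17 y) ∧ ∀ y, σ''.mem 17 y < 2 * m := by
      refine recompute_wp (by omega) (fun y => by have := h7 y; omega) ⟨?_, n - 1, by omega, ?_⟩
      · simp [WordExp.eval]; omega
      · simp only [WordExp.eval, reg_setReg, reg_setMem, mem_setReg, mem_setMem, realMem_setReg,
          realMem_setMem, if_true, h3]
        norm_num
        refine ⟨?_, by omega, fun y hy hym ht => IsWon.update h5 y hy hym ht, fun y hy => ?_,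
          fun y => ?_⟩
        · obtain ⟨n, rfl⟩ := Nat.exists_eq_succ_of_ne_zero hn
          rw [pow_succ] at h1
          simp only [Nat.succ_eq_add_one, Nat.add_sub_cancel]; omega
        · rw [Function.update_of_ne (by omega)]; exact h6 y hy
        · rw [Function.update_apply]
          split_ifs
          · rcases winner_eq_or val (σ'.mem 17 (2 * σ'.reg 4))
              (σ'.mem 17 (2 * σ'.reg 4 + 1)) with h | h <;> rw [h] <;> exact h7 _
          · exact h7 y
    exact hwp.runs.mono (by norm_num [recompute, Program.size, WordExp.steps, Test.steps,
      RealExp.steps]) fun _ h => h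
  · simp only [Test.steps, WordExp.steps]; omega
  · rintro σ' ⟨hf, ⟨n, -, -, h3, h5, h6, h7⟩, hb⟩
    simp only [Test.Holds, WordExp.eval, not_lt, nonpos_iff_eq_zero] at hb
    exact ⟨⟨hf.mem, hf.reg⟩, h3,
      fun y hy hym => h5 y hy hym fun t => by rw [hb, Nat.zero_div]; omega, h6, h7⟩

/-- Removes the best leaf `x` of the tree and records the rank of its value in array 3. Register 14
counts the distinct values so far, and register 7 holds the leaf that was removed last. -/
def removeMin : Program :=
  .seq (.letWord 5 (.mem 17 (.lit 1)))
  (.seq (.ite (.wordEq (.reg 14) (.lit 0))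
    (.letWord 14 (.lit 1))
    (.ite (.realLt (.mem 0 (.reg 7)) (.mem 0 (.reg 5)))
      (.letWord 14 (.plus (.reg 14) (.lit 1)))
      .nop))
  (.seq (.letWord 7 (.reg 5))
  (.seq (.putWord 3 (.minus (.reg 5) (.reg 2)) (.minus (.reg 14) (.lit 1)))
  (.seq (.putWord 17 (.reg 5) (.lit 0))
    (.letWord 4 (.quot (.reg 5) (.lit 2)))))))

/-- The state after the leaves in `D` have been removed in increasing order of their values. -/
structure SortState (m : ℕ) (val : ℕ → ℝ) (D : Finset ℕ) (σ : State) : Prop where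
  tree : TreeState m val σ
  mem_iff : ∀ x, x ∈ D ↔ m ≤ x ∧ x < 2 * m ∧ σ.mem 17 x = 0
  le : ∀ x ∈ D, ∀ y, m ≤ y → y < 2 * m → y ∉ D → val x ≤ val y
  count : σ.reg 14 = (D.image val).card
  rank : ∀ x ∈ D, σ.mem 3 (x - m) = valuesBelow val D (val x)
  prev : D.Nonempty → σ.reg 7 ∈ D ∧ ∀ y ∈ D, val y ≤ val (σ.reg 7)

/-- The root of the tree holds a remaining leaf of least value. -/
theorem SortState.root (h : SortState m val D σ) (hlt : D.card < m) :
    m ≤ σ.mem 17 1 ∧ σ.mem 17 1 < 2 * m ∧ σ.mem 17 1 ∉ D ∧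
      ∀ y, m ≤ y → y < 2 * m → y ∉ D → val (σ.mem 17 1) ≤ val y := by
  have hroot : ∀ y, m ≤ y → y < 2 * m → y ∉ D →
      σ.mem 17 1 ≠ 0 ∧ val (σ.mem 17 1) ≤ val y := by
    intro y hy hy' hD
    have h0 : σ.mem 17 y ≠ 0 := fun h0 => hD ((h.mem_iff y).2 ⟨hy, hy', h0⟩)
    have := root_le h.tree.won (by omega : 1 ≤ y) hy' h0
    rwa [(h.tree.leaves y hy hy').resolve_right h0] at this
  obtain ⟨y, hy, hyD⟩ : ∃ y ∈ Finset.Ico m (2 * m), y ∉ D :=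
    Finset.exists_mem_notMem_of_card_lt_card (by rw [Nat.card_Ico]; omega)
  rw [Finset.mem_Ico] at hy
  have h0 := (hroot y hy.1 hy.2 hyD).1
  obtain ⟨h1, h2, h3⟩ := node_leaf h.tree.won h.tree.leaves le_rfl (by omega) h0
  exact ⟨h1, h2, fun h4 => h0 (h3 ▸ ((h.mem_iff _).1 h4).2.2), fun y hy hy' hD =>
    (hroot y hy hy' hD).2⟩

theorem removeMin_wp (h : SortState m val D σ) (hlt : D.card < m) (h2 : σ.reg 2 = m)
    (hW : 2 * m ≤ W) : ∃ x, m ≤ x ∧ x < 2 * m ∧ x ∉ D ∧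
    (∀ y, m ≤ y → y < 2 * m → y ∉ D → val x ≤ val y) ∧
    removeMin.Wp W F σ fun σ' => σ'.realMem 0 = val ∧ σ'.reg 7 = x ∧ σ'.reg 4 = x / 2 ∧
      σ'.reg 14 = ((insert x D).image val).card ∧
      σ'.mem 3 = Function.update (σ.mem 3) (x - m) (((insert x D).image val).card - 1) ∧
      σ'.mem 17 = Function.update (σ.mem 17) x 0 := by
  obtain ⟨hx, hx', hxD, hmin⟩ := h.root hlt
  refine ⟨_, hx, hx', hxD, hmin, ?_⟩
  set x := σ.mem 17 1 with hxd
  have hcount : ((insert x D).image val).card = if σ.reg 14 = 0 then 1 else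
      if val (σ.reg 7) < val x then σ.reg 14 + 1 else σ.reg 14 := by
    rw [h.count]
    by_cases hD : D.Nonempty
    · obtain ⟨h3, h4⟩ := h.prev hD
      rw [if_neg (Finset.card_pos.2 (hD.image val)).ne']
      exact card_image_insert h3 h4 (h.le _ h3 _ hx hx' hxD)
    · rw [Finset.not_nonempty_iff_eq_empty] at hD
      simp [hD]
  have hcard : ((insert x D).image val).card ≤ m :=
    Finset.card_image_le.trans (by rw [Finset.card_insert_of_notMem hxD]; omega)
  have hreal := h.tree.real
  rw [Finset.image_insert] at hcount hcard
  simp only [removeMin, Program.Wp, Test.Holds, WordExp.eval, RealExp.eval, mem_setReg, mem_setMem,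
    realMem_setReg, realMem_setMem, reg_setReg, reg_setMem, hreal, h2, ← hxd]
  norm_num
  refine ⟨by omega, fun h3 => ?_, fun h3 => ⟨fun h4 => ?_, fun h4 => ?_⟩⟩
  · rw [if_pos h3] at hcount
    rw [hcount]; refine ⟨by omega, by omega, by omega, by omega, ?_⟩; simp; omega
  · rw [if_neg h3, if_pos h4] at hcount
    rw [hcount]; refine ⟨by omega, by omega, by omega, by omega, by omega, ?_⟩; simp; omega
  · rw [if_neg h3, if_neg (not_lt.2 h4)] at hcount
    rw [hcount]; refine ⟨by omega, by omega, by omega, by omega, ?_⟩; simp; omega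

theorem SortState.step {σ' : State} {x : ℕ} (h : SortState m val D σ) (hx : m ≤ x)
    (hx' : x < 2 * m) (hxD : x ∉ D)
    (hmin : ∀ y, m ≤ y → y < 2 * m → y ∉ D → val x ≤ val y)
    (htree : ∀ y, m ≤ y → σ'.mem 17 y = Function.update (σ.mem 17) x 0 y)
    (hreal : σ'.realMem 0 = val) (hwon : ∀ y, 1 ≤ y → y < m → IsWon val (σ'.mem 17) y)
    (hlt : ∀ y, σ'.mem 17 y < 2 * m) (h7 : σ'.reg 7 = x)
    (h14 : σ'.reg 14 = ((insert x D).image val).card)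
    (h3 : σ'.mem 3 = Function.update (σ.mem 3) (x - m) (((insert x D).image val).card - 1)) :
    SortState m val (insert x D) σ' := by
  have hle : ∀ y ∈ D, val y ≤ val x := fun y hy => h.le y hy x hx hx' hxD
  refine ⟨⟨hreal, hwon, fun y hy hy' => ?_, hlt⟩, fun y => ?_, fun y hy z hz hz' hzD => ?_, h14,
    fun y hy => ?_, fun _ => ?_⟩
  · rw [htree y hy, Function.update_apply]
    split_ifs
    exacts [Or.inr rfl, h.tree.leaves y hy hy']
  · rw [Finset.mem_insert, h.mem_iff]
    by_cases hy : m ≤ y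
    · rw [htree y hy, Function.update_apply]
      split_ifs with h1
      · simp [h1, hx, hx']
      · simp [h1]
    · have : y ≠ x := by omega
      simp [hy, this]
  · rw [Finset.mem_insert, not_or] at hzD
    rcases Finset.mem_insert.1 hy with rfl | hy
    exacts [hmin z hz hz' hzD.2, h.le y hy z hz hz' hzD.2]
  · rw [h3]
    rcases Finset.mem_insert.1 hy with rfl | hyD
    · rw [Function.update_self, valuesBelow_insert_self hle]
    · have h1 := (h.mem_iff y).1 hyD
      have h2 : y ≠ x := by rintro rfl; exact hxD hyD
      rw [Function.update_of_ne (by omega), h.rank y hyD, valuesBelow_insert_of_le (hle y hyD)]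
  · rw [h7]
    refine ⟨Finset.mem_insert_self _ _, fun y hy => ?_⟩
    rcases Finset.mem_insert.1 hy with rfl | hy
    exacts [le_rfl, hle y hy]

/-- Removes all leaves in increasing order of their values, repairing the tree after each removal.
-/
def sortLeaves : Program := forLoop 3 2 (.seq removeMin pullUp)

theorem sortLeaves_runs (hdat : EdgeData W nU m eu ev σ) (ht : TreeState m val σ)
    (hall : ∀ y, m ≤ y → y < 2 * m → σ.mem 17 y = y) (h14 : σ.reg 14 = 0) : ∃ c, c = 120 ∧
    Runs W F sortLeaves σ (c * ((m + 1) * (Nat.clog 2 m + 1))) fun σ' => Frame sortLeaves σ σ' ∧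
      SortState m val (Finset.Ico m (2 * m)) σ' := by
  refine ⟨_, rfl, ?_⟩
  have hb := hdat.bound
  refine (Runs.forLoop (c := 50 + 50 * (Nat.clog 2 m + 1)) (by decide) (by decide) (by decide)
    (by rw [hdat.reg2]; omega) (fun k σ' => ∃ D, D.card = k ∧ SortState m val D σ')
    ?_ ?_).mono ?_ ?_
  · refine ⟨∅, rfl, ⟨ht.real, ht.won, ht.leaves, ht.lt⟩, fun x => ?_, by simp, by simp [h14],
      by simp, by simp⟩
    simp only [Finset.notMem_empty, false_iff, mem_setReg]
    rintro ⟨h1, h2, h3⟩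
    rw [hall x h1 h2] at h3; omega
  · rintro k σ' hk hk' hf ⟨D, rfl, hD⟩
    rw [hdat.reg2] at hk
    have hd := hdat.of_frame hf (by decide) (by decide) (by decide) (by decide)
    obtain ⟨x, hx, hx', hxD, hmin, hwp⟩ := removeMin_wp (F := F) hD hk hd.reg2
      (by omega : 2 * m ≤ W)
    refine (hwp.runs.seq (B' := 50 * (Nat.clog 2 m + 1)) fun σ₁ h => ?_).mono ?_ fun _ h => h
    · obtain ⟨h1, h2, h3, h4, h5, h6⟩ := h
      obtain ⟨_, rfl, h7⟩ := pullUp_runs (F := F) h1 (by omega : σ₁.reg 4 < m)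
        (by omega : 2 * m ≤ W)
        (fun y hy hym ht => by rw [h6]; exact IsWon.remove hD.tree.won hx y hy hym (h3 ▸ ht))
        (fun y => by
          rw [h6, Function.update_apply]
          have := hD.tree.lt y
          split_ifs <;> omega)
      refine h7.mono le_rfl ?_
      rintro σ₂ ⟨hf₂, h8, h9, h10, h11⟩
      refine ⟨insert x D, Finset.card_insert_of_notMem hxD, ?_⟩
      have h12 : SortState m val (insert x D) σ₂ :=
        hD.step hx hx' hxD hmin (fun y hy => by rw [h10 y hy, h6]) h8 h9 h11
          ((hf₂.reg 7 (by decide)).trans h2) ((hf₂.reg 14 (by decide)).trans h4)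
          ((hf₂.mem 3 (by decide)).trans h5)
      exact ⟨⟨h12.tree.real, h12.tree.won, h12.tree.leaves, h12.tree.lt⟩, h12.mem_iff, h12.le,
        by simpa using h12.count, h12.rank, by simpa using h12.prev⟩
    · norm_num [removeMin, Program.size, WordExp.steps, Test.steps, RealExp.steps]
  · rw [hdat.reg2]; nlinarith
  · rintro σ' ⟨hf, D, hD, hs⟩
    rw [hdat.reg2] at hD
    have : D = Finset.Ico m (2 * m) := by
      refine Finset.eq_of_subset_of_card_le (fun x hx => ?_) (by rw [Nat.card_Ico]; omega)
      have := (hs.mem_iff x).1 hx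
      exact Finset.mem_Ico.2 ⟨this.1, this.2.1⟩
    exact ⟨hf, this ▸ hs⟩

/-- Computes the ranks of the slots in the general problem and the number of cost centers. -/
def convexRanks : Program := .seq readSlots (.seq buildTree sortLeaves)

theorem convexRanks_runs (hdat : EdgeData W nU m eu ev σ) (hm : 0 < m) (h4 : ∀ v, σ.mem 4 v = 0)
    (h17 : ∀ y, σ.mem 17 y = 0) (h14 : σ.reg 14 = 0) : ∃ c, c = 250 ∧
    Runs W F convexRanks σ (c * ((m + 1) * (Nat.clog 2 m + 1))) fun σ' => Frame convexRanks σ σ' ∧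
      ∃ val : ℕ → ℝ, (∀ j < m, val (m + j) =
        F (ev j) (edgeRank ev j + 1) - F (ev j) (edgeRank ev j)) ∧
      SortState m val (Finset.Ico m (2 * m)) σ' := by
  refine ⟨_, rfl, ?_⟩
  obtain ⟨_, rfl, h1⟩ := readSlots_runs (F := F) hdat h4 h17
  refine ((h1.seq (B' := 50 * (m + 1) + 120 * ((m + 1) * (Nat.clog 2 m + 1)))
    (R := fun σ' => ∃ val : ℕ → ℝ, (∀ j < m, val (m + j) =
        F (ev j) (edgeRank ev j + 1) - F (ev j) (edgeRank ev j)) ∧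
      SortState m val (Finset.Ico m (2 * m)) σ') fun σ₁ h => ?_).mono ?_ fun _ h => h).frame.mono
      le_rfl fun σ' h => ⟨h.2, h.1⟩
  · obtain ⟨hf₁, hval, htree⟩ := h
    have hd₁ := hdat.of_frame hf₁ (by decide) (by decide) (by decide) (by decide)
    obtain ⟨_, rfl, h2⟩ := buildTree_runs (F := F) hd₁ hm htree
    refine h2.seq fun σ₂ h => ?_
    obtain ⟨hf₂, ht, hall⟩ := h
    obtain ⟨_, rfl, h3⟩ := sortLeaves_runs (F := F)
      (hd₁.of_frame hf₂ (by decide) (by decide) (by decide) (by decide)) ht hall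
      (by rw [hf₂.reg 14 (by decide), hf₁.reg 14 (by decide), h14])
    exact h3.mono le_rfl fun σ' h => ⟨_, hval, h.2⟩
  · nlinarith

theorem Prepared.convex {σ' : State} {f : Fin nV → ℕ → ℝ} (hdat : EdgeData W nU m eu ev σ)
    (hd : CountsDegrees E m ev) (he : EdgeList E m eu ev) (hf : Frame convexRanks σ σ')
    (hzero : ∀ a ∈ [5, 6, 7, 8, 9], ∀ i, σ.mem a i = 0)
    (hval : ∀ j < m, val (m + j) =
      costQuery f (ev j) (edgeRank ev j + 1) - costQuery f (ev j) (edgeRank ev j))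
    (hs : SortState m val (Finset.Ico m (2 * m)) σ') :
    Prepared E (marginalSlot f) W m eu ev σ' := by
  have hval' : ∀ j < m, ∀ v : Fin nV, ev j = v →
      val (m + j) = marginalSlot f v (edgeRank ev j) := by
    intro j hj v hv
    rw [hval j hj, hv]
    simp [costQuery, marginalSlot]
  have hc : centers E (marginalSlot f) = (Finset.Ico m (2 * m)).image val := by
    ext x
    simp only [hd.mem_centers_iff, Finset.mem_image, Finset.mem_Ico]
    constructor
    · rintro ⟨v, j, hj, hv, rfl⟩
      exact ⟨m + j, by omega, hval' j hj v hv⟩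
    · rintro ⟨y, hy, rfl⟩
      obtain ⟨j, rfl⟩ := Nat.exists_eq_add_of_le hy.1
      exact ⟨⟨ev j, he.machine_lt j (by omega)⟩, j, by omega, rfl, (hval' j (by omega) _ rfl).symm⟩
  refine ⟨hdat.of_frame hf (by decide) (by decide) (by decide) (by decide), hc ▸ hs.count,
    fun v x => ?_, fun a ha i => ?_⟩
  · rw [hd.slotCut_eq]
    congr 1
    refine Finset.filter_congr fun j hj => and_congr_right fun hv => ?_
    rw [Finset.mem_range] at hj
    have h1 := hs.rank (m + j) (Finset.mem_Ico.2 (by omega))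
    rw [Nat.add_sub_cancel_left] at h1
    rw [h1, centerRank, hc, ← hval' j hj v hv, valuesBelow]
  · rw [← hzero a ha i, hf.mem a]
    simp only [List.mem_cons, List.not_mem_nil, or_false] at ha
    rcases ha with rfl | rfl | rfl | rfl | rfl <;> decide

end RAM

namespace RAM

/-! ### The programs on their inputs -/

variable {nU nV : ℕ} {es : List (Fin nU × Fin nV)} {W : ℕ} {F : ℕ → ℕ → ℝ} {σ : State}
  {w : Fin nV → ℕ → ℝ}

/-- The jobs in a list of edges, by position. -/
def jobAt (es : List (Fin nU × Fin nV)) (j : ℕ) : ℕ := (es[j]?.map fun e => (e.1 : ℕ)).getD 0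

/-- The machines in a list of edges, by position. -/
def machineAt (es : List (Fin nU × Fin nV)) (j : ℕ) : ℕ := (es[j]?.map fun e => (e.2 : ℕ)).getD 0

theorem jobAt_eq {j : ℕ} (hj : j < es.length) : jobAt es j = (es[j].1 : ℕ) := by
  simp [jobAt, hj]

theorem machineAt_eq {j : ℕ} (hj : j < es.length) : machineAt es j = (es[j].2 : ℕ) := by
  simp [machineAt, hj]

theorem edgeList (es : List (Fin nU × Fin nV)) :
    EdgeList es.toFinset es.length (jobAt es) (machineAt es) where
  mem_iff u v := by
    rw [List.mem_toFinset, List.mem_iff_getElem]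
    refine exists_congr fun j => ⟨fun ⟨hj, h⟩ => ⟨hj, ?_⟩, fun ⟨hj, h⟩ => ⟨hj, ?_⟩⟩
    · rw [jobAt_eq hj, machineAt_eq hj, h]; exact ⟨rfl, rfl⟩
    · rw [jobAt_eq hj, machineAt_eq hj] at h
      exact Prod.ext (Fin.ext h.1) (Fin.ext h.2)
  job_lt j hj := by rw [jobAt_eq hj]; exact Fin.isLt _
  machine_lt j hj := by rw [machineAt_eq hj]; exact Fin.isLt _

theorem countsDegrees (h : es.Nodup) : CountsDegrees es.toFinset es.length (machineAt es) := by
  intro v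
  refine (Finset.card_bij (fun j hj => es[j]'(by simp at hj; exact hj.1)) ?_ ?_ ?_).symm
  · intro j hj
    simp only [Finset.mem_filter, Finset.mem_range] at hj
    rw [machineAt_eq hj.1] at hj
    simp [Fin.ext_iff, hj.2]
  · intro i hi j hj hij
    exact (h.getElem_inj_iff).1 hij
  · intro e he
    simp only [Finset.mem_filter, List.mem_toFinset, List.mem_iff_getElem] at he
    obtain ⟨⟨j, hj, rfl⟩, h2⟩ := he
    exact ⟨j, by simp [hj, machineAt_eq, h2], rfl⟩

/-- The first listed edges form the semi-matching of an assignment. -/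
theorem exists_firstAssignment (hE : ∀ u, ∃ v, (u, v) ∈ es) : ∃ μ : Fin nU → Fin nV,
    graphOf μ = firstSemiMatching es ∧ ∀ u : Fin nU, ∃ j < es.length,
      jobAt es j = u ∧ machineAt es j = μ u ∧ ∀ i < j, jobAt es i ≠ u := by
  have h : ∀ u, ∃ v, es.find? (fun e => decide (e.1 = u)) = some (u, v) := by
    intro u
    obtain ⟨v, hv⟩ := hE u
    obtain ⟨⟨u', v'⟩, he⟩ := Option.isSome_iff_exists.1
      (List.find?_isSome.2 ⟨(u, v), hv, by simp⟩ :
        (es.find? (fun e => decide (e.1 = u))).isSome)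
    have := List.find?_some he
    simp only [decide_eq_true_eq] at this
    exact ⟨v', by rw [he, this]⟩
  choose μ hμ using h
  refine ⟨μ, ?_, fun u => ?_⟩
  · ext ⟨u, v⟩
    have h1 : (u, v) ∈ firstSemiMatching es ↔ (u, v) ∈ es ∧
        es.find? (fun e => decide (e.1 = u)) = some (u, v) := by
      simp only [firstSemiMatching, Finset.mem_filter, List.mem_toFinset]
      refine and_congr_right fun _ => ?_
      convert Iff.rfl
    rw [mem_graphOf, h1, hμ, Option.some.injEq, Prod.mk.injEq]
    constructor
    · rintro rfl; exact ⟨List.mem_of_find?_eq_some (hμ u), rfl, rfl⟩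
    · exact fun h => h.2.2
  · obtain ⟨-, j, hj, h1, h2⟩ := List.find?_eq_some_iff_getElem.1 (hμ u)
    refine ⟨j, hj, by rw [jobAt_eq hj, h1], by rw [machineAt_eq hj, h1], fun i hi => ?_⟩
    have h3 := h2 i hi
    rw [jobAt_eq (hi.trans hj)]
    simpa [Fin.ext_iff] using h3

theorem edgeData_inputState (es : List (Fin nU × Fin nV)) (hV : nV ≤ W)
    (hW : 2 * es.length + nU + 10 ≤ W) :
    EdgeData W nU es.length (jobAt es) (machineAt es) (inputState nU nV es) :=
  ⟨rfl, rfl, rfl, rfl, (edgeList es).job_lt, fun j hj =>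
    ((edgeList es).machine_lt j hj).le.trans hV, hW⟩

/-- Words of at most `n ^ 5` suffice for all indices and entries. -/
theorem word_bound {n m u v : ℕ} (hn : 2 ≤ n) (hu : u + v = n) (hm : m ≤ n ^ 2) :
    2 * m + u + 10 ≤ n ^ 5 ∧ v ≤ n ^ 5 := by
  obtain ⟨k, rfl⟩ := Nat.exists_eq_add_of_le hn
  constructor
  · calc 2 * m + u + 10 ≤ 2 * (2 + k) ^ 2 + (2 + k) + 10 := by omega
      _ ≤ (2 + k) ^ 5 := by
        ring_nf
        nlinarith [Nat.zero_le (k ^ 2), Nat.zero_le (k ^ 3), Nat.zero_le (k ^ 4),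
          Nat.zero_le (k ^ 5)]
  · exact (by omega : v ≤ 2 + k).trans (Nat.le_self_pow (by norm_num) _)

/-- A program that prepares the ranks, followed by the levels, performs CancelAll. -/
theorem Runs.cancelAll {p : Program} {c : ℕ} (hne : es ≠ []) (hE : ∀ u, ∃ v, (u, v) ∈ es)
    (hw : ∀ v, Monotone (w v)) (hcard : (centers es.toFinset w).card ≤ es.length)
    (hm : es.length ≤ (nU + nV) ^ 2)
    (hp : Runs ((nU + nV) ^ 5) F p (inputState nU nV es)
      (c * ((es.length + 1) * (Nat.clog 2 es.length + 1)))
      fun σ => Prepared es.toFinset w ((nU + nV) ^ 5) es.length (jobAt es) (machineAt es) σ) :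
    ∃ (σ : State) (steps : ℕ) (φ' : NetArc (Fin nU) (Fin nV) → ℕ) (t : ℕ),
      Exec ((nU + nV) ^ 5) F (.seq p RAM.cancelAll) (inputState nU nV es) σ steps ∧
      (steps : ℝ) ≤ (36 * (c + 3000) : ℝ) * timeBound (nU + nV) es.length ∧
      CancelAll es.toFinset w (innerVertices es.toFinset w) (flowOf w (firstSemiMatching es)) φ' t ∧
      Outputs σ (flowEdges es.toFinset φ') := by
  have hne' : es.toFinset.Nonempty := by simpa using hne
  obtain ⟨μ, hμ, hfirst⟩ := exists_firstAssignment hE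
  have hlen : 1 ≤ es.length := List.length_pos_iff.2 hne
  have hrun := hp.seq fun σ' h => by
    obtain ⟨_, rfl, h1⟩ := cancelAll_runs (F := F) (edgeList es) h hw hcard
      (card_centers_pos hne') hfirst
    exact h1
  obtain ⟨σ, s, h1, h2, μe, hrep, t, ht⟩ := hrun
  refine ⟨σ, s, assignFlow w μe, t, h1, ?_, hμ ▸ ht, fun u v => ?_⟩
  · have h3 : s ≤ (c + 3000) *
        ((2 * Nat.sqrt (4 * nU) + 2) * (es.length * (Nat.clog 2 es.length + 1))) := by
      have h4 : es.length + 1 ≤ (2 * Nat.sqrt (4 * nU) + 2) * es.length := by nlinarith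
      have h5 := Nat.mul_le_mul_left c (Nat.mul_le_mul_right (Nat.clog 2 es.length + 1) h4)
      rw [mul_assoc] at h5
      rw [add_mul]; omega
    have h6 := bound_le_timeBound (two_le_of_nonempty hne') (by omega : nU ≤ nU + nV) hm
    calc (s : ℝ) ≤ ((c + 3000) * ((2 * Nat.sqrt (4 * nU) + 2) *
          (es.length * (Nat.clog 2 es.length + 1))) : ℕ) := by exact_mod_cast h3
      _ ≤ (c + 3000 : ℝ) * (36 * timeBound (nU + nV) es.length) := by
        rw [Nat.cast_mul]; push_cast at h6 ⊢; gcongr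
      _ = _ := by ring
  · rw [flowEdges_assignFlow hrep.edge, mem_graphOf, hrep.eq, Fin.ext_iff]

/-- The program for the unweighted problem. -/
theorem unweighted_runs (hes : es.Nodup) (hne : es ≠ []) (hE : ∀ u, ∃ v, (u, v) ∈ es) :
    ∃ (σ : State) (steps : ℕ) (φ' : NetArc (Fin nU) (Fin nV) → ℕ) (t : ℕ),
      Exec ((nU + nV) ^ 5) F (.seq unweightedRanks cancelAll) (inputState nU nV es) σ steps ∧
      (steps : ℝ) ≤ (36 * (30 + 3000) : ℝ) * timeBound (nU + nV) es.length ∧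
      CancelAll es.toFinset unweightedSlot (innerVertices es.toFinset unweightedSlot)
        (flowOf unweightedSlot (firstSemiMatching es)) φ' t ∧
      Outputs σ (flowEdges es.toFinset φ') := by
  have hcard := List.toFinset_card_of_nodup hes
  have hm : es.length ≤ (nU + nV) ^ 2 := hcard ▸ card_edges_le es.toFinset
  have hn : 2 ≤ nU + nV := two_le_of_nonempty (E := es.toFinset) (by simpa using hne)
  obtain ⟨hW, hV⟩ := word_bound hn rfl hm
  have hdat := edgeData_inputState es hV hW
  refine Runs.cancelAll (c := 30) hne hE (fun v i j h => ?_) (hcard ▸ card_centers_le) hm ?_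
  · simpa [unweightedSlot] using h
  · obtain ⟨_, rfl, h⟩ := unweightedRanks_runs (F := F) hdat (fun _ => rfl) rfl
    refine h.mono ?_ fun σ h => Prepared.unweighted hdat (countsDegrees hes) (edgeList es) h.1
      (by simp [inputState]) h.2.1 h.2.2
    nlinarith [Nat.zero_le ((es.length + 1) * Nat.clog 2 es.length)]

/-- The program for convex cost functions. -/
theorem convex_runs {f : Fin nV → ℕ → ℝ} (hes : es.Nodup) (hne : es ≠ [])
    (hE : ∀ u, ∃ v, (u, v) ∈ es) (hf : ∀ v, IsDiscreteConvex (f v)) :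
    ∃ (σ : State) (steps : ℕ) (φ' : NetArc (Fin nU) (Fin nV) → ℕ) (t : ℕ),
      Exec ((nU + nV) ^ 5) (costQuery f) (.seq convexRanks cancelAll) (inputState nU nV es) σ
        steps ∧
      (steps : ℝ) ≤ (36 * (250 + 3000) : ℝ) * timeBound (nU + nV) es.length ∧
      CancelAll es.toFinset (marginalSlot f) (innerVertices es.toFinset (marginalSlot f))
        (flowOf (marginalSlot f) (firstSemiMatching es)) φ' t ∧
      Outputs σ (flowEdges es.toFinset φ') := by
  have hcard := List.toFinset_card_of_nodup hes
  have hm : es.length ≤ (nU + nV) ^ 2 := hcard ▸ card_edges_le es.toFinset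
  have hn : 2 ≤ nU + nV := two_le_of_nonempty (E := es.toFinset) (by simpa using hne)
  obtain ⟨hW, hV⟩ := word_bound hn rfl hm
  have hdat := edgeData_inputState es hV hW
  refine Runs.cancelAll (c := 250) hne hE (fun v => (hf v).monotone) (hcard ▸ card_centers_le)
    hm ?_
  obtain ⟨_, rfl, h⟩ := convexRanks_runs (F := costQuery f) hdat (List.length_pos_iff.2 hne)
    (fun _ => rfl) (fun _ => rfl) rfl
  refine h.mono le_rfl fun σ h => ?_
  obtain ⟨hfr, val, hval, hs⟩ := h
  exact Prepared.convex hdat (countsDegrees hes) (edgeList es) hfr (by simp [inputState]) hval hs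

end RAM

theorem firstSemiMatching_isFull {nU nV : ℕ} {es : List (Fin nU × Fin nV)}
    {w : Fin nV → ℕ → ℝ} (hE : ∀ u, ∃ v, (u, v) ∈ es) :
    IsFull es.toFinset w (flowOf w (firstSemiMatching es)) := by
  obtain ⟨μ, hμ, h⟩ := RAM.exists_firstAssignment hE
  rw [← hμ]
  refine (graphOf_isSemiMatching fun u => ?_).isFull
  obtain ⟨j, hj, h1, h2, -⟩ := h u
  exact ((RAM.edgeList es).mem_iff _ _).2 ⟨j, hj, h1, h2⟩

theorem mainTheorem1 :
    -- unweighted: every run of CancelAll is correct and has work `O(√n m log n)`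
    (∃ c : ℝ, ∀ (nU nV : ℕ) (E : Finset (Fin nU × Fin nV)),
      E.Nonempty → (∀ u, ∃ v, (u, v) ∈ E) →
      ∀ φ : NetArc (Fin nU) (Fin nV) → ℕ,
        (semiMatchingNetwork E unweightedSlot).IsMaxFlow φ →
        (∃ φ' t, CancelAll E unweightedSlot (innerVertices E unweightedSlot) φ φ' t) ∧
        ∀ φ' t, CancelAll E unweightedSlot (innerVertices E unweightedSlot) φ φ' t →
          (semiMatchingNetwork E unweightedSlot).IsMinCostFlow φ' ∧
          IsOptimalSemiMatching unweightedCost E (flowEdges E φ') ∧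
          (t : ℝ) ≤ c * timeBound (nU + nV) E.card) ∧
    -- unweighted: a random access machine carries CancelAll out in `O(√n m log n)` steps
    (∃ (P : RAM.Program) (c : ℝ) (d : ℕ),
      ∀ (nU nV : ℕ) (es : List (Fin nU × Fin nV)),
        es.Nodup → es ≠ [] → (∀ u, ∃ v, (u, v) ∈ es) →
        ∃ (σ : RAM.State) (steps : ℕ) (φ' : NetArc (Fin nU) (Fin nV) → ℕ) (t : ℕ),
          RAM.Exec ((nU + nV) ^ d) (fun _ _ => 0) P (RAM.inputState nU nV es) σ steps ∧
          (steps : ℝ) ≤ c * timeBound (nU + nV) es.length ∧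
          CancelAll es.toFinset unweightedSlot (innerVertices es.toFinset unweightedSlot)
            (flowOf unweightedSlot (firstSemiMatching es)) φ' t ∧
          RAM.Outputs σ (flowEdges es.toFinset φ') ∧
          IsOptimalSemiMatching unweightedCost es.toFinset (flowEdges es.toFinset φ')) ∧
    -- a convex cost function for each machine: every run of CancelAll
    (∃ c : ℝ, ∀ (nU nV : ℕ) (E : Finset (Fin nU × Fin nV)) (f : Fin nV → ℕ → ℝ),
      E.Nonempty → (∀ u, ∃ v, (u, v) ∈ E) → (∀ v, IsDiscreteConvex (f v)) →
      ∀ φ : NetArc (Fin nU) (Fin nV) → ℕ,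
        (semiMatchingNetwork E (marginalSlot f)).IsMaxFlow φ →
        (∃ φ' t, CancelAll E (marginalSlot f) (innerVertices E (marginalSlot f)) φ φ' t) ∧
        ∀ φ' t, CancelAll E (marginalSlot f) (innerVertices E (marginalSlot f)) φ φ' t →
          (semiMatchingNetwork E (marginalSlot f)).IsMinCostFlow φ' ∧
          IsOptimalSemiMatching (machineCost f) E (flowEdges E φ') ∧
          (t : ℝ) ≤ c * timeBound (nU + nV) E.card) ∧
    -- a convex cost function for each machine: the random access machine
    (∃ (P : RAM.Program) (c : ℝ) (d : ℕ),
      ∀ (nU nV : ℕ) (es : List (Fin nU × Fin nV)) (f : Fin nV → ℕ → ℝ),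
        es.Nodup → es ≠ [] → (∀ u, ∃ v, (u, v) ∈ es) → (∀ v, IsDiscreteConvex (f v)) →
        ∃ (σ : RAM.State) (steps : ℕ) (φ' : NetArc (Fin nU) (Fin nV) → ℕ) (t : ℕ),
          RAM.Exec ((nU + nV) ^ d) (RAM.costQuery f) P (RAM.inputState nU nV es) σ steps ∧
          (steps : ℝ) ≤ c * timeBound (nU + nV) es.length ∧
          CancelAll es.toFinset (marginalSlot f) (innerVertices es.toFinset (marginalSlot f))
            (flowOf (marginalSlot f) (firstSemiMatching es)) φ' t ∧
          RAM.Outputs σ (flowEdges es.toFinset φ') ∧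
          IsOptimalSemiMatching (machineCost f) es.toFinset (flowEdges es.toFinset φ')) := by
  -- The factor `36` comes from `bound_le_timeBound`, the other numbers from the analysis of the
  -- programs, and the exponent `5` of the word bound from `word_bound`.
  refine ⟨⟨72, fun nU nV E hne hE φ hφ => ?_⟩,
    ⟨.seq RAM.unweightedRanks RAM.cancelAll, 36 * (30 + 3000), 5, fun nU nV es hes hne hE => ?_⟩,
    ⟨72, fun nU nV E f hne hE hf φ hφ => cancelAll_convex E f hne hE hf hφ⟩,
    ⟨.seq RAM.convexRanks RAM.cancelAll, 36 * (250 + 3000), 5,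
      fun nU nV es f hes hne hE hf => ?_⟩⟩
  · have h := cancelAll_convex E triangularCost hne hE isDiscreteConvex_triangularCost
      (φ := φ) (by rwa [marginalSlot_triangularCost])
    simp only [marginalSlot_triangularCost, ← isOptimal_unweighted_iff] at h
    exact h
  · obtain ⟨σ, s, φ', t, h1, h2, h3, h4⟩ := RAM.unweighted_runs (F := fun _ _ => 0) hes hne hE
    refine ⟨σ, s, φ', t, h1, h2, h3, h4, isOptimal_unweighted_iff.2 ?_⟩
    rw [← marginalSlot_triangularCost] at h3
    exact h3.isOptimal isDiscreteConvex_triangularCost (firstSemiMatching_isFull hE)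
  · obtain ⟨σ, s, φ', t, h1, h2, h3, h4⟩ := RAM.convex_runs hes hne hE hf
    exact ⟨σ, s, φ', t, h1, h2, h3, h4, h3.isOptimal hf (firstSemiMatching_isFull hE)⟩
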